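/- Let $\mathfrak a=\bigoplus_{n\ge 0}\mathfrak a_n$ be a $\mathbb Z_{\ge 0}$-graded complex Lie algebra with all $\mathfrak a_n$ finite-dimensional and $\mathfrak g=\mathfrak a_0$ semisimple, and put $\mathfrak a_+=\bigoplus_{n>0}\mathfrak a_n$. Fix a Cartan subalgebra $\mathfrak h$ of $\mathfrak g$ and a set of simple roots, with dominant integral weights $P^+$ and positive nilradical $\mathfrak n^+$, and put $\Lambda=P^+\times\mathbb Z$. For $\lambda\in P^+$ let $V(\lambda)$ be the finite-dimensional simple $\mathfrak g$-module of highest weight $\lambda$. Let $\widehat{\mathcal G}$ be the category of $\mathbb Z$-graded $\mathfrak a$-modules $V=\bigoplus_r V[r]$ with finite-dimensional graded pieces, with degree-preserving $\mathfrak a$-module maps. For $(\lambda,r)\in\Lambda$ let $V(\lambda,r)\in\widehat{\mathcal G}$ be $V(\lambda)$ placed in degree $r$ with $\mathfrak a_+$ acting by $0$, let $[V:V(\lambda,r)]=\dim\operatorname{Hom}_{\mathfrak g}(V(\lambda),V[r])$, and put $$P(\lambda,r)=U(\mathfrak a)\otimes_{U(\mathfrak g)}V(\lambda,r),\qquad P_j(\lambda,r)=U(\mathfrak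 a)\otimes_{U(\mathfrak g)}\bigl(\textstyle\bigwedge^j\mathfrak a_+\otimes V(\lambda,r)\bigr)\quad(j\ge 0),$$ so that $P_0(\lambda,r)=P(\lambda,r)$. Let $d_0:P(\lambda,r)\to V(\lambda,r)$, $d_0(u\otimes v)=uv$, and for $j>0$ let $d_j:P_j(\lambda,r)\to P_{j-1}(\lambda,r)$ be the Chevalley–Eilenberg (Koszul) differential of $\mathfrak a_+$ tensored with the identity of $V(\lambda,r)$: $$d_j\bigl(u\otimes (x_1\wedge\dots\wedge x_j)\otimes v\bigr)=\sum_i(-1)^{i+1}ux_i\otimes(x_1\wedge\cdots\widehat{x_i}\cdots\wedge x_j)\otimes v+\sum_{p<q}(-1)^{p+q}u\otimes([x_p,x_q]\wedge x_1\wedge\cdots\widehat{x_p}\cdots\widehat{x_q}\cdots\wedge x_j)\otimes v .$$ Say that $(\mu,s)\in\Lambda$ covers $(\lambda,r)\in\Lambda$ if $s>r$ and $\mu-\lambda$ is a weight of the $\mathfrak g$-module $\mathfrak a_{s-r}$, and let $\preccurlyeq$ be the reflexive and transitive closure of this relation. A subset $\Gamma\subset\Lambda$ is interval-closed if $\alpha\preccurlyeq\beta\preccurlyeq\gamma$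 and $\alpha,\gamma\in\Gamma$ imply $\beta\in\Gamma$. Let $\mathcal G[\Gamma]$ be the full subcategory of $\widehat{\mathcal G}$ of finite-dimensional $V$ such that $[V:V(\lambda,r)]>0$ implies $(\lambda,r)\in\Gamma$. For $V\in\widehat{\mathcal G}$ let $V_{\Lambda\setminus\Gamma}$ be the $\mathfrak g$-submodule generated by the vectors $v\in V[r]$ of weight $\lambda$ with $(\lambda,r)\in\Lambda\setminus\Gamma$ and $\mathfrak n^+v=0$; put $V^\Gamma=V/V_{\Lambda\setminus\Gamma}$, and let $f^\Gamma:V^\Gamma\to W^\Gamma$ be the map induced by a morphism $f:V\to W$. Suppose that $\Gamma\subset\Lambda$ is finite and interval-closed, and let $(\lambda,r),(\mu,s)\in\Gamma$. Then, for all $j\ge0$, $P_j(\mu,s)\in\widehat{\mathcal G}$ and $P_j(\mu,s)_{\Lambda\setminus\Gamma}$ is an $\mathfrak a$-submodule of $P_j(\mu,s)$, so that $P_j(\mu,s)^\Gamma$ is a graded $\mathfrak a$-module; moreover: (i) $P(\lambda,r)^\Gamma$, with the map to $V(\lambda,r)$ induced by $d_0$, is the projective cover of $V(\lambda,r)$ in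 $\mathcal G[\Gamma]$. (ii) $[P(\lambda,r):V(\mu,s)]=[P(\lambda,r)^\Gamma:V(\mu,s)]=\dim\operatorname{Hom}_{\mathcal G[\Gamma]}(P(\mu,s)^\Gamma,P(\lambda,r)^\Gamma)$. (iii) The map $f\mapsto f^\Gamma$ is an isomorphism $\operatorname{Hom}_{\widehat{\mathcal G}}(P(\lambda,r),P(\mu,s))\cong\operatorname{Hom}_{\mathcal G[\Gamma]}(P(\lambda,r)^\Gamma,P(\mu,s)^\Gamma)$. (iv) For all $j\ge0$, $P_j(\mu,s)^\Gamma\in\mathcal G[\Gamma]$, and the induced sequence $$\cdots\xrightarrow{d_3^\Gamma}P_2(\mu,s)^\Gamma\xrightarrow{d_2^\Gamma}P_1(\mu,s)^\Gamma\xrightarrow{d_1^\Gamma}P(\mu,s)^\Gamma\xrightarrow{d_0^\Gamma}V(\mu,s)\to0$$ is a finite projective resolution of $V(\mu,s)$ in $\mathcal G[\Gamma]$: it is exact, every $P_j(\mu,s)^\Gamma$ is projective in $\mathcal G[\Gamma]$, and $P_j(\mu,s)^\Gamma=0$ for all large $j$. -/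

import Mathlib

open scoped TensorProduct
open CategoryTheory

universe u

noncomputable section

namespace GradedCurrent

attribute [local instance] LieRing.ofAssociativeRing

/-! ### Dominant weights and the simple modules of a semisimple Lie algebra -/

section Semisimple

variable {L : Type u} [LieRing L] [LieAlgebra ℂ L] [FiniteDimensional ℂ L]
  [LieAlgebra.IsKilling ℂ L] {H : LieSubalgebra ℂ L} [H.IsCartanSubalgebra]

open LieAlgebra LieAlgebra.IsKilling

/-- Indices of the positive roots `R⁺ = R ∩ Q⁺` determined by a set of simple roots. -/
def positiveRoots (b : (rootSystem H).Base) : Set H.root :=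
  {α | (rootSystem H).root α ∈ AddSubmonoid.closure ((rootSystem H).root '' b.support)}

/-- `λ` is dominant integral: `λ(hᵢ)` is a non-negative integer for every simple coroot `hᵢ`,
that is, `λ` lies in the `ℤ₊`-span of the fundamental weights. -/
def IsDominant (b : (rootSystem H).Base) (wt : Module.Dual ℂ H) : Prop :=
  ∀ i ∈ b.support, ∃ n : ℕ, wt ((rootSystem H).coroot i) = n

/-- The set `P⁺` of dominant integral weights. -/
abbrev DominantWeight (b : (rootSystem H).Base) : Type u :=
  {wt : Module.Dual ℂ H // IsDominant b wt}

/-- The left ideal of `U(L)` generated by `𝔫⁺`, by `h - λ(h)` for `h ∈ 𝔥`, and by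
`(xᵢ⁻)^(λ(hᵢ)+1)` for the simple roots `αᵢ`, `xᵢ⁻` running through the root space of `-αᵢ`. -/
def simpleIdeal (b : (rootSystem H).Base) (wt : Module.Dual ℂ H) :
    Submodule (UniversalEnvelopingAlgebra ℂ L) (UniversalEnvelopingAlgebra ℂ L) :=
  Submodule.span _
    ({a | ∃ α ∈ positiveRoots b, ∃ x ∈ rootSpace H (α : LieModule.Weight ℂ H L),
        a = UniversalEnvelopingAlgebra.ι ℂ x} ∪
     {a | ∃ h : H, a = UniversalEnvelopingAlgebra.ι ℂ (h : L) -
        algebraMap ℂ (UniversalEnvelopingAlgebra ℂ L) (wt h)} ∪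
     {a | ∃ i ∈ b.support, ∃ y ∈ rootSpace H (-(i : LieModule.Weight ℂ H L)), ∃ n : ℕ,
        wt ((rootSystem H).coroot i) = n ∧ a = UniversalEnvelopingAlgebra.ι ℂ y ^ (n + 1)})

/-- The finite-dimensional simple `L`-module `V(λ)` of highest weight `λ ∈ P⁺`: it is generated by
a vector `v` with defining relations `𝔫⁺ v = 0`, `h v = λ(h) v`, `(xᵢ⁻)^(λ(hᵢ)+1) v = 0`. -/
def SimpleModule (b : (rootSystem H).Base) (wt : DominantWeight b) : Type u :=
  UniversalEnvelopingAlgebra ℂ L ⧸ simpleIdeal b wt.1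

variable (b : (rootSystem H).Base) (wt : DominantWeight b)

instance : AddCommGroup (SimpleModule b wt) :=
  inferInstanceAs (AddCommGroup (UniversalEnvelopingAlgebra ℂ L ⧸ simpleIdeal b wt.1))

instance : Module (UniversalEnvelopingAlgebra ℂ L) (SimpleModule b wt) :=
  inferInstanceAs (Module (UniversalEnvelopingAlgebra ℂ L)
    (UniversalEnvelopingAlgebra ℂ L ⧸ simpleIdeal b wt.1))

instance : Module ℂ (SimpleModule b wt) :=
  inferInstanceAs (Module ℂ (UniversalEnvelopingAlgebra ℂ L ⧸ simpleIdeal b wt.1))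

instance : IsScalarTower ℂ (UniversalEnvelopingAlgebra ℂ L) (SimpleModule b wt) :=
  inferInstanceAs (IsScalarTower ℂ (UniversalEnvelopingAlgebra ℂ L)
    (UniversalEnvelopingAlgebra ℂ L ⧸ simpleIdeal b wt.1))

/-- `L` acts through `U(L)`. -/
instance : LieRingModule L (SimpleModule b wt) where
  bracket x v := UniversalEnvelopingAlgebra.ι ℂ x • v
  add_lie x y v := by simp [add_smul]
  lie_add x v w := smul_add _ _ _
  leibniz_lie x y v := by
    simp only [LieHom.map_lie, LieRing.of_associative_ring_bracket, sub_smul, mul_smul]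
    abel

instance : LieModule ℂ L (SimpleModule b wt) where
  smul_lie c x v := by
    change UniversalEnvelopingAlgebra.ι ℂ (c • x) • v = c • (UniversalEnvelopingAlgebra.ι ℂ x • v)
    rw [map_smul, smul_assoc]
  lie_smul c x v := by
    change UniversalEnvelopingAlgebra.ι ℂ x • (c • v) = c • (UniversalEnvelopingAlgebra.ι ℂ x • v)
    rw [← algebraMap_smul (UniversalEnvelopingAlgebra ℂ L) c v, ← mul_smul,
      ← Algebra.commutes, mul_smul, algebraMap_smul]

end Semisimple

/-! ### Exterior powers of Lie modules -/

section Exterior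

variable {M : Type u} [AddCommGroup M] [Module ℂ M]

/-- The alternating map `(x₁, …, xⱼ) ↦ ∑ₗ x₁ ∧ … ∧ D xₗ ∧ … ∧ xⱼ`. -/
def derivAlternating (j : ℕ) (D : M →ₗ[ℂ] M) : M [⋀^Fin j]→ₗ[ℂ] (⋀[ℂ]^j M) where
  toMultilinearMap := ∑ l : Fin j, (exteriorPower.ιMulti ℂ j).toMultilinearMap.compLinearMap
    (fun i => if i = l then D else LinearMap.id)
  map_eq_zero_of_eq' := by
    intro v a c hac hne
    have key : ∀ l : Fin j, (fun i => (if i = l then D else LinearMap.id) (v i)) =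
        Function.update v l (D (v l)) := by
      intro l; ext i
      by_cases h : i = l
      · subst h; simp
      · simp [h]
    simp only [MultilinearMap.toFun_eq_coe, sum_apply,
      MultilinearMap.compLinearMap_apply, AlternatingMap.coe_multilinearMap, key]
    rw [Fintype.sum_eq_add a c hne]
    · have : Function.update v c (D (v c)) =
          Function.update v a (D (v a)) ∘ Equiv.swap a c := by
        ext i
        by_cases h1 : i = a
        · subst h1; simp [hne, hne.symm, hac]
        · by_cases h2 : i = c
          · subst h2; simp [hac]
          · simp [h1, h2, Equiv.swap_apply_of_ne_of_ne]
      rw [this, AlternatingMap.map_swap _ _ hne, add_neg_cancel]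
    · rintro l ⟨h1, h2⟩
      exact AlternatingMap.map_eq_zero_of_eq _ _
        (by simp [Function.update_of_ne h1.symm, Function.update_of_ne h2.symm, hac]) hne

/-- The operator on `⋀ʲ M` which extends the linear endomorphism `D` of `M` as a derivation. -/
def exteriorDeriv (j : ℕ) (D : M →ₗ[ℂ] M) : ⋀[ℂ]^j M →ₗ[ℂ] ⋀[ℂ]^j M :=
  exteriorPower.alternatingMapLinearEquiv (derivAlternating j D)

theorem exteriorDeriv_ιMulti (j : ℕ) (D : M →ₗ[ℂ] M) (v : Fin j → M) :
    exteriorDeriv j D (exteriorPower.ιMulti ℂ j v) =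
      ∑ l, exteriorPower.ιMulti ℂ j (Function.update v l (D (v l))) := by
  have key : ∀ l : Fin j, (fun i => (if i = l then D else LinearMap.id) (v i)) =
      Function.update v l (D (v l)) := by
    intro l; ext i
    by_cases h : i = l
    · subst h; simp
    · simp [h]
  rw [exteriorDeriv, exteriorPower.alternatingMapLinearEquiv_apply_ιMulti, derivAlternating]
  change (∑ l : Fin j, (exteriorPower.ιMulti ℂ j).toMultilinearMap.compLinearMap
    (fun i => if i = l then D else LinearMap.id)) v = _
  simp only [sum_apply,
      MultilinearMap.compLinearMap_apply, AlternatingMap.coe_multilinearMap, key]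

theorem exteriorDeriv_add (j : ℕ) (D E : M →ₗ[ℂ] M) :
    exteriorDeriv j (D + E) = exteriorDeriv j D + exteriorDeriv j E := by
  apply exteriorPower.linearMap_ext
  ext1 v
  simp only [LinearMap.compAlternatingMap_apply, LinearMap.add_apply, exteriorDeriv_ιMulti,
    ← Finset.sum_add_distrib, AlternatingMap.map_update_add]

theorem exteriorDeriv_smul (j : ℕ) (c : ℂ) (D : M →ₗ[ℂ] M) :
    exteriorDeriv j (c • D) = c • exteriorDeriv j D := by
  apply exteriorPower.linearMap_ext
  ext1 v
  simp only [LinearMap.compAlternatingMap_apply, LinearMap.smul_apply, exteriorDeriv_ιMulti,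
    Finset.smul_sum, AlternatingMap.map_update_smul]

theorem exteriorDeriv_lie (j : ℕ) (D E : M →ₗ[ℂ] M) :
    exteriorDeriv j (D ∘ₗ E - E ∘ₗ D) =
      exteriorDeriv j D ∘ₗ exteriorDeriv j E - exteriorDeriv j E ∘ₗ exteriorDeriv j D := by
  have aux : ∀ (D E : M →ₗ[ℂ] M) (v : Fin j → M),
      exteriorDeriv j D (exteriorDeriv j E (exteriorPower.ιMulti ℂ j v)) =
        ∑ l, exteriorPower.ιMulti ℂ j (Function.update v l (D (E (v l)))) +
        ∑ l, ∑ k ∈ Finset.univ.erase l, exteriorPower.ιMulti ℂ j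
          (Function.update (Function.update v l (E (v l))) k (D (v k))) := by
    intro D E v
    simp only [exteriorDeriv_ιMulti, map_sum]
    rw [← Finset.sum_add_distrib]
    refine Finset.sum_congr rfl fun l _ => ?_
    rw [← Finset.add_sum_erase _ _ (Finset.mem_univ l)]
    congr 1
    · simp
    · refine Finset.sum_congr rfl fun k hk => ?_
      rw [Function.update_of_ne (Finset.ne_of_mem_erase hk)]
  apply exteriorPower.linearMap_ext
  ext1 v
  simp only [LinearMap.compAlternatingMap_apply, LinearMap.sub_apply, LinearMap.comp_apply, aux]
  have hsw : (∑ l, ∑ k ∈ Finset.univ.erase l, exteriorPower.ιMulti ℂ j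
          (Function.update (Function.update v l (E (v l))) k (D (v k)))) =
      ∑ l, ∑ k ∈ Finset.univ.erase l, exteriorPower.ιMulti ℂ j
          (Function.update (Function.update v l (D (v l))) k (E (v k))) := by
    rw [Finset.sum_comm' (t' := Finset.univ) (s' := fun k => Finset.univ.erase k)]
    · refine Finset.sum_congr rfl fun l _ => Finset.sum_congr rfl fun k hk => ?_
      rw [Function.update_comm (Finset.ne_of_mem_erase hk)]
    · intro x y; simp [eq_comm]
  rw [hsw, exteriorDeriv_ιMulti, add_sub_add_right_eq_sub, ← Finset.sum_sub_distrib]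
  refine Finset.sum_congr rfl fun l _ => ?_
  simp [AlternatingMap.map_update_sub]

section LieModule

variable {A : Type u} [LieRing A] [LieAlgebra ℂ A] [LieRingModule A M] [LieModule ℂ A M]

/-- The action `y (x₁ ∧ … ∧ xⱼ) = ∑ₗ x₁ ∧ … ∧ ⁅y, xₗ⁆ ∧ … ∧ xⱼ` on an exterior power. -/
instance exteriorLieRingModule (j : ℕ) : LieRingModule A (⋀[ℂ]^j M) where
  bracket y w := exteriorDeriv j (LieModule.toEnd ℂ A M y) w
  add_lie y z w := by rw [map_add, exteriorDeriv_add]; rfl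
  lie_add y w w' := map_add _ _ _
  leibniz_lie y z w := by
    rw [LieHom.map_lie, LieRing.of_associative_ring_bracket]
    have := LinearMap.congr_fun
      (exteriorDeriv_lie j (LieModule.toEnd ℂ A M y) (LieModule.toEnd ℂ A M z)) w
    change exteriorDeriv j _ (exteriorDeriv j _ w) = exteriorDeriv j (_ ∘ₗ _ - _ ∘ₗ _) w + _
    rw [this]; simp

instance exteriorLieModule (j : ℕ) : LieModule ℂ A (⋀[ℂ]^j M) where
  smul_lie c y w := by
    change exteriorDeriv j _ w = c • exteriorDeriv j _ w
    rw [map_smul, exteriorDeriv_smul]; rfl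
  lie_smul c y w := map_smul (exteriorDeriv j (LieModule.toEnd ℂ A M y)) c w

theorem lie_ιMulti (j : ℕ) (y : A) (v : Fin j → M) :
    ⁅y, exteriorPower.ιMulti ℂ j v⁆ =
      ∑ l, exteriorPower.ιMulti ℂ j (Function.update v l ⁅y, v l⁆) :=
  exteriorDeriv_ιMulti j _ v

end LieModule

/-- The linear map `⋀ʲ⁺¹ M → M ⊗ ⋀ʲ M`,
`x₀ ∧ … ∧ xⱼ ↦ ∑ᵢ (-1)ⁱ xᵢ ⊗ (x₀ ∧ … ∧ x̂ᵢ ∧ … ∧ xⱼ)`. -/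
def exteriorSplit (j : ℕ) : ⋀[ℂ]^(j + 1) M →ₗ[ℂ] M ⊗[ℂ] ⋀[ℂ]^j M :=
  exteriorPower.alternatingMapLinearEquiv (AlternatingMap.alternatizeUncurryFin
    { toFun := fun x => (TensorProduct.mk ℂ M (⋀[ℂ]^j M) x).compAlternatingMap
        (exteriorPower.ιMulti ℂ j)
      map_add' := fun x y => by ext; simp
      map_smul' := fun c x => by ext; simp })

theorem exteriorSplit_ιMulti (j : ℕ) (v : Fin (j + 1) → M) :
    exteriorSplit j (exteriorPower.ιMulti ℂ (j + 1) v) =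
      ∑ i : Fin (j + 1), (-1 : ℤ) ^ (i : ℕ) • v i ⊗ₜ[ℂ] exteriorPower.ιMulti ℂ j (i.removeNth v) := by
  rw [exteriorSplit, exteriorPower.alternatingMapLinearEquiv_apply_ιMulti,
    AlternatingMap.alternatizeUncurryFin_apply]
  rfl

theorem exteriorSplit_lie {A : Type u} [LieRing A] [LieAlgebra ℂ A] [LieRingModule A M]
    [LieModule ℂ A M] (j : ℕ) (y : A) (w : ⋀[ℂ]^(j + 1) M) :
    exteriorSplit j ⁅y, w⁆ = ⁅y, exteriorSplit j w⁆ := by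
  have : exteriorSplit j ∘ₗ (LieModule.toEnd ℂ A (⋀[ℂ]^(j + 1) M) y) =
      (LieModule.toEnd ℂ A (M ⊗[ℂ] ⋀[ℂ]^j M) y) ∘ₗ exteriorSplit j := by
    apply exteriorPower.linearMap_ext
    ext1 v
    simp only [LinearMap.compAlternatingMap_apply, LinearMap.comp_apply,
      LieModule.toEnd_apply_apply, lie_ιMulti, map_sum, exteriorSplit_ιMulti, lie_zsmul,
      TensorProduct.LieModule.lie_tmul_right, TensorProduct.tmul_sum]
    rw [Finset.sum_comm]
    refine Finset.sum_congr rfl fun i _ => ?_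
    rw [← Finset.smul_sum, Fin.sum_univ_succAbove _ i]
    congr 2
    · simp
    · refine Finset.sum_congr rfl fun l _ => ?_
      rw [Function.update_of_ne (Fin.succAbove_ne i l).symm]
      congr 2
      ext m
      by_cases h : m = l
      · subst h; simp [Fin.removeNth]
      · simp [Fin.removeNth, h]
  exact LinearMap.congr_fun this w

end Exterior

/-! ### Gradings -/

section Grading

theorem two_zpow_injective : Function.Injective (fun k : ℤ => (2 : ℂ) ^ k) := by
  intro a c h
  have h' : ((2 : ℝ) ^ a) = (2 : ℝ) ^ c := by
    have := congrArg norm (h : (2 : ℂ) ^ a = 2 ^ c)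
    simpa [norm_zpow] using this
  exact zpow_right_injective₀ (by norm_num) (by norm_num) h'

variable {M : Type*} [AddCommGroup M] [Module ℂ M]

/-- Pieces on which one endomorphism acts by the scalars `2ᵏ` are independent. -/
theorem isInternal_of_scaling (S : ℤ → Submodule ℂ M) (φ : M →ₗ[ℂ] M)
    (hφ : ∀ k, ∀ v ∈ S k, φ v = (2 : ℂ) ^ k • v) (hS : ⨆ k, S k = ⊤) :
    DirectSum.IsInternal S := by
  rw [DirectSum.isInternal_submodule_iff_iSupIndep_and_iSup_eq_top]
  refine ⟨?_, hS⟩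
  have h := (Module.End.eigenspaces_iSupIndep φ).comp two_zpow_injective
  exact h.mono fun k v hv => Module.End.mem_eigenspace_iff.mpr (hφ k v hv)

/-- A grading has a scaling endomorphism. -/
theorem exists_scaling {ι : Type*} [DecidableEq ι] (S : ι → Submodule ℂ M)
    (hS : DirectSum.IsInternal S) (c : ι → ℂ) :
    ∃ φ : M →ₗ[ℂ] M, ∀ k, ∀ v ∈ S k, φ v = c k • v := by
  let e := LinearEquiv.ofBijective (DirectSum.coeLinearMap S) hS
  refine ⟨DirectSum.toModule ℂ ι M (fun k => c k • (S k).subtype) ∘ₗ e.symm.toLinearMap, ?_⟩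
  intro k v hv
  have : e.symm v = DirectSum.lof ℂ ι (fun k => S k) k ⟨v, hv⟩ := by
    rw [LinearEquiv.symm_apply_eq]
    exact (DirectSum.coeLinearMap_lof S k ⟨v, hv⟩).symm
  simp [this]

theorem iSup_eq_top_of_isInternal {ι : Type*} [DecidableEq ι] {S : ι → Submodule ℂ M}
    (hS : DirectSum.IsInternal S) : ⨆ k, S k = ⊤ :=
  ((DirectSum.isInternal_submodule_iff_iSupIndep_and_iSup_eq_top S).mp hS).2

theorem isInternal_single (r : ℤ) :
    DirectSum.IsInternal (fun k : ℤ => if k = r then (⊤ : Submodule ℂ M) else ⊥) := by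
  apply isInternal_of_scaling _ ((2 : ℂ) ^ r • LinearMap.id)
  · intro k v hv
    by_cases h : k = r
    · subst h; simp
    · simp only [h, if_false, Submodule.mem_bot] at hv
      simp [hv]
  · refine top_le_iff.mp (le_trans ?_ (le_iSup _ r))
    simp

end Grading

variable {𝔞 : Type u} [LieRing 𝔞] [LieAlgebra ℂ 𝔞] (𝒜 : ℕ → Submodule ℂ 𝔞) [GradedLieAlgebra 𝒜]

theorem isInternal_pieces : DirectSum.IsInternal 𝒜 := DirectSum.Decomposition.isInternal 𝒜

theorem bracket_mem {m n : ℕ} {x y : 𝔞} (hx : x ∈ 𝒜 m) (hy : y ∈ 𝒜 n) : ⁅x, y⁆ ∈ 𝒜 (m + n) :=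
  SetLike.GradedBracket.bracket_mem hx hy

/-- The Lie subalgebra `𝔤 = 𝔞₀`. -/
def zeroPart : LieSubalgebra ℂ 𝔞 where
  __ := 𝒜 0
  lie_mem' hx hy := bracket_mem 𝒜 (m := 0) (n := 0) hx hy

instance [∀ n, FiniteDimensional ℂ (𝒜 n)] : FiniteDimensional ℂ (zeroPart 𝒜) :=
  inferInstanceAs (FiniteDimensional ℂ (𝒜 0))

/-- The ideal `𝔞₊ = ⨁_{n > 0} 𝔞ₙ`. -/
def posPart : LieIdeal ℂ 𝔞 where
  __ := ⨆ n : ℕ, 𝒜 (n + 1)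
  lie_mem := by
    intro x m hm
    change m ∈ ⨆ n : ℕ, 𝒜 (n + 1) at hm
    change ⁅x, m⁆ ∈ ⨆ n : ℕ, 𝒜 (n + 1)
    have hx : x ∈ ⨆ n, 𝒜 n := by
      rw [iSup_eq_top_of_isInternal (isInternal_pieces 𝒜)]; trivial
    induction hm using Submodule.iSup_induction' with
    | zero => simp
    | add y z _ _ hy hz => rw [lie_add]; exact add_mem hy hz
    | mem n y hy =>
      induction hx using Submodule.iSup_induction' with
      | zero => simp
      | add y z _ _ hy hz => rw [add_lie]; exact add_mem hy hz
      | mem k x hx =>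
        have h := bracket_mem 𝒜 hx hy
        exact Submodule.mem_iSup_of_mem (k + n) h

/-- The projection `𝔞 → 𝔞₀ = 𝔤` along `𝔞₊`, a homomorphism of Lie algebras. -/
def projZero : 𝔞 →ₗ⁅ℂ⁆ zeroPart 𝒜 where
  toFun x := ⟨DirectSum.decompose 𝒜 x 0, (DirectSum.decompose 𝒜 x 0).2⟩
  map_add' x y := by ext; simp [DirectSum.decompose_add]
  map_smul' c x := by ext; simp only [DirectSum.decompose_smul]; rfl
  map_lie' := by
    intro x y
    ext
    change ((DirectSum.decompose 𝒜 ⁅x, y⁆ 0 : 𝒜 0) : 𝔞) =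
      ⁅((DirectSum.decompose 𝒜 x 0 : 𝒜 0) : 𝔞), ((DirectSum.decompose 𝒜 y 0 : 𝒜 0) : 𝔞)⁆
    have hx : x ∈ ⨆ n, 𝒜 n := by
      rw [iSup_eq_top_of_isInternal (isInternal_pieces 𝒜)]; trivial
    have hy : y ∈ ⨆ n, 𝒜 n := by
      rw [iSup_eq_top_of_isInternal (isInternal_pieces 𝒜)]; trivial
    induction hx using Submodule.iSup_induction' with
    | zero => simp
    | add a c _ _ ha hc =>
      simp only [add_lie, DirectSum.decompose_add, DirectSum.add_apply, Submodule.coe_add, ha, hc]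
    | mem m x hx =>
      induction hy using Submodule.iSup_induction' with
      | zero => simp
      | add a c _ _ ha hc =>
        simp only [lie_add, DirectSum.decompose_add, DirectSum.add_apply, Submodule.coe_add, ha, hc]
      | mem n y hy =>
        by_cases hm : m = 0
        · subst hm
          rw [DirectSum.decompose_of_mem_same 𝒜 hx]
          by_cases hn : n = 0
          · subst hn
            rw [DirectSum.decompose_of_mem_same 𝒜 hy]
            exact DirectSum.decompose_of_mem_same 𝒜 (bracket_mem 𝒜 hx hy)
          · rw [DirectSum.decompose_of_mem_ne 𝒜 hy hn,
              DirectSum.decompose_of_mem_ne 𝒜 (bracket_mem 𝒜 hx hy) (by omega), lie_zero]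
        · rw [DirectSum.decompose_of_mem_ne 𝒜 hx hm,
              DirectSum.decompose_of_mem_ne 𝒜 (bracket_mem 𝒜 hx hy) (by omega), zero_lie]

theorem projZero_of_mem_zeroPart (y : zeroPart 𝒜) : projZero 𝒜 (y : 𝔞) = y := by
  ext
  exact DirectSum.decompose_of_mem_same 𝒜 y.2

theorem projZero_of_mem_ne {n : ℕ} (hn : n ≠ 0) {x : 𝔞} (hx : x ∈ 𝒜 n) : projZero 𝒜 x = 0 := by
  ext
  exact DirectSum.decompose_of_mem_ne 𝒜 hx hn

/-! ### Graded modules -/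

/-- A `ℤ`-graded module over the Lie algebra `𝔤 = 𝔞₀`, the grading being by submodules. -/
structure GrZeroMod where
  carrier : Type u
  [addCommGroup : AddCommGroup carrier]
  [module : Module ℂ carrier]
  [lieRingModule : LieRingModule (zeroPart 𝒜) carrier]
  [lieModule : LieModule ℂ (zeroPart 𝒜) carrier]
  gr : ℤ → Submodule ℂ carrier
  isInternal : DirectSum.IsInternal gr
  lie_mem : ∀ (k : ℤ) (y : zeroPart 𝒜) (v : carrier), v ∈ gr k → ⁅y, v⁆ ∈ gr k

/-- A `ℤ`-graded module over the graded Lie algebra `𝔞`. -/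
structure GrMod where
  carrier : Type u
  [addCommGroup : AddCommGroup carrier]
  [module : Module ℂ carrier]
  [lieRingModule : LieRingModule 𝔞 carrier]
  [lieModule : LieModule ℂ 𝔞 carrier]
  gr : ℤ → Submodule ℂ carrier
  isInternal : DirectSum.IsInternal gr
  lie_mem : ∀ (n : ℕ) (k : ℤ) (x : 𝔞) (v : carrier), x ∈ 𝒜 n → v ∈ gr k → ⁅x, v⁆ ∈ gr (n + k)

variable {𝒜}

attribute [instance] GrZeroMod.addCommGroup GrZeroMod.module GrZeroMod.lieRingModule
  GrZeroMod.lieModule GrMod.addCommGroup GrMod.module GrMod.lieRingModule GrMod.lieModule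

/-- Morphisms of graded modules: `𝔞`-linear maps `f` with `f(V[k]) ⊆ W[k]` for all `k`. They form
a complex vector space. -/
def gHom (V W : GrMod 𝒜) : Submodule ℂ (V.carrier →ₗ⁅ℂ,𝔞⁆ W.carrier) where
  carrier := {f | ∀ k, ∀ v ∈ V.gr k, f v ∈ W.gr k}
  add_mem' hf hg k v hv := add_mem (hf k v hv) (hg k v hv)
  zero_mem' k _ _ := zero_mem (W.gr k)
  smul_mem' c _ hf k v hv := (W.gr k).smul_mem c (hf k v hv)

/-- Composition of morphisms. -/
def gComp {U V W : GrMod 𝒜} (g : gHom V W) (f : gHom U V) : gHom U W :=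
  ⟨g.1.comp f.1, fun k v hv => g.2 k _ (f.2 k v hv)⟩

/-- The category of graded `𝔞`-modules. -/
instance : Category (GrMod 𝒜) where
  Hom V W := gHom V W
  id V := ⟨LieModuleHom.id, fun _ _ hv => hv⟩
  comp f g := gComp g f

/-- The graded piece `V[k]` as a `𝔤`-module. -/
def GrMod.piece (V : GrMod 𝒜) (k : ℤ) : LieSubmodule ℂ (zeroPart 𝒜) V.carrier where
  __ := V.gr k
  lie_mem := by
    intro y v hv
    have := V.lie_mem 0 k y v y.2 hv
    simpa using this

/-- A graded `𝔤`-module regarded as a graded `𝔞`-module on which `𝔞₊` acts by zero. -/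
def inflate (M : GrZeroMod 𝒜) : GrMod 𝒜 where
  carrier := M.carrier
  lieRingModule := LieRingModule.compLieHom M.carrier (projZero 𝒜)
  lieModule := LieModule.compLieHom M.carrier (projZero 𝒜)
  gr := M.gr
  isInternal := M.isInternal
  lie_mem := by
    intro n k x v hx hv
    change ⁅projZero 𝒜 x, v⁆ ∈ _
    by_cases hn : n = 0
    · subst hn
      simpa using M.lie_mem k _ v hv
    · rw [projZero_of_mem_ne 𝒜 hn hx, zero_lie]
      exact zero_mem _

theorem inflate_lie (M : GrZeroMod 𝒜) (x : 𝔞) (v : M.carrier) :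
    @Bracket.bracket 𝔞 (inflate M).carrier _ x v = ⁅projZero 𝒜 x, v⁆ := rfl

/-! ### Induced modules -/

section Ind

variable (𝒜) in
/-- The graded piece `U(𝔞)[i]`, spanned by the monomials `a₁ ⋯ aₖ` with `aₗ ∈ 𝔞_{sₗ}` and
`s₁ + ⋯ + sₖ = i`. -/
def ueaPiece (i : ℕ) : Submodule ℂ (UniversalEnvelopingAlgebra ℂ 𝔞) :=
  Submodule.span ℂ {a | ∃ l : List (Σ n, 𝒜 n), (l.map Sigma.fst).sum = i ∧
    a = (l.map fun p => UniversalEnvelopingAlgebra.ι ℂ (p.2 : 𝔞)).prod}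

theorem one_mem_ueaPiece : (1 : UniversalEnvelopingAlgebra ℂ 𝔞) ∈ ueaPiece 𝒜 0 :=
  Submodule.subset_span ⟨[], rfl, rfl⟩

theorem ι_mul_mem_ueaPiece {n i : ℕ} {x : 𝔞} (hx : x ∈ 𝒜 n)
    {u : UniversalEnvelopingAlgebra ℂ 𝔞} (hu : u ∈ ueaPiece 𝒜 i) :
    UniversalEnvelopingAlgebra.ι ℂ x * u ∈ ueaPiece 𝒜 (n + i) := by
  induction hu using Submodule.span_induction with
  | mem u hu =>
    obtain ⟨l, hl, rfl⟩ := hu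
    exact Submodule.subset_span ⟨⟨n, ⟨x, hx⟩⟩ :: l, by simp [hl], by simp⟩
  | zero => simp
  | add u v _ _ hu hv => rw [mul_add]; exact add_mem hu hv
  | smul c u _ hu => rw [mul_smul_comm]; exact Submodule.smul_mem _ c hu

variable (𝒜) in
theorem iSup_ueaPiece : ⨆ i, ueaPiece 𝒜 i = ⊤ := by
  rw [eq_top_iff]
  intro u _
  have key : ∀ x : 𝔞, ∀ v ∈ ⨆ i, ueaPiece 𝒜 i,
      UniversalEnvelopingAlgebra.ι ℂ x * v ∈ ⨆ i, ueaPiece 𝒜 i := by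
    intro x v hv
    have hx : x ∈ ⨆ n, 𝒜 n := by
      rw [iSup_eq_top_of_isInternal (isInternal_pieces 𝒜)]; trivial
    induction hv using Submodule.iSup_induction' with
    | zero => simp
    | add a c _ _ ha hc => rw [mul_add]; exact add_mem ha hc
    | mem i v hv =>
      induction hx using Submodule.iSup_induction' with
      | zero => simp
      | add a c _ _ ha hc => rw [map_add, add_mul]; exact add_mem ha hc
      | mem n x hx => exact Submodule.mem_iSup_of_mem (n + i) (ι_mul_mem_ueaPiece hx hv)
  let S : Subalgebra ℂ (UniversalEnvelopingAlgebra ℂ 𝔞) :=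
    { carrier := {a | ∀ v ∈ ⨆ i, ueaPiece 𝒜 i, a * v ∈ ⨆ i, ueaPiece 𝒜 i}
      mul_mem' := fun {a c} ha hc v hv => by rw [mul_assoc]; exact ha _ (hc v hv)
      add_mem' := fun {a c} ha hc v hv => by rw [add_mul]; exact add_mem (ha v hv) (hc v hv)
      algebraMap_mem' := fun c v hv => by
        rw [← Algebra.smul_def]; exact Submodule.smul_mem _ c hv }
  let f : 𝔞 →ₗ⁅ℂ⁆ S :=
    { toFun := fun x => ⟨UniversalEnvelopingAlgebra.ι ℂ x, key x⟩
      map_add' := fun x y => by ext; simp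
      map_smul' := fun c x => by ext; simp
      map_lie' := fun {x y} => by
        ext
        simp [LieRing.of_associative_ring_bracket] }
  have hF : S.val.comp (UniversalEnvelopingAlgebra.lift ℂ f) = AlgHom.id ℂ _ := by
    apply UniversalEnvelopingAlgebra.hom_ext
    ext x
    change ((UniversalEnvelopingAlgebra.lift ℂ f (UniversalEnvelopingAlgebra.ι ℂ x) : S) :
      UniversalEnvelopingAlgebra ℂ 𝔞) = UniversalEnvelopingAlgebra.ι ℂ x
    rw [UniversalEnvelopingAlgebra.lift_ι_apply]
    rfl
  have hu : u ∈ S := by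
    have h : ((UniversalEnvelopingAlgebra.lift ℂ f u : S) : UniversalEnvelopingAlgebra ℂ 𝔞) = u :=
      AlgHom.congr_fun hF u
    exact h ▸ (UniversalEnvelopingAlgebra.lift ℂ f u).2
  have := hu 1 (Submodule.mem_iSup_of_mem 0 one_mem_ueaPiece)
  rwa [mul_one] at this

variable (M : GrZeroMod 𝒜)

/-- The relations `u y ⊗ m = u ⊗ y m`, `y ∈ 𝔤`, which define `U(𝔞) ⊗_{U(𝔤)} M` as a quotient of
`U(𝔞) ⊗_ℂ M`. -/
def indRel : Submodule ℂ (UniversalEnvelopingAlgebra ℂ 𝔞 ⊗[ℂ] M.carrier) :=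
  Submodule.span ℂ {t | ∃ (u : UniversalEnvelopingAlgebra ℂ 𝔞) (y : zeroPart 𝒜) (m : M.carrier),
    t = (u * UniversalEnvelopingAlgebra.ι ℂ (y : 𝔞)) ⊗ₜ[ℂ] m - u ⊗ₜ[ℂ] ⁅y, m⁆}

/-- The underlying space of `U(𝔞) ⊗_{U(𝔤)} M`. -/
def IndCarrier : Type u := (UniversalEnvelopingAlgebra ℂ 𝔞 ⊗[ℂ] M.carrier) ⧸ indRel M

instance : AddCommGroup (IndCarrier M) :=
  inferInstanceAs (AddCommGroup ((UniversalEnvelopingAlgebra ℂ 𝔞 ⊗[ℂ] M.carrier) ⧸ indRel M))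

instance : Module ℂ (IndCarrier M) :=
  inferInstanceAs (Module ℂ ((UniversalEnvelopingAlgebra ℂ 𝔞 ⊗[ℂ] M.carrier) ⧸ indRel M))

/-- The class `u ⊗ m`. -/
def indMk : UniversalEnvelopingAlgebra ℂ 𝔞 →ₗ[ℂ] M.carrier →ₗ[ℂ] IndCarrier M :=
  (TensorProduct.mk ℂ (UniversalEnvelopingAlgebra ℂ 𝔞) M.carrier).compr₂ (indRel M).mkQ

theorem indMk_mul (u : UniversalEnvelopingAlgebra ℂ 𝔞) (y : zeroPart 𝒜) (m : M.carrier) :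
    indMk M (u * UniversalEnvelopingAlgebra.ι ℂ (y : 𝔞)) m = indMk M u ⁅y, m⁆ :=
  (Submodule.Quotient.eq _).mpr (Submodule.subset_span ⟨u, y, m, rfl⟩)

variable {M} in
@[ext]
theorem indCarrier_hom_ext {N : Type*} [AddCommGroup N] [Module ℂ N] {f g : IndCarrier M →ₗ[ℂ] N}
    (h : ∀ u m, f (indMk M u m) = g (indMk M u m)) : f = g := by
  apply Submodule.linearMap_qext
  apply TensorProduct.ext'
  exact h

variable {M} in
theorem indCarrier_induction {p : IndCarrier M → Prop} (hmk : ∀ u m, p (indMk M u m))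
    (hadd : ∀ a c, p a → p c → p (a + c)) (t : IndCarrier M) : p t := by
  obtain ⟨t, rfl⟩ := Submodule.mkQ_surjective (indRel M) t
  induction t using TensorProduct.induction_on with
  | zero =>
    have h := hmk 0 0
    rwa [map_zero] at h
  | tmul u m => exact hmk u m
  | add a c ha hc => exact hadd _ _ ha hc

variable {M} in
/-- Maps out of `U(𝔞) ⊗_{U(𝔤)} M` from balanced bilinear maps. -/
def indDesc {N : Type*} [AddCommGroup N] [Module ℂ N]
    (f : UniversalEnvelopingAlgebra ℂ 𝔞 →ₗ[ℂ] M.carrier →ₗ[ℂ] N)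
    (hf : ∀ u (y : zeroPart 𝒜) m,
      f (u * UniversalEnvelopingAlgebra.ι ℂ (y : 𝔞)) m = f u ⁅y, m⁆) :
    IndCarrier M →ₗ[ℂ] N :=
  (indRel M).liftQ (TensorProduct.lift f) (by
    rw [indRel, Submodule.span_le]
    rintro t ⟨u, y, m, rfl⟩
    simp [hf, -UniversalEnvelopingAlgebra.ι_apply])

variable {M} in
@[simp]
theorem indDesc_mk {N : Type*} [AddCommGroup N] [Module ℂ N]
    (f : UniversalEnvelopingAlgebra ℂ 𝔞 →ₗ[ℂ] M.carrier →ₗ[ℂ] N)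
    (hf : ∀ u (y : zeroPart 𝒜) m,
      f (u * UniversalEnvelopingAlgebra.ι ℂ (y : 𝔞)) m = f u ⁅y, m⁆) (u m) :
    indDesc f hf (indMk M u m) = f u m := rfl

/-- Left multiplication by an element of `U(𝔞)`. -/
def indMul (a : UniversalEnvelopingAlgebra ℂ 𝔞) : IndCarrier M →ₗ[ℂ] IndCarrier M :=
  indDesc ((indMk M) ∘ₗ LinearMap.mulLeft ℂ a) (by
    intro u y m
    simp [← mul_assoc, indMk_mul, -UniversalEnvelopingAlgebra.ι_apply])

@[simp]
theorem indMul_mk (a u : UniversalEnvelopingAlgebra ℂ 𝔞) (m : M.carrier) :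
    indMul M a (indMk M u m) = indMk M (a * u) m := rfl

/-- `𝔞` acts on `U(𝔞) ⊗_{U(𝔤)} M` by left multiplication. -/
instance : LieRingModule 𝔞 (IndCarrier M) where
  bracket x t := indMul M (UniversalEnvelopingAlgebra.ι ℂ x) t
  add_lie x y t := by
    induction t using indCarrier_induction with
    | hmk u m => simp [add_mul]
    | hadd a c ha hc => simp only [map_add] at ha hc ⊢; rw [ha, hc]; abel
  lie_add x s t := map_add _ _ _
  leibniz_lie x y t := by
    induction t using indCarrier_induction with
    | hmk u m =>
      simp only [indMul_mk, LieHom.map_lie, LieRing.of_associative_ring_bracket, sub_mul, map_sub,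
        LinearMap.sub_apply, mul_assoc]
      abel
    | hadd a c ha hc => simp only [map_add] at ha hc ⊢; rw [ha, hc]; abel

@[simp]
theorem lie_indMk (x : 𝔞) (u : UniversalEnvelopingAlgebra ℂ 𝔞) (m : M.carrier) :
    ⁅x, indMk M u m⁆ = indMk M (UniversalEnvelopingAlgebra.ι ℂ x * u) m := rfl

instance : LieModule ℂ 𝔞 (IndCarrier M) where
  smul_lie c x t := by
    induction t using indCarrier_induction with
    | hmk u m => simp
    | hadd a d ha hd => rw [lie_add, ha, hd, lie_add, smul_add]
  lie_smul c x t := map_smul (indMul M (UniversalEnvelopingAlgebra.ι ℂ x)) c t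

/-- The graded piece `(U(𝔞) ⊗_{U(𝔤)} M)[k]`, spanned by the images of `U(𝔞)[i] ⊗ M[k - i]`. -/
def indPiece (k : ℤ) : Submodule ℂ (IndCarrier M) :=
  Submodule.span ℂ {t | ∃ (i : ℕ) (l : ℤ) (u : UniversalEnvelopingAlgebra ℂ 𝔞) (m : M.carrier),
    u ∈ ueaPiece 𝒜 i ∧ m ∈ M.gr l ∧ i + l = k ∧ t = indMk M u m}

theorem indMk_mem {i : ℕ} {l k : ℤ} {u : UniversalEnvelopingAlgebra ℂ 𝔞} {m : M.carrier}
    (hu : u ∈ ueaPiece 𝒜 i) (hm : m ∈ M.gr l) (h : i + l = k) : indMk M u m ∈ indPiece M k :=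
  Submodule.subset_span ⟨i, l, u, m, hu, hm, h, rfl⟩

variable (𝒜) in
/-- A homogeneous scaling of `𝔞`, an endomorphism of Lie algebras. -/
theorem exists_lieScaling : ∃ σ : 𝔞 →ₗ⁅ℂ⁆ 𝔞, ∀ n, ∀ x ∈ 𝒜 n, σ x = (2 : ℂ) ^ n • x := by
  obtain ⟨σ, hσ⟩ := exists_scaling 𝒜 (isInternal_pieces 𝒜) (fun n => (2 : ℂ) ^ n)
  refine ⟨{ σ with map_lie' := ?_ }, hσ⟩
  intro x y
  change σ ⁅x, y⁆ = ⁅σ x, σ y⁆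
  have hx : x ∈ ⨆ n, 𝒜 n := by
    rw [iSup_eq_top_of_isInternal (isInternal_pieces 𝒜)]; trivial
  have hy : y ∈ ⨆ n, 𝒜 n := by
    rw [iSup_eq_top_of_isInternal (isInternal_pieces 𝒜)]; trivial
  induction hx using Submodule.iSup_induction' with
  | zero => simp
  | add a c _ _ ha hc => simp only [add_lie, map_add, ha, hc]
  | mem m x hx =>
    induction hy using Submodule.iSup_induction' with
    | zero => simp
    | add a c _ _ ha hc => simp only [lie_add, map_add, ha, hc]
    | mem n y hy =>
      rw [hσ m x hx, hσ n y hy, hσ _ _ (bracket_mem 𝒜 hx hy), smul_lie, lie_smul, smul_smul,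
        pow_add]

variable (𝒜) in
theorem exists_ueaScaling : ∃ Ψ : UniversalEnvelopingAlgebra ℂ 𝔞 →ₐ[ℂ]
    UniversalEnvelopingAlgebra ℂ 𝔞, (∀ i, ∀ u ∈ ueaPiece 𝒜 i, Ψ u = (2 : ℂ) ^ i • u) ∧
    ∀ y : zeroPart 𝒜, Ψ (UniversalEnvelopingAlgebra.ι ℂ (y : 𝔞)) =
      UniversalEnvelopingAlgebra.ι ℂ (y : 𝔞) := by
  obtain ⟨σ, hσ⟩ := exists_lieScaling 𝒜
  let Ψ := UniversalEnvelopingAlgebra.lift ℂ ((UniversalEnvelopingAlgebra.ι ℂ (L := 𝔞)).comp σ)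
  have hΨ : ∀ n, ∀ x ∈ 𝒜 n, Ψ (UniversalEnvelopingAlgebra.ι ℂ x) =
      (2 : ℂ) ^ n • UniversalEnvelopingAlgebra.ι ℂ x := by
    intro n x hx
    simp only [Ψ]
    rw [UniversalEnvelopingAlgebra.lift_ι_apply, LieHom.comp_apply, hσ n x hx, map_smul]
  refine ⟨Ψ, ?_, ?_⟩
  · intro i u hu
    induction hu using Submodule.span_induction with
    | zero => simp
    | add a c _ _ ha hc => rw [map_add, ha, hc, smul_add]
    | smul d a _ ha => rw [map_smul, ha, smul_comm]
    | mem u hu =>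
      obtain ⟨l, rfl, rfl⟩ := hu
      induction l with
      | nil => simp
      | cons p l ih =>
        simp only [List.map_cons, List.prod_cons, List.sum_cons]
        rw [map_mul, ih, hΨ p.1 _ p.2.2, smul_mul_smul_comm, pow_add]
  · intro y
    simpa using hΨ 0 y y.2

theorem indPiece_isInternal : DirectSum.IsInternal (indPiece M) := by
  obtain ⟨Ψ, hΨ, hΨ0⟩ := exists_ueaScaling 𝒜
  obtain ⟨σ, hσ⟩ := exists_scaling M.gr M.isInternal (fun k => (2 : ℂ) ^ k)
  have hσy : ∀ (y : zeroPart 𝒜) (m : M.carrier), σ ⁅y, m⁆ = ⁅y, σ m⁆ := by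
    intro y m
    have hm : m ∈ ⨆ n, M.gr n := by
      rw [iSup_eq_top_of_isInternal M.isInternal]; trivial
    induction hm using Submodule.iSup_induction' with
    | zero => simp
    | add a c _ _ ha hc => simp only [lie_add, map_add, ha, hc]
    | mem k m hm => rw [hσ k _ (M.lie_mem k y m hm), hσ k m hm, lie_smul]
  let φ : IndCarrier M →ₗ[ℂ] IndCarrier M :=
    indDesc ((indMk M).compl₁₂ Ψ.toLinearMap σ) (by
      intro u y m
      simp [hΨ0, hσy, indMk_mul, -UniversalEnvelopingAlgebra.ι_apply])
  apply isInternal_of_scaling _ φ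
  · intro k v hv
    induction hv using Submodule.span_induction with
    | zero => simp
    | add a c _ _ ha hc => rw [map_add, ha, hc, smul_add]
    | smul d a _ ha => rw [map_smul, ha, smul_comm]
    | mem v hv =>
      obtain ⟨i, l, u, m, hu, hm, rfl, rfl⟩ := hv
      simp only [φ, indDesc_mk, LinearMap.compl₁₂_apply, AlgHom.toLinearMap_apply]
      rw [hΨ i u hu, hσ l m hm, map_smul, map_smul, LinearMap.smul_apply, smul_smul,
        zpow_add₀ (by norm_num), zpow_natCast, mul_comm]
  · rw [eq_top_iff]
    rintro t -
    induction t using indCarrier_induction with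
    | hadd a c ha hc => exact add_mem ha hc
    | hmk u m =>
      have hu : u ∈ ⨆ i, ueaPiece 𝒜 i := by rw [iSup_ueaPiece]; trivial
      have hm : m ∈ ⨆ n, M.gr n := by
        rw [iSup_eq_top_of_isInternal M.isInternal]; trivial
      induction hu using Submodule.iSup_induction' with
      | zero => simp
      | add a c _ _ ha hc => rw [map_add, LinearMap.add_apply]; exact add_mem ha hc
      | mem i u hu =>
        induction hm using Submodule.iSup_induction' with
        | zero => simp
        | add a c _ _ ha hc => rw [map_add]; exact add_mem ha hc
        | mem l m hm => exact Submodule.mem_iSup_of_mem (i + l) (indMk_mem M hu hm rfl)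

/-- The graded `𝔞`-module `U(𝔞) ⊗_{U(𝔤)} M`. -/
def Ind : GrMod 𝒜 where
  carrier := IndCarrier M
  gr := indPiece M
  isInternal := indPiece_isInternal M
  lie_mem := by
    intro n k x v hx hv
    induction hv using Submodule.span_induction with
    | zero => simp
    | add a c _ _ ha hc => rw [lie_add]; exact add_mem ha hc
    | smul d a _ ha => rw [lie_smul]; exact Submodule.smul_mem _ d ha
    | mem v hv =>
      obtain ⟨i, l, u, m, hu, hm, rfl, rfl⟩ := hv
      rw [lie_indMk]
      exact indMk_mem M (ι_mul_mem_ueaPiece hx hu) hm (by push_cast; ring)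

variable {M} in
/-- The linear map `u ⊗ m ↦ u f(m)`. -/
def indLiftLinear {W : GrMod 𝒜} (f : M.carrier →ₗ[ℂ] W.carrier)
    (hf : ∀ (y : zeroPart 𝒜) m, f ⁅y, m⁆ = ⁅(y : 𝔞), f m⁆) : IndCarrier M →ₗ[ℂ] W.carrier :=
  indDesc (N := W.carrier) ((LinearMap.lcomp ℂ W.carrier f) ∘ₗ
    (UniversalEnvelopingAlgebra.lift ℂ (LieModule.toEnd ℂ 𝔞 W.carrier)).toLinearMap) (by
      intro u y m
      simp only [LinearMap.comp_apply, AlgHom.toLinearMap_apply, map_mul, LinearMap.lcomp_apply]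
      rw [Module.End.mul_apply, UniversalEnvelopingAlgebra.lift_ι_apply, hf]
      rfl)

variable {M} in
theorem indLiftLinear_mk {W : GrMod 𝒜} (f : M.carrier →ₗ[ℂ] W.carrier)
    (hf : ∀ (y : zeroPart 𝒜) m, f ⁅y, m⁆ = ⁅(y : 𝔞), f m⁆)
    (u : UniversalEnvelopingAlgebra ℂ 𝔞) (m : M.carrier) :
    indLiftLinear f hf (indMk M u m) =
      UniversalEnvelopingAlgebra.lift ℂ (LieModule.toEnd ℂ 𝔞 W.carrier) u (f m) := rfl

variable {M} in
theorem indLiftLinear_mem {W : GrMod 𝒜} (f : M.carrier →ₗ[ℂ] W.carrier)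
    (hf : ∀ (y : zeroPart 𝒜) m, f ⁅y, m⁆ = ⁅(y : 𝔞), f m⁆)
    (hgr : ∀ k, ∀ m ∈ M.gr k, f m ∈ W.gr k) {k : ℤ} {t : IndCarrier M} (ht : t ∈ indPiece M k) :
    indLiftLinear f hf t ∈ W.gr k := by
  induction ht using Submodule.span_induction with
  | zero => simp
  | add a c _ _ ha hc => rw [map_add]; exact add_mem ha hc
  | smul d a _ ha => rw [map_smul]; exact Submodule.smul_mem _ d ha
  | mem t ht =>
    obtain ⟨i, l, u, m, hu, hm, rfl, rfl⟩ := ht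
    rw [indLiftLinear_mk]
    have hfm := hgr l m hm
    induction hu using Submodule.span_induction with
    | zero => simp
    | add a c _ _ ha hc => rw [map_add, LinearMap.add_apply]; exact add_mem ha hc
    | smul d a _ ha => rw [map_smul]; exact Submodule.smul_mem _ d ha
    | mem u hu =>
      obtain ⟨L, rfl, rfl⟩ := hu
      induction L with
      | nil => simpa using hfm
      | cons p L ih =>
        simp only [List.map_cons, List.prod_cons, List.sum_cons, map_mul]
        rw [Module.End.mul_apply, UniversalEnvelopingAlgebra.lift_ι_apply]
        have := W.lie_mem p.1 _ _ _ p.2.2 ih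
        rw [← add_assoc] at this
        exact_mod_cast this

variable {M} in
/-- The morphism `U(𝔞) ⊗_{U(𝔤)} M → W`, `u ⊗ m ↦ u f(m)`, given by a graded `𝔤`-linear map
`f : M → W`. -/
def indLift {W : GrMod 𝒜} (f : M.carrier →ₗ[ℂ] W.carrier)
    (hf : ∀ (y : zeroPart 𝒜) m, f ⁅y, m⁆ = ⁅(y : 𝔞), f m⁆)
    (hgr : ∀ k, ∀ m ∈ M.gr k, f m ∈ W.gr k) : gHom (Ind M) W :=
  ⟨{ indLiftLinear f hf with
      map_lie' := by
        intro x t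
        change indLiftLinear f hf ⁅x, t⁆ = ⁅x, indLiftLinear f hf t⁆
        induction t using indCarrier_induction with
        | hmk u m =>
          rw [lie_indMk, indLiftLinear_mk, indLiftLinear_mk, map_mul, Module.End.mul_apply,
            UniversalEnvelopingAlgebra.lift_ι_apply]
          rfl
        | hadd a c ha hc => rw [lie_add, map_add, ha, hc, map_add, lie_add] },
    fun _ _ ht => indLiftLinear_mem f hf hgr ht⟩

theorem indLift_mk {W : GrMod 𝒜} (f : M.carrier →ₗ[ℂ] W.carrier)
    (hf : ∀ (y : zeroPart 𝒜) m, f ⁅y, m⁆ = ⁅(y : 𝔞), f m⁆)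
    (hgr : ∀ k, ∀ m ∈ M.gr k, f m ∈ W.gr k) (u : UniversalEnvelopingAlgebra ℂ 𝔞) (m : M.carrier) :
    (indLift f hf hgr).1 (indMk M u m) =
      UniversalEnvelopingAlgebra.lift ℂ (LieModule.toEnd ℂ 𝔞 W.carrier) u (f m) := rfl

end Ind

/-! ### The Chevalley–Eilenberg modules and differentials -/

section Koszul

variable (M : GrZeroMod 𝒜) (j : ℕ)

/-- The space `⋀ʲ 𝔞₊ ⊗ M`. -/
def WedgeCarrier : Type u := (⋀[ℂ]^j (posPart 𝒜)) ⊗[ℂ] M.carrier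

instance : AddCommGroup (WedgeCarrier M j) :=
  inferInstanceAs (AddCommGroup ((⋀[ℂ]^j (posPart 𝒜)) ⊗[ℂ] M.carrier))

instance : Module ℂ (WedgeCarrier M j) :=
  inferInstanceAs (Module ℂ ((⋀[ℂ]^j (posPart 𝒜)) ⊗[ℂ] M.carrier))

/-- `𝔤` acts diagonally on `⋀ʲ 𝔞₊ ⊗ M`, through the adjoint action on `𝔞₊`. -/
instance : LieRingModule (zeroPart 𝒜) (WedgeCarrier M j) :=
  inferInstanceAs (LieRingModule (zeroPart 𝒜) ((⋀[ℂ]^j (posPart 𝒜)) ⊗[ℂ] M.carrier))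

instance : LieModule ℂ (zeroPart 𝒜) (WedgeCarrier M j) :=
  inferInstanceAs (LieModule ℂ (zeroPart 𝒜) ((⋀[ℂ]^j (posPart 𝒜)) ⊗[ℂ] M.carrier))

/-- The element `w ⊗ m`. -/
def wedgeMk : (⋀[ℂ]^j (posPart 𝒜)) →ₗ[ℂ] M.carrier →ₗ[ℂ] WedgeCarrier M j :=
  TensorProduct.mk ℂ (⋀[ℂ]^j (posPart 𝒜)) M.carrier

/-- The element `(x₁ ∧ … ∧ xⱼ) ⊗ m`. -/
def wedge (x : Fin j → posPart 𝒜) (m : M.carrier) : WedgeCarrier M j :=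
  wedgeMk M j (exteriorPower.ιMulti ℂ j x) m

variable {M j} in
/-- Maps out of `⋀ʲ 𝔞₊ ⊗ M` from bilinear maps. -/
def wedgeDesc {N : Type*} [AddCommGroup N] [Module ℂ N]
    (f : (⋀[ℂ]^j (posPart 𝒜)) →ₗ[ℂ] M.carrier →ₗ[ℂ] N) : WedgeCarrier M j →ₗ[ℂ] N :=
  TensorProduct.lift f

variable {M j} in
theorem wedgeDesc_mk {N : Type*} [AddCommGroup N] [Module ℂ N]
    (f : (⋀[ℂ]^j (posPart 𝒜)) →ₗ[ℂ] M.carrier →ₗ[ℂ] N) (w m) :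
    wedgeDesc f (wedgeMk M j w m) = f w m := rfl

theorem zeroPart_lie_wedge_aux (y : zeroPart 𝒜) (x : Fin j → posPart 𝒜) :
    ⁅y, exteriorPower.ιMulti ℂ j x⁆ =
      ∑ l, exteriorPower.ιMulti ℂ j (Function.update x l ⁅(y : 𝔞), x l⁆) :=
  lie_ιMulti j y x

theorem lie_wedgeMk (y : zeroPart 𝒜) (w : ⋀[ℂ]^j (posPart 𝒜)) (m : M.carrier) :
    ⁅y, wedgeMk M j w m⁆ = wedgeMk M j ⁅y, w⁆ m + wedgeMk M j w ⁅y, m⁆ :=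
  TensorProduct.LieModule.lie_tmul_right y w m

theorem lie_wedge (y : zeroPart 𝒜) (x : Fin j → posPart 𝒜) (m : M.carrier) :
    ⁅y, wedge M j x m⁆ =
      ∑ l, wedge M j (Function.update x l ⁅(y : 𝔞), x l⁆) m + wedge M j x ⁅y, m⁆ := by
  rw [wedge, lie_wedgeMk, zeroPart_lie_wedge_aux, map_sum, LinearMap.sum_apply]
  rfl

/-- The graded piece `(⋀ʲ 𝔞₊ ⊗ M)[k]`, spanned by the `(x₁ ∧ … ∧ xⱼ) ⊗ m` with `xₗ ∈ 𝔞_{nₗ}`,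
`m ∈ M[i]` and `n₁ + ⋯ + nⱼ + i = k`. -/
def wedgePiece (k : ℤ) : Submodule ℂ (WedgeCarrier M j) :=
  Submodule.span ℂ {t | ∃ (x : Fin j → posPart 𝒜) (n : Fin j → ℕ) (i : ℤ) (m : M.carrier),
    (∀ l, (x l : 𝔞) ∈ 𝒜 (n l)) ∧ m ∈ M.gr i ∧ (∑ l, n l : ℕ) + i = k ∧ t = wedge M j x m}

theorem wedge_mem {x : Fin j → posPart 𝒜} {n : Fin j → ℕ} {i k : ℤ} {m : M.carrier}
    (hx : ∀ l, (x l : 𝔞) ∈ 𝒜 (n l)) (hm : m ∈ M.gr i) (hk : (∑ l, n l : ℕ) + i = k) :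
    wedge M j x m ∈ wedgePiece M j k :=
  Submodule.subset_span ⟨x, n, i, m, hx, hm, hk, rfl⟩

variable (𝒜) in
theorem span_homogeneous_posPart :
    Submodule.span ℂ {x : posPart 𝒜 | ∃ n, (x : 𝔞) ∈ 𝒜 n} = ⊤ := by
  rw [eq_top_iff]
  rintro ⟨x, hx⟩ -
  have hx' : x ∈ ⨆ n : ℕ, 𝒜 (n + 1) := hx
  suffices h : ∀ y ∈ ⨆ n : ℕ, 𝒜 (n + 1), ∀ hy : y ∈ posPart 𝒜,
      (⟨y, hy⟩ : posPart 𝒜) ∈ Submodule.span ℂ {x : posPart 𝒜 | ∃ n, (x : 𝔞) ∈ 𝒜 n} from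
    h x hx' hx
  intro y hy
  induction hy using Submodule.iSup_induction' with
  | zero => intro h; exact zero_mem _
  | mem n y hy => intro h; exact Submodule.subset_span ⟨n + 1, hy⟩
  | add a c ha hc iha ihc => intro h; exact add_mem (iha ha) (ihc hc)

variable (𝒜) in
theorem span_homogeneous_exterior :
    Submodule.span ℂ {w : ⋀[ℂ]^j (posPart 𝒜) | ∃ x : Fin j → posPart 𝒜,
      (∀ l, ∃ n, (x l : 𝔞) ∈ 𝒜 n) ∧ w = exteriorPower.ιMulti ℂ j x} = ⊤ := by
  rw [eq_top_iff, ← exteriorPower.ιMulti_span_of_span ℂ j _ (span_homogeneous_posPart 𝒜)]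
  refine Submodule.span_mono ?_
  rintro _ ⟨x, hx, rfl⟩
  exact ⟨x, fun l => hx ⟨l, rfl⟩, rfl⟩

variable {M j} in
theorem wedge_induction {p : WedgeCarrier M j → Prop}
    (hmk : ∀ x m, p (wedge M j x m)) (hadd : ∀ a c, p a → p c → p (a + c))
    (hsmul : ∀ (d : ℂ) a, p a → p (d • a)) (t : WedgeCarrier M j) : p t := by
  have hz : p 0 := by
    have h := hsmul 0 _ (hmk (fun _ => 0) 0)
    rwa [zero_smul] at h
  suffices h : ∀ w m, p (wedgeMk M j w m) by
    refine TensorProduct.induction_on (motive := p) t hz h hadd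
  intro w m
  have hw : w ∈ Submodule.span ℂ (Set.range (exteriorPower.ιMulti ℂ j)) := by
    rw [exteriorPower.ιMulti_span]; trivial
  induction hw using Submodule.span_induction with
  | zero => rw [map_zero, LinearMap.zero_apply]; exact hz
  | add a c _ _ ha hc => rw [map_add, LinearMap.add_apply]; exact hadd _ _ ha hc
  | smul d a _ ha => rw [map_smul, LinearMap.smul_apply]; exact hsmul _ _ ha
  | mem w hw => obtain ⟨x, rfl⟩ := hw; exact hmk x m

theorem iSup_wedgePiece : ⨆ k, wedgePiece M j k = ⊤ := by
  rw [eq_top_iff]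
  rintro t -
  suffices h : ∀ w m, wedgeMk M j w m ∈ ⨆ k, wedgePiece M j k from
    TensorProduct.induction_on (motive := fun t : WedgeCarrier M j => t ∈ ⨆ k, wedgePiece M j k)
      t (zero_mem _) h (fun _ _ => add_mem)
  intro w m
  have hm : m ∈ ⨆ n, M.gr n := by
    rw [iSup_eq_top_of_isInternal M.isInternal]; trivial
  have hw := (Submodule.eq_top_iff'.mp (span_homogeneous_exterior 𝒜 j)) w
  induction hm using Submodule.iSup_induction' with
  | zero => rw [map_zero]; exact zero_mem _
  | add a c _ _ ha hc => rw [map_add]; exact add_mem ha hc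
  | mem i m hm =>
    induction hw using Submodule.span_induction with
    | zero => rw [map_zero]; exact zero_mem _
    | add a c _ _ ha hc => rw [map_add]; exact add_mem ha hc
    | smul d a _ ha => rw [map_smul]; exact Submodule.smul_mem _ d ha
    | mem w hw =>
      obtain ⟨x, hx, rfl⟩ := hw
      choose n hn using hx
      exact Submodule.mem_iSup_of_mem _ (wedge_mem M j hn hm rfl)

theorem wedgePiece_isInternal : DirectSum.IsInternal (wedgePiece M j) := by
  obtain ⟨σ, hσ⟩ := exists_lieScaling 𝒜
  obtain ⟨σM, hσM⟩ := exists_scaling M.gr M.isInternal (fun k => (2 : ℂ) ^ k)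
  have hpos : ∀ x : 𝔞, x ∈ posPart 𝒜 → σ x ∈ posPart 𝒜 := by
    intro x hx
    have hx' : x ∈ ⨆ n : ℕ, 𝒜 (n + 1) := hx
    change σ x ∈ ⨆ n : ℕ, 𝒜 (n + 1)
    clear hx
    induction hx' using Submodule.iSup_induction' with
    | zero => rw [map_zero]; exact zero_mem _
    | add a c ha hc iha ihc => rw [map_add]; exact add_mem iha ihc
    | mem n x hx =>
      rw [hσ _ x hx]
      exact Submodule.mem_iSup_of_mem n (Submodule.smul_mem _ _ hx)
  let σ' : posPart 𝒜 →ₗ[ℂ] posPart 𝒜 :=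
    { toFun := fun x => ⟨σ x, hpos x x.2⟩
      map_add' := fun x y => by ext; simp
      map_smul' := fun c x => by ext; simp }
  let φ : WedgeCarrier M j →ₗ[ℂ] WedgeCarrier M j :=
    wedgeDesc ((wedgeMk M j).compl₁₂ (exteriorPower.map j σ') σM)
  apply isInternal_of_scaling (wedgePiece M j) φ
  · intro k v hv
    induction hv using Submodule.span_induction with
    | zero => simp
    | add a c _ _ ha hc => rw [map_add, ha, hc, smul_add]
    | smul d a _ ha => rw [map_smul, ha, smul_comm]
    | mem v hv =>
      obtain ⟨x, n, i, m, hx, hm, rfl, rfl⟩ := hv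
      have h : (fun l => σ' (x l)) = fun l => (2 : ℂ) ^ n l • x l := by
        ext l
        exact hσ _ _ (hx l)
      have h1 : φ (wedge M j x m) =
          wedgeMk M j (exteriorPower.ιMulti ℂ j (fun l => σ' (x l))) (σM m) := by
        rw [wedge, wedgeDesc_mk, LinearMap.compl₁₂_apply, exteriorPower.map_apply_ιMulti]
        rfl
      rw [h1, h, AlternatingMap.map_smul_univ, hσM i m hm, map_smul, map_smul,
        LinearMap.smul_apply, smul_smul, zpow_add₀ (by norm_num), zpow_natCast,
        Finset.prod_pow_eq_pow_sum, mul_comm]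
      rfl
  · exact iSup_wedgePiece M j

theorem wedgePiece_lie_mem (k : ℤ) (y : zeroPart 𝒜) (v : WedgeCarrier M j)
    (hv : v ∈ wedgePiece M j k) : ⁅y, v⁆ ∈ wedgePiece M j k := by
  induction hv using Submodule.span_induction with
  | zero => rw [lie_zero]; exact zero_mem _
  | add a c _ _ ha hc => rw [lie_add]; exact add_mem ha hc
  | smul d a _ ha => rw [lie_smul]; exact Submodule.smul_mem _ d ha
  | mem v hv =>
    obtain ⟨x, n, i, m, hx, hm, rfl, rfl⟩ := hv
    rw [lie_wedge]
    refine add_mem (sum_mem fun l _ => ?_) (wedge_mem M j hx (M.lie_mem i y m hm) rfl)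
    refine wedge_mem M j (n := n) ?_ hm rfl
    intro p
    by_cases hp : p = l
    · subst hp
      rw [Function.update_self]
      have h := bracket_mem 𝒜 (m := 0) y.2 (hx p)
      rw [zero_add] at h
      exact h
    · rw [Function.update_of_ne hp]
      exact hx p

/-- The graded `𝔤`-module `⋀ʲ 𝔞₊ ⊗ M`. -/
def wedgeTensor : GrZeroMod 𝒜 where
  carrier := WedgeCarrier M j
  gr := wedgePiece M j
  isInternal := wedgePiece_isInternal M j
  lie_mem := wedgePiece_lie_mem M j

/-- The space `U(𝔞) ⊗_{U(𝔤)} (⋀ʲ 𝔞₊ ⊗ M)`. -/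
abbrev KoszulCarrier : Type u := IndCarrier (wedgeTensor M j)

/-- The element `u ⊗ w`. -/
def koszulMk : UniversalEnvelopingAlgebra ℂ 𝔞 →ₗ[ℂ] WedgeCarrier M j →ₗ[ℂ] KoszulCarrier M j :=
  indMk (wedgeTensor M j)

/-- For `x ∈ 𝔞`, the operator `(ad x) ⊗ 1` on `⋀ʲ 𝔞₊ ⊗ M`, where `ad x` acts on the exterior
power as a derivation. -/
def wedgeAd : 𝔞 →ₗ[ℂ] WedgeCarrier M j →ₗ[ℂ] WedgeCarrier M j where
  toFun x := wedgeDesc ((wedgeMk M j) ∘ₗ (LieModule.toEnd ℂ 𝔞 (⋀[ℂ]^j (posPart 𝒜)) x))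
  map_add' x y := TensorProduct.ext' fun w m => by
    change wedgeMk M j ⁅x + y, w⁆ m = wedgeMk M j ⁅x, w⁆ m + wedgeMk M j ⁅y, w⁆ m
    rw [add_lie, map_add, LinearMap.add_apply]
  map_smul' c x := TensorProduct.ext' fun w m => by
    change wedgeMk M j ⁅c • x, w⁆ m = c • wedgeMk M j ⁅x, w⁆ m
    rw [smul_lie, map_smul, LinearMap.smul_apply]

theorem wedgeAd_mk (x : 𝔞) (w : ⋀[ℂ]^j (posPart 𝒜)) (m : M.carrier) :
    wedgeAd M j x (wedgeMk M j w m) = wedgeMk M j ⁅x, w⁆ m := rfl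

theorem wedgeAd_wedge (z : 𝔞) (x : Fin j → posPart 𝒜) (m : M.carrier) :
    wedgeAd M j z (wedge M j x m) = ∑ l, wedge M j (Function.update x l ⁅z, x l⁆) m := by
  rw [wedge, wedgeAd_mk, lie_ιMulti, map_sum, LinearMap.sum_apply]
  rfl

/-- For `x ∈ 𝔞₊` and `w ∈ ⋀ʲ 𝔞₊ ⊗ M`, the element `x ⊗ w - ½ (1 ⊗ (ad x) w)`. -/
def koszulStep : posPart 𝒜 →ₗ[ℂ] WedgeCarrier M j →ₗ[ℂ] KoszulCarrier M j :=
  (koszulMk M j ∘ₗ (UniversalEnvelopingAlgebra.ι ℂ (L := 𝔞)).toLinearMap -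
    (1 / 2 : ℂ) • ((koszulMk M j 1).compRight ℂ ∘ₗ wedgeAd M j)) ∘ₗ (posPart 𝒜).subtype

theorem koszulStep_apply (x : posPart 𝒜) (w : WedgeCarrier M j) :
    koszulStep M j x w = koszulMk M j (UniversalEnvelopingAlgebra.ι ℂ (x : 𝔞)) w -
      (1 / 2 : ℂ) • koszulMk M j 1 (wedgeAd M j x w) := rfl

theorem lift_toEnd_ind (M : GrZeroMod 𝒜) (u : UniversalEnvelopingAlgebra ℂ 𝔞) (t : IndCarrier M) :
    UniversalEnvelopingAlgebra.lift ℂ (LieModule.toEnd ℂ 𝔞 (IndCarrier M)) u t =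
      indMul M u t := by
  let F : UniversalEnvelopingAlgebra ℂ 𝔞 →ₐ[ℂ] Module.End ℂ (IndCarrier M) :=
    AlgHom.ofLinearMap
      { toFun := indMul M
        map_add' := fun a c => indCarrier_hom_ext fun u m => by simp [add_mul]
        map_smul' := fun d a => indCarrier_hom_ext fun u m => by simp }
      (indCarrier_hom_ext fun u m => by
        change indMul M 1 _ = _
        rw [indMul_mk, one_mul]; rfl)
      (fun a c => indCarrier_hom_ext fun u m => by
        change indMul M (a * c) (indMk M u m) = indMul M a (indMul M c (indMk M u m))
        simp only [indMul_mk, mul_assoc])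
  have hF : F = UniversalEnvelopingAlgebra.lift ℂ (LieModule.toEnd ℂ 𝔞 (IndCarrier M)) :=
    (UniversalEnvelopingAlgebra.lift_unique ℂ _ F).mp rfl
  rw [← hF]
  rfl

theorem coe_lie_posPart (y : zeroPart 𝒜) (x : posPart 𝒜) : ⁅y, x⁆ = ⁅(y : 𝔞), x⁆ := rfl

theorem coe_lie_exterior (y : zeroPart 𝒜) (w : ⋀[ℂ]^j (posPart 𝒜)) : ⁅y, w⁆ = ⁅(y : 𝔞), w⁆ := rfl

theorem lie_koszulMk (x : 𝔞) (u : UniversalEnvelopingAlgebra ℂ 𝔞) (w : WedgeCarrier M j) :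
    ⁅x, koszulMk M j u w⁆ = koszulMk M j (UniversalEnvelopingAlgebra.ι ℂ x * u) w := rfl

theorem koszulMk_mul (u : UniversalEnvelopingAlgebra ℂ 𝔞) (y : zeroPart 𝒜)
    (w : WedgeCarrier M j) :
    koszulMk M j (u * UniversalEnvelopingAlgebra.ι ℂ (y : 𝔞)) w = koszulMk M j u ⁅y, w⁆ :=
  indMk_mul (wedgeTensor M j) u y w

theorem koszulMk_ι_mul (y : zeroPart 𝒜) (x : 𝔞) (w : WedgeCarrier M j) :
    koszulMk M j (UniversalEnvelopingAlgebra.ι ℂ (y : 𝔞) * UniversalEnvelopingAlgebra.ι ℂ x) w =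
      koszulMk M j (UniversalEnvelopingAlgebra.ι ℂ ⁅(y : 𝔞), x⁆) w +
      koszulMk M j (UniversalEnvelopingAlgebra.ι ℂ x) ⁅y, w⁆ := by
  rw [← koszulMk_mul, LieHom.map_lie, LieRing.of_associative_ring_bracket, map_sub,
    LinearMap.sub_apply, sub_add_cancel]

theorem lie_wedgeAd (y : zeroPart 𝒜) (x : 𝔞) (w : WedgeCarrier M j) :
    ⁅y, wedgeAd M j x w⁆ = wedgeAd M j ⁅(y : 𝔞), x⁆ w + wedgeAd M j x ⁅y, w⁆ := by
  induction w using wedge_induction with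
  | hadd a c ha hc => simp only [map_add, lie_add, ha, hc]; abel
  | hsmul d a ha => simp only [map_smul, lie_smul, ha, smul_add]
  | hmk v m =>
    simp only [wedge, lie_wedgeMk, map_add, wedgeAd_mk, coe_lie_exterior, lie_lie, map_sub,
      LinearMap.sub_apply]
    abel

theorem lie_koszulStep (y : zeroPart 𝒜) (x : posPart 𝒜) (w : WedgeCarrier M j) :
    ⁅(y : 𝔞), koszulStep M j x w⁆ = koszulStep M j ⁅y, x⁆ w + koszulStep M j x ⁅y, w⁆ := by
  have h1 : ((⁅y, x⁆ : posPart 𝒜) : 𝔞) = ⁅(y : 𝔞), (x : 𝔞)⁆ := rfl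
  have h2 : ∀ w : WedgeCarrier M j, koszulMk M j (UniversalEnvelopingAlgebra.ι ℂ (y : 𝔞)) w =
      koszulMk M j 1 ⁅y, w⁆ := by
    intro w
    rw [← koszulMk_mul, one_mul]
  simp only [koszulStep_apply, lie_sub, lie_smul, lie_koszulMk, mul_one, koszulMk_ι_mul, h1, h2,
    lie_wedgeAd, map_add, smul_add]
  abel

/-- The map `(x ⊗ w) ⊗ m ↦ x ⊗ (w ⊗ m) - ½ (1 ⊗ ((ad x) w ⊗ m))`. -/
def koszulPre : posPart 𝒜 ⊗[ℂ] ⋀[ℂ]^j (posPart 𝒜) →ₗ[ℂ] M.carrier →ₗ[ℂ] KoszulCarrier M j :=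
  TensorProduct.lift (LinearMap.mk₂ ℂ (fun x w => koszulStep M j x ∘ₗ wedgeMk M j w)
    (fun x y w => by rw [map_add, LinearMap.add_comp])
    (fun c x w => by rw [map_smul, LinearMap.smul_comp])
    (fun x w w' => by rw [map_add, LinearMap.comp_add])
    (fun c x w => by rw [map_smul, LinearMap.comp_smul]))

theorem koszulPre_tmul (x : posPart 𝒜) (w : ⋀[ℂ]^j (posPart 𝒜)) (m : M.carrier) :
    koszulPre M j (x ⊗ₜ[ℂ] w) m = koszulStep M j x (wedgeMk M j w m) := rfl

theorem lie_koszulPre (y : zeroPart 𝒜) (t : posPart 𝒜 ⊗[ℂ] ⋀[ℂ]^j (posPart 𝒜)) (m : M.carrier) :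
    ⁅(y : 𝔞), koszulPre M j t m⁆ = koszulPre M j ⁅(y : 𝔞), t⁆ m + koszulPre M j t ⁅y, m⁆ := by
  induction t using TensorProduct.induction_on with
  | zero => simp
  | add a c ha hc =>
    have h : ⁅(y : 𝔞), a + c⁆ = ⁅(y : 𝔞), a⁆ + ⁅(y : 𝔞), c⁆ := lie_add _ _ _
    rw [h]
    simp only [map_add, LinearMap.add_apply, lie_add, ha, hc]; abel
  | tmul x w =>
    have h : ⁅(y : 𝔞), x ⊗ₜ[ℂ] w⁆ = ⁅(y : 𝔞), x⁆ ⊗ₜ[ℂ] w + x ⊗ₜ[ℂ] ⁅(y : 𝔞), w⁆ :=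
      TensorProduct.LieModule.lie_tmul_right _ _ _
    rw [h, map_add, LinearMap.add_apply]
    simp only [koszulPre_tmul, lie_koszulStep, lie_wedgeMk, map_add, coe_lie_posPart,
      coe_lie_exterior]
    abel

/-- The restriction of the differential to `⋀ʲ⁺¹ 𝔞₊ ⊗ M`. -/
def koszulMap : WedgeCarrier M (j + 1) →ₗ[ℂ] KoszulCarrier M j :=
  wedgeDesc (koszulPre M j ∘ₗ exteriorSplit j)

theorem koszulMap_wedge (x : Fin (j + 1) → posPart 𝒜) (m : M.carrier) :
    koszulMap M j (wedge M (j + 1) x m) = ∑ i : Fin (j + 1), (-1 : ℤ) ^ (i : ℕ) •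
      koszulStep M j (x i) (wedge M j (i.removeNth x) m) := by
  rw [koszulMap, wedge, wedgeDesc_mk, LinearMap.comp_apply, exteriorSplit_ιMulti, map_sum,
    LinearMap.sum_apply]
  refine Finset.sum_congr rfl fun i _ => ?_
  rw [map_zsmul, LinearMap.smul_apply, koszulPre_tmul]
  rfl

theorem koszulMap_lie (y : zeroPart 𝒜) (w : WedgeCarrier M (j + 1)) :
    koszulMap M j ⁅y, w⁆ = ⁅(y : 𝔞), koszulMap M j w⁆ := by
  induction w using wedge_induction with
  | hadd a c ha hc => simp only [map_add, lie_add, ha, hc]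
  | hsmul d a ha => simp only [map_smul, lie_smul, ha]
  | hmk v m =>
    rw [wedge, lie_wedgeMk, map_add, koszulMap, wedgeDesc_mk, wedgeDesc_mk, wedgeDesc_mk]
    simp only [LinearMap.comp_apply]
    rw [lie_koszulPre, coe_lie_exterior, exteriorSplit_lie]

theorem koszulMap_mem (k : ℤ) (w : WedgeCarrier M (j + 1)) (hw : w ∈ wedgePiece M (j + 1) k) :
    koszulMap M j w ∈ indPiece (wedgeTensor M j) k := by
  induction hw using Submodule.span_induction with
  | zero => rw [map_zero]; exact zero_mem _
  | add a c _ _ ha hc => rw [map_add]; exact add_mem ha hc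
  | smul d a _ ha => rw [map_smul]; exact Submodule.smul_mem _ d ha
  | mem w hw =>
    obtain ⟨x, n, i, m, hx, hm, rfl, rfl⟩ := hw
    rw [koszulMap_wedge]
    refine sum_mem fun p _ => zsmul_mem ?_ _
    have hdeg : (∑ l, n l : ℕ) = n p + ∑ l : Fin j, n (p.succAbove l) :=
      Fin.sum_univ_succAbove n p
    rw [koszulStep_apply]
    have hι : UniversalEnvelopingAlgebra.ι ℂ (x p : 𝔞) ∈ ueaPiece 𝒜 (n p) := by
      have h := ι_mul_mem_ueaPiece (hx p) one_mem_ueaPiece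
      rwa [mul_one] at h
    refine sub_mem (indMk_mem (wedgeTensor M j) hι (wedge_mem M j
      (n := fun l => n (p.succAbove l)) (fun l => hx _) hm rfl) ?_) (Submodule.smul_mem _ _ ?_)
    · rw [hdeg]; push_cast; ring
    · rw [wedgeAd_wedge, map_sum]
      refine sum_mem fun l _ => ?_
      refine indMk_mem (wedgeTensor M j) one_mem_ueaPiece (wedge_mem M j
        (n := Function.update (fun l => n (p.succAbove l)) l (n p + n (p.succAbove l)))
        ?_ hm rfl) ?_
      · intro q
        by_cases hq : q = l
        · subst hq
          rw [Function.update_self, Function.update_self]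
          exact bracket_mem 𝒜 (hx p) (hx _)
        · rw [Function.update_of_ne hq, Function.update_of_ne hq]
          exact hx _
      · rw [hdeg, Finset.sum_update_of_mem (Finset.mem_univ l),
          ← Finset.add_sum_erase Finset.univ (fun l => n (p.succAbove l)) (Finset.mem_univ l),
          Finset.sdiff_singleton_eq_erase]
        push_cast; ring

/-- The Chevalley–Eilenberg (Koszul) differential of `𝔞₊` tensored with `id_M`,
`d : U(𝔞) ⊗_{U(𝔤)} (⋀ʲ⁺¹ 𝔞₊ ⊗ M) → U(𝔞) ⊗_{U(𝔤)} (⋀ʲ 𝔞₊ ⊗ M)`. Explicitly,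
`d (u ⊗ (x₀ ∧ … ∧ xⱼ) ⊗ m) = ∑ᵢ (-1)ⁱ u xᵢ ⊗ (x₀ ∧ … x̂ᵢ … ∧ xⱼ) ⊗ m
  + ∑_{p < q} (-1)^(p + q) u ⊗ (⁅x_p, x_q⁆ ∧ x₀ ∧ … x̂_p … x̂_q … ∧ xⱼ) ⊗ m`;
see `koszulD_mk_wedge`. (The second sum is
`-½ ∑ᵢ (-1)ⁱ u ⊗ (ad xᵢ)(x₀ ∧ … x̂ᵢ … ∧ xⱼ) ⊗ m`, the form used in the construction.) -/
def koszulD : gHom (Ind (wedgeTensor M (j + 1))) (Ind (wedgeTensor M j)) :=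
  indLift (M := wedgeTensor M (j + 1)) (W := Ind (wedgeTensor M j)) (koszulMap M j)
    (koszulMap_lie M j) (koszulMap_mem M j)

theorem wedge_update (x : Fin (j + 1) → posPart 𝒜) (l : Fin (j + 1)) (z : posPart 𝒜)
    (m : M.carrier) : wedge M (j + 1) (Function.update x l z) m =
      (-1 : ℤ) ^ (l : ℕ) • wedge M (j + 1) (Matrix.vecCons z (l.removeNth x)) m := by
  have h : Function.update x l z = l.insertNth z (l.removeNth x) := by
    rw [← Fin.insertNth_removeNth]
  rw [wedge, h, AlternatingMap.map_insertNth, map_zsmul, LinearMap.smul_apply]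
  rfl

/-- The alternating maps `v ↦ (⁅a, c⁆ ∧ v₁ ∧ … ∧ vⱼ) ⊗ m`. -/
def bracketWedge (m : M.carrier) : posPart 𝒜 →ₗ[ℂ] posPart 𝒜 →ₗ[ℂ]
    (posPart 𝒜) [⋀^Fin j]→ₗ[ℂ] WedgeCarrier M (j + 1) :=
  LinearMap.mk₂ ℂ (fun a c => ((wedgeMk M (j + 1)).flip m).compAlternatingMap
      ((exteriorPower.ιMulti ℂ (j + 1)).curryLeft ⁅a, c⁆))
    (fun a a' c => by ext v; simp [add_lie])
    (fun d a c => by ext v; simp [smul_lie])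
    (fun a c c' => by ext v; simp [lie_add])
    (fun d a c => by ext v; simp [lie_smul])

theorem bracketWedge_apply (m : M.carrier) (a c : posPart 𝒜) (v : Fin j → posPart 𝒜) :
    bracketWedge M j m a c v = wedge M (j + 1) (Matrix.vecCons ⁅a, c⁆ v) m := rfl

theorem sum_wedgeAd (x : Fin (j + 2) → posPart 𝒜) (m : M.carrier) :
    ∑ i : Fin (j + 2), (-1 : ℤ) ^ (i : ℕ) •
        wedgeAd M (j + 1) (x i : 𝔞) (wedge M (j + 1) (i.removeNth x) m) =
      (2 : ℂ) • ∑ p : Fin (j + 1), ∑ q ≥ p, (-1 : ℤ) ^ (p + q : ℕ) •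
        wedge M (j + 1) (Matrix.vecCons ⁅x p.castSucc, x q.succ⁆
          (q.removeNth (p.castSucc.removeNth x))) m := by
  have h := AlternatingMap.alternatizeUncurryFin_alternatizeUncurryFinLM_comp_apply
    (bracketWedge M j m) x
  have hL : AlternatingMap.alternatizeUncurryFin
      (AlternatingMap.alternatizeUncurryFinLM ∘ₗ bracketWedge M j m) x =
      ∑ i : Fin (j + 2), (-1 : ℤ) ^ (i : ℕ) •
        wedgeAd M (j + 1) (x i : 𝔞) (wedge M (j + 1) (i.removeNth x) m) := by
    rw [AlternatingMap.alternatizeUncurryFin_apply]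
    refine Finset.sum_congr rfl fun i _ => ?_
    rw [LinearMap.comp_apply, AlternatingMap.alternatizeUncurryFinLM_apply,
      AlternatingMap.alternatizeUncurryFin_apply, wedgeAd_wedge]
    congr 1
    refine Finset.sum_congr rfl fun l _ => ?_
    rw [wedge_update, bracketWedge_apply]
    rfl
  rw [← hL, h, Finset.smul_sum]
  refine Finset.sum_congr rfl fun p _ => ?_
  rw [Finset.smul_sum]
  refine Finset.sum_congr rfl fun q _ => ?_
  have hskew : bracketWedge M j m (x q.succ) (x p.castSucc) =
      - bracketWedge M j m (x p.castSucc) (x q.succ) := by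
    ext v
    change wedgeMk M (j + 1) ((exteriorPower.ιMulti ℂ (j + 1)).curryLeft ⁅x q.succ, x p.castSucc⁆ v) m
      = - wedgeMk M (j + 1) ((exteriorPower.ιMulti ℂ (j + 1)).curryLeft
        ⁅x p.castSucc, x q.succ⁆ v) m
    rw [← lie_skew, map_neg, AlternatingMap.neg_apply, map_neg, LinearMap.neg_apply]
  rw [hskew, AlternatingMap.neg_apply, sub_neg_eq_add, ← two_smul ℂ, bracketWedge_apply,
    smul_comm]

theorem koszulMap_wedge_explicit (x : Fin (j + 2) → posPart 𝒜) (m : M.carrier) :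
    koszulMap M (j + 1) (wedge M (j + 2) x m) =
      ∑ i : Fin (j + 2), (-1 : ℤ) ^ (i : ℕ) •
        koszulMk M (j + 1) (UniversalEnvelopingAlgebra.ι ℂ (x i : 𝔞))
          (wedge M (j + 1) (i.removeNth x) m) +
      ∑ p : Fin (j + 1), ∑ q ≥ p, (-1 : ℤ) ^ (p.castSucc + q.succ : ℕ) •
        koszulMk M (j + 1) 1 (wedge M (j + 1)
          (Matrix.vecCons ⁅x p.castSucc, x q.succ⁆ (q.removeNth (p.castSucc.removeNth x))) m) := by
  rw [koszulMap_wedge]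
  simp only [koszulStep_apply, smul_sub, Finset.sum_sub_distrib]
  rw [sub_eq_add_neg]
  congr 1
  have h := congrArg (fun t => (1 / 2 : ℂ) • koszulMk M (j + 1) 1 t) (sum_wedgeAd M j x m)
  simp only [map_sum, map_zsmul, map_smul, Finset.smul_sum] at h
  simp only [smul_comm (1 / 2 : ℂ)] at h
  rw [h, ← Finset.sum_neg_distrib]
  refine Finset.sum_congr rfl fun p _ => ?_
  rw [← Finset.sum_neg_distrib]
  refine Finset.sum_congr rfl fun q _ => ?_
  rw [Fin.val_castSucc, Fin.val_succ, ← add_assoc, pow_succ, mul_neg_one, neg_smul, neg_inj,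
    smul_comm (2 : ℂ), smul_smul]
  norm_num

theorem koszulD_mk (u : UniversalEnvelopingAlgebra ℂ 𝔞) (w : WedgeCarrier M (j + 1)) :
    (koszulD M j).1 (koszulMk M (j + 1) u w) = indMul (wedgeTensor M j) u (koszulMap M j w) :=
  lift_toEnd_ind (wedgeTensor M j) u (koszulMap M j w)

/-- The explicit form of the differential in degree `1`. -/
theorem koszulD_mk_wedge_one (u : UniversalEnvelopingAlgebra ℂ 𝔞) (x : Fin 1 → posPart 𝒜)
    (m : M.carrier) :
    (koszulD M 0).1 (koszulMk M 1 u (wedge M 1 x m)) =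
      koszulMk M 0 (u * UniversalEnvelopingAlgebra.ι ℂ (x 0 : 𝔞))
        (wedge M 0 (Fin.removeNth 0 x) m) := by
  have h := koszulMap_wedge M 0 x m
  rw [Fin.sum_univ_one, koszulStep_apply, wedgeAd_wedge, Fin.sum_univ_zero, map_zero, smul_zero,
    sub_zero, Fin.val_zero, pow_zero, one_smul] at h
  have h2 := koszulD_mk M 0 u (wedge M 1 x m)
  rw [h] at h2
  exact h2

/-- The explicit form of the differential in degrees `≥ 2`. -/
theorem koszulD_mk_wedge (u : UniversalEnvelopingAlgebra ℂ 𝔞) (x : Fin (j + 2) → posPart 𝒜)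
    (m : M.carrier) :
    (koszulD M (j + 1)).1 (koszulMk M (j + 2) u (wedge M (j + 2) x m)) =
      ∑ i : Fin (j + 2), (-1 : ℤ) ^ (i : ℕ) •
        koszulMk M (j + 1) (u * UniversalEnvelopingAlgebra.ι ℂ (x i : 𝔞))
          (wedge M (j + 1) (i.removeNth x) m) +
      ∑ p : Fin (j + 1), ∑ q ≥ p, (-1 : ℤ) ^ (p.castSucc + q.succ : ℕ) •
        koszulMk M (j + 1) u (wedge M (j + 1)
          (Matrix.vecCons ⁅x p.castSucc, x q.succ⁆ (q.removeNth (p.castSucc.removeNth x))) m) := by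
  have hmul : ∀ (a : UniversalEnvelopingAlgebra ℂ 𝔞) (w : WedgeCarrier M (j + 1)),
      indMul (wedgeTensor M (j + 1)) u (koszulMk M (j + 1) a w) = koszulMk M (j + 1) (u * a) w :=
    fun _ _ => rfl
  rw [koszulD_mk, koszulMap_wedge_explicit]
  simp only [map_add, map_sum, map_zsmul, hmul, mul_one]
  rfl

/-- The canonical isomorphism `⋀⁰ 𝔞₊ ⊗ M ≅ M`, followed by `m ↦ 1 ⊗ m`. -/
def wedgeZeroMap : WedgeCarrier M 0 →ₗ[ℂ] IndCarrier M :=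
  wedgeDesc ((LinearMap.lsmul ℂ (M.carrier →ₗ[ℂ] IndCarrier M)).flip (indMk M 1) ∘ₗ
    (exteriorPower.zeroEquiv ℂ (posPart 𝒜)).toLinearMap)

theorem wedgeZeroMap_wedge (x : Fin 0 → posPart 𝒜) (m : M.carrier) :
    wedgeZeroMap M (wedge M 0 x m) = indMk M 1 m := by
  rw [wedgeZeroMap, wedge, wedgeDesc_mk]
  simp

theorem wedgeZeroMap_lie (y : zeroPart 𝒜) (w : WedgeCarrier M 0) :
    wedgeZeroMap M ⁅y, w⁆ = ⁅(y : 𝔞), wedgeZeroMap M w⁆ := by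
  induction w using wedge_induction with
  | hadd a c ha hc => simp only [map_add, lie_add, ha, hc]
  | hsmul d a ha => simp only [map_smul, lie_smul, ha]
  | hmk v m =>
    rw [lie_wedge, Fin.sum_univ_zero, zero_add, wedgeZeroMap_wedge, wedgeZeroMap_wedge,
      lie_indMk, mul_one, ← indMk_mul, one_mul]

theorem wedgeZeroMap_mem (k : ℤ) (w : WedgeCarrier M 0) (hw : w ∈ wedgePiece M 0 k) :
    wedgeZeroMap M w ∈ indPiece M k := by
  induction hw using Submodule.span_induction with
  | zero => rw [map_zero]; exact zero_mem _
  | add a c _ _ ha hc => rw [map_add]; exact add_mem ha hc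
  | smul d a _ ha => rw [map_smul]; exact Submodule.smul_mem _ d ha
  | mem w hw =>
    obtain ⟨x, n, i, m, hx, hm, rfl, rfl⟩ := hw
    rw [wedgeZeroMap_wedge]
    exact indMk_mem M one_mem_ueaPiece hm (by simp)

/-- The canonical identification `U(𝔞) ⊗_{U(𝔤)} (⋀⁰ 𝔞₊ ⊗ M) → U(𝔞) ⊗_{U(𝔤)} M`,
`u ⊗ (c ⊗ m) ↦ u ⊗ c m`. -/
def wedgeZeroHom : gHom (Ind (wedgeTensor M 0)) (Ind M) :=
  indLift (M := wedgeTensor M 0) (W := Ind M) (wedgeZeroMap M) (wedgeZeroMap_lie M)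
    (wedgeZeroMap_mem M)

end Koszul

/-! ### Simple objects, projective objects, and the order on their parameters -/

section Objects

variable [∀ n, FiniteDimensional ℂ (𝒜 n)] [LieAlgebra.IsKilling ℂ (zeroPart 𝒜)]
  {H : LieSubalgebra ℂ (zeroPart 𝒜)} [H.IsCartanSubalgebra]

open LieAlgebra LieAlgebra.IsKilling

/-- The parameter set `Λ = P⁺ × ℤ`. -/
abbrev Parameter (b : (rootSystem H).Base) : Type u := DominantWeight b × ℤ

variable {b : (rootSystem H).Base}

/-- `V(λ)` placed in degree `r`. -/
def simpleZero (w : Parameter b) : GrZeroMod 𝒜 where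
  carrier := SimpleModule b w.1
  gr k := if k = w.2 then ⊤ else ⊥
  isInternal := isInternal_single w.2
  lie_mem := by
    intro k y v hv
    by_cases h : k = w.2
    · simp [h]
    · simp only [h, if_false, Submodule.mem_bot] at hv ⊢
      rw [hv, lie_zero]

/-- The graded `𝔞`-module `V(λ, r)`: `V(λ)` in degree `r`, with `𝔞₊` acting by zero. -/
def simpleObj (w : Parameter b) : GrMod 𝒜 := inflate (simpleZero w)

/-- `P(λ, r) = U(𝔞) ⊗_{U(𝔤)} V(λ, r)`. -/
def projObj (w : Parameter b) : GrMod 𝒜 := Ind (simpleZero w)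

/-- `d₀ : P(λ, r) → V(λ, r)`, `u ⊗ v ↦ u v`. -/
def augmentation (w : Parameter b) : gHom (projObj w) (simpleObj w) :=
  indLift (M := simpleZero w) (W := simpleObj w) LinearMap.id
    (fun y m => by
      change ⁅y, m⁆ = ⁅projZero 𝒜 (y : 𝔞), m⁆
      rw [projZero_of_mem_zeroPart])
    (fun _ _ hm => hm)

/-- The terms `P_j(λ, r)` of the resolution: `P(λ, r)` for `j = 0`, and
`U(𝔞) ⊗_{U(𝔤)} (⋀ʲ 𝔞₊ ⊗ V(λ, r))` for `j > 0`. -/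
def resolutionObj (w : Parameter b) : ℕ → GrMod 𝒜
  | 0 => projObj w
  | j + 1 => Ind (wedgeTensor (simpleZero w) (j + 1))

/-- The differential `d_{j+1} : P_{j+1}(λ, r) → P_j(λ, r)`. -/
def resolutionD (w : Parameter b) :
    ∀ j : ℕ, gHom (resolutionObj w (j + 1)) (resolutionObj w j)
  | 0 => gComp (wedgeZeroHom (simpleZero w)) (koszulD (simpleZero w) 0)
  | j + 1 => koszulD (simpleZero w) (j + 1)

/-- The multiplicity `[V : V(λ, r)] = dim Hom_𝔤(V(λ), V[r])`. -/
def simpleMult (V : GrMod 𝒜) (w : Parameter b) : ℕ :=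
  Module.finrank ℂ (SimpleModule b w.1 →ₗ⁅ℂ,zeroPart 𝒜⁆ V.piece w.2)

/-- `(μ, s)` covers `(λ, r)`: `s > r`, and `μ - λ` is a weight of `𝔞_{s - r}`. -/
def Covers (ms lr : Parameter b) : Prop :=
  lr.2 < ms.2 ∧ ∃ x ∈ 𝒜 (ms.2 - lr.2).toNat, x ≠ 0 ∧
    ∀ h : H, ⁅((h : zeroPart 𝒜) : 𝔞), x⁆ = (ms.1.1 h - lr.1.1 h) • x

/-- The partial order on `Λ`: the reflexive and transitive closure of the covering relation. -/
def ParamLE (lr ms : Parameter b) : Prop :=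
  Relation.ReflTransGen (fun a c => Covers c a) lr ms

/-- Interval-closed subsets of `Λ`. -/
def IntervalClosed (Γ : Set (Parameter b)) : Prop :=
  ∀ lr np ms : Parameter b, ParamLE lr np → ParamLE np ms → lr ∈ Γ → ms ∈ Γ → np ∈ Γ

/-! ### Truncation -/

/-- `V_Γ⁺`: the vectors in `V[r]_λ`, `(λ, r) ∈ Γ`, killed by `𝔫⁺`. -/
def maximalVectors (V : GrMod 𝒜) (Γ : Set (Parameter b)) : Set V.carrier :=
  {v | ∃ w ∈ Γ, v ∈ V.gr w.2 ∧ (∀ h : H, ⁅(h : zeroPart 𝒜), v⁆ = w.1.1 h • v) ∧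
    ∀ α ∈ positiveRoots b, ∀ x ∈ rootSpace H (α : LieModule.Weight ℂ H (zeroPart 𝒜)), ⁅x, v⁆ = 0}

/-- `V_Γ = U(𝔤) V_Γ⁺`. -/
def lowerTrunc (V : GrMod 𝒜) (Γ : Set (Parameter b)) : LieSubmodule ℂ (zeroPart 𝒜) V.carrier :=
  LieSubmodule.lieSpan ℂ (zeroPart 𝒜) (maximalVectors V Γ)

/-- A subspace is `𝔞`-stable. -/
def IsStable (V : GrMod 𝒜) (S : LieSubmodule ℂ (zeroPart 𝒜) V.carrier) : Prop :=
  ∀ x : 𝔞, ∀ v ∈ S, ⁅x, v⁆ ∈ S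

/-- The `𝔞`-submodule generated by `V_{Λ ∖ Γ}`; it is `V_{Λ ∖ Γ}` itself as soon as the latter is
`𝔞`-stable. -/
def truncKernel (V : GrMod 𝒜) (Γ : Set (Parameter b)) : LieSubmodule ℂ 𝔞 V.carrier :=
  LieSubmodule.lieSpan ℂ 𝔞 (lowerTrunc V Γᶜ : Set V.carrier)

theorem mem_truncKernel_iff {V : GrMod 𝒜} {Γ : Set (Parameter b)}
    (h : IsStable V (lowerTrunc V Γᶜ)) (v : V.carrier) :
    v ∈ truncKernel V Γ ↔ v ∈ lowerTrunc V Γᶜ := by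
  constructor
  · intro hv
    exact (LieSubmodule.lieSpan_le (N := ({ (lowerTrunc V Γᶜ).toSubmodule with
      lie_mem := fun {x m} hm => h x m hm } : LieSubmodule ℂ 𝔞 V.carrier))).mpr
        (fun _ hx => hx) hv
  · exact fun hv => LieSubmodule.subset_lieSpan hv

theorem mem_truncKernel_of_maximal {V : GrMod 𝒜} {Γ : Set (Parameter b)} {v : V.carrier}
    (hv : v ∈ maximalVectors V Γᶜ) : v ∈ truncKernel V Γ :=
  LieSubmodule.subset_lieSpan (LieSubmodule.subset_lieSpan hv)

/-- An `𝔞`-submodule containing the maximal vectors of the excluded weights contains the kernel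
of the truncation. -/
theorem truncKernel_le {V : GrMod 𝒜} {Γ : Set (Parameter b)} {N : LieSubmodule ℂ 𝔞 V.carrier}
    (h : maximalVectors V Γᶜ ⊆ N) : truncKernel V Γ ≤ N := by
  rw [truncKernel, LieSubmodule.lieSpan_le]
  intro v hv
  exact (LieSubmodule.lieSpan_le (N := ({ N.toSubmodule with
      lie_mem := fun {x m} hm => N.lie_mem (x := (x : 𝔞)) hm } :
        LieSubmodule ℂ (zeroPart 𝒜) V.carrier))).mpr h hv

theorem exists_truncScaling (V : GrMod 𝒜) (Γ : Set (Parameter b)) :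
    ∃ σ : V.carrier →ₗ[ℂ] V.carrier, (∀ k, ∀ v ∈ V.gr k, σ v = (2 : ℂ) ^ k • v) ∧
      ∀ v ∈ truncKernel V Γ, σ v ∈ truncKernel V Γ := by
  obtain ⟨σ, hσ⟩ := exists_scaling V.gr V.isInternal (fun k => (2 : ℂ) ^ k)
  obtain ⟨τ, hτ⟩ := exists_lieScaling 𝒜
  have hcomm : ∀ (x : 𝔞) (v : V.carrier), σ ⁅x, v⁆ = ⁅τ x, σ v⁆ := by
    intro x v
    have hx : x ∈ ⨆ n, 𝒜 n := by
      rw [iSup_eq_top_of_isInternal (isInternal_pieces 𝒜)]; trivial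
    have hv : v ∈ ⨆ n, V.gr n := by
      rw [iSup_eq_top_of_isInternal V.isInternal]; trivial
    induction hx using Submodule.iSup_induction' with
    | zero => simp
    | add a c _ _ ha hc => simp only [add_lie, map_add, ha, hc]
    | mem m x hx =>
      induction hv using Submodule.iSup_induction' with
      | zero => simp
      | add a c _ _ ha hc => simp only [lie_add, map_add, ha, hc]
      | mem n v hv =>
        rw [hσ _ _ (V.lie_mem m n x v hx hv), hσ n v hv, hτ m x hx, smul_lie, lie_smul, smul_smul,
          zpow_add₀ (by norm_num), zpow_natCast]
  refine ⟨σ, hσ, ?_⟩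
  let N : LieSubmodule ℂ 𝔞 V.carrier :=
    { (truncKernel V Γ).toSubmodule.comap σ with
      lie_mem := by
        intro x v hv
        change σ ⁅x, v⁆ ∈ truncKernel V Γ
        rw [hcomm]
        exact (truncKernel V Γ).lie_mem hv }
  have hN : truncKernel V Γ ≤ N := by
    apply truncKernel_le
    intro v hv
    change σ v ∈ truncKernel V Γ
    have hv' := mem_truncKernel_of_maximal hv
    obtain ⟨w, -, hw, -⟩ := hv
    rw [hσ _ v hw]
    exact (truncKernel V Γ).smul_mem _ hv'
  exact fun v hv => hN hv

/-- `V^Γ`, the quotient of `V` by (the `𝔞`-submodule generated by) `V_{Λ ∖ Γ}`. -/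
def trunc (V : GrMod 𝒜) (Γ : Set (Parameter b)) : GrMod 𝒜 where
  carrier := V.carrier ⧸ truncKernel V Γ
  gr k := (V.gr k).map (LieSubmodule.Quotient.mk' (truncKernel V Γ)).toLinearMap
  isInternal := by
    obtain ⟨σ, hσ, hσN⟩ := exists_truncScaling V Γ
    apply isInternal_of_scaling (M := V.carrier ⧸ truncKernel V Γ) _
      ((truncKernel V Γ).toSubmodule.mapQ (truncKernel V Γ).toSubmodule σ hσN)
    · rintro k _ ⟨v, hv, rfl⟩
      change LieSubmodule.Quotient.mk' (truncKernel V Γ) (σ v) = _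
      rw [hσ k v hv, map_smul]
      rfl
    · rw [← Submodule.map_iSup, iSup_eq_top_of_isInternal V.isInternal, Submodule.map_top,
        LinearMap.range_eq_top]
      exact LieSubmodule.Quotient.surjective_mk' _
  lie_mem := by
    rintro n k x _ hx ⟨v, hv, rfl⟩
    exact ⟨⁅x, v⁆, V.lie_mem n k x v hx hv, LieModuleHom.map_lie _ x v⟩

/-- The projection `V → V^Γ`. -/
def truncProj (V : GrMod 𝒜) (Γ : Set (Parameter b)) : gHom V (trunc V Γ) :=
  ⟨LieSubmodule.Quotient.mk' (truncKernel V Γ), fun _ v hv => ⟨v, hv, rfl⟩⟩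

theorem truncProj_surjective (V : GrMod 𝒜) (Γ : Set (Parameter b)) :
    Function.Surjective (truncProj V Γ).1 :=
  LieSubmodule.Quotient.surjective_mk' _

theorem map_truncKernel {V W : GrMod 𝒜} (Γ : Set (Parameter b)) (f : gHom V W) :
    truncKernel V Γ ≤ (truncKernel W Γ).comap f.1 := by
  apply truncKernel_le
  rintro v ⟨w, hw, hgr, hwt, hn⟩
  refine mem_truncKernel_of_maximal ⟨w, hw, f.2 _ _ hgr, fun h => ?_, fun α hα x hx => ?_⟩
  · exact (LieModuleHom.map_lie f.1 ((h : zeroPart 𝒜) : 𝔞) v).symm.trans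
      ((congrArg f.1 (hwt h)).trans (map_smul f.1 _ v))
  · exact (LieModuleHom.map_lie f.1 (x : 𝔞) v).symm.trans
      ((congrArg f.1 (hn α hα x hx)).trans (map_zero f.1))

/-- The assignment `f ↦ f^Γ` on morphisms `f : V → W`, where `f^Γ : V^Γ → W^Γ` is induced by
`f`. -/
def truncMap {V W : GrMod 𝒜} (Γ : Set (Parameter b)) :
    gHom V W →ₗ[ℂ] gHom (trunc V Γ) (trunc W Γ) where
  toFun f :=
    ⟨{ (truncKernel V Γ).toSubmodule.mapQ (truncKernel W Γ).toSubmodule f.1.toLinearMap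
          (map_truncKernel Γ f) with
        map_lie' := by
          intro x t
          obtain ⟨v, rfl⟩ := truncProj_surjective V Γ t
          exact congrArg (truncProj W Γ).1 (LieModuleHom.map_lie f.1 x v) }, by
      rintro k _ ⟨v, hv, rfl⟩
      exact ⟨f.1 v, f.2 k v hv, rfl⟩⟩
  map_add' f g := by
    ext t
    obtain ⟨v, rfl⟩ := truncProj_surjective V Γ t
    rfl
  map_smul' c f := by
    ext t
    obtain ⟨v, rfl⟩ := truncProj_surjective V Γ t
    rfl

theorem truncMap_proj {V W : GrMod 𝒜} (Γ : Set (Parameter b)) (f : gHom V W) (v : V.carrier) :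
    (truncMap Γ f).1 ((truncProj V Γ).1 v) = (truncProj W Γ).1 (f.1 v) := rfl

/-! ### Categories of graded modules -/

variable (𝒜) in
/-- The category `Ĝ`: the full subcategory of graded modules with finite-dimensional pieces. -/
def categoryGhat : ObjectProperty (GrMod 𝒜) := fun V => ∀ k, FiniteDimensional ℂ (V.gr k)

/-- The category `G[Γ]`: the full subcategory of the finite-dimensional graded modules `V` such
that `[V : V(λ, r)] > 0` only if `(λ, r) ∈ Γ`. -/
def categoryG (Γ : Set (Parameter b)) : ObjectProperty (GrMod 𝒜) := fun V =>
  FiniteDimensional ℂ V.carrier ∧ ∀ w : Parameter b, 0 < simpleMult V w → w ∈ Γ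

end Objects

/-- `P` is a projective object of the full subcategory `C`. -/
def IsProjectiveIn (C : ObjectProperty (GrMod 𝒜)) (P : GrMod 𝒜) : Prop :=
  ∃ hP : C P, Projective (⟨P, hP⟩ : C.FullSubcategory)

/-- A morphism `π : P → X` is a projective cover in a category: `P` is projective and `π` is an
essential epimorphism. -/
structure IsProjectiveCover {C : Type*} [Category C] {P X : C} (π : P ⟶ X) : Prop where
  projective : Projective P
  epi : Epi π
  essential : ∀ ⦃Y : C⦄ (g : Y ⟶ P), Epi (g ≫ π) → Epi g

/-- `π : P → X` is a projective cover in the full subcategory `C`. -/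
def IsProjectiveCoverIn (C : ObjectProperty (GrMod 𝒜)) {P X : GrMod 𝒜} (π : gHom P X) : Prop :=
  ∃ (hP : C P) (hX : C X),
    IsProjectiveCover (ObjectProperty.homMk (X := ⟨P, hP⟩) (Y := ⟨X, hX⟩) π : _ ⟶ _)

end GradedCurrent

end

open GradedCurrent

noncomputable section

namespace GradedCurrent

attribute [local instance] LieRing.ofAssociativeRing
set_option linter.unusedSectionVars false

/-! ### Weyl's theorem on complete reducibility. -/

section CompleteReducibility

open LieAlgebra Module

variable {L : Type*} [LieRing L] [LieAlgebra ℂ L] [FiniteDimensional ℂ L] [LieAlgebra.IsKilling ℂ L]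

/-! Truncation discards `𝔤`-isotypic components, and everything rests on three facts: these
components split off, the discarded ones form an `𝔞`-submodule of each `P_j(μ, s)`, and the
untruncated Koszul complex is an exact complex of induced modules.

Splitting. Each graded piece is finite-dimensional, so Weyl's theorem (`exists_lieProjection`)
decomposes it into isotypic components. Hence `V = V_Γ ⊕ V_{Λ∖Γ}` over `𝔤` (`lowerTrunc_sup_compl`,
`lowerTrunc_disjoint`), and morphisms preserve both summands. So `V ↦ V^Γ` preserves exactness
(`exact_truncMap`) and the multiplicities of parameters in `Γ` (`simpleMult_trunc`), as soon as
`V_{Λ∖Γ}` is `𝔞`-stable.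

Stability. A constituent `V(ν)` of a quotient of `𝔞_n ⊗ V(μ)` has `ν - μ` among the weights of `𝔞_n`
(`exists_weight_of_bilinear`), so `𝔞_n` with `n > 0` moves a parameter to parameters covering it,
and `V_Φ` is `𝔞`-stable when `Φ` is closed under covers (`isStable_lowerTrunc`). The same remark,
applied to exterior products and to `U(𝔞)`, shows that all parameters of `P_j(μ, s)` lie above `(μ,
s)` (`lowerTrunc_resolutionObj`). Among parameters above a member of `Γ`, those outside `Γ` are
closed under covers: this is interval-closedness (`coverClosed_compl_inter`).

Projectivity and Hom-spaces. Maps out of an induced module are `𝔤`-maps out of its generators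
(`exists_ind_hom`), and surjections in `Ĝ` have `𝔤`-linear sections degree by degree, so morphisms
from induced modules lift (`exists_ind_lift`). A morphism from `V` to an object of `G[Γ]` factors
through `V^Γ`; hence `P_j(μ, s)^Γ` is projective and `Hom(P(μ, s)^Γ, X) = Hom_𝔤(V(μ), X[s])`
(`finrank_gHom_trunc`). The cover is essential because `P(λ, r)` is just `1 ⊗ V(λ)` in its lowest
degree. The resolution is finite because `P_j(μ, s)` starts in degree `s + j` while the degrees
occurring in `Γ` are bounded.

Exactness of the Koszul complex avoids the Poincaré–Birkhoff–Witt theorem. A linear retraction of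
`U(𝔞)` onto `𝔞₊`, compatible with right multiplication by `𝔤` (`exists_ueaRetract`), yields a map
`h` raising exterior degree. Filter by the number of factors from `𝔞₊`. To leading order `dh + hd`
multiplies by the number of factors plus the exterior degree, as in the classical Koszul complex
(`homotopy_zero`, `homotopy_succ`). A cycle is therefore a boundary plus a cycle lower in the
filtration, and one inducts (`exists_koszulD_eq`, `exists_koszulD_zero_eq`). That `d² = 0` comes
from Cartan's formula on a free model (`freeD_freeCons`, `freeD_freeD`).

The representation theory of `𝔤` is built up first. Since `V(λ)` is given by generators and
relations, its finite-dimensionality has to be proved; it follows from the invariance of its weights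
under the finite group generated by the simple reflections. -/

variable (L) in
-- Brackets of elements of the Killing complement of the derived ideal lie both in it and in the
-- derived ideal, hence vanish. The complement is thus an abelian ideal, and so zero.
theorem derivedSeries_one_eq_top : derivedSeries ℂ L 1 = ⊤ := by
  set D : LieIdeal ℂ L := derivedSeries ℂ L 1
  have hc := D.isCompl_killingCompl
  have hab : IsLieAbelian D.killingCompl := by
    constructor
    rintro ⟨x, hx⟩ ⟨y, hy⟩
    ext
    have h1 : ⁅x, y⁆ ∈ D := by
      change ⁅x, y⁆ ∈ derivedSeries ℂ L 1
      rw [derivedSeries_def, derivedSeriesOfIdeal_succ, derivedSeriesOfIdeal_zero]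
      exact LieSubmodule.lie_mem_lie (I := (⊤ : LieIdeal ℂ L)) (N := (⊤ : LieIdeal ℂ L))
        (LieSubmodule.mem_top x) (LieSubmodule.mem_top y)
    have h2 : ⁅x, y⁆ ∈ D.killingCompl := D.killingCompl.lie_mem (x := x) (m := y) hy
    have : ⁅x, y⁆ ∈ D ⊓ D.killingCompl := ⟨h1, h2⟩
    rw [hc.inf_eq_bot] at this
    simpa using this
  have h0 : D.killingCompl = ⊥ := IsKilling.ideal_eq_bot_of_isLieAbelian _
  have := hc.sup_eq_top
  rwa [h0, sup_bot_eq] at this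

/-- A function which kills all brackets `⁅x, y⁆` kills a perfect Lie algebra. -/
theorem eq_zero_of_lie_eq_zero {N : Type*} [AddCommGroup N] [Module ℂ N] (f : L →ₗ[ℂ] N)
    (h : ∀ x y : L, f ⁅x, y⁆ = 0) (x : L) : f x = 0 := by
  have hx : x ∈ derivedSeries ℂ L 1 := by rw [derivedSeries_one_eq_top]; trivial
  rw [derivedSeries_def, derivedSeriesOfIdeal_succ, derivedSeriesOfIdeal_zero,
    ← LieSubmodule.mem_toSubmodule, LieSubmodule.lieIdeal_oper_eq_linear_span'] at hx
  induction hx using Submodule.span_induction with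
  | zero => simp
  | add a c _ _ ha hc => rw [map_add, ha, hc, add_zero]
  | smul d a _ ha => rw [map_smul, ha, smul_zero]
  | mem x hx => obtain ⟨a, -, c, -, rfl⟩ := hx; exact h a c

/-- Dual bases of an ideal on which the trace form of a representation is nondegenerate define
an operator that commutes with the action. -/
theorem exists_casimir {N : Type*} [AddCommGroup N] [Module ℂ N] [LieRingModule L N]
    [LieModule ℂ L N] [FiniteDimensional ℂ N] [LieModule.IsIrreducible ℂ L N]
    (hN : ∃ x : L, ∃ v : N, ⁅x, v⁆ ≠ 0) :
    ∃ (n : ℕ) (e f : Fin n → L), n ≠ 0 ∧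
      (∑ i, LinearMap.trace ℂ N (LieModule.toEnd ℂ L N (e i) ∘ₗ LieModule.toEnd ℂ L N (f i)) = n) ∧
      ∃ a : L → Fin n → Fin n → ℂ, ∀ x, (∀ i, ⁅x, e i⁆ = ∑ j, a x i j • e j) ∧
        (∀ i, ⁅x, f i⁆ = - ∑ j, a x j i • f j) := by
  set t := LieModule.traceForm ℂ L N
  let I : LieIdeal ℂ L :=
    { LinearMap.ker t with
      lie_mem := by
        intro x m hm
        have hm' : t m = 0 := hm
        change t ⁅x, m⁆ = 0
        ext z
        rw [← lie_skew, map_neg, LinearMap.neg_apply, LieModule.traceForm_apply_lie_apply]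
        change - t m _ = 0
        rw [hm']; simp }
  have hI : ∀ x, x ∈ I ↔ t x = 0 := fun x => Iff.rfl
  -- If the trace form vanished, the derived algebra, which is all of `L`, would act nilpotently.
  -- The lower central series of the irreducible `N` is zero at stage one, against the nonzero
  -- bracket, or else constantly `N`, against nilpotency.
  have ht : t ≠ 0 := by
    intro h0
    have h1 := LieModule.isNilpotent_derivedSeries_of_traceForm_eq_zero h0
    obtain ⟨x, v, hxv⟩ := hN
    have h2 := (LieModule.isNilpotent_iff_forall' (R := ℂ)).mp h1
    have h3 : LieModule.IsNilpotent L N := by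
      rw [LieModule.isNilpotent_iff_forall' (R := ℂ)]
      intro x
      have := h2 ⟨x, by rw [derivedSeries_one_eq_top]; trivial⟩
      exact this
    have h4 : LieModule.lowerCentralSeries ℂ L N 1 = ⊥ ∨
        LieModule.lowerCentralSeries ℂ L N 1 = ⊤ := eq_bot_or_eq_top _
    rcases h4 with h4 | h4
    · have : ⁅x, v⁆ ∈ LieModule.lowerCentralSeries ℂ L N 1 := by
        rw [LieModule.lowerCentralSeries_succ, LieModule.lowerCentralSeries_zero]
        exact LieSubmodule.lie_mem_lie (LieSubmodule.mem_top _) (LieSubmodule.mem_top _)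
      rw [h4] at this
      exact hxv (by simpa using this)
    · have h5 : ∀ k, LieModule.lowerCentralSeries ℂ L N k = ⊤ := by
        intro k
        induction k with
        | zero => rfl
        | succ k ih =>
          rw [LieModule.lowerCentralSeries_succ, ih]
          rw [LieModule.lowerCentralSeries_succ, LieModule.lowerCentralSeries_zero] at h4
          exact h4
      obtain ⟨k, hk⟩ := (LieModule.isNilpotent_iff ℂ L N).mp h3
      rw [h5] at hk
      have := LieModule.nontrivial_of_isIrreducible ℂ L N
      exact top_ne_bot hk
  -- `L = I ⊕ J` with `I` the radical of the trace form, so the form is nondegenerate on `J`, and `J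
  -- ≠ 0` because the form is nonzero. The dual bases are taken in `J`.
  set J := I.killingCompl
  have hIJ : IsCompl I J := I.isCompl_killingCompl
  let B : LinearMap.BilinForm ℂ J := t.restrict J.toSubmodule
  have hB : B.Nondegenerate := by
    have hs : B.IsRefl := fun x y h => by
      change t y x = 0
      rw [LieModule.traceForm_comm]; exact h
    refine (LinearMap.IsRefl.nondegenerate_iff_separatingLeft hs).mpr ?_
    intro x hx
    have : (x : L) ∈ I ⊓ J := by
      refine ⟨(hI _).mpr ?_, x.2⟩
      ext z
      have hz : z ∈ I ⊔ J := by rw [hIJ.sup_eq_top]; trivial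
      obtain ⟨a, ha, c, hc, rfl⟩ := LieSubmodule.mem_sup _ _ _ |>.mp hz
      rw [map_add]
      have h1 : t x a = 0 := by
        rw [LieModule.traceForm_comm]
        change t a x = 0
        rw [(hI a).mp ha]; rfl
      have h2 : t x c = 0 := hx ⟨c, hc⟩
      rw [h1, h2]; simp
    rw [hIJ.inf_eq_bot] at this
    ext; simpa using this
  let bs := finBasis ℂ J
  let ds := B.dualBasis hB bs
  refine ⟨finrank ℂ J, fun i => (bs i : L), fun i => (ds i : L), ?_, ?_, ?_⟩
  · intro h0
    have : J = ⊥ := by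
      have := (Submodule.finrank_eq_zero (S := J.toSubmodule)).mp h0
      exact (LieSubmodule.toSubmodule_eq_bot J).mp this
    rw [this] at hIJ
    have hI' : I = ⊤ := by have := hIJ.sup_eq_top; rwa [sup_bot_eq] at this
    exact ht (LinearMap.ext fun x => (hI x).mp (by rw [hI']; trivial))
  · have : ∀ i, LinearMap.trace ℂ N (LieModule.toEnd ℂ L N (bs i) ∘ₗ LieModule.toEnd ℂ L N (ds i))
        = 1 := by
      intro i
      have h := LinearMap.BilinForm.apply_dualBasis_left hB bs i i
      rw [if_pos rfl] at h
      rw [← LieModule.traceForm_apply_apply, LieModule.traceForm_comm]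
      exact h
    simp [this]
  -- `a x` is the matrix of `ad x` in the basis. Invariance of the form makes the dual basis
  -- transform by the negative transpose, which is what makes `∑ eᵢ fᵢ` commute with `L` in any
  -- module.
  · refine ⟨fun x i j => bs.repr ⁅x, bs i⁆ j, fun x => ⟨fun i => ?_, fun i => ?_⟩⟩
    · have := congrArg (fun z : J => (z : L)) (bs.sum_repr ⁅x, bs i⁆)
      simp only [LieSubmodule.coe_bracket] at this
      rw [← this]
      push_cast
      rfl
    · have key : ⁅x, ds i⁆ = - ∑ j, (bs.repr ⁅x, bs j⁆ i) • ds j := by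
        rw [← ds.sum_repr ⁅x, ds i⁆, ← Finset.sum_neg_distrib]
        refine Finset.sum_congr rfl fun j _ => ?_
        rw [← neg_smul, LinearMap.BilinForm.dualBasis_repr_apply]
        congr 1
        have h1 : B ⁅x, ds i⁆ (bs j) = - B (ds i) ⁅x, bs j⁆ := by
          change t ⁅x, (ds i : L)⁆ (bs j) = - t (ds i) ⁅x, (bs j : L)⁆
          rw [← lie_skew, map_neg, LinearMap.neg_apply, LieModule.traceForm_apply_lie_apply]
        rw [h1]
        rw [neg_inj]
        conv_lhs => rw [← bs.sum_repr ⁅x, bs j⁆]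
        simp only [ds, map_sum, map_smul, LinearMap.BilinForm.apply_dualBasis_left, smul_eq_mul]
        simp
      have := congrArg (fun z : J => (z : L)) key
      simpa using this

/-- An endomorphism of an irreducible module which commutes with the action is a scalar. -/
theorem exists_eq_smul_of_irreducible {N : Type*} [AddCommGroup N] [Module ℂ N] [LieRingModule L N]
    [LieModule ℂ L N] [FiniteDimensional ℂ N] [LieModule.IsIrreducible ℂ L N] (C : N →ₗ[ℂ] N)
    (hC : ∀ (x : L) v, C ⁅x, v⁆ = ⁅x, C v⁆) : ∃ c : ℂ, ∀ v, C v = c • v := by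
  have := LieModule.nontrivial_of_isIrreducible ℂ L N
  obtain ⟨c, hc⟩ := Module.End.exists_eigenvalue C
  let E : LieSubmodule ℂ L N :=
    { Module.End.eigenspace C c with
      lie_mem := by
        intro x m hm
        have hm' : C m = c • m := Module.End.mem_eigenspace_iff.mp hm
        refine Module.End.mem_eigenspace_iff.mpr ?_
        rw [hC, hm', lie_smul] }
  have hE : E ≠ ⊥ := by
    intro h
    obtain ⟨v, hv, hv0⟩ := hc.exists_hasEigenvector
    have : v ∈ E := hv
    rw [h] at this
    exact hv0 (by simpa using this)
  refine ⟨c, fun v => Module.End.mem_eigenspace_iff.mp ?_⟩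
  have : v ∈ E := by rw [(eq_bot_or_eq_top E).resolve_left hE]; trivial
  exact this

/-- A surjection of a finite-dimensional module onto the trivial module has an invariant
section. -/
theorem exists_invariant {X : Type*} [AddCommGroup X] [Module ℂ X] [LieRingModule L X]
    [LieModule ℂ L X] [FiniteDimensional ℂ X] (π : X →ₗ[ℂ] ℂ) (hπ : ∀ (x : L) v, π ⁅x, v⁆ = 0)
    (h0 : π ≠ 0) : ∃ v : X, (∀ x : L, ⁅x, v⁆ = 0) ∧ π v = 1 := by
  induction hn : finrank ℂ X using Nat.strong_induction_on generalizing X with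
  | _ n ih =>
  subst hn
  obtain ⟨v₀, hv₀⟩ : ∃ v, π v = 1 := by
    obtain ⟨v, hv⟩ := DFunLike.ne_iff.mp h0
    replace hv : π v ≠ 0 := hv
    exact ⟨(π v)⁻¹ • v, by simp [hv]⟩
  let N : LieSubmodule ℂ L X := { LinearMap.ker π with lie_mem := fun {x m} _ => hπ x m }
  have hN : ∀ v, v ∈ N ↔ π v = 0 := fun v => Iff.rfl
  -- If `N` is a trivial module, then `⁅x, y⁆ v₀ = x (y v₀) - y (x v₀) = 0` since `y v₀` and `x v₀`
  -- lie in `N`, and brackets span `L`.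
  by_cases htriv : ∀ (x : L), ∀ w ∈ N, ⁅x, w⁆ = 0
  · refine ⟨v₀, ?_, hv₀⟩
    refine eq_zero_of_lie_eq_zero (((LieModule.toEnd ℂ L X).toLinearMap : L →ₗ[ℂ] X →ₗ[ℂ] X).flip v₀) ?_
    intro x y
    change ⁅⁅x, y⁆, v₀⁆ = 0
    rw [lie_lie, htriv x _ (hπ y v₀), htriv y _ (hπ x v₀), sub_zero]
  -- For a proper nonzero submodule `N' < N`, the induction applies twice: to `X / N'`, giving `v`
  -- with `L v ⊆ N'`, and then to `ℂ v + N'`, which is smaller than `X` because `N' ≠ N`.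
  by_cases hirr : ∃ N' : LieSubmodule ℂ L X, N' ≤ N ∧ N' ≠ ⊥ ∧ N' ≠ N
  · obtain ⟨N', hle, hbot, hne⟩ := hirr
    have hlt : finrank ℂ (X ⧸ N') < finrank ℂ X := by
      have h1 := N'.toSubmodule.finrank_quotient_add_finrank
      have h2 : 0 < finrank ℂ N'.toSubmodule := by
        rw [Nat.pos_iff_ne_zero]
        intro h
        exact hbot ((LieSubmodule.toSubmodule_eq_bot N').mp (Submodule.finrank_eq_zero.mp h))
      have h3 : finrank ℂ (X ⧸ N') = finrank ℂ (X ⧸ N'.toSubmodule) := rfl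
      omega
    let π' : (X ⧸ N') →ₗ[ℂ] ℂ := N'.toSubmodule.liftQ π hle
    have hmk : ∀ v, π' (LieSubmodule.Quotient.mk (N := N') v) = π v := fun v => rfl
    obtain ⟨q, hq, hq1⟩ := ih _ hlt π' (by
      intro x q
      obtain ⟨v, rfl⟩ := LieSubmodule.Quotient.surjective_mk' N' q
      exact hπ x v) (by
      intro h
      have := hmk v₀
      rw [h, hv₀] at this
      simp at this) rfl
    obtain ⟨v, rfl⟩ := LieSubmodule.Quotient.surjective_mk' N' q
    have hv1 : π v = 1 := hq1
    have hv : ∀ x : L, ⁅x, v⁆ ∈ N' := by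
      intro x
      have h1 : LieSubmodule.Quotient.mk' N' ⁅x, v⁆ = 0 := by
        rw [LieModuleHom.map_lie]; exact hq x
      exact (LieSubmodule.Quotient.mk_eq_zero (N := N')).mp h1
    let Y : LieSubmodule ℂ L X :=
      { carrier := {w | ∃ c : ℂ, w - c • v ∈ N'}
        add_mem' := by
          rintro a a' ⟨c, hc⟩ ⟨d, hd⟩
          refine ⟨c + d, ?_⟩
          have : a + a' - (c + d) • v = (a - c • v) + (a' - d • v) := by rw [add_smul]; abel
          rw [this]; exact add_mem hc hd
        zero_mem' := ⟨0, by simp⟩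
        smul_mem' := by
          rintro d a ⟨c, hc⟩
          refine ⟨d * c, ?_⟩
          rw [mul_smul, ← smul_sub]; exact N'.smul_mem d hc
        lie_mem := by
          rintro x a ⟨c, hc⟩
          refine ⟨0, ?_⟩
          have h1 := add_mem (N'.lie_mem (x := x) hc) (N'.smul_mem c (hv x))
          rw [lie_sub, lie_smul, sub_add_cancel] at h1
          simpa using h1 }
    have hY : finrank ℂ Y < finrank ℂ X := by
      apply Submodule.finrank_lt (s := Y.toSubmodule)
      intro h
      apply hne
      refine le_antisymm hle fun w hw => ?_
      obtain ⟨c, hc⟩ : w ∈ Y.toSubmodule := by rw [h]; trivial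
      have h1 : π (w - c • v) = 0 := hle hc
      rw [map_sub, (hN w).mp hw, map_smul, hv1] at h1
      have : c = 0 := by simpa using h1
      simpa [this] using hc
    have hvY : v ∈ Y := ⟨1, by simp⟩
    obtain ⟨y, hy, hy1⟩ := ih _ hY (π ∘ₗ Y.toSubmodule.subtype : Y →ₗ[ℂ] ℂ) (fun x y => hπ x y.1) (by
      intro h
      have h1 := LinearMap.congr_fun h ⟨v, hvY⟩
      have h2 : π v = 0 := h1
      rw [hv1] at h2
      simp at h2) rfl
    exact ⟨y.1, fun x => congrArg Subtype.val (hy x), hy1⟩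
  -- Here `N` is irreducible with nonzero action. The Casimir operator attached to `N` acts on all
  -- of `X`, commutes with `L`, and sends `X` into `N`.
  · push Not at hirr htriv
    obtain ⟨x₀, w₀, hw₀, hxw⟩ := htriv
    have hnt : Nontrivial N := ⟨⟨w₀, hw₀⟩, 0, fun h => hxw (by
      have : w₀ = 0 := congrArg Subtype.val h
      rw [this, lie_zero])⟩
    have hIrr : LieModule.IsIrreducible ℂ L N := by
      apply LieModule.IsIrreducible.mk
      intro M hM
      have h1 := hirr (M.map N.incl) (by
        rintro _ ⟨m, -, rfl⟩
        exact m.2) (by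
        intro h
        apply hM
        rw [eq_bot_iff]
        intro m hm
        have : (m : X) ∈ M.map N.incl := ⟨m, hm, rfl⟩
        rw [h] at this
        have h2 : (m : X) = 0 := by simpa using this
        have h3 : m = 0 := Subtype.ext h2
        simp [h3])
      rw [eq_top_iff]
      intro m _
      have : (m : X) ∈ M.map N.incl := by rw [h1]; exact m.2
      obtain ⟨m', hm', he⟩ := this
      have : m' = m := Subtype.ext he
      exact this ▸ hm'
    obtain ⟨n, e, f, hn, htr, a, ha⟩ := exists_casimir (L := L) (N := N)
      ⟨x₀, ⟨w₀, hw₀⟩, fun h => hxw (congrArg Subtype.val h)⟩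
    let C : X →ₗ[ℂ] X := ∑ i, LieModule.toEnd ℂ L X (e i) ∘ₗ LieModule.toEnd ℂ L X (f i)
    have hCapp : ∀ v, C v = ∑ i, ⁅e i, ⁅f i, v⁆⁆ := fun v => by
      simp [C, LinearMap.sum_apply]
    have hC : ∀ (x : L) v, C ⁅x, v⁆ = ⁅x, C v⁆ := by
      intro x v
      rw [hCapp, hCapp, ← sub_eq_zero, lie_sum, ← Finset.sum_sub_distrib]
      have h1 : ∀ i, ⁅e i, ⁅f i, ⁅x, v⁆⁆⁆ - ⁅x, ⁅e i, ⁅f i, v⁆⁆⁆ =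
          ∑ j, a x j i • ⁅e i, ⁅f j, v⁆⁆ - ∑ j, a x i j • ⁅e j, ⁅f i, v⁆⁆ := by
        intro i
        have h2 : ⁅x, ⁅e i, ⁅f i, v⁆⁆⁆ = ⁅⁅x, e i⁆, ⁅f i, v⁆⁆ + ⁅e i, ⁅⁅x, f i⁆, v⁆⁆ +
            ⁅e i, ⁅f i, ⁅x, v⁆⁆⁆ := by
          rw [leibniz_lie x (e i), leibniz_lie x (f i) v, lie_add]; abel
        rw [h2, (ha x).1, (ha x).2]
        simp only [sum_lie, smul_lie, neg_lie, lie_neg, lie_sum, lie_smul]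
        abel
      simp only [h1, Finset.sum_sub_distrib]
      rw [Finset.sum_comm, sub_self]
    have hCN : ∀ v, C v ∈ N := fun v => by
      rw [hCapp]; exact sum_mem fun i _ => hπ _ _
    let CN : N →ₗ[ℂ] N := ∑ i, LieModule.toEnd ℂ L N (e i) ∘ₗ LieModule.toEnd ℂ L N (f i)
    have hCNC : ∀ v : N, (CN v : X) = C v := by
      intro v
      rw [hCapp]
      simp [CN, LinearMap.sum_apply]
    obtain ⟨c, hc⟩ := exists_eq_smul_of_irreducible (L := L) CN (fun x v => Subtype.ext (by
      rw [hCNC, LieSubmodule.coe_bracket, LieSubmodule.coe_bracket, hC, hCNC]))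
    -- The trace on `N` is the dimension `n` of `J`, which is nonzero.
    have hc0 : c ≠ 0 := by
      rintro rfl
      have : CN = 0 := LinearMap.ext fun v => by rw [hc, zero_smul]; rfl
      have h1 : LinearMap.trace ℂ N CN = n := by rw [map_sum]; exact htr
      rw [this, map_zero] at h1
      exact hn (by exact_mod_cast h1.symm)
    have hcN : ∀ w ∈ N, C w = c • w := fun w hw => by
      rw [← hCNC ⟨w, hw⟩, hc]; rfl
    -- The corrected vector lies in the kernel of `C`. Its image under any `x` lies in `N` and is
    -- still killed by `C`, which acts there by `c ≠ 0`.
    refine ⟨v₀ - c⁻¹ • C v₀, fun x => ?_, ?_⟩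
    · have hCw : C (v₀ - c⁻¹ • C v₀) = 0 := by
        rw [map_sub, map_smul, hcN _ (hCN v₀), smul_smul, inv_mul_cancel₀ hc0, one_smul, sub_self]
      have h1 := hC x (v₀ - c⁻¹ • C v₀)
      rw [hCw, lie_zero, hcN _ (hπ x _)] at h1
      exact (smul_eq_zero.mp h1).resolve_left hc0
    · rw [map_sub, map_smul, (hN _).mp (hCN v₀), hv₀]; simp

/-- Weyl's theorem: every submodule is the image of an equivariant projection. -/
theorem exists_lieProjection {V : Type*} [AddCommGroup V] [Module ℂ V] [LieRingModule L V]
    [LieModule ℂ L V] [FiniteDimensional ℂ V] (W : LieSubmodule ℂ L V) :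
    ∃ p : V →ₗ⁅ℂ,L⁆ W, ∀ w : W, p w = w := by
  by_cases hW : W = ⊥
  · subst hW
    exact ⟨0, fun w => Subsingleton.elim _ _⟩
  obtain ⟨w₀, hw₀, hne⟩ := (Submodule.ne_bot_iff W.toSubmodule).mp
    (fun h => hW ((LieSubmodule.toSubmodule_eq_bot W).mp h))
  -- Linear maps that are scalar on `W`; brackets have scalar zero. Reading off the scalar is a
  -- surjection onto the trivial module, nonzero because a linear projection has scalar one, and an
  -- invariant of scalar one is an equivariant projection.
  let X : LieSubmodule ℂ L (V →ₗ[ℂ] W) :=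
    { carrier := {f | ∃ c : ℂ, ∀ w : W, f w = c • w}
      add_mem' := by
        rintro f g ⟨c, hc⟩ ⟨d, hd⟩
        exact ⟨c + d, fun w => by rw [LinearMap.add_apply, hc, hd, add_smul]⟩
      zero_mem' := ⟨0, fun w => by simp⟩
      smul_mem' := by
        rintro a f ⟨c, hc⟩
        exact ⟨a * c, fun w => by rw [LinearMap.smul_apply, hc, mul_smul]⟩
      lie_mem := by
        rintro x f ⟨c, hc⟩
        refine ⟨0, fun w => ?_⟩
        rw [LieHom.lie_apply, hc, ← LieSubmodule.coe_bracket, hc, lie_smul, sub_self, zero_smul] }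
  obtain ⟨ℓ, hℓ⟩ := Module.Projective.exists_dual_eq_one ℂ (x := (⟨w₀, hw₀⟩ : W))
    (fun h => hne (congrArg Subtype.val h))
  let π : X →ₗ[ℂ] ℂ := ℓ ∘ₗ (LinearMap.applyₗ w₀) ∘ₗ X.toSubmodule.subtype
  have hπ : ∀ f : X, ∀ c : ℂ, (∀ w : W, f.1 w = c • w) → π f = c := by
    intro f c hc
    change ℓ (f.1 w₀) = c
    rw [hc ⟨w₀, hw₀⟩, map_smul, hℓ]; simp
  obtain ⟨q, hq⟩ := W.toSubmodule.exists_isCompl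
  obtain ⟨f, hf, hf1⟩ := exists_invariant (L := L) π (by
      rintro x ⟨f, c, hc⟩
      apply hπ
      intro w
      change ⁅x, f⁆ _ = _
      rw [LieHom.lie_apply, hc, ← LieSubmodule.coe_bracket, hc, lie_smul, sub_self, zero_smul])
    (by
      intro h
      have h1 := hπ ⟨W.toSubmodule.projectionOnto q hq, 1, fun w => by
        rw [one_smul]; exact Submodule.projectionOnto_apply_left hq w⟩ 1
        (fun w => by
          rw [one_smul]; exact Submodule.projectionOnto_apply_left hq w)
      rw [h] at h1
      simp at h1)
  obtain ⟨f, c, hc⟩ := f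
  have hc1 : c = 1 := by rw [← hf1]; exact (hπ _ c hc).symm
  subst hc1
  refine ⟨{ f with map_lie' := ?_ }, fun w => (hc w).trans (one_smul ℂ w)⟩
  intro x v
  have h1 : ⁅x, f⁆ = 0 := congrArg Subtype.val (hf x)
  have := LinearMap.congr_fun h1 v
  rw [LieHom.lie_apply, LinearMap.zero_apply, sub_eq_zero] at this
  exact this.symm

end CompleteReducibility

/-! ### Heights and highest weight modules. -/

section HighestWeight

variable {L : Type*} [LieRing L] [LieAlgebra ℂ L] [FiniteDimensional ℂ L]
  [LieAlgebra.IsKilling ℂ L] {H : LieSubalgebra ℂ L} [H.IsCartanSubalgebra]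

open LieAlgebra LieAlgebra.IsKilling Module

/-! ### Positive roots and the height element -/

variable (b : (rootSystem H).Base)

/-- An element of `𝔥` on which all simple roots take the value `1`. -/
theorem exists_heightElt : ∃ h₀ : H, ∀ i ∈ b.support, (rootSystem H).root i h₀ = 1 := by
  -- The simple roots form a basis of the dual of `𝔥`, so their values may be prescribed.
  refine ⟨(Module.evalEquiv ℂ H).symm (b.toWeightBasis.constr ℂ (fun _ => (1 : ℂ))), ?_⟩
  intro i hi
  rw [Module.apply_evalEquiv_symm_apply]
  have h := b.toWeightBasis_apply ⟨i, hi⟩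
  simp only at h
  rw [← h, Basis.constr_basis]

/-- An element of `𝔥` on which all simple roots take the value `1`. -/
def heightElt : H := (exists_heightElt b).choose

variable {b}

theorem root_heightElt {i : H.root} (hi : i ∈ b.support) :
    (rootSystem H).root i (heightElt b) = 1 :=
  (exists_heightElt b).choose_spec i hi

/-- A sum of simple roots has as height the number of its terms, so height zero would force the zero
functional, which is no root. Heights drive all the descent arguments below. -/
theorem positiveRoots_heightElt {α : H.root} (hα : α ∈ positiveRoots b) :
    ∃ n : ℕ, n ≠ 0 ∧ (rootSystem H).root α (heightElt b) = n := by
  have key : ∀ χ ∈ AddSubmonoid.closure ((rootSystem H).root '' b.support),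
      ∃ n : ℕ, χ (heightElt b) = n ∧ (n = 0 → χ = 0) := by
    intro χ hχ
    induction hχ using AddSubmonoid.closure_induction with
    | mem x hx =>
      obtain ⟨i, hi, rfl⟩ := hx
      exact ⟨1, by rw [root_heightElt hi]; simp, by simp⟩
    | zero => exact ⟨0, by simp, fun _ => rfl⟩
    | add x y _ _ hx hy =>
      obtain ⟨n, hn, hn0⟩ := hx
      obtain ⟨m, hm, hm0⟩ := hy
      refine ⟨n + m, by rw [LinearMap.add_apply, hn, hm]; push_cast; rfl, fun h => ?_⟩
      rw [hn0 (by omega), hm0 (by omega), add_zero]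
  obtain ⟨n, hn, hn0⟩ := key _ hα
  exact ⟨n, fun h => (rootSystem H).ne_zero α (hn0 h), hn⟩

variable (b) in
theorem mem_positiveRoots_or_neg (α : H.root) :
    α ∈ positiveRoots b ∨ ∃ β ∈ positiveRoots b,
      (α : LieModule.Weight ℂ H L) = -(β : LieModule.Weight ℂ H L) := by
  have hsum : ∀ f : H.root → ℕ, ∑ j ∈ b.support, f j • (rootSystem H).root j ∈
      AddSubmonoid.closure ((rootSystem H).root '' b.support) := fun f =>
    sum_mem fun j hj => nsmul_mem (AddSubmonoid.subset_closure (Set.mem_image_of_mem _ hj)) _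
  obtain ⟨f, -, hf | hf⟩ := b.exists_root_eq_sum_nat_or_neg α
  · left
    change (rootSystem H).root α ∈ AddSubmonoid.closure ((rootSystem H).root '' b.support)
    rw [hf]; exact hsum f
  · right
    have hneg : (-(α : LieModule.Weight ℂ H L)) ∈ H.root := by
      have := α.2
      simp only [LieSubalgebra.root, Finset.mem_filter, Finset.mem_univ, true_and] at this ⊢
      exact LieModule.Weight.IsNonZero.neg this
    refine ⟨⟨_, hneg⟩, ?_, by simp⟩
    change (rootSystem H).root ⟨_, hneg⟩ ∈
      AddSubmonoid.closure ((rootSystem H).root '' b.support)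
    have h1 : (rootSystem H).root ⟨_, hneg⟩ = - (rootSystem H).root α := rfl
    rw [h1, hf, neg_neg]; exact hsum f

variable (b) in
/-- Triangular decomposition. -/
theorem triangular_induction {p : L → Prop} (hH : ∀ h : H, p h)
    (hpos : ∀ α ∈ positiveRoots b, ∀ x ∈ rootSpace H (α : LieModule.Weight ℂ H L), p x)
    (hneg : ∀ α ∈ positiveRoots b, ∀ x ∈ rootSpace H (-(α : LieModule.Weight ℂ H L)), p x)
    (hadd : ∀ x y, p x → p y → p (x + y)) (x : L) : p x := by
  have hx : x ∈ (H.toLieSubmodule ⊔ ⨆ α : LieModule.Weight ℂ H L, ⨆ (_ : α.IsNonZero),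
      rootSpace H ⇑α : LieSubmodule ℂ H L) := by
    rw [cartan_sup_iSup_rootSpace_eq_top]; trivial
  obtain ⟨y, hy, z, hz, rfl⟩ := (LieSubmodule.mem_sup _ _ _).mp hx
  refine hadd _ _ (hH ⟨y, hy⟩) ?_
  have h0 : p 0 := hH 0
  clear hx hy
  induction hz using LieSubmodule.iSup_induction' with
  | zero => exact h0
  | add a c _ _ ha hc => exact hadd _ _ ha hc
  | mem α x hx =>
    induction hx using LieSubmodule.iSup_induction' with
    | zero => exact h0
    | add a c _ _ ha hc => exact hadd _ _ ha hc
    | mem hα x hx =>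
      have hmem : α ∈ H.root := by simpa [LieSubalgebra.root] using hα
      rcases mem_positiveRoots_or_neg b ⟨α, hmem⟩ with h | ⟨β, hβ, he⟩
      · exact hpos _ h x hx
      · refine hneg β hβ x ?_
        have he' : α = -(β : LieModule.Weight ℂ H L) := he
        rw [he', LieModule.Weight.coe_neg] at hx
        exact hx

/-! ### Highest weight vectors -/

section Maximal

variable {X : Type*} [AddCommGroup X] [Module ℂ X] [LieRingModule L X] [LieModule ℂ L X]

variable (b) in
/-- `v` has weight `μ` and is killed by `𝔫⁺`. -/
def IsMaximalVector (μ : Dual ℂ H) (v : X) : Prop :=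
  (∀ h : H, ⁅(h : L), v⁆ = μ h • v) ∧
    ∀ α ∈ positiveRoots b, ∀ x ∈ rootSpace H (α : LieModule.Weight ℂ H L), ⁅x, v⁆ = 0

theorem lie_cartan_rootSpace {χ : H → ℂ} {x : L} (hx : x ∈ rootSpace H χ) (h : H) :
    ⁅(h : L), x⁆ = χ h • x := lie_eq_smul_of_mem_rootSpace hx h

variable (b) in
/-- Vectors obtained from `v` by applying negative root vectors, with the sum of the roots. -/
inductive Descends (v : X) : Dual ℂ H → X → Prop
  | refl : Descends v 0 v
  | step {ν : Dual ℂ H} {y : X} (h : Descends v ν y) (α : H.root) (hα : α ∈ positiveRoots b)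
      (x : L) (hx : x ∈ rootSpace H (-(α : LieModule.Weight ℂ H L))) :
      Descends v (ν + (rootSystem H).root α) ⁅x, y⁆

theorem Descends.weight {v : X} {μ ν : Dual ℂ H} {y : X} (h : Descends b v ν y)
    (hv : ∀ h : H, ⁅(h : L), v⁆ = μ h • v) (t : H) : ⁅(t : L), y⁆ = (μ - ν) t • y := by
  induction h with
  | refl => simpa using hv t
  | step _ α hα x hx ih =>
    rw [leibniz_lie, lie_cartan_rootSpace hx, ih, lie_smul, smul_lie, ← add_smul]
    congr 1
    simp only [LinearMap.sub_apply, LinearMap.add_apply, rootSystem_root_apply]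
    simp
    ring

/-- Each step adds a positive height, so height zero means that no step was taken. -/
theorem Descends.height {v : X} {ν : Dual ℂ H} {y : X} (h : Descends b v ν y) :
    ∃ n : ℕ, ν (heightElt b) = n ∧ (n = 0 → y = v) := by
  induction h with
  | refl => exact ⟨0, by simp, fun _ => rfl⟩
  | step _ α hα x hx ih =>
    obtain ⟨n, hn, -⟩ := ih
    obtain ⟨m, hm, hm'⟩ := positiveRoots_heightElt hα
    exact ⟨n + m, by rw [LinearMap.add_apply, hn, hm']; push_cast; rfl, fun h => by omega⟩

variable (b) in
/-- The span of the vectors properly below `v`. -/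
def properSpan (v : X) : Submodule ℂ X :=
  Submodule.span ℂ {y | ∃ ν, Descends b v ν y ∧ ∃ n : ℕ, n ≠ 0 ∧ ν (heightElt b) = n}

variable (b) in
def descendSpan (v : X) : Submodule ℂ X := Submodule.span ℂ {y | ∃ ν, Descends b v ν y}

theorem descendSpan_eq (v : X) : descendSpan b v = Submodule.span ℂ {v} ⊔ properSpan b v := by
  apply le_antisymm
  · refine Submodule.span_le.mpr ?_
    rintro y ⟨ν, hy⟩
    obtain ⟨n, hn, h0⟩ := hy.height
    by_cases hn0 : n = 0
    · rw [h0 hn0]; exact Submodule.mem_sup_left (Submodule.mem_span_singleton_self v)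
    · exact Submodule.mem_sup_right (Submodule.subset_span ⟨ν, hy, n, hn0, hn⟩)
  · refine sup_le ?_ (Submodule.span_mono fun y ⟨ν, hy, _⟩ => ⟨ν, hy⟩)
    rw [Submodule.span_singleton_le_iff_mem]
    exact Submodule.subset_span ⟨0, .refl⟩

theorem neg_lie_mem_properSpan {v y : X} (hy : y ∈ descendSpan b v) {α : H.root}
    (hα : α ∈ positiveRoots b) {x : L} (hx : x ∈ rootSpace H (-(α : LieModule.Weight ℂ H L))) :
    ⁅x, y⁆ ∈ properSpan b v := by
  induction hy using Submodule.span_induction with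
  | zero => simp
  | add a c _ _ ha hc => rw [lie_add]; exact add_mem ha hc
  | smul d a _ ha => rw [lie_smul]; exact Submodule.smul_mem _ d ha
  | mem y hy =>
    obtain ⟨ν, hy⟩ := hy
    obtain ⟨n, hn, -⟩ := hy.height
    obtain ⟨m, hm, hm'⟩ := positiveRoots_heightElt hα
    exact Submodule.subset_span ⟨_, hy.step α hα x hx, n + m, by omega, by
      rw [LinearMap.add_apply, hn, hm']; push_cast; rfl⟩

theorem properSpan_le (v : X) : properSpan b v ≤ descendSpan b v := by
  rw [descendSpan_eq]; exact le_sup_right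

theorem cartan_lie_mem_properSpan {v y : X} {μ : Dual ℂ H}
    (hv : ∀ h : H, ⁅(h : L), v⁆ = μ h • v) (hy : y ∈ properSpan b v) (t : H) :
    ⁅(t : L), y⁆ ∈ properSpan b v := by
  induction hy using Submodule.span_induction with
  | zero => simp
  | add a c _ _ ha hc => rw [lie_add]; exact add_mem ha hc
  | smul d a _ ha => rw [lie_smul]; exact Submodule.smul_mem _ d ha
  | mem y hy =>
    obtain ⟨ν, hy, h⟩ := hy
    rw [hy.weight hv]
    exact Submodule.smul_mem _ _ (Submodule.subset_span ⟨ν, hy, h⟩)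

/-- Induction on the word: `x (f y) = ⁅x, f⁆ y + f (x y)`, with the hypothesis kept for every `x` so
that it also covers `⁅x, f⁆`. -/
theorem lie_mem_descendSpan {v y : X} {μ : Dual ℂ H} (hv : IsMaximalVector b μ v)
    (hy : y ∈ descendSpan b v) (x : L) : ⁅x, y⁆ ∈ descendSpan b v := by
  induction hy using Submodule.span_induction generalizing x with
  | zero => simp
  | add a c _ _ ha hc => rw [lie_add]; exact add_mem (ha x) (hc x)
  | smul d a _ ha => rw [lie_smul]; exact Submodule.smul_mem _ d (ha x)
  | mem y hy =>
    obtain ⟨ν, hy⟩ := hy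
    have hvm : v ∈ descendSpan b v := Submodule.subset_span ⟨0, .refl⟩
    induction hy generalizing x with
    | refl =>
      induction x using triangular_induction b with
      | hH h => rw [hv.1]; exact Submodule.smul_mem _ _ hvm
      | hpos α hα x hx => rw [hv.2 α hα x hx]; exact zero_mem _
      | hneg α hα x hx => exact properSpan_le v (neg_lie_mem_properSpan hvm hα hx)
      | hadd x y hx hy => rw [add_lie]; exact add_mem hx hy
    | step _ α hα f hf ih =>
      rw [leibniz_lie]
      exact add_mem (ih _) (properSpan_le v (neg_lie_mem_properSpan (ih x) hα hf))

/-- The identity `U(L) v = U(𝔫⁻) v`, obtained from stability of the right-hand side instead of a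
basis theorem. -/
theorem mem_lieSpan_iff {v y : X} {μ : Dual ℂ H} (hv : IsMaximalVector b μ v) :
    y ∈ LieSubmodule.lieSpan ℂ L {v} ↔ y ∈ descendSpan b v := by
  constructor
  · intro hy
    exact (LieSubmodule.lieSpan_le (N := ({ descendSpan b v with
      lie_mem := fun {x m} hm => lie_mem_descendSpan hv hm x } : LieSubmodule ℂ L X))).mpr
        (by
          rintro _ rfl
          exact Submodule.subset_span (s := {y | ∃ ν, Descends b _ ν y}) ⟨0, .refl⟩) hy
  · intro hy
    refine (Submodule.span_le (p := (LieSubmodule.lieSpan ℂ L {v}).toSubmodule)).mpr ?_ hy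
    rintro y ⟨ν, hy⟩
    induction hy with
    | refl => exact LieSubmodule.subset_lieSpan rfl
    | step _ α hα x hx ih => exact LieSubmodule.lie_mem _ ih

/-- Eigenspaces of the height element. -/
theorem properSpan_le_eigenspaces {v : X} {μ : Dual ℂ H}
    (hv : ∀ h : H, ⁅(h : L), v⁆ = μ h • v) :
    properSpan b v ≤ ⨆ c : {c : ℂ // ∃ n : ℕ, n ≠ 0 ∧ c = μ (heightElt b) - n},
      End.eigenspace (LieModule.toEnd ℂ L X (heightElt b : L)) c := by
  refine Submodule.span_le.mpr ?_
  rintro y ⟨ν, hy, n, hn, hν⟩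
  refine Submodule.mem_iSup_of_mem ⟨_, n, hn, rfl⟩ ?_
  rw [End.mem_eigenspace_iff, LieModule.toEnd_apply_apply, hy.weight hv, LinearMap.sub_apply, hν]

theorem eigenspace_disjoint (φ : End ℂ X) (S : Set ℂ) {c : ℂ} (hc : c ∉ S) :
    Disjoint (End.eigenspace φ c) (⨆ d : S, End.eigenspace φ d) := by
  have h := φ.eigenspaces_iSupIndep c
  refine h.mono_right (iSup_le fun d => ?_)
  exact le_iSup₂_of_le (d : ℂ) (fun h => hc (h ▸ d.2)) le_rfl

/-- The top weight space of a highest weight module is spanned by the highest weight vector. -/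
theorem mem_span_of_height_eq {v y : X} {μ : Dual ℂ H} (hv : IsMaximalVector b μ v)
    (hy : y ∈ LieSubmodule.lieSpan ℂ L {v})
    (hyh : ⁅(heightElt b : L), y⁆ = μ (heightElt b) • y) : y ∈ Submodule.span ℂ {v} := by
  rw [mem_lieSpan_iff hv, descendSpan_eq] at hy
  obtain ⟨a, ha, c, hc, rfl⟩ := Submodule.mem_sup.mp hy
  obtain ⟨d, rfl⟩ := Submodule.mem_span_singleton.mp ha
  have h1 := properSpan_le_eigenspaces hv.1 hc
  have h2 : ⁅(heightElt b : L), c⁆ = μ (heightElt b) • c := by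
    rw [lie_add, lie_smul, hv.1, smul_add, smul_comm d] at hyh
    exact add_left_cancel hyh
  have h3 : c = 0 := by
    refine Submodule.disjoint_def.mp (eigenspace_disjoint
      (LieModule.toEnd ℂ L X (heightElt b : L)) {c : ℂ | ∃ n : ℕ, n ≠ 0 ∧ c = μ (heightElt b) - n}
      (c := μ (heightElt b)) ?_) c (End.mem_eigenspace_iff.mpr h2) h1
    rintro ⟨n, hn, h⟩
    have : (n : ℂ) = 0 := by linear_combination h
    exact hn (by exact_mod_cast this)
  rw [h3, add_zero]; exact ha

/-- Heights in a highest weight module. -/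
theorem exists_height_eq {v y : X} {μ : Dual ℂ H} (hv : IsMaximalVector b μ v)
    (hy : y ∈ LieSubmodule.lieSpan ℂ L {v}) (hy0 : y ≠ 0) {c : ℂ}
    (hyh : ⁅(heightElt b : L), y⁆ = c • y) : ∃ n : ℕ, c = μ (heightElt b) - n := by
  by_contra hne
  rw [mem_lieSpan_iff hv] at hy
  have h1 : descendSpan b v ≤ ⨆ c : {c : ℂ | ∃ n : ℕ, c = μ (heightElt b) - n},
      End.eigenspace (LieModule.toEnd ℂ L X (heightElt b : L)) c := by
    refine Submodule.span_le.mpr ?_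
    rintro z ⟨ν, hz⟩
    obtain ⟨n, hn, -⟩ := hz.height
    refine Submodule.mem_iSup_of_mem ⟨_, n, rfl⟩ ?_
    rw [End.mem_eigenspace_iff, LieModule.toEnd_apply_apply, hz.weight hv.1, LinearMap.sub_apply,
      hn]
  exact hy0 (Submodule.disjoint_def.mp (eigenspace_disjoint
      (LieModule.toEnd ℂ L X (heightElt b : L)) {c : ℂ | ∃ n : ℕ, c = μ (heightElt b) - n}
      (c := c) hne) y (End.mem_eigenspace_iff.mpr hyh) (h1 hy))

/-- The functional on a highest weight module which reads off the coefficient of the highest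
weight vector. -/
theorem exists_highestFunctional {v : X} {μ : Dual ℂ H} (hv : IsMaximalVector b μ v)
    (hv0 : v ≠ 0) : ∃ φ : X →ₗ[ℂ] ℂ, φ v ≠ 0 ∧
      (∀ z ∈ LieSubmodule.lieSpan ℂ L {v}, ∀ α ∈ positiveRoots b,
        ∀ x ∈ rootSpace H (-(α : LieModule.Weight ℂ H L)), φ ⁅x, z⁆ = 0) ∧
      ∀ z ∈ LieSubmodule.lieSpan ℂ L {v}, ∀ h : H, φ ⁅(h : L), z⁆ = μ h * φ z := by
  have hvn : v ∉ properSpan b v := by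
    intro h
    refine hv0 (Submodule.disjoint_def.mp (eigenspace_disjoint
      (LieModule.toEnd ℂ L X (heightElt b : L)) {c : ℂ | ∃ n : ℕ, n ≠ 0 ∧ c = μ (heightElt b) - n}
      (c := μ (heightElt b)) ?_) v (End.mem_eigenspace_iff.mpr (hv.1 _))
      (properSpan_le_eigenspaces hv.1 h))
    rintro ⟨n, hn, h⟩
    have : (n : ℂ) = 0 := by linear_combination h
    exact hn (by exact_mod_cast this)
  obtain ⟨φ, h1, h2⟩ := Submodule.exists_le_ker_of_notMem hvn
  refine ⟨φ, h1, fun z hz α hα x hx => ?_, fun z hz h => ?_⟩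
  · exact h2 (neg_lie_mem_properSpan ((mem_lieSpan_iff hv).mp hz) hα hx)
  · rw [mem_lieSpan_iff hv, descendSpan_eq] at hz
    obtain ⟨a, ha, c, hc, rfl⟩ := Submodule.mem_sup.mp hz
    obtain ⟨d, rfl⟩ := Submodule.mem_span_singleton.mp ha
    have h3 : φ c = 0 := h2 hc
    have h4 : φ ⁅(h : L), c⁆ = 0 := h2 (cartan_lie_mem_properSpan hv.1 hc h)
    rw [lie_add, map_add, h4, lie_smul, hv.1, map_add, h3]
    simp; ring

/-- Maximal vectors of a finite-dimensional highest weight module are multiples of the highest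
weight vector. -/
theorem IsMaximalVector.mem_span [FiniteDimensional ℂ X] {v y : X} {μ ν : Dual ℂ H}
    (hv : IsMaximalVector b μ v) (hy : IsMaximalVector b ν y)
    (hmem : y ∈ LieSubmodule.lieSpan ℂ L {v}) : y ∈ Submodule.span ℂ {v} := by
  by_cases hy0 : y = 0
  · rw [hy0]; exact zero_mem _
  -- The projection onto `U(L) y` preserves weights, and the top weight space of `U(L) v` is a line,
  -- so `p v = c v`. If `c = 0`, then `p` kills `U(L) v` and with it `y = p y`. If `c ≠ 0`, then `v`
  -- lies in `U(L) y`; each of `v`, `y` is at most as high as the other, so `y` has top height.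
  obtain ⟨p, hp⟩ := exists_lieProjection (LieSubmodule.lieSpan ℂ L {y})
  have hpv : (p v : X) ∈ Submodule.span ℂ {v} := by
    refine mem_span_of_height_eq hv ?_ ?_
    · exact (LieSubmodule.lieSpan_le.mpr (by rintro _ rfl; exact hmem)) (p v).2
    · rw [← LieSubmodule.coe_bracket, ← LieModuleHom.map_lie, hv.1, map_smul]; rfl
  obtain ⟨c, hc⟩ := Submodule.mem_span_singleton.mp hpv
  by_cases hc0 : c = 0
  · exfalso
    rw [hc0, zero_smul] at hc
    have h1 : LieSubmodule.lieSpan ℂ L {v} ≤ p.ker := by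
      rw [LieSubmodule.lieSpan_le]
      rintro _ rfl
      exact LieModuleHom.mem_ker.mpr (Subtype.ext hc.symm)
    have h2 := hp ⟨y, LieSubmodule.subset_lieSpan rfl⟩
    have h3 : p y = 0 := LieModuleHom.mem_ker.mp (h1 hmem)
    rw [h3] at h2
    exact hy0 (congrArg Subtype.val h2).symm
  · have hvy : v ∈ LieSubmodule.lieSpan ℂ L {y} := by
      have : v = c⁻¹ • (p v : X) := by rw [← hc, smul_smul, inv_mul_cancel₀ hc0, one_smul]
      rw [this]; exact (LieSubmodule.lieSpan ℂ L {y}).smul_mem _ (p v).2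
    have hv0 : v ≠ 0 := by
      rintro rfl
      have : LieSubmodule.lieSpan ℂ L {(0 : X)} ≤ ⊥ := by
        rw [LieSubmodule.lieSpan_le]; rintro _ rfl; simp
      exact hy0 (by simpa using this hmem)
    obtain ⟨n, hn⟩ := exists_height_eq hv hmem hy0 (hy.1 _)
    obtain ⟨m, hm⟩ := exists_height_eq hy hvy hv0 (hv.1 _)
    have : (n : ℂ) + m = 0 := by linear_combination hn + hm
    have hn0 : n = 0 := by
      have : n + m = 0 := by exact_mod_cast this
      omega
    refine mem_span_of_height_eq hv hmem ?_
    rw [hy.1, hn, hn0]; simp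

end Maximal

end HighestWeight

/-! ### Finite-dimensional modules and their isotypic parts. -/

section HighestWeight

variable {L : Type*} [LieRing L] [LieAlgebra ℂ L] [FiniteDimensional ℂ L]
  [LieAlgebra.IsKilling ℂ L] {H : LieSubalgebra ℂ L} [H.IsCartanSubalgebra]

open LieAlgebra LieAlgebra.IsKilling Module

variable {b : (rootSystem H).Base}

section Finite

variable {X : Type*} [AddCommGroup X] [Module ℂ X] [LieRingModule L X] [LieModule ℂ L X]

variable (b X) in
/-- A nonzero finite-dimensional module has a highest weight vector. -/
theorem exists_maximalVector [FiniteDimensional ℂ X] [Nontrivial X] :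
    ∃ (μ : Dual ℂ H) (v : X), v ≠ 0 ∧ IsMaximalVector b μ v := by
  have hne : Nonempty (LieModule.Weight ℂ H X) := by
    by_contra h
    rw [not_nonempty_iff] at h
    have h1 := LieModule.iSup_genWeightSpace_eq_top' ℂ H X
    rw [iSup_of_empty] at h1
    have h2 := congrArg LieSubmodule.toSubmodule h1
    simp only [LieSubmodule.bot_toSubmodule, LieSubmodule.top_toSubmodule] at h2
    exact bot_ne_top h2
  -- A positive root vector raises the height by a positive integer, so it must kill a weight vector
  -- whose height has maximal real part.
  obtain ⟨χ, hχ⟩ := Finite.exists_max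
    (fun χ : LieModule.Weight ℂ H X => (χ (heightElt b)).re)
  obtain ⟨v, hv0, hv⟩ := LieModule.exists_forall_lie_eq_smul ℂ H X χ
  refine ⟨LieModule.Weight.toLinear ℂ H X χ, v, hv0, fun h => hv h, fun α hα x hx => ?_⟩
  by_contra hne
  have hvm : v ∈ LieModule.genWeightSpace X χ := by
    apply LieModule.weightSpace_le_genWeightSpace
    rw [LieModule.mem_weightSpace]
    exact hv
  have h1 := lie_mem_genWeightSpace_of_mem_genWeightSpace hx hvm
  let χ' : LieModule.Weight ℂ H X :=
    ⟨(α : LieModule.Weight ℂ H L) + χ, fun h => hne (by rw [h] at h1; simpa using h1)⟩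
  have h2 := hχ χ'
  obtain ⟨n, hn, hn'⟩ := positiveRoots_heightElt hα
  have h3 : χ' (heightElt b) = n + χ (heightElt b) := by
    rw [← hn']; rfl
  rw [h3, Complex.add_re, Complex.natCast_re] at h2
  have : (0 : ℝ) < n := by exact_mod_cast Nat.pos_of_ne_zero hn
  linarith

theorem exists_maximalVector_mem [FiniteDimensional ℂ X] {Y : LieSubmodule ℂ L X} (hY : Y ≠ ⊥) :
    ∃ (μ : Dual ℂ H) (v : X), v ∈ Y ∧ v ≠ 0 ∧ IsMaximalVector b μ v := by
  have : Nontrivial Y := (LieSubmodule.nontrivial_iff_ne_bot ℂ L X).mpr hY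
  obtain ⟨μ, v, hv0, h1, h2⟩ := exists_maximalVector b Y
  exact ⟨μ, v, v.2, fun h => hv0 (Subtype.ext h), fun h => congrArg Subtype.val (h1 h),
    fun α hα x hx => congrArg Subtype.val (h2 α hα x hx)⟩

theorem mem_positiveRoots_of_mem_support {i : H.root} (hi : i ∈ b.support) :
    i ∈ positiveRoots b :=
  AddSubmonoid.subset_closure (Set.mem_image_of_mem _ hi)

/-- An `𝔰𝔩₂`-triple for each root. -/
theorem exists_sl2 (α : H.root) : ∃ e f : L, ∃ _ : IsSl2Triple ((coroot (α : LieModule.Weight ℂ H L) : H) : L) e f,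
    e ∈ rootSpace H (α : LieModule.Weight ℂ H L) ∧
    f ∈ rootSpace H (-(α : LieModule.Weight ℂ H L)) ∧
    ∀ y ∈ rootSpace H (-(α : LieModule.Weight ℂ H L)), ∃ c : ℂ, y = c • f := by
  have hα : (α : LieModule.Weight ℂ H L).IsNonZero := LieSubalgebra.isNonZero_coe_root α
  obtain ⟨h, e, f, t, he, hf⟩ := exists_isSl2Triple_of_weight_isNonZero hα
  have hh := t.h_eq_coroot hα he hf
  subst hh
  refine ⟨e, f, t, he, hf, fun y hy => ?_⟩
  have h1 := finrank_rootSpace_eq_one (-(α : LieModule.Weight ℂ H L)) hα.neg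
  rw [LieModule.Weight.coe_neg] at h1
  obtain ⟨c, hc⟩ := (finrank_eq_one_iff_of_nonzero' (⟨f, hf⟩ : rootSpace H (-⇑(α : LieModule.Weight ℂ H L)))
    (fun h => t.f_ne_zero (congrArg Subtype.val h))).mp h1 ⟨y, hy⟩
  exact ⟨c, (congrArg Subtype.val hc).symm⟩

/-- For each simple root, the vector is primitive for an `𝔰𝔩₂`-triple acting on a finite-dimensional
space, so the coroot acts by a natural number. -/
theorem IsMaximalVector.isDominant [FiniteDimensional ℂ X] {v : X} {μ : Dual ℂ H}
    (hv : IsMaximalVector b μ v) (hv0 : v ≠ 0) : IsDominant b μ := by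
  intro i hi
  obtain ⟨e, f, t, he, hf, -⟩ := exists_sl2 i
  have P : t.HasPrimitiveVectorWith v (μ (coroot (i : LieModule.Weight ℂ H L))) :=
    ⟨hv0, hv.1 _, hv.2 i (mem_positiveRoots_of_mem_support hi) e he⟩
  exact P.exists_nat

/-- The submodule generated by the highest weight vectors whose weight lies in `S`. -/
def weightSpan (b : (rootSystem H).Base) (X : Type*) [AddCommGroup X] [Module ℂ X]
    [LieRingModule L X] (S : Set (Dual ℂ H)) : LieSubmodule ℂ L X :=
  LieSubmodule.lieSpan ℂ L {v | ∃ μ ∈ S, IsMaximalVector b μ v}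

variable (b X) in
-- A nonzero complement would contain a maximal vector, which already lies in the span.
theorem weightSpan_univ [FiniteDimensional ℂ X] : weightSpan b X Set.univ = ⊤ := by
  obtain ⟨p, hp⟩ := exists_lieProjection (weightSpan b X Set.univ)
  have hker : p.ker = ⊥ := by
    by_contra hne
    obtain ⟨μ, v, hv, hv0, hm⟩ := exists_maximalVector_mem (b := b) hne
    have h1 := hp ⟨v, LieSubmodule.subset_lieSpan ⟨μ, trivial, hm⟩⟩
    have h2 : p v = 0 := LieModuleHom.mem_ker.mp hv
    rw [h2] at h1
    exact hv0 (congrArg Subtype.val h1).symm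
  rw [eq_top_iff]
  intro x _
  have h1 : x - p x ∈ p.ker := by
    rw [LieModuleHom.mem_ker, map_sub, hp, sub_self]
  rw [hker] at h1
  have h2 : x = p x := by
    have : x - p x = 0 := by simpa using h1
    exact sub_eq_zero.mp this
  rw [h2]; exact (p x).2

variable (b X) in
theorem weightSpan_sup_compl [FiniteDimensional ℂ X] (S : Set (Dual ℂ H)) :
    weightSpan b X S ⊔ weightSpan b X Sᶜ = ⊤ := by
  rw [← weightSpan_univ b X, weightSpan, weightSpan, weightSpan, ← LieSubmodule.span_union]
  congr 1
  ext v
  constructor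
  · rintro (⟨μ, -, h⟩ | ⟨μ, -, h⟩) <;> exact ⟨μ, trivial, h⟩
  · rintro ⟨μ, -, h⟩
    by_cases hμ : μ ∈ S
    · exact Or.inl ⟨μ, hμ, h⟩
    · exact Or.inr ⟨μ, hμ, h⟩

theorem IsMaximalVector.map {Y : Type*} [AddCommGroup Y] [Module ℂ Y] [LieRingModule L Y]
    [LieModule ℂ L Y] {v : X} {μ : Dual ℂ H} (hv : IsMaximalVector b μ v) (f : X →ₗ⁅ℂ,L⁆ Y) :
    IsMaximalVector b μ (f v) :=
  ⟨fun h => by rw [← LieModuleHom.map_lie, hv.1, map_smul],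
    fun α hα x hx => by rw [← LieModuleHom.map_lie, hv.2 α hα x hx, map_zero]⟩

theorem IsMaximalVector.weight_eq {v : X} {μ ν : Dual ℂ H} (hv : IsMaximalVector b μ v)
    (hv' : IsMaximalVector b ν v) (hv0 : v ≠ 0) : μ = ν := by
  ext h
  have := (hv.1 h).symm.trans (hv'.1 h)
  exact smul_left_injective ℂ hv0 this

/-- A maximal vector in the submodule generated by maximal vectors of weights in `S` has weight
in `S`. -/
theorem mem_of_mem_weightSpan [FiniteDimensional ℂ X] {S : Set (Dual ℂ H)} {v : X} {μ : Dual ℂ H}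
    (hv : IsMaximalVector b μ v) (hv0 : v ≠ 0) (hmem : v ∈ weightSpan b X S) : μ ∈ S := by
  -- The projection onto `U(L) v` sends a generator of weight `ν` to a maximal vector, that is, to a
  -- multiple of `v`. If that multiple is nonzero then `ν = μ`. So if `μ ∉ S`, every generator is
  -- killed, and with them `v = p v`.
  obtain ⟨p, hp⟩ := exists_lieProjection (LieSubmodule.lieSpan ℂ L {v})
  by_contra hμ
  have h1 : weightSpan b X S ≤ p.ker := by
    rw [weightSpan, LieSubmodule.lieSpan_le]
    rintro w ⟨ν, hν, hw⟩
    refine LieModuleHom.mem_ker.mpr ?_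
    by_contra hpw
    have hpm : IsMaximalVector b ν (p w : X) :=
      (hw.map p).map (LieSubmodule.lieSpan ℂ L {v}).incl
    obtain ⟨c, hc⟩ := Submodule.mem_span_singleton.mp (hv.mem_span hpm (p w).2)
    have hc0 : c ≠ 0 := by
      rintro rfl
      exact hpw (Subtype.ext (by rw [← hc, zero_smul]; rfl))
    have : IsMaximalVector b ν v := by
      have h2 : v = c⁻¹ • (p w : X) := by rw [← hc, smul_smul, inv_mul_cancel₀ hc0, one_smul]
      rw [h2]
      exact ⟨fun h => by rw [lie_smul, hpm.1, smul_comm],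
        fun α hα x hx => by rw [lie_smul, hpm.2 α hα x hx, smul_zero]⟩
    exact hμ (hv.weight_eq this hv0 ▸ hν)
  have h2 := hp ⟨v, LieSubmodule.subset_lieSpan rfl⟩
  have h3 : p v = 0 := LieModuleHom.mem_ker.mp (h1 hmem)
  rw [h3] at h2
  exact hv0 (congrArg Subtype.val h2).symm

theorem weightSpan_disjoint [FiniteDimensional ℂ X] {S T : Set (Dual ℂ H)} (hST : Disjoint S T) :
    weightSpan b X S ⊓ weightSpan b X T = ⊥ := by
  by_contra hne
  obtain ⟨μ, v, hv, hv0, hm⟩ := exists_maximalVector_mem (b := b) hne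
  exact Set.disjoint_left.mp hST (mem_of_mem_weightSpan hm hv0 hv.1)
    (mem_of_mem_weightSpan hm hv0 hv.2)

theorem weightSpan_map_le {Y : Type*} [AddCommGroup Y] [Module ℂ Y] [LieRingModule L Y]
    [LieModule ℂ L Y] (f : X →ₗ⁅ℂ,L⁆ Y) (S : Set (Dual ℂ H)) {v : X} (hv : v ∈ weightSpan b X S) :
    f v ∈ weightSpan b Y S := by
  have : weightSpan b X S ≤ (weightSpan b Y S).comap f := by
    rw [weightSpan, LieSubmodule.lieSpan_le]
    rintro w ⟨ν, hν, hw⟩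
    exact LieSubmodule.subset_lieSpan ⟨ν, hν, hw.map f⟩
  exact this hv

end Finite

end HighestWeight

/-! ### Finite-dimensionality of the modules `V(λ)`. -/

section SimpleModule

variable {L : Type u} [LieRing L] [LieAlgebra ℂ L]

/-- Induction on the enveloping algebra through left multiplication by elements of `L`. -/
theorem uea_induction {p : UniversalEnvelopingAlgebra ℂ L → Prop} (h1 : p 1)
    (hadd : ∀ u v, p u → p v → p (u + v)) (hsmul : ∀ (c : ℂ) u, p u → p (c • u))
    (hι : ∀ x u, p u → p (UniversalEnvelopingAlgebra.ι ℂ x * u))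
    (u : UniversalEnvelopingAlgebra ℂ L) : p u := by
  let S : Subalgebra ℂ (UniversalEnvelopingAlgebra ℂ L) :=
    { carrier := {a | ∀ v, p v → p (a * v)}
      mul_mem' := fun {a c} ha hc v hv => by rw [mul_assoc]; exact ha _ (hc v hv)
      add_mem' := fun {a c} ha hc v hv => by rw [add_mul]; exact hadd _ _ (ha v hv) (hc v hv)
      algebraMap_mem' := fun c v hv => by rw [← Algebra.smul_def]; exact hsmul c v hv }
  let f : L →ₗ⁅ℂ⁆ S :=
    { toFun := fun x => ⟨UniversalEnvelopingAlgebra.ι ℂ x, hι x⟩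
      map_add' := fun x y => by ext; simp
      map_smul' := fun c x => by ext; simp
      map_lie' := fun {x y} => by
        ext
        simp [LieRing.of_associative_ring_bracket] }
  have hF : S.val.comp (UniversalEnvelopingAlgebra.lift ℂ f) = AlgHom.id ℂ _ := by
    apply UniversalEnvelopingAlgebra.hom_ext
    ext x
    change ((UniversalEnvelopingAlgebra.lift ℂ f (UniversalEnvelopingAlgebra.ι ℂ x) : S) :
      UniversalEnvelopingAlgebra ℂ L) = UniversalEnvelopingAlgebra.ι ℂ x
    rw [UniversalEnvelopingAlgebra.lift_ι_apply]
    rfl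
  have hu : u ∈ S := by
    have h : ((UniversalEnvelopingAlgebra.lift ℂ f u : S) : UniversalEnvelopingAlgebra ℂ L) = u :=
      AlgHom.congr_fun hF u
    exact h ▸ (UniversalEnvelopingAlgebra.lift ℂ f u).2
  have := hu 1 h1
  rwa [mul_one] at this

variable [FiniteDimensional ℂ L]
  [LieAlgebra.IsKilling ℂ L] {H : LieSubalgebra ℂ L} [H.IsCartanSubalgebra]

open LieAlgebra LieAlgebra.IsKilling Module

variable {b : (rootSystem H).Base}

section Weyl

variable (b) in
/-- The group generated by the simple reflections. -/
def simpleReflections : Subgroup (Dual ℂ H ≃ₗ[ℂ] Dual ℂ H) :=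
  Subgroup.closure {g | ∃ i ∈ b.support, g = (rootSystem H).reflection i}

theorem reflection_eq (i : H.root) (χ : Dual ℂ H) :
    (rootSystem H).reflection i χ = χ - χ ((rootSystem H).coroot i) • (rootSystem H).root i := by
  rw [RootPairing.reflection_apply]
  rfl

theorem mem_iff_of_mem_simpleReflections {S : Set (Dual ℂ H)}
    (hS : ∀ i ∈ b.support, ∀ χ ∈ S, (rootSystem H).reflection i χ ∈ S)
    {g : Dual ℂ H ≃ₗ[ℂ] Dual ℂ H} (hg : g ∈ simpleReflections b) (χ : Dual ℂ H) :
    χ ∈ S ↔ g χ ∈ S := by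
  induction hg using Subgroup.closure_induction generalizing χ with
  | mem g hg =>
    obtain ⟨i, hi, rfl⟩ := hg
    refine ⟨hS i hi χ, fun h => ?_⟩
    have := hS i hi _ h
    rwa [RootPairing.reflection_same] at this
  | one => rfl
  | mul g k _ _ hg hk => rw [hk, hg]; rfl
  | inv g _ hg =>
    rw [hg (g⁻¹ χ)]
    have : g (g⁻¹ χ) = χ := LinearEquiv.apply_symm_apply g χ
    rw [this]

/-- The group permutes the finitely many roots, and faithfully so because the roots span. -/
instance : Finite (simpleReflections b) := by
  have hmem : ∀ g : simpleReflections b, ∀ i : H.root,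
      g.1 ((rootSystem H).root i) ∈ Set.range (rootSystem H).root := fun g i =>
    (mem_iff_of_mem_simpleReflections (b := b) (S := Set.range (rootSystem H).root)
      (fun i _ χ hχ => (rootSystem H).mapsTo_reflection_root i hχ) g.2 _).mp ⟨i, rfl⟩
  have : Finite (Set.range (rootSystem H).root) := Set.finite_range _
  refine Finite.of_injective
    (fun (g : simpleReflections b) (i : H.root) =>
      (⟨_, hmem g i⟩ : Set.range (rootSystem H).root)) ?_
  intro g k hgk
  ext1
  apply LinearEquiv.toLinearMap_injective
  refine LinearMap.ext_on_range (v := (rootSystem H).root) ?_ fun i => ?_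
  · exact RootPairing.IsRootSystem.span_root_eq_top
  · exact congrArg Subtype.val (congrFun hgk i)

/-- The sum is fixed by every simple reflection, so it vanishes on the simple coroots, and these
span `𝔥`. This bounds the depth of weights in `V(λ)`. -/
theorem sum_simpleReflections [Fintype (simpleReflections b)] (χ : Dual ℂ H) :
    ∑ g : simpleReflections b, g.1 χ = 0 := by
  have hfix : ∀ i ∈ b.support,
      (∑ g : simpleReflections b, g.1 χ) ((rootSystem H).coroot i) = 0 := by
    intro i hi
    let s : simpleReflections b :=
      ⟨(rootSystem H).reflection i, Subgroup.subset_closure ⟨i, hi, rfl⟩⟩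
    have h1 : (rootSystem H).reflection i (∑ g : simpleReflections b, g.1 χ) =
        ∑ g : simpleReflections b, g.1 χ := by
      rw [map_sum]
      exact Equiv.sum_comp (Equiv.mulLeft s) (fun g : simpleReflections b => g.1 χ)
    rw [reflection_eq, sub_eq_self] at h1
    exact (smul_eq_zero.mp h1).resolve_right ((rootSystem H).ne_zero i)
  have hspan : Submodule.span ℂ ((rootSystem H).coroot '' b.support) = ⊤ := by
    rw [b.span_coroot_support]
    exact RootPairing.IsRootSystem.span_coroot_eq_top
  refine LinearMap.ext_on hspan ?_
  rintro _ ⟨i, hi, rfl⟩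
  exact hfix i hi

end Weyl

section Sl2

variable {X : Type*} [AddCommGroup X] [Module ℂ X] [LieRingModule L X] [LieModule ℂ L X]

theorem pow_toEnd_weight {χ : H → ℂ} {x : L} (hx : x ∈ rootSpace H χ) {μ : H → ℂ} {u : X}
    (hu : ∀ h : H, ⁅(h : L), u⁆ = μ h • u) (k : ℕ) (h : H) :
    ⁅(h : L), (LieModule.toEnd ℂ L X x ^ k) u⁆ =
      (μ h + k * χ h) • (LieModule.toEnd ℂ L X x ^ k) u := by
  induction k with
  | zero => simp [hu]
  | succ k ih =>
    rw [pow_succ', Module.End.mul_apply, LieModule.toEnd_apply_apply, leibniz_lie,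
      lie_cartan_rootSpace hx, ih, lie_smul, smul_lie, ← add_smul]
    congr 1
    push_cast
    ring

/-- The last nonzero `e^k u` is primitive of weight `c + 2k`. If `f^n` is the last power not killing
it, then `e f^(n+1) = 0` on it reads `(n + 1)(c + 2k - n) = 0`. -/
theorem exists_pow_lie_ne_zero {h e f : L} (t : IsSl2Triple h e f) {u : X} (hu0 : u ≠ 0) {c : ℂ}
    (hu : ∀ k : ℕ, ⁅h, (LieModule.toEnd ℂ L X e ^ k) u⁆ =
      (c + 2 * k) • (LieModule.toEnd ℂ L X e ^ k) u)
    (he : ∃ k : ℕ, (LieModule.toEnd ℂ L X e ^ k) u = 0)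
    (hf : ∀ w : X, ∃ k : ℕ, (LieModule.toEnd ℂ L X f ^ k) w = 0) :
    ∃ n k : ℕ, c = n - 2 * k ∧ (k ≤ n → (LieModule.toEnd ℂ L X f ^ (n - k))
      ((LieModule.toEnd ℂ L X e ^ k) u) ≠ 0) := by
  obtain ⟨k, hk, hk'⟩ := Nat.exists_not_and_succ_of_not_zero_of_exists
    (p := fun k => (LieModule.toEnd ℂ L X e ^ k) u = 0) (by simpa using hu0) he
  have P : t.HasPrimitiveVectorWith ((LieModule.toEnd ℂ L X e ^ k) u) (c + 2 * k) :=
    ⟨hk, hu k, by rw [pow_succ', Module.End.mul_apply] at hk'; exact hk'⟩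
  obtain ⟨n, hn, hn'⟩ := Nat.exists_not_and_succ_of_not_zero_of_exists
    (p := fun n => (LieModule.toEnd ℂ L X f ^ n) ((LieModule.toEnd ℂ L X e ^ k) u) = 0)
    (by simpa using hk) (hf _)
  have h1 := P.lie_e_pow_succ_toEnd_f n
  rw [hn', lie_zero, eq_comm, smul_eq_zero_iff_left hn, mul_eq_zero, sub_eq_zero] at h1
  have h2 := h1.resolve_left (Nat.cast_add_one_ne_zero n)
  refine ⟨n, k, by linear_combination h2, fun hkn h0 => hn ?_⟩
  have : n = k + (n - k) := by omega
  rw [this, pow_add, Module.End.mul_apply, h0, map_zero]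

/-- The weights of a module on which simple root vectors act locally nilpotently are permuted by
the simple reflections. -/
theorem reflection_mem_weights (i : H.root)
    (hloc : ∀ x : L, x ∈ rootSpace H (i : LieModule.Weight ℂ H L) ∨
      x ∈ rootSpace H (-(i : LieModule.Weight ℂ H L)) →
      ∀ w : X, ∃ k : ℕ, (LieModule.toEnd ℂ L X x ^ k) w = 0) (χ : Dual ℂ H)
    (hχ : ∃ u : X, u ≠ 0 ∧ ∀ h : H, ⁅(h : L), u⁆ = χ h • u) :
    ∃ u : X, u ≠ 0 ∧ ∀ h : H, ⁅(h : L), u⁆ = (rootSystem H).reflection i χ h • u := by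
  obtain ⟨u, hu0, hu⟩ := hχ
  obtain ⟨e, f, t, he, hf, -⟩ := exists_sl2 i
  have hroot : (rootSystem H).root i ((rootSystem H).coroot i) = 2 := by
    exact (rootSystem H).root_coroot_two i
  set α : H → ℂ := ⇑(i : LieModule.Weight ℂ H L)
  have hroot' : α (coroot (i : LieModule.Weight ℂ H L)) = 2 := hroot
  have hpow := fun (k : ℕ) (h : H) => pow_toEnd_weight he hu k h
  have hpow' := fun (k : ℕ) (h : H) => pow_toEnd_weight hf hu k h
  have hr : ∀ h, (rootSystem H).reflection i χ h =
      χ h - χ (coroot (i : LieModule.Weight ℂ H L)) * α h := by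
    intro h; rw [reflection_eq]; rfl
  obtain ⟨n, k, hnk, h1⟩ := exists_pow_lie_ne_zero t hu0
    (c := χ (coroot (i : LieModule.Weight ℂ H L)))
    (fun k => by rw [hpow k, hroot', mul_comm (k : ℂ)])
    (hloc e (Or.inl he) u) (hloc f (Or.inr hf))
  obtain ⟨n', k', hnk', h1'⟩ := exists_pow_lie_ne_zero t.symm hu0
    (c := -χ (coroot (i : LieModule.Weight ℂ H L)))
    (fun k => by
      rw [neg_lie, hpow' k, Pi.neg_apply, hroot', ← neg_smul]
      congr 1
      ring)
    (hloc f (Or.inr hf) u) (hloc e (Or.inl he))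
  -- The vector `f^(n-k) e^k u` has weight `χ - (n - 2k) α`, the reflected one. If `k > n`, exchange
  -- `e` and `f`: the relation `n + n' = 2k + 2k'` then forces `k' ≤ n'`.
  by_cases hkn : k ≤ n
  · refine ⟨_, h1 hkn, fun h => ?_⟩
    rw [pow_toEnd_weight hf (fun h => hpow k h), hr, hnk]
    congr 1
    rw [Nat.cast_sub hkn, Pi.neg_apply]
    ring
  · have hle : k' ≤ n' := by
      have : ((n + n' : ℕ) : ℂ) = ((2 * k + 2 * k' : ℕ) : ℂ) := by
        push_cast
        linear_combination -hnk - hnk'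
      have := Nat.cast_injective this
      omega
    refine ⟨_, h1' hle, fun h => ?_⟩
    rw [pow_toEnd_weight he (fun h => hpow' k' h), hr]
    congr 1
    rw [Nat.cast_sub hle, Pi.neg_apply]
    linear_combination (α h) * (-hnk')

end Sl2

section Simple

variable (wt : DominantWeight b)

/-- The generator of `V(λ)`. -/
def SimpleModule.gen : SimpleModule b wt :=
  (Submodule.Quotient.mk (1 : UniversalEnvelopingAlgebra ℂ L) :
    UniversalEnvelopingAlgebra ℂ L ⧸ simpleIdeal b wt.1)

theorem SimpleModule.lie_def (x : L) (v : SimpleModule b wt) :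
    ⁅x, v⁆ = UniversalEnvelopingAlgebra.ι ℂ x • v := rfl

theorem SimpleModule.smul_gen_eq_zero {a : UniversalEnvelopingAlgebra ℂ L}
    (ha : a ∈ simpleIdeal b wt.1) : a • SimpleModule.gen wt = 0 := by
  refine Eq.trans ?_ ((Submodule.Quotient.mk_eq_zero _).mpr ha)
  change Submodule.Quotient.mk (a • (1 : UniversalEnvelopingAlgebra ℂ L)) = _
  rw [smul_eq_mul, mul_one]

theorem SimpleModule.exists_smul_gen (v : SimpleModule b wt) :
    ∃ a : UniversalEnvelopingAlgebra ℂ L, a • SimpleModule.gen wt = v := by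
  obtain ⟨a, rfl⟩ := Submodule.Quotient.mk_surjective (simpleIdeal b wt.1) v
  refine ⟨a, ?_⟩
  change Submodule.Quotient.mk (a • (1 : UniversalEnvelopingAlgebra ℂ L)) = _
  rw [smul_eq_mul, mul_one]

theorem SimpleModule.lieSpan_gen :
    LieSubmodule.lieSpan ℂ L {SimpleModule.gen wt} = ⊤ := by
  rw [eq_top_iff]
  intro v _
  obtain ⟨a, rfl⟩ := SimpleModule.exists_smul_gen wt v
  induction a using uea_induction with
  | h1 => rw [one_smul]; exact LieSubmodule.subset_lieSpan rfl
  | hadd u v hu hv => rw [add_smul]; exact add_mem (hu trivial) (hv trivial)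
  | hsmul c u hu => rw [smul_assoc]; exact SMulMemClass.smul_mem c (hu trivial)
  | hι x u hu => rw [mul_smul, ← SimpleModule.lie_def]; exact LieSubmodule.lie_mem _ (hu trivial)

theorem SimpleModule.isMaximalVector_gen : IsMaximalVector b wt.1 (SimpleModule.gen wt) := by
  refine ⟨fun h => ?_, fun α hα x hx => ?_⟩
  · have h1 := SimpleModule.smul_gen_eq_zero wt
      (Submodule.subset_span (Or.inl (Or.inr ⟨h, rfl⟩)))
    rw [sub_smul, sub_eq_zero, algebraMap_smul] at h1
    exact h1
  · exact SimpleModule.smul_gen_eq_zero wt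
      (Submodule.subset_span (Or.inl (Or.inl ⟨α, hα, x, hx, rfl⟩)))

theorem SimpleModule.pow_lie_gen {i : H.root} (hi : i ∈ b.support) {y : L}
    (hy : y ∈ rootSpace H (-(i : LieModule.Weight ℂ H L))) :
    ∃ k : ℕ, (LieModule.toEnd ℂ L (SimpleModule b wt) y ^ k) (SimpleModule.gen wt) = 0 := by
  obtain ⟨n, hn⟩ := wt.2 i hi
  refine ⟨n + 1, ?_⟩
  have h1 := SimpleModule.smul_gen_eq_zero wt
      (Submodule.subset_span (Or.inr ⟨i, hi, y, hy, n, hn, rfl⟩))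
  have h2 : ∀ k : ℕ, ∀ v : SimpleModule b wt,
      (LieModule.toEnd ℂ L (SimpleModule b wt) y ^ k) v =
      UniversalEnvelopingAlgebra.ι ℂ y ^ k • v := by
    intro k
    induction k with
    | zero => intro v; rw [pow_zero, pow_zero, one_smul]; rfl
    | succ k ih => intro v; rw [pow_succ', pow_succ', Module.End.mul_apply, ih, mul_smul]; rfl
  rw [h2]
  exact h1

/-- Since `ad x` is nilpotent, the vectors killed by some power of `x` form a submodule, and the
defining relations put the generator in it. -/
theorem SimpleModule.locally_nilpotent {i : H.root} (hi : i ∈ b.support) (x : L)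
    (hx : x ∈ rootSpace H (i : LieModule.Weight ℂ H L) ∨
      x ∈ rootSpace H (-(i : LieModule.Weight ℂ H L))) (w : SimpleModule b wt) :
    ∃ k : ℕ, (LieModule.toEnd ℂ L (SimpleModule b wt) x ^ k) w = 0 := by
  have hnil : IsNilpotent (ad ℂ L x) := by
    have hi0 : (i : LieModule.Weight ℂ H L).IsNonZero := LieSubalgebra.isNonZero_coe_root i
    rcases hx with hx | hx
    · refine isNilpotent_ad_of_mem_rootSpace H (fun h => hi0 ?_) hx
      simp at h
    · refine isNilpotent_ad_of_mem_rootSpace H (fun h => hi0 ?_) hx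
      simp at h
  have hgen : ∃ k : ℕ, (LieModule.toEnd ℂ L (SimpleModule b wt) x ^ k)
      (SimpleModule.gen wt) = 0 := by
    rcases hx with hx | hx
    · exact ⟨1, (SimpleModule.isMaximalVector_gen wt).2 i (mem_positiveRoots_of_mem_support hi) x hx⟩
    · exact SimpleModule.pow_lie_gen wt hi hx
  have hmem : ∀ (Y : Type u) [AddCommGroup Y] [Module ℂ Y] (φ : End ℂ Y) (v : Y),
      v ∈ φ.maxGenEigenspace 0 ↔ ∃ k : ℕ, (φ ^ k) v = 0 := by
    intro Y _ _ φ v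
    rw [Module.End.mem_maxGenEigenspace]
    simp
  let N : LieSubmodule ℂ L (SimpleModule b wt) :=
    { (LieModule.toEnd ℂ L (SimpleModule b wt) x).maxGenEigenspace 0 with
      lie_mem := by
        intro y v hv
        have hy : y ∈ (LieModule.toEnd ℂ L L x).maxGenEigenspace 0 := by
          obtain ⟨k, hk⟩ := hnil
          exact (hmem _ _ _).mpr ⟨k, by
            change (ad ℂ L x ^ k) y = 0
            rw [hk]; rfl⟩
        have := LieModule.lie_mem_maxGenEigenspace_toEnd hy hv
        rwa [add_zero] at this }
  have hN : LieSubmodule.lieSpan ℂ L {SimpleModule.gen wt} ≤ N := by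
    rw [LieSubmodule.lieSpan_le]
    rintro _ rfl
    exact (hmem _ _ _).mpr hgen
  rw [SimpleModule.lieSpan_gen] at hN
  exact (hmem _ _ _).mp (hN (trivial : w ∈ (⊤ : LieSubmodule ℂ L (SimpleModule b wt))))

/-- The images of `v` under words of length at most `k` in elements of `L`. -/
def wordSpan {X : Type*} [AddCommGroup X] [Module ℂ X] [LieRingModule L X] [LieModule ℂ L X]
    (v : X) : ℕ → Submodule ℂ X
  | 0 => Submodule.span ℂ {v}
  | k + 1 => wordSpan v k ⊔
      Submodule.map₂ (LieModule.toEnd ℂ L X : L →ₗ[ℂ] Module.End ℂ X) ⊤ (wordSpan v k)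

theorem wordSpan_fg {X : Type*} [AddCommGroup X] [Module ℂ X] [LieRingModule L X]
    [LieModule ℂ L X] (v : X) (k : ℕ) : (wordSpan (L := L) v k).FG := by
  induction k with
  | zero => exact Submodule.fg_span_singleton v
  | succ k ih => exact ih.sup (Submodule.FG.map₂ _ Module.Finite.fg_top ih)

theorem wordSpan_mono {X : Type*} [AddCommGroup X] [Module ℂ X] [LieRingModule L X]
    [LieModule ℂ L X] (v : X) : Monotone (wordSpan (L := L) v) :=
  monotone_nat_of_le_succ fun _ => le_sup_left

/-- Every step has height at least one, so the number of letters is at most the height. -/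
theorem Descends.mem_wordSpan {X : Type*} [AddCommGroup X] [Module ℂ X] [LieRingModule L X]
    [LieModule ℂ L X] {v : X} {ν : Dual ℂ H} {y : X} (h : Descends b v ν y) {n : ℕ}
    (hn : ν (heightElt b) = n) : y ∈ wordSpan (L := L) v n := by
  induction h generalizing n with
  | refl => exact wordSpan_mono (L := L) v (Nat.zero_le n) (Submodule.mem_span_singleton_self v)
  | step h α hα x hx ih =>
    obtain ⟨m, hm, -⟩ := h.height
    obtain ⟨k, hk, hk'⟩ := positiveRoots_heightElt hα
    have hnm : n = m + k := by
      rw [LinearMap.add_apply, hm, hk'] at hn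
      exact_mod_cast hn.symm
    refine wordSpan_mono (L := L) v (show m + 1 ≤ n by omega) (Submodule.mem_sup_right ?_)
    exact Submodule.apply_mem_map₂ _ (Submodule.mem_top (x := x)) (ih hm)

/-- Local nilpotency makes the simple reflections permute the weights. Along the transforms `g χ` of
a weight, the heights are `λ(h₀) - m(g)` with `m(g) ≥ 0` and sum to zero, so `∑ m(g) = |W| λ(h₀)`,
where `W` is the group generated by the simple reflections. The depth `m(1)` of `χ` is at most this
number, and words of bounded length in a finite-dimensional algebra span a finite-dimensional space.
-/
instance SimpleModule.finiteDimensional : FiniteDimensional ℂ (SimpleModule b wt) := by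
  have := Fintype.ofFinite (simpleReflections b)
  set v := SimpleModule.gen wt
  have hv : IsMaximalVector b wt.1 v := SimpleModule.isMaximalVector_gen wt
  -- Given any weight, the number inside turns out to be the natural number `∑ m(g)`; the floor of
  -- the real part allows the bound to be named before a weight is chosen.
  let N : ℕ := ⌊((Fintype.card (simpleReflections b) : ℂ) * wt.1 (heightElt b)).re⌋₊
  let S : Set (Dual ℂ H) :=
    {χ | ∃ u : SimpleModule b wt, u ≠ 0 ∧ ∀ h : H, ⁅(h : L), u⁆ = χ h • u}
  have hbound : ∀ χ ∈ S, ∀ n : ℕ, χ (heightElt b) = wt.1 (heightElt b) - n → n ≤ N := by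
    intro χ hχ n hn
    have hS : ∀ g : simpleReflections b, g.1 χ ∈ S := fun g =>
      (mem_iff_of_mem_simpleReflections (b := b) (S := S)
        (fun i hi χ hχ => reflection_mem_weights i
          (SimpleModule.locally_nilpotent wt hi) χ hχ) g.2 χ).mp hχ
    have hht : ∀ g : simpleReflections b, ∃ m : ℕ,
        g.1 χ (heightElt b) = wt.1 (heightElt b) - m := by
      intro g
      obtain ⟨u, hu0, hu⟩ := hS g
      exact exists_height_eq hv (by rw [SimpleModule.lieSpan_gen]; trivial) hu0 (hu _)
    choose m hm using hht
    have h1 := congrArg (fun χ : Dual ℂ H => χ (heightElt b)) (sum_simpleReflections (b := b) χ)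
    simp only [LinearMap.sum_apply, hm, Finset.sum_sub_distrib, LinearMap.zero_apply,
      Finset.sum_const, Finset.card_univ, nsmul_eq_mul] at h1
    have h2 : (Fintype.card (simpleReflections b) : ℂ) * wt.1 (heightElt b) =
        ((∑ g, m g : ℕ) : ℂ) := by
      push_cast
      linear_combination h1
    have hN : N = ∑ g, m g := by
      simp only [N]
      rw [h2, Complex.natCast_re, Nat.floor_natCast]
    have hm1 : m 1 = n := by
      have h3 := hm 1
      have h4 : ((1 : simpleReflections b).1 χ) = χ := rfl
      rw [h4, hn] at h3
      exact_mod_cast (sub_right_inj.mp h3).symm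
    rw [hN, ← hm1]
    exact Finset.single_le_sum (fun _ _ => Nat.zero_le _) (Finset.mem_univ _)
  have htop : wordSpan (L := L) v N = ⊤ := by
    rw [eq_top_iff]
    intro w _
    have hw : w ∈ LieSubmodule.lieSpan ℂ L {v} := by rw [SimpleModule.lieSpan_gen]; trivial
    rw [mem_lieSpan_iff hv] at hw
    refine (Submodule.span_le (p := wordSpan (L := L) v N)).mpr ?_ hw
    rintro y ⟨ν, hy⟩
    by_cases hy0 : y = 0
    · rw [hy0]; exact zero_mem _
    obtain ⟨n, hn, -⟩ := hy.height
    refine wordSpan_mono (L := L) v (hbound (wt.1 - ν) ⟨y, hy0, hy.weight hv.1⟩ n ?_)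
      (hy.mem_wordSpan hn)
    rw [LinearMap.sub_apply, hn]
  exact ⟨htop ▸ wordSpan_fg (L := L) v N⟩

end Simple

end SimpleModule

/-! ### Universal property of `V(λ)`, equivariant sections, weights of equivariant bilinear images.
-/

section Multiplicity

variable {L : Type u} [LieRing L] [LieAlgebra ℂ L] [FiniteDimensional ℂ L]
  [LieAlgebra.IsKilling ℂ L] {H : LieSubalgebra ℂ L} [H.IsCartanSubalgebra]

open LieAlgebra LieAlgebra.IsKilling Module

variable {b : (rootSystem H).Base} (wt : DominantWeight b)

section Lift

variable {X : Type*} [AddCommGroup X] [Module ℂ X] [LieRingModule L X] [LieModule ℂ L X]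

variable {wt} in
theorem SimpleModule.hom_ext {f g : SimpleModule b wt →ₗ⁅ℂ,L⁆ X}
    (h : f (SimpleModule.gen wt) = g (SimpleModule.gen wt)) : f = g := by
  have hle : LieSubmodule.lieSpan ℂ L {SimpleModule.gen wt} ≤ (f - g).ker := by
    rw [LieSubmodule.lieSpan_le]
    rintro _ rfl
    exact LieModuleHom.mem_ker.mpr (by rw [LieModuleHom.sub_apply, h, sub_self])
  rw [SimpleModule.lieSpan_gen] at hle
  ext v
  have := LieModuleHom.mem_ker.mp (hle (LieSubmodule.mem_top v))
  rwa [LieModuleHom.sub_apply, sub_eq_zero] at this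

/-- The universal property of `V(λ)`. -/
theorem SimpleModule.exists_lift [FiniteDimensional ℂ X] {v : X}
    (hv : IsMaximalVector b wt.1 v) :
    ∃ φ : SimpleModule b wt →ₗ⁅ℂ,L⁆ X, φ (SimpleModule.gen wt) = v := by
  let ρ := UniversalEnvelopingAlgebra.lift ℂ (LieModule.toEnd ℂ L X)
  have hρ : ∀ x, ρ (UniversalEnvelopingAlgebra.ι ℂ x) = LieModule.toEnd ℂ L X x := fun x =>
    UniversalEnvelopingAlgebra.lift_ι_apply _ _ _
  have hI : ∀ a ∈ simpleIdeal b wt.1, ρ a v = 0 := by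
    intro a ha
    induction ha using Submodule.span_induction with
    | zero => rw [map_zero]; rfl
    | add a c _ _ ha hc => rw [map_add, LinearMap.add_apply, ha, hc, add_zero]
    | smul d a _ ha => rw [smul_eq_mul, map_mul, Module.End.mul_apply, ha, map_zero]
    | mem a ha =>
      rcases ha with (⟨α, hα, x, hx, rfl⟩ | ⟨h, rfl⟩) | ⟨i, hi, y, hy, n, hn, rfl⟩
      · rw [hρ]; exact hv.2 α hα x hx
      · rw [map_sub, hρ, AlgHom.commutes, LinearMap.sub_apply, LieModule.toEnd_apply_apply, hv.1,
          Module.algebraMap_end_apply, sub_self]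
      -- This relation is the one that needs `X` to be finite-dimensional: it is `𝔰𝔩₂`-theory for a
      -- primitive vector of weight `n`.
      · by_cases hv0 : v = 0
        · rw [hv0, map_zero]
        obtain ⟨e, f, t, he, hf, hy'⟩ := exists_sl2 i
        obtain ⟨c, rfl⟩ := hy' y hy
        have P : t.HasPrimitiveVectorWith v (n : ℂ) :=
          ⟨hv0, by rw [← hn]; exact hv.1 _, hv.2 i (mem_positiveRoots_of_mem_support hi) e he⟩
        rw [map_pow, hρ, map_smul, smul_pow, LinearMap.smul_apply,
          P.pow_toEnd_f_eq_zero_of_eq_nat rfl, smul_zero]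
  let ψ : UniversalEnvelopingAlgebra ℂ L →ₗ[ℂ] X :=
    (LinearMap.applyₗ v) ∘ₗ ρ.toLinearMap
  let ψ' : SimpleModule b wt →ₗ[ℂ] X :=
    ((simpleIdeal b wt.1).restrictScalars ℂ).liftQ ψ (fun a ha => hI a ha) ∘ₗ
      (Submodule.Quotient.restrictScalarsEquiv ℂ (simpleIdeal b wt.1)).symm.toLinearMap
  have hψ : ∀ a, ψ' (a • SimpleModule.gen wt) = ρ a v := by
    intro a
    have : a • SimpleModule.gen wt =
        (Submodule.Quotient.mk a : UniversalEnvelopingAlgebra ℂ L ⧸ simpleIdeal b wt.1) := by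
      change Submodule.Quotient.mk (a • (1 : UniversalEnvelopingAlgebra ℂ L)) = _
      rw [smul_eq_mul, mul_one]
    rw [this]
    rfl
  refine ⟨{ ψ' with map_lie' := ?_ }, ?_⟩
  · intro x w
    obtain ⟨a, rfl⟩ := SimpleModule.exists_smul_gen wt w
    change ψ' ⁅x, _⁆ = ⁅x, ψ' _⁆
    rw [SimpleModule.lie_def, ← mul_smul, hψ, hψ, map_mul, hρ]
    rfl
  · have := hψ 1
    rw [one_smul, map_one] at this
    exact this

instance SimpleModule.finite_hom [FiniteDimensional ℂ X] :
    FiniteDimensional ℂ (SimpleModule b wt →ₗ⁅ℂ,L⁆ X) := by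
  let ev : (SimpleModule b wt →ₗ⁅ℂ,L⁆ X) →ₗ[ℂ] X :=
    { toFun := fun f => f (SimpleModule.gen wt)
      map_add' := fun _ _ => rfl
      map_smul' := fun _ _ => rfl }
  exact Module.Finite.of_injective ev fun _ _ h => SimpleModule.hom_ext h

theorem SimpleModule.finrank_hom_pos [FiniteDimensional ℂ X] {v : X} (hv0 : v ≠ 0)
    (hv : IsMaximalVector b wt.1 v) : 0 < finrank ℂ (SimpleModule b wt →ₗ⁅ℂ,L⁆ X) := by
  obtain ⟨φ, hφ⟩ := SimpleModule.exists_lift wt hv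
  refine finrank_pos_iff_exists_ne_zero.mpr ⟨φ, ?_⟩
  rintro rfl
  exact hv0 hφ.symm

theorem SimpleModule.exists_of_finrank_hom_pos
    (h : 0 < finrank ℂ (SimpleModule b wt →ₗ⁅ℂ,L⁆ X)) :
    ∃ v : X, v ≠ 0 ∧ IsMaximalVector b wt.1 v := by
  have := Module.nontrivial_of_finrank_pos h
  obtain ⟨φ, hφ⟩ := exists_ne (0 : SimpleModule b wt →ₗ⁅ℂ,L⁆ X)
  exact ⟨φ (SimpleModule.gen wt), fun h0 => hφ (SimpleModule.hom_ext h0),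
    (SimpleModule.isMaximalVector_gen wt).map φ⟩

end Lift

section Sections

/-- Surjections of finite-dimensional modules split. -/
theorem exists_lieSection {X Y : Type*} [AddCommGroup X] [Module ℂ X] [LieRingModule L X]
    [LieModule ℂ L X] [AddCommGroup Y] [Module ℂ Y] [LieRingModule L Y] [LieModule ℂ L Y]
    [FiniteDimensional ℂ X] (f : X →ₗ⁅ℂ,L⁆ Y) (hf : Function.Surjective f) :
    ∃ s : Y →ₗ⁅ℂ,L⁆ X, ∀ y, f (s y) = y := by
  obtain ⟨p, hp⟩ := exists_lieProjection f.ker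
  obtain ⟨s₀, hs₀⟩ := (f : X →ₗ[ℂ] Y).exists_rightInverse_of_surjective
    (LinearMap.range_eq_top.mpr hf)
  have hs : ∀ y, f (s₀ y) = y := LinearMap.congr_fun hs₀
  -- The failure of `s₀` to be equivariant lies in the kernel of `f`, where `p` is the identity, so
  -- subtracting `p ∘ s₀` removes it.
  refine ⟨{ s₀ - (f.ker.incl.comp p : X →ₗ⁅ℂ,L⁆ X).toLinearMap ∘ₗ s₀ with map_lie' := ?_ }, ?_⟩
  · intro a y
    change s₀ ⁅a, y⁆ - (p (s₀ ⁅a, y⁆) : X) = ⁅a, s₀ y - (p (s₀ y) : X)⁆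
    have h1 : s₀ ⁅a, y⁆ - ⁅a, s₀ y⁆ ∈ f.ker := by
      rw [LieModuleHom.mem_ker, map_sub, hs, LieModuleHom.map_lie, hs, sub_self]
    have h2 := congrArg Subtype.val (hp ⟨_, h1⟩)
    rw [map_sub, LieModuleHom.map_lie] at h2
    rw [lie_sub]
    change (p (s₀ ⁅a, y⁆) : X) - ⁅a, (p (s₀ y) : X)⁆ = s₀ ⁅a, y⁆ - ⁅a, s₀ y⁆ at h2
    rw [sub_eq_sub_iff_add_eq_add] at h2 ⊢
    rw [← h2, add_comm]
  · intro y
    change f (s₀ y - (p (s₀ y) : X)) = y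
    rw [map_sub, hs, LieModuleHom.mem_ker.mp (p (s₀ y)).2, sub_zero]

end Sections

section Tensor

variable {A X Y : Type*} [AddCommGroup A] [Module ℂ A] [LieRingModule L A] [LieModule ℂ L A]
  [FiniteDimensional ℂ A] [AddCommGroup X] [Module ℂ X] [LieRingModule L X] [LieModule ℂ L X]
  [AddCommGroup Y] [Module ℂ Y] [LieRingModule L Y] [LieModule ℂ L Y] [FiniteDimensional ℂ Y]

/-- A linear functional which is an eigenvector for `𝔥` comes from a weight. -/
theorem exists_weight_of_functional (φ : A →ₗ[ℂ] ℂ) (hφ : φ ≠ 0) (χ : Dual ℂ H)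
    (h : ∀ (t : H) (a : A), φ ⁅(t : L), a⁆ = χ t * φ a) :
    ∃ a : A, a ≠ 0 ∧ ∀ t : H, ⁅(t : L), a⁆ = χ t • a := by
  obtain ⟨ψ, hψ⟩ : ∃ ψ : LieModule.Weight ℂ H A, ∃ a ∈ LieModule.genWeightSpace A ψ, φ a ≠ 0 := by
    by_contra! hc
    apply hφ
    ext a
    have ha : a ∈ (⨆ ψ : LieModule.Weight ℂ H A, LieModule.genWeightSpace A ψ) := by
      rw [LieModule.iSup_genWeightSpace_eq_top']; trivial
    induction ha using LieSubmodule.iSup_induction' with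
    | zero => simp
    | add x y _ _ hx hy => rw [map_add, hx, hy, map_add]
    | mem ψ a ha => simpa using hc ψ a ha
  obtain ⟨a, ha, hφa⟩ := hψ
  obtain ⟨a', ha0, ha'⟩ := LieModule.exists_forall_lie_eq_smul ℂ H A ψ
  refine ⟨a', ha0, fun t => ?_⟩
  -- Under `φ` the operator `t - ψ(t)` becomes the scalar `χ(t) - ψ(t)`. It is nilpotent on the
  -- generalised weight vector `a`, and `φ a ≠ 0`, so `χ = ψ`.
  have hpow : ∀ (k : ℕ) (c : A),
      φ (((LieModule.toEnd ℂ H A t - ψ t • (1 : Module.End ℂ A)) ^ k) c) =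
        (χ t - ψ t) ^ k * φ c := by
    intro k
    induction k with
    | zero => intro c; simp
    | succ k ih =>
      intro c
      rw [pow_succ, Module.End.mul_apply, ih, LinearMap.sub_apply, LieModule.toEnd_apply_apply,
        map_sub]
      have : φ ⁅t, c⁆ = χ t * φ c := h t c
      rw [this, LinearMap.smul_apply, Module.End.one_apply, map_smul, smul_eq_mul]
      ring
  obtain ⟨k, hk⟩ := (LieModule.mem_genWeightSpace A ψ a).mp ha t
  have h1 := hpow k a
  rw [hk, map_zero, eq_comm, mul_eq_zero] at h1
  have h2 : χ t - ψ t = 0 := eq_zero_of_pow_eq_zero (h1.resolve_right hφa)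
  rw [sub_eq_zero.mp h2]
  exact ha' t

variable (B : A →ₗ[ℂ] X →ₗ[ℂ] Y) (hB : ∀ (l : L) a x, ⁅l, B a x⁆ = B ⁅l, a⁆ x + B a ⁅l, x⁆)
  {S : Set (Dual ℂ H)}

include hB in
-- Project onto `U(L) y` and read off the coefficient of `y`, obtaining a bilinear form `f` on `A ×
-- X`. That coefficient vanishes on `𝔫⁻`-images, so `f(a, x z) = -f(x a, z)` for `x ∈ 𝔫⁻`, and `f`
-- on `weightSpan b X S` is determined by its values on maximal vectors. As `y` itself has
-- coefficient nonzero, some maximal `v` of weight `μ ∈ S` has `f(·, v) ≠ 0`, a functional on `A` of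
-- weight `ν - μ`.
theorem exists_weight_of_bilinear {y : Y} (hy0 : y ≠ 0) {ν : Dual ℂ H}
    (hy : IsMaximalVector b ν y)
    (hmem : y ∈ Submodule.span ℂ {z | ∃ a, ∃ x ∈ weightSpan b X S, z = B a x}) :
    ∃ μ ∈ S, ∃ a : A, a ≠ 0 ∧ ∀ t : H, ⁅(t : L), a⁆ = (ν - μ) t • a := by
  obtain ⟨q, hq⟩ := exists_lieProjection (LieSubmodule.lieSpan ℂ L {y})
  obtain ⟨φ, hφ, hneg, hcart⟩ := exists_highestFunctional hy hy0
  let f : A →ₗ[ℂ] X →ₗ[ℂ] ℂ := B.compr₂ (φ ∘ₗ ((LieSubmodule.lieSpan ℂ L {y}).incl.comp q : Y →ₗ⁅ℂ,L⁆ Y).toLinearMap)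
  have hf : ∀ a x, f a x = φ (q (B a x) : Y) := fun _ _ => rfl
  have hlie : ∀ (l : L) a x, φ ⁅l, (q (B a x) : Y)⁆ = f ⁅l, a⁆ x + f a ⁅l, x⁆ := by
    intro l a x
    rw [hf, hf, ← LieSubmodule.coe_bracket, ← LieModuleHom.map_lie, hB, map_add,
      LieSubmodule.coe_add, map_add]
  obtain ⟨μ, hμ, v, hv, a, hav⟩ : ∃ μ ∈ S, ∃ v : X, IsMaximalVector b μ v ∧ ∃ a, f a v ≠ 0 := by
    by_contra! hc
    have h1 : ∀ μ ∈ S, ∀ v : X, IsMaximalVector b μ v → ∀ x ∈ LieSubmodule.lieSpan ℂ L {v},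
        ∀ a, f a x = 0 := by
      intro μ hμ v hv x hx
      rw [mem_lieSpan_iff hv] at hx
      induction hx using Submodule.span_induction with
      | zero => simp
      | add x y _ _ hx hy => intro a; rw [map_add, hx, hy, add_zero]
      | smul c x _ hx => intro a; rw [map_smul, hx, smul_zero]
      | mem x hx =>
        obtain ⟨ν, hx⟩ := hx
        induction hx with
        | refl => exact hc μ hμ v hv
        | @step ν z h α hα x hx ih =>
          intro a
          have h2 := hlie x a z
          rw [hneg _ (q _).2 α hα x hx, ih, zero_add] at h2
          exact h2.symm
    have h2 : ∀ x ∈ weightSpan b X S, ∀ a, f a x = 0 := by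
      intro x hx
      have hx' : x ∈ ⨆ v : {v : X | ∃ μ ∈ S, IsMaximalVector b μ v},
          LieSubmodule.lieSpan ℂ L {(v : X)} := by
        refine (LieSubmodule.lieSpan_le.mpr ?_ : weightSpan b X S ≤ _) hx
        intro v hv
        exact (le_iSup (fun v : {v : X | ∃ μ ∈ S, IsMaximalVector b μ v} =>
          LieSubmodule.lieSpan ℂ L {(v : X)}) ⟨v, hv⟩) (LieSubmodule.subset_lieSpan rfl)
      clear hx
      induction hx' using LieSubmodule.iSup_induction' with
      | zero => simp
      | add x y _ _ hx hy => intro a; rw [map_add, hx, hy, add_zero]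
      | mem v x hx =>
        obtain ⟨v, μ, hμ, hv⟩ := v
        exact h1 μ hμ v hv x hx
    have h3 : ∀ z ∈ Submodule.span ℂ {z | ∃ a, ∃ x ∈ weightSpan b X S, z = B a x},
        φ (q z : Y) = 0 := by
      intro z hz
      induction hz using Submodule.span_induction with
      | zero => simp
      | add x y _ _ hx hy => rw [map_add, LieSubmodule.coe_add, map_add, hx, hy, add_zero]
      | smul c x _ hx => rw [map_smul, SetLike.val_smul, map_smul, hx, smul_zero]
      | mem z hz =>
        obtain ⟨a, x, hx, rfl⟩ := hz
        exact h2 x hx a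
    have h4 := h3 y hmem
    have h5 : (q y : Y) = y := congrArg Subtype.val (hq ⟨y, LieSubmodule.subset_lieSpan rfl⟩)
    rw [h5] at h4
    exact hφ h4
  refine ⟨μ, hμ, exists_weight_of_functional (f.flip v) (fun h => hav ?_) (ν - μ) fun t a => ?_⟩
  · exact LinearMap.congr_fun h a
  · have h1 := hlie (t : L) a v
    rw [hcart _ (q _).2, hv.1, map_smul] at h1
    change f ⁅(t : L), a⁆ v = (ν t - μ t) * f a v
    rw [← hf, smul_eq_mul] at h1
    linear_combination -h1

include hB in
/-- The weights of the image of an equivariant bilinear map. -/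
theorem bilinear_mem_weightSpan (a : A) {x : X} (hx : x ∈ weightSpan b X S) :
    B a x ∈ weightSpan b Y {ν | ∃ μ ∈ S, ∃ a : A, a ≠ 0 ∧ ∀ t : H, ⁅(t : L), a⁆ = (ν - μ) t • a} := by
  set T : Set (Dual ℂ H) :=
    {ν | ∃ μ ∈ S, ∃ a : A, a ≠ 0 ∧ ∀ t : H, ⁅(t : L), a⁆ = (ν - μ) t • a}
  obtain ⟨p, hp⟩ := exists_lieProjection (weightSpan b Y T)
  -- The part of `B` outside the expected isotypic components is again equivariant. A maximal vector
  -- in its image would have weight in `T`, hence be fixed by `p`, while `p` kills that image; so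
  -- the image is zero.
  let r : Y →ₗ⁅ℂ,L⁆ Y := LieModuleHom.id - (weightSpan b Y T).incl.comp p
  have hr : ∀ y, r y = y - p y := fun y => rfl
  let B' : A →ₗ[ℂ] X →ₗ[ℂ] Y := B.compr₂ r.toLinearMap
  have hB' : ∀ (l : L) a x, ⁅l, B' a x⁆ = B' ⁅l, a⁆ x + B' a ⁅l, x⁆ := by
    intro l a x
    change ⁅l, r (B a x)⁆ = r (B _ x) + r (B a _)
    rw [← LieModuleHom.map_lie, hB, map_add]
  let Z : LieSubmodule ℂ L Y :=
    { Submodule.span ℂ {z | ∃ a, ∃ x ∈ weightSpan b X S, z = B' a x} with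
      lie_mem := by
        intro l z hz
        change z ∈ Submodule.span ℂ _ at hz
        change ⁅l, z⁆ ∈ Submodule.span ℂ _
        induction hz using Submodule.span_induction with
        | zero => simp
        | add x y _ _ hx hy => rw [lie_add]; exact add_mem hx hy
        | smul c x _ hx => rw [lie_smul]; exact Submodule.smul_mem _ c hx
        | mem z hz =>
          obtain ⟨a, x, hx, rfl⟩ := hz
          rw [hB']
          exact add_mem (Submodule.subset_span ⟨_, x, hx, rfl⟩)
            (Submodule.subset_span ⟨a, _, LieSubmodule.lie_mem _ hx, rfl⟩) }
  have hZ : Z = ⊥ := by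
    by_contra hne
    obtain ⟨ν, y, hyZ, hy0, hy⟩ := exists_maximalVector_mem (b := b) hne
    have h1 : y ∈ weightSpan b Y T :=
      LieSubmodule.subset_lieSpan ⟨ν, exists_weight_of_bilinear B' hB' hy0 hy hyZ, hy⟩
    have h2 : Z.toSubmodule ≤ LinearMap.ker (p : Y →ₗ[ℂ] weightSpan b Y T) := by
      refine Submodule.span_le.mpr ?_
      rintro _ ⟨a, x, -, rfl⟩
      change p (B a x - p (B a x)) = 0
      rw [map_sub, hp, sub_self]
    have h3 : p y = 0 := h2 hyZ
    have h4 := hp ⟨y, h1⟩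
    rw [h3] at h4
    exact hy0 (congrArg Subtype.val h4).symm
  have h1 : B' a x ∈ Z := Submodule.subset_span ⟨a, x, hx, rfl⟩
  rw [hZ] at h1
  have h2 : B a x - (p (B a x) : Y) = 0 := (LieSubmodule.mem_bot _).mp h1
  rw [sub_eq_zero.mp h2]
  exact (p _).2

end Tensor

end Multiplicity

/-! ### Cartan's formula on a free model, and `d² = 0`. -/

section Koszul

variable {𝔞 : Type u} [LieRing 𝔞] [LieAlgebra ℂ 𝔞] {𝒜 : ℕ → Submodule ℂ 𝔞} [GradedLieAlgebra 𝒜]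
  (M : GrZeroMod 𝒜)

open TensorProduct

/-- Exterior multiplication by an element of `𝔞₊`. -/
def wedgeCons (j : ℕ) : posPart 𝒜 →ₗ[ℂ] WedgeCarrier M j →ₗ[ℂ] WedgeCarrier M (j + 1) :=
  (LinearMap.rTensorHom M.carrier : _ →ₗ[ℂ] (⋀[ℂ]^j (posPart 𝒜)) ⊗[ℂ] M.carrier →ₗ[ℂ]
      (⋀[ℂ]^(j + 1) (posPart 𝒜)) ⊗[ℂ] M.carrier) ∘ₗ
    exteriorPower.alternatingMapLinearEquiv.toLinearMap ∘ₗ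
      (exteriorPower.ιMulti ℂ (j + 1)).curryLeft

theorem wedgeCons_wedge (j : ℕ) (z : posPart 𝒜) (x : Fin j → posPart 𝒜) (m : M.carrier) :
    wedgeCons M j z (wedge M j x m) = wedge M (j + 1) (Matrix.vecCons z x) m := by
  change (exteriorPower.alternatingMapLinearEquiv
    ((exteriorPower.ιMulti ℂ (j + 1)).curryLeft z) (exteriorPower.ιMulti ℂ j x)) ⊗ₜ[ℂ] m = _
  rw [exteriorPower.alternatingMapLinearEquiv_apply_ιMulti]
  rfl

variable {M} in
theorem wedgeCons_induction {j : ℕ} {p : WedgeCarrier M (j + 1) → Prop}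
    (hmk : ∀ z w, p (wedgeCons M j z w)) (hadd : ∀ a c, p a → p c → p (a + c))
    (hsmul : ∀ (d : ℂ) a, p a → p (d • a)) (t : WedgeCarrier M (j + 1)) : p t := by
  induction t using wedge_induction with
  | hadd a c ha hc => exact hadd _ _ ha hc
  | hsmul d a ha => exact hsmul _ _ ha
  | hmk x m =>
    have h := hmk (x 0) (wedge M j (Fin.tail x) m)
    rw [wedgeCons_wedge] at h
    have hx : Matrix.vecCons (x 0) (Fin.tail x) = x := Fin.cons_self_tail x
    rwa [hx] at h

theorem wedgeCons_removeNth (j : ℕ) (x : Fin (j + 1) → posPart 𝒜) (i : Fin (j + 1))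
    (m : M.carrier) :
    (-1 : ℤ) ^ (i : ℕ) • wedgeCons M j (x i) (wedge M j (i.removeNth x) m) =
      wedge M (j + 1) x m := by
  rw [wedgeCons_wedge, ← wedge_update, Function.update_eq_self]

theorem update_vecCons_zero {α : Type*} {j : ℕ} (z z' : α) (x : Fin j → α) :
    Function.update (Matrix.vecCons z x) 0 z' = Matrix.vecCons z' x := Fin.update_cons_zero _ _ _

theorem update_vecCons_succ {α : Type*} {j : ℕ} (z z' : α) (x : Fin j → α) (l : Fin j) :
    Function.update (Matrix.vecCons z x) l.succ z' = Matrix.vecCons z (Function.update x l z') :=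
  (Fin.cons_update _ _ _ _).symm

theorem wedgeAd_wedgeCons (j : ℕ) (x : 𝔞) (z : posPart 𝒜) (w : WedgeCarrier M j) :
    wedgeAd M (j + 1) x (wedgeCons M j z w) =
      wedgeCons M j ⁅x, z⁆ w + wedgeCons M j z (wedgeAd M j x w) := by
  induction w using wedge_induction with
  | hadd a c ha hc => simp only [map_add, ha, hc]; abel
  | hsmul d a ha => simp only [map_smul, ha, smul_add]
  | hmk v m =>
    rw [wedgeCons_wedge, wedgeAd_wedge, wedgeAd_wedge, Fin.sum_univ_succ, wedgeCons_wedge, map_sum]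
    simp only [wedgeCons_wedge, update_vecCons_succ, update_vecCons_zero, Matrix.cons_val_zero,
      Matrix.cons_val_succ]

theorem lie_wedgeCons (j : ℕ) (y : zeroPart 𝒜) (z : posPart 𝒜) (w : WedgeCarrier M j) :
    ⁅y, wedgeCons M j z w⁆ = wedgeCons M j ⁅(y : 𝔞), z⁆ w + wedgeCons M j z ⁅y, w⁆ := by
  induction w using wedge_induction with
  | hadd a c ha hc => simp only [map_add, lie_add, ha, hc]; abel
  | hsmul d a ha => simp only [map_smul, lie_smul, ha, smul_add]
  | hmk v m =>
    rw [wedgeCons_wedge, lie_wedge, lie_wedge, Fin.sum_univ_succ, map_add, map_sum]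
    simp only [wedgeCons_wedge, update_vecCons_succ, update_vecCons_zero, Matrix.cons_val_zero,
      Matrix.cons_val_succ, add_assoc]

theorem wedgeAd_zero (x : 𝔞) (w : WedgeCarrier M 0) : wedgeAd M 0 x w = 0 := by
  induction w using wedge_induction with
  | hadd a c ha hc => simp only [map_add, ha, hc, add_zero]
  | hsmul d a ha => simp only [map_smul, ha, smul_zero]
  | hmk v m => rw [wedgeAd_wedge, Fin.sum_univ_zero]

theorem wedgeAd_lie (j : ℕ) (x y : 𝔞) (w : WedgeCarrier M j) :
    wedgeAd M j ⁅x, y⁆ w = wedgeAd M j x (wedgeAd M j y w) - wedgeAd M j y (wedgeAd M j x w) := by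
  induction w using wedge_induction with
  | hadd a c ha hc => simp only [map_add, ha, hc]; abel
  | hsmul d a ha => simp only [map_smul, ha, smul_sub]
  | hmk v m =>
    simp only [wedge, wedgeAd_mk, lie_lie, map_sub, LinearMap.sub_apply]

/-! #### The free model -/

/-- The free `U(𝔞)`-module `U(𝔞) ⊗_ℂ (⋀ʲ 𝔞₊ ⊗ M)`. -/
abbrev FreeCarrier (j : ℕ) : Type u := UniversalEnvelopingAlgebra ℂ 𝔞 ⊗[ℂ] WedgeCarrier M j

variable {M} in
theorem freeCarrier_ext {j : ℕ} {N : Type*} [AddCommGroup N] [Module (UniversalEnvelopingAlgebra ℂ 𝔞) N]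
    {f g : FreeCarrier M j →ₗ[UniversalEnvelopingAlgebra ℂ 𝔞] N}
    (h : ∀ w, f (1 ⊗ₜ w) = g (1 ⊗ₜ w)) : f = g := by
  ext t
  induction t using TensorProduct.induction_on with
  | zero => simp
  | add a c ha hc => rw [map_add, map_add, ha, hc]
  | tmul u w =>
    have : u ⊗ₜ[ℂ] w = u • ((1 : UniversalEnvelopingAlgebra ℂ 𝔞) ⊗ₜ[ℂ] w) := by
      rw [TensorProduct.smul_tmul', smul_eq_mul, mul_one]
    rw [this, map_smul, map_smul, h]

/-- The `U(𝔞)`-linear extension of a map out of `⋀ʲ 𝔞₊ ⊗ M`. -/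
def freeExtend {j k : ℕ} (f : WedgeCarrier M j →ₗ[ℂ] FreeCarrier M k) :
    FreeCarrier M j →ₗ[UniversalEnvelopingAlgebra ℂ 𝔞] FreeCarrier M k :=
  AlgebraTensorModule.lift (LinearMap.toSpanSingleton (UniversalEnvelopingAlgebra ℂ 𝔞) _ f)

theorem freeExtend_one {j k : ℕ} (f : WedgeCarrier M j →ₗ[ℂ] FreeCarrier M k)
    (w : WedgeCarrier M j) : freeExtend M f (1 ⊗ₜ w) = f w := by
  rw [freeExtend, AlgebraTensorModule.lift_tmul, LinearMap.toSpanSingleton_apply, one_smul]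

/-- Exterior multiplication on the free model. -/
def freeCons (j : ℕ) (z : posPart 𝒜) :
    FreeCarrier M j →ₗ[UniversalEnvelopingAlgebra ℂ 𝔞] FreeCarrier M (j + 1) :=
  freeExtend M (TensorProduct.mk ℂ _ _ 1 ∘ₗ wedgeCons M j z)

theorem freeExtend_tmul {j k : ℕ} (f : WedgeCarrier M j →ₗ[ℂ] FreeCarrier M k)
    (u : UniversalEnvelopingAlgebra ℂ 𝔞) (w : WedgeCarrier M j) :
    freeExtend M f (u ⊗ₜ w) = u • f w := rfl

/-- This operator is not balanced over `U(𝔤)`, because `𝔤` moves `z`. It exists only over `ℂ`, which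
is the reason for computing in the free model and projecting afterwards. -/
theorem freeCons_tmul (j : ℕ) (z : posPart 𝒜) (u : UniversalEnvelopingAlgebra ℂ 𝔞)
    (w : WedgeCarrier M j) : freeCons M j z (u ⊗ₜ w) = u ⊗ₜ wedgeCons M j z w := by
  rw [freeCons, freeExtend_tmul, LinearMap.comp_apply, TensorProduct.mk_apply,
    TensorProduct.smul_tmul', smul_eq_mul, mul_one]

/-- The operator `u ⊗ w ↦ u x ⊗ w - u ⊗ (ad x) w`. -/
def freeTheta (j : ℕ) (x : posPart 𝒜) :
    FreeCarrier M j →ₗ[UniversalEnvelopingAlgebra ℂ 𝔞] FreeCarrier M j :=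
  freeExtend M (TensorProduct.mk ℂ _ _ (UniversalEnvelopingAlgebra.ι ℂ (x : 𝔞)) -
    TensorProduct.mk ℂ _ _ 1 ∘ₗ wedgeAd M j x)

theorem freeTheta_tmul (j : ℕ) (x : posPart 𝒜) (u : UniversalEnvelopingAlgebra ℂ 𝔞)
    (w : WedgeCarrier M j) : freeTheta M j x (u ⊗ₜ w) =
      (u * UniversalEnvelopingAlgebra.ι ℂ (x : 𝔞)) ⊗ₜ w - u ⊗ₜ wedgeAd M j x w := by
  rw [freeTheta, freeExtend_tmul, LinearMap.sub_apply, LinearMap.comp_apply, TensorProduct.mk_apply,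
    TensorProduct.mk_apply, smul_sub, TensorProduct.smul_tmul', TensorProduct.smul_tmul',
    smul_eq_mul, smul_eq_mul, mul_one]

/-- The lift of `koszulStep` to the free model. -/
def freeStep (j : ℕ) : posPart 𝒜 →ₗ[ℂ] WedgeCarrier M j →ₗ[ℂ] FreeCarrier M j :=
  (TensorProduct.mk ℂ _ _ ∘ₗ (UniversalEnvelopingAlgebra.ι ℂ (L := 𝔞)).toLinearMap -
    (1 / 2 : ℂ) • ((TensorProduct.mk ℂ (UniversalEnvelopingAlgebra ℂ 𝔞) (WedgeCarrier M j)
      1).compRight ℂ ∘ₗ wedgeAd M j)) ∘ₗ (posPart 𝒜).subtype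

theorem freeStep_apply (j : ℕ) (x : posPart 𝒜) (w : WedgeCarrier M j) :
    freeStep M j x w = UniversalEnvelopingAlgebra.ι ℂ (x : 𝔞) ⊗ₜ w -
      (1 / 2 : ℂ) • (1 ⊗ₜ wedgeAd M j x w) := rfl

/-- The lift of `koszulPre` to the free model. -/
def freePre (j : ℕ) :
    posPart 𝒜 ⊗[ℂ] ⋀[ℂ]^j (posPart 𝒜) →ₗ[ℂ] M.carrier →ₗ[ℂ] FreeCarrier M j :=
  TensorProduct.lift (LinearMap.mk₂ ℂ (fun x w => freeStep M j x ∘ₗ wedgeMk M j w)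
    (fun x y w => by rw [map_add, LinearMap.add_comp])
    (fun c x w => by rw [map_smul, LinearMap.smul_comp])
    (fun x w w' => by rw [map_add, LinearMap.comp_add])
    (fun c x w => by rw [map_smul, LinearMap.comp_smul]))

/-- The lift of `koszulMap` to the free model. -/
def freeMap (j : ℕ) : WedgeCarrier M (j + 1) →ₗ[ℂ] FreeCarrier M j :=
  wedgeDesc (freePre M j ∘ₗ exteriorSplit j)

theorem freeMap_wedge (j : ℕ) (x : Fin (j + 1) → posPart 𝒜) (m : M.carrier) :
    freeMap M j (wedge M (j + 1) x m) = ∑ i : Fin (j + 1), (-1 : ℤ) ^ (i : ℕ) •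
      freeStep M j (x i) (wedge M j (i.removeNth x) m) := by
  rw [freeMap, wedge, wedgeDesc_mk, LinearMap.comp_apply, exteriorSplit_ιMulti, map_sum,
    LinearMap.sum_apply]
  refine Finset.sum_congr rfl fun i _ => ?_
  rw [map_zsmul, LinearMap.smul_apply]
  rfl

/-- The differential of the free model. -/
def freeD (j : ℕ) : FreeCarrier M (j + 1) →ₗ[UniversalEnvelopingAlgebra ℂ 𝔞] FreeCarrier M j :=
  freeExtend M (freeMap M j)

theorem freeMap_wedgeCons_zero (x : posPart 𝒜) (w : WedgeCarrier M 0) :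
    freeMap M 0 (wedgeCons M 0 x w) = freeTheta M 0 x (1 ⊗ₜ w) := by
  induction w using wedge_induction with
  | hadd a c ha hc => simp only [map_add, ha, hc, tmul_add]
  | hsmul d a ha => simp only [map_smul, ha, tmul_smul, LinearMap.map_smul_of_tower]
  | hmk v m =>
    rw [wedgeCons_wedge, freeMap_wedge, Fin.sum_univ_one, freeTheta_tmul, freeStep_apply,
      wedgeAd_zero, wedgeAd_zero]
    simp [Fin.removeNth_zero]

theorem removeNth_succ_vecCons {α : Type*} {j : ℕ} (z : α) (x : Fin (j + 1) → α)
    (i : Fin (j + 1)) :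
    i.succ.removeNth (Matrix.vecCons z x) = Matrix.vecCons z (i.removeNth x) := by
  ext l
  refine Fin.cases ?_ (fun l => ?_) l
  · simp [Fin.removeNth]
  · simp [Fin.removeNth]

/-- Cartan's formula `d ε_x + ε_x d = θ_x`, where `ε_x` is exterior multiplication by `x`. The full
`ad x` in `θ_x` is assembled from two halves: one in the term that extracts `x`, the other from the
remaining terms, where `ad vᵢ` hits `x`. -/
theorem freeMap_wedgeCons (j : ℕ) (x : posPart 𝒜) (w : WedgeCarrier M (j + 1)) :
    freeMap M (j + 1) (wedgeCons M (j + 1) x w) =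
      freeTheta M (j + 1) x (1 ⊗ₜ w) - freeCons M j x (freeMap M j w) := by
  induction w using wedge_induction with
  | hadd a c ha hc => simp only [map_add, ha, hc, tmul_add]; abel
  | hsmul d a ha => simp only [map_smul, ha, tmul_smul, LinearMap.map_smul_of_tower, smul_sub]
  | hmk v m =>
    rw [wedgeCons_wedge, freeMap_wedge, freeMap_wedge, Fin.sum_univ_succ, freeTheta_tmul, map_sum]
    simp only [removeNth_succ_vecCons, Matrix.cons_val_zero, Matrix.cons_val_succ, Fin.val_zero,
      pow_zero, one_smul, Fin.val_succ]
    have h0 : (0 : Fin (j + 2)).removeNth (Matrix.vecCons x v) = v := by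
      rw [Fin.removeNth_zero]; rfl
    rw [h0]
    have hterm : ∀ i : Fin (j + 1), (-1 : ℤ) ^ ((i : ℕ) + 1) •
        freeStep M (j + 1) (v i) (wedge M (j + 1) (Matrix.vecCons x (i.removeNth v)) m) =
        (1 / 2 : ℂ) • ((1 : UniversalEnvelopingAlgebra ℂ 𝔞) ⊗ₜ[ℂ]
          ((-1 : ℤ) ^ (i : ℕ) • wedgeCons M j ⁅(v i : 𝔞), x⁆ (wedge M j (i.removeNth v) m))) -
        freeCons M j x ((-1 : ℤ) ^ (i : ℕ) •
          freeStep M j (v i) (wedge M j (i.removeNth v) m)) := by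
      intro i
      rw [← wedgeCons_wedge, freeStep_apply, freeStep_apply, wedgeAd_wedgeCons, map_zsmul, map_sub,
        freeCons_tmul, LinearMap.map_smul_of_tower, freeCons_tmul, tmul_add, tmul_smul, pow_succ,
        mul_neg_one, neg_smul, smul_comm (1 / 2 : ℂ)]
      simp only [smul_sub, smul_add]
      abel
    rw [Finset.sum_congr rfl fun i _ => hterm i, Finset.sum_sub_distrib]
    -- Moving `⁅vᵢ, x⁆ = -⁅x, vᵢ⁆` back to slot `i` absorbs the sign `(-1)ⁱ`.
    have had : ∑ i : Fin (j + 1), (-1 : ℤ) ^ (i : ℕ) •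
        wedgeCons M j ⁅(v i : 𝔞), x⁆ (wedge M j (i.removeNth v) m) =
        - wedgeAd M (j + 1) x (wedge M (j + 1) v m) := by
      rw [wedgeAd_wedge, ← Finset.sum_neg_distrib]
      refine Finset.sum_congr rfl fun i _ => ?_
      rw [wedge_update, ← wedgeCons_wedge, ← smul_neg]
      congr 1
      have : ⁅(v i : 𝔞), x⁆ = -⁅(x : 𝔞), v i⁆ := by
        ext
        exact (lie_skew _ _).symm
      rw [this, map_neg, LinearMap.neg_apply]
    rw [← Finset.smul_sum, ← tmul_sum, had, freeStep_apply, one_mul, tmul_neg, smul_neg]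
    module

theorem freeD_one (j : ℕ) (w : WedgeCarrier M (j + 1)) :
    freeD M j (1 ⊗ₜ w) = freeMap M j w := freeExtend_one M _ w

theorem freeD_freeCons_zero (x : posPart 𝒜) (t : FreeCarrier M 0) :
    freeD M 0 (freeCons M 0 x t) = freeTheta M 0 x t := by
  have : freeD M 0 ∘ₗ freeCons M 0 x = freeTheta M 0 x := freeCarrier_ext fun w => by
    rw [LinearMap.comp_apply, freeCons_tmul, freeD_one, freeMap_wedgeCons_zero]
  exact LinearMap.congr_fun this t

theorem freeD_freeCons (j : ℕ) (x : posPart 𝒜) (t : FreeCarrier M (j + 1)) :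
    freeD M (j + 1) (freeCons M (j + 1) x t) =
      freeTheta M (j + 1) x t - freeCons M j x (freeD M j t) := by
  have : freeD M (j + 1) ∘ₗ freeCons M (j + 1) x =
      freeTheta M (j + 1) x - freeCons M j x ∘ₗ freeD M j := freeCarrier_ext fun w => by
    rw [LinearMap.comp_apply, freeCons_tmul, freeD_one, freeMap_wedgeCons, LinearMap.sub_apply,
      LinearMap.comp_apply, freeD_one]
  exact LinearMap.congr_fun this t

theorem freeTheta_freeCons (j : ℕ) (x y : posPart 𝒜) (t : FreeCarrier M j) :
    freeTheta M (j + 1) x (freeCons M j y t) =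
      freeCons M j y (freeTheta M j x t) - freeCons M j ⁅x, y⁆ t := by
  have : freeTheta M (j + 1) x ∘ₗ freeCons M j y =
      freeCons M j y ∘ₗ freeTheta M j x - freeCons M j ⁅x, y⁆ := freeCarrier_ext fun w => by
    rw [LinearMap.comp_apply, freeCons_tmul, freeTheta_tmul, LinearMap.sub_apply,
      LinearMap.comp_apply, freeTheta_tmul, map_sub, freeCons_tmul, freeCons_tmul, freeCons_tmul,
      wedgeAd_wedgeCons, tmul_add]
    have : ⁅(x : 𝔞), y⁆ = ⁅x, y⁆ := rfl
    rw [this]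
    abel
  exact LinearMap.congr_fun this t

/-- The order on the right is reversed because `θ_x` multiplies `U(𝔞)` from the right. -/
theorem freeTheta_lie (j : ℕ) (x y : posPart 𝒜) (t : FreeCarrier M j) :
    freeTheta M j ⁅x, y⁆ t =
      freeTheta M j y (freeTheta M j x t) - freeTheta M j x (freeTheta M j y t) := by
  have : freeTheta M j ⁅x, y⁆ =
      freeTheta M j y ∘ₗ freeTheta M j x - freeTheta M j x ∘ₗ freeTheta M j y :=
    freeCarrier_ext fun w => by
    have h : ((⁅x, y⁆ : posPart 𝒜) : 𝔞) = ⁅(x : 𝔞), (y : 𝔞)⁆ := rfl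
    simp only [LinearMap.sub_apply, LinearMap.comp_apply, freeTheta_tmul, map_sub, h, wedgeAd_lie,
      LieHom.map_lie, LieRing.of_associative_ring_bracket, sub_tmul, tmul_sub, one_mul]
    abel
  exact LinearMap.congr_fun this t

variable {M} in
-- In positive exterior degree the images of the operators `ε_x` span, so identities may be tested
-- after composing with them, where Cartan's formula applies.
theorem freeCarrier_ext_succ {j : ℕ} {N : Type*} [AddCommGroup N]
    [Module (UniversalEnvelopingAlgebra ℂ 𝔞) N]
    {f g : FreeCarrier M (j + 1) →ₗ[UniversalEnvelopingAlgebra ℂ 𝔞] N}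
    (h : ∀ x t, f (freeCons M j x t) = g (freeCons M j x t)) : f = g := by
  refine freeCarrier_ext fun w => ?_
  induction w using wedgeCons_induction with
  | hadd a c ha hc => simp only [tmul_add, map_add, ha, hc]
  | hsmul d a ha =>
    have : (1 : UniversalEnvelopingAlgebra ℂ 𝔞) ⊗ₜ[ℂ] (d • a) =
        (algebraMap ℂ (UniversalEnvelopingAlgebra ℂ 𝔞) d) •
          ((1 : UniversalEnvelopingAlgebra ℂ 𝔞) ⊗ₜ[ℂ] a) := by
      rw [algebraMap_smul, tmul_smul]
    rw [this, map_smul, map_smul, ha]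
  | hmk z w => rw [← freeCons_tmul, h]

/-- Apply both sides to `ε_y t`; Cartan's formula and the commutation rules reduce the claim to one
exterior degree lower. -/
theorem freeD_freeTheta (j : ℕ) (x : posPart 𝒜) (t : FreeCarrier M (j + 1)) :
    freeD M j (freeTheta M (j + 1) x t) = freeTheta M j x (freeD M j t) := by
  induction j with
  | zero =>
    have : freeD M 0 ∘ₗ freeTheta M 1 x = freeTheta M 0 x ∘ₗ freeD M 0 :=
      freeCarrier_ext_succ fun y t => by
      simp only [LinearMap.comp_apply, freeTheta_freeCons, map_sub, freeD_freeCons_zero,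
        freeTheta_lie]
      abel
    exact LinearMap.congr_fun this t
  | succ j ih =>
    have : freeD M (j + 1) ∘ₗ freeTheta M (j + 2) x = freeTheta M (j + 1) x ∘ₗ freeD M (j + 1) :=
      freeCarrier_ext_succ fun y t => by
      simp only [LinearMap.comp_apply, freeTheta_freeCons, map_sub, freeD_freeCons, ih,
        freeTheta_lie]
      abel
    exact LinearMap.congr_fun this t

/-- By Cartan's formula `d d ε_x = d θ_x - d ε_x d = d θ_x - θ_x d + ε_x d d`; the first two terms
cancel, and the last vanishes by induction. -/
theorem freeD_freeD (j : ℕ) (t : FreeCarrier M (j + 2)) :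
    freeD M j (freeD M (j + 1) t) = 0 := by
  induction j with
  | zero =>
    have : freeD M 0 ∘ₗ freeD M 1 = 0 := freeCarrier_ext_succ fun y t => by
      simp only [LinearMap.comp_apply, freeD_freeCons, map_sub, freeD_freeCons_zero,
        freeD_freeTheta, sub_self, LinearMap.zero_apply]
    exact LinearMap.congr_fun this t
  | succ j ih =>
    have : freeD M (j + 1) ∘ₗ freeD M (j + 2) = 0 := freeCarrier_ext_succ fun y t => by
      simp only [LinearMap.comp_apply, freeD_freeCons, map_sub,
        freeD_freeTheta, ih, map_zero, sub_zero, sub_self, LinearMap.zero_apply]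
    exact LinearMap.congr_fun this t

/-- The projection of the free model to `U(𝔞) ⊗_{U(𝔤)} (⋀ʲ 𝔞₊ ⊗ M)`. -/
def freeProj (j : ℕ) : FreeCarrier M j →ₗ[ℂ] KoszulCarrier M j := TensorProduct.lift (koszulMk M j)

theorem freeProj_tmul (j : ℕ) (u : UniversalEnvelopingAlgebra ℂ 𝔞) (w : WedgeCarrier M j) :
    freeProj M j (u ⊗ₜ w) = koszulMk M j u w := rfl

theorem freeProj_smul (j : ℕ) (u : UniversalEnvelopingAlgebra ℂ 𝔞) (t : FreeCarrier M j) :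
    freeProj M j (u • t) = indMul (wedgeTensor M j) u (freeProj M j t) := by
  induction t using TensorProduct.induction_on with
  | zero => simp
  | add a c ha hc => rw [smul_add, map_add, ha, hc, map_add, map_add]
  | tmul v w => rfl

theorem freeProj_freeMap (j : ℕ) (w : WedgeCarrier M (j + 1)) :
    freeProj M j (freeMap M j w) = koszulMap M j w := by
  induction w using wedge_induction with
  | hadd a c ha hc => simp only [map_add, ha, hc]
  | hsmul d a ha => simp only [map_smul, ha]
  | hmk v m =>
    rw [freeMap_wedge, koszulMap_wedge, map_sum]
    refine Finset.sum_congr rfl fun i _ => ?_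
    rw [map_zsmul]
    rfl

theorem freeProj_freeD (j : ℕ) (t : FreeCarrier M (j + 1)) :
    freeProj M j (freeD M j t) = (koszulD M j).1 (freeProj M (j + 1) t) := by
  induction t using TensorProduct.induction_on with
  | zero => rw [map_zero, map_zero, map_zero]; exact (map_zero (koszulD M j).1).symm
  | add a c ha hc =>
    rw [map_add, map_add, ha, hc, map_add]; exact (map_add (koszulD M j).1 _ _).symm
  | tmul u w =>
    rw [freeProj_tmul, koszulD_mk, ← freeProj_freeMap, ← freeProj_smul]
    rfl

theorem freeProj_surjective (j : ℕ) : Function.Surjective (freeProj M j) := by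
  intro t
  induction t using indCarrier_induction with
  | hmk u w => exact ⟨u ⊗ₜ w, rfl⟩
  | hadd a c ha hc =>
    obtain ⟨a, rfl⟩ := ha
    obtain ⟨c, rfl⟩ := hc
    exact ⟨a + c, map_add _ _ _⟩

theorem koszulD_koszulD (j : ℕ) (t : KoszulCarrier M (j + 2)) :
    (koszulD M j).1 ((koszulD M (j + 1)).1 t) = 0 := by
  obtain ⟨t, rfl⟩ := freeProj_surjective M (j + 2) t
  rw [← freeProj_freeD, ← freeProj_freeD, freeD_freeD, map_zero]
  rfl

end Koszul

/-! ### A retraction of `U(𝔞)` onto `𝔞₊`, and the filtration by number of factors. -/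

section Contraction

variable {𝔞 : Type u} [LieRing 𝔞] [LieAlgebra ℂ 𝔞] {𝒜 : ℕ → Submodule ℂ 𝔞} [GradedLieAlgebra 𝒜]

open TensorProduct

variable (𝒜) in
theorem homogeneous_induction {p : 𝔞 → Prop} (hmem : ∀ n, ∀ x ∈ 𝒜 n, p x)
    (hadd : ∀ x y, p x → p y → p (x + y)) (x : 𝔞) : p x := by
  have hx : x ∈ ⨆ n, 𝒜 n := by
    rw [iSup_eq_top_of_isInternal (isInternal_pieces 𝒜)]; trivial
  induction hx using Submodule.iSup_induction' with
  | zero => exact hmem 0 0 (zero_mem _)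
  | add a c _ _ ha hc => exact hadd _ _ ha hc
  | mem n x hx => exact hmem n x hx

theorem mem_posPart {n : ℕ} {x : 𝔞} (hx : x ∈ 𝒜 (n + 1)) : x ∈ posPart 𝒜 :=
  Submodule.mem_iSup_of_mem (p := fun n => 𝒜 (n + 1)) n hx

theorem posPart_induction {p : (x : 𝔞) → x ∈ posPart 𝒜 → Prop}
    (hmem : ∀ n, ∀ x, ∀ hx : x ∈ 𝒜 (n + 1), p x (mem_posPart hx))
    (hadd : ∀ x y hx hy, p x hx → p y hy → p (x + y) (add_mem hx hy)) {x : 𝔞}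
    (hx : x ∈ posPart 𝒜) : p x hx := by
  have hx' : x ∈ ⨆ n, 𝒜 (n + 1) := hx
  suffices h : ∃ hx, p x hx from h.2
  clear hx
  induction hx' using Submodule.iSup_induction' with
  | zero => exact ⟨_, hmem 0 0 (zero_mem _)⟩
  | add a c _ _ ha hc => exact ⟨_, hadd _ _ _ _ ha.2 hc.2⟩
  | mem n x hx => exact ⟨_, hmem n x hx⟩

variable (𝒜) in
theorem exists_zero_add_pos (x : 𝔞) : ∃ y : zeroPart 𝒜, ∃ z : posPart 𝒜, x = y + z := by
  induction x using homogeneous_induction 𝒜 with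
  | hmem n x hx =>
    cases n with
    | zero => exact ⟨⟨x, hx⟩, 0, by simp⟩
    | succ n => exact ⟨0, ⟨x, mem_posPart hx⟩, by simp⟩
  | hadd x y hx hy =>
    obtain ⟨y₁, z₁, rfl⟩ := hx
    obtain ⟨y₂, z₂, rfl⟩ := hy
    exact ⟨y₁ + y₂, z₁ + z₂, by push_cast; abel⟩

variable (𝒜) in
/-- A linear retraction of `U(𝔞)` onto `𝔞₊`, equivariant for right multiplication by `𝔤`. -/
theorem exists_ueaRetract : ∃ e : UniversalEnvelopingAlgebra ℂ 𝔞 →ₗ[ℂ] posPart 𝒜, e 1 = 0 ∧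
    (∀ x : posPart 𝒜, e (UniversalEnvelopingAlgebra.ι ℂ (x : 𝔞)) = x) ∧
    ∀ a (y : zeroPart 𝒜), e (a * UniversalEnvelopingAlgebra.ι ℂ (y : 𝔞)) = -⁅(y : 𝔞), e a⁆ := by
  obtain ⟨E, hE⟩ := exists_scaling 𝒜 (isInternal_pieces 𝒜) (fun n => (n : ℂ))
  -- `F` inverts the degree derivation `E` on `𝔞₊`; the convention `0⁻¹ = 0` makes it vanish on `𝔤`.
  obtain ⟨F, hF⟩ := exists_scaling 𝒜 (isInternal_pieces 𝒜) (fun n => (n : ℂ)⁻¹)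
  have hEd : ∀ x y : 𝔞, E ⁅x, y⁆ = ⁅E x, y⁆ + ⁅x, E y⁆ := by
    intro x y
    induction x using homogeneous_induction 𝒜 with
    | hadd a c ha hc => simp only [add_lie, map_add, ha, hc]; abel
    | hmem m x hx =>
      induction y using homogeneous_induction 𝒜 with
      | hadd a c ha hc => simp only [lie_add, map_add, ha, hc]; abel
      | hmem n y hy =>
        rw [hE m x hx, hE n y hy, hE _ _ (bracket_mem 𝒜 hx hy), smul_lie, lie_smul, ← add_smul]
        push_cast
        rfl
  have hFy : ∀ z : 𝔞, ∀ y ∈ 𝒜 0, F ⁅z, y⁆ = ⁅F z, y⁆ := by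
    intro z y hy
    induction z using homogeneous_induction 𝒜 with
    | hadd a c ha hc => simp only [add_lie, map_add, ha, hc]
    | hmem m x hx =>
      rw [hF m x hx, hF _ _ (bracket_mem 𝒜 hx hy), smul_lie, add_zero]
  have hFpos : ∀ z : 𝔞, F z ∈ posPart 𝒜 := by
    intro z
    induction z using homogeneous_induction 𝒜 with
    | hadd a c ha hc => rw [map_add]; exact add_mem ha hc
    | hmem m x hx =>
      rw [hF m x hx]
      cases m with
      | zero => simp
      | succ m => exact SMulMemClass.smul_mem _ (mem_posPart hx)
  have hFE : ∀ x ∈ posPart 𝒜, F (E x) = x := by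
    intro x hx
    induction hx using posPart_induction with
    | hadd a c _ _ ha hc => rw [map_add, map_add, ha, hc]
    | hmem m x hx =>
      rw [hE _ x hx, map_smul, hF _ x hx, smul_smul, mul_inv_cancel₀ (by exact_mod_cast m.succ_ne_zero),
        one_smul]
  have hE0 : ∀ y ∈ 𝒜 0, E y = 0 := by
    intro y hy
    rw [hE 0 y hy, Nat.cast_zero, zero_smul]
  -- A right module structure on `𝔞 ⊕ ℂ`: the adjoint module extended by the derivation `E`, whose
  -- Leibniz rule gives compatibility with brackets. The retraction sends `a` to `F` of the first
  -- component of `(0, 1) · a`. For `x ∈ 𝔞₊` this is `F (E x) = x`; for `y ∈ 𝔤` one has `E y = 0`,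
  -- so right multiplication by `y` becomes a bracket.
  let R : 𝔞 →ₗ[ℂ] Module.End ℂ (𝔞 × ℂ) := LinearMap.mk₂ ℂ
    (fun x p => ((⁅p.1, x⁆ + p.2 • E x, 0) : 𝔞 × ℂ))
    (fun x x' p => by ext <;> simp; abel) (fun c x p => by ext <;> simp [smul_comm c])
    (fun x p p' => by ext <;> simp [add_smul]; abel)
    (fun c x p => by ext <;> simp [mul_smul])
  have hR : ∀ x p, R x p = (⁅p.1, x⁆ + p.2 • E x, 0) := fun _ _ => rfl
  let ρ : 𝔞 →ₗ⁅ℂ⁆ (Module.End ℂ (𝔞 × ℂ))ᵐᵒᵖ :=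
    { (MulOpposite.opLinearEquiv ℂ).toLinearMap ∘ₗ R with
      map_lie' := by
        intro x y
        change MulOpposite.op (R ⁅x, y⁆) =
          MulOpposite.op (R x) * MulOpposite.op (R y) - MulOpposite.op (R y) * MulOpposite.op (R x)
        rw [← MulOpposite.op_mul, ← MulOpposite.op_mul, ← MulOpposite.op_sub]
        congr 1
        apply LinearMap.ext
        rintro ⟨z, c⟩
        rw [LinearMap.sub_apply, Module.End.mul_apply, Module.End.mul_apply, hR, hR, hR, hR, hR, hEd]
        ext
        · simp only [Prod.fst_sub, zero_smul, add_zero, add_lie, smul_lie, smul_add]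
          rw [leibniz_lie z x y, ← lie_skew (E y) x, ← lie_skew ⁅z, y⁆ x, smul_neg]
          abel
        · simp }
  let g := UniversalEnvelopingAlgebra.lift ℂ ρ
  have hg : ∀ x, g (UniversalEnvelopingAlgebra.ι ℂ x) = MulOpposite.op (R x) := fun x =>
    UniversalEnvelopingAlgebra.lift_ι_apply _ _ _
  let F' : 𝔞 →ₗ[ℂ] posPart 𝒜 := F.codRestrict (posPart 𝒜).toSubmodule hFpos
  let ev : (Module.End ℂ (𝔞 × ℂ))ᵐᵒᵖ →ₗ[ℂ] 𝔞 :=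
    LinearMap.fst ℂ 𝔞 ℂ ∘ₗ LinearMap.applyₗ ((0, 1) : 𝔞 × ℂ) ∘ₗ
      (MulOpposite.opLinearEquiv ℂ).symm.toLinearMap
  have hev : ∀ φ : Module.End ℂ (𝔞 × ℂ), ev (MulOpposite.op φ) = (φ (0, 1)).1 := fun _ => rfl
  refine ⟨F' ∘ₗ ev ∘ₗ g.toLinearMap, ?_, fun x => ?_, fun a y => ?_⟩
  · ext
    change F (ev (g 1)) = 0
    rw [map_one, ← MulOpposite.op_one, hev, Module.End.one_apply, map_zero]
  · ext
    change F (ev (g _)) = x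
    rw [hg, hev, hR]
    simp only [zero_lie, one_smul, zero_add]
    exact hFE x x.2
  · ext
    change F (ev (g _)) = -⁅(y : 𝔞), F (ev (g a))⁆
    rw [map_mul, hg, lie_skew, ← hFy _ _ y.2]
    congr 1
    obtain ⟨φ, hφ⟩ := MulOpposite.op_surjective (g a)
    rw [← hφ, ← MulOpposite.op_mul, hev, hev, Module.End.mul_apply, hR, hE0 _ y.2, smul_zero,
      add_zero]

section Filtration

variable (N : GrZeroMod 𝒜)

/-- The filtration of `U(𝔞) ⊗ N` by the number of factors from `𝔞₊`. -/
def indFilt : ℕ → Submodule ℂ (IndCarrier N)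
  | 0 => ⊥
  | p + 1 => Submodule.span ℂ ({t | ∃ m, t = indMk N 1 m} ∪
      {t | ∃ x : posPart 𝒜, ∃ s ∈ indFilt p, t = ⁅(x : 𝔞), s⁆})

/-- The index is shifted: level `k + 1` holds products with at most `k` factors from `𝔞₊`, and level
`0` is zero. -/
theorem one_mem_indFilt (k : ℕ) (m : N.carrier) : indMk N 1 m ∈ indFilt N (k + 1) := by
  rw [indFilt]; exact Submodule.subset_span (Or.inl ⟨m, rfl⟩)

theorem lie_mem_indFilt {k : ℕ} {s : IndCarrier N} (hs : s ∈ indFilt N k) (x : posPart 𝒜) :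
    ⁅(x : 𝔞), s⁆ ∈ indFilt N (k + 1) := by
  rw [indFilt]; exact Submodule.subset_span (Or.inr ⟨x, s, hs, rfl⟩)

variable {N} in
theorem indFilt_induction {k : ℕ} {p : (t : IndCarrier N) → t ∈ indFilt N (k + 1) → Prop}
    (h1 : ∀ m, p (indMk N 1 m) (one_mem_indFilt N k m))
    (hlie : ∀ (x : posPart 𝒜), ∀ s, ∀ hs : s ∈ indFilt N k, p ⁅(x : 𝔞), s⁆ (lie_mem_indFilt N hs x))
    (hadd : ∀ a c ha hc, p a ha → p c hc → p (a + c) (add_mem ha hc))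
    (hsmul : ∀ (d : ℂ) a ha, p a ha → p (d • a) (Submodule.smul_mem _ d ha))
    {t : IndCarrier N} (ht : t ∈ indFilt N (k + 1)) : p t ht := by
  have ht' := ht
  rw [indFilt] at ht'
  suffices h : ∃ ht, p t ht from h.2
  clear ht
  induction ht' using Submodule.span_induction with
  | zero =>
    have := h1 0
    exact ⟨zero_mem _, by convert this; rw [map_zero]⟩
  | add a c _ _ ha hc => exact ⟨_, hadd _ _ _ _ ha.2 hc.2⟩
  | smul d a _ ha => exact ⟨_, hsmul _ _ _ ha.2⟩
  | mem t ht =>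
    rcases ht with ⟨m, rfl⟩ | ⟨x, s, hs, rfl⟩
    · exact ⟨_, h1 m⟩
    · exact ⟨_, hlie x s hs⟩

theorem indFilt_mono : Monotone (indFilt N) := by
  refine monotone_nat_of_le_succ fun k => ?_
  induction k with
  | zero => exact bot_le
  | succ k ih =>
    intro t ht
    induction ht using indFilt_induction with
    | h1 m => exact one_mem_indFilt N _ m
    | hlie x s hs => exact lie_mem_indFilt N (ih hs) x
    | hadd a c _ _ ha hc => exact add_mem ha hc
    | hsmul d a _ ha => exact Submodule.smul_mem _ d ha

/-- An element of `𝔤` moves past the factors, as it normalises `𝔞₊`, and is finally absorbed by `N`.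
-/
theorem zeroPart_lie_mem_indFilt {k : ℕ} {s : IndCarrier N} (hs : s ∈ indFilt N k)
    (y : zeroPart 𝒜) : ⁅(y : 𝔞), s⁆ ∈ indFilt N k := by
  induction k generalizing s with
  | zero =>
    have : s = 0 := hs
    rw [this, lie_zero]; exact zero_mem _
  | succ k ih =>
    induction hs using indFilt_induction with
    | h1 m =>
      rw [lie_indMk, mul_one, ← one_mul (UniversalEnvelopingAlgebra.ι ℂ (y : 𝔞)), indMk_mul]
      exact one_mem_indFilt N _ _
    | hlie x s hs =>
      rw [leibniz_lie]
      exact add_mem (lie_mem_indFilt N hs ⁅(y : 𝔞), x⁆) (lie_mem_indFilt N (ih hs) x)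
    | hadd a c _ _ ha hc => rw [lie_add]; exact add_mem ha hc
    | hsmul d a _ ha => rw [lie_smul]; exact Submodule.smul_mem _ d ha

theorem exists_mem_indFilt (t : IndCarrier N) : ∃ k, t ∈ indFilt N k := by
  induction t using indCarrier_induction with
  | hmk u m =>
    induction u using uea_induction with
    | h1 => exact ⟨1, one_mem_indFilt N 0 m⟩
    | hadd u v hu hv =>
      obtain ⟨k, hk⟩ := hu
      obtain ⟨l, hl⟩ := hv
      rw [map_add, LinearMap.add_apply]
      exact ⟨max k l, add_mem (indFilt_mono N (le_max_left _ _) hk)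
        (indFilt_mono N (le_max_right _ _) hl)⟩
    | hsmul c u hu =>
      obtain ⟨k, hk⟩ := hu
      rw [map_smul, LinearMap.smul_apply]
      exact ⟨k, Submodule.smul_mem _ c hk⟩
    | hι x u hu =>
      obtain ⟨k, hk⟩ := hu
      obtain ⟨y, z, rfl⟩ := exists_zero_add_pos 𝒜 x
      rw [← lie_indMk, add_lie]
      exact ⟨k + 1, add_mem (indFilt_mono N k.le_succ (zeroPart_lie_mem_indFilt N hk y))
        (lie_mem_indFilt N hk z)⟩
  | hadd a c ha hc =>
    obtain ⟨k, hk⟩ := ha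
    obtain ⟨l, hl⟩ := hc
    exact ⟨max k l, add_mem (indFilt_mono N (le_max_left _ _) hk)
      (indFilt_mono N (le_max_right _ _) hl)⟩

variable {N} in
/-- An operator which acts on the associated graded of the filtration through `c + p`. -/
theorem homotopy_sub_mem_indFilt
    (G : IndCarrier N →ₗ[ℂ] UniversalEnvelopingAlgebra ℂ 𝔞 →ₗ[ℂ] IndCarrier N) (c : ℂ)
    (hG : ∀ (x : 𝔞) t a, G ⁅x, t⁆ a = ⁅x, G t a⁆ + G t (a * UniversalEnvelopingAlgebra.ι ℂ x))
    (hF : ∀ p, ∀ t ∈ indFilt N p, ∀ a, G t a ∈ indFilt N (p + 1))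
    (h1 : ∀ (x : posPart 𝒜) m, G (indMk N 1 m) (UniversalEnvelopingAlgebra.ι ℂ (x : 𝔞)) -
      ⁅(x : 𝔞), indMk N 1 m⁆ ∈ indFilt N 1)
    (hT : ∀ m, G (indMk N 1 m) 1 = c • indMk N 1 m) (p : ℕ) {t : IndCarrier N}
    (ht : t ∈ indFilt N (p + 1)) : G t 1 - (c + p) • t ∈ indFilt N p := by
  -- To leading order `G t x` is `x t`. For `t = y s`, the differences are `y` applied to the error
  -- for `s`, the commutator `⁅x, y⁆ s`, and `G s (x y)`; each has one factor fewer than `x y s`.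
  have hx : ∀ p, ∀ t ∈ indFilt N p, ∀ x : posPart 𝒜,
      G t (UniversalEnvelopingAlgebra.ι ℂ (x : 𝔞)) - ⁅(x : 𝔞), t⁆ ∈ indFilt N p := by
    intro p
    induction p with
    | zero =>
      intro t ht x
      have : t = 0 := ht
      rw [this, lie_zero, map_zero, LinearMap.zero_apply, sub_zero]
      exact zero_mem _
    | succ p ih =>
      intro t ht x
      induction ht using indFilt_induction with
      | h1 m => exact indFilt_mono N (Nat.le_add_left 1 p) (h1 x m)
      | hlie y s hs =>
        have h2 : G ⁅(y : 𝔞), s⁆ (UniversalEnvelopingAlgebra.ι ℂ (x : 𝔞)) - ⁅(x : 𝔞), ⁅(y : 𝔞), s⁆⁆ =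
            ⁅(y : 𝔞), G s (UniversalEnvelopingAlgebra.ι ℂ (x : 𝔞)) - ⁅(x : 𝔞), s⁆⁆ +
            G s (UniversalEnvelopingAlgebra.ι ℂ (x : 𝔞) * UniversalEnvelopingAlgebra.ι ℂ (y : 𝔞)) -
            ⁅((⁅x, y⁆ : posPart 𝒜) : 𝔞), s⁆ := by
          have h3 : ((⁅x, y⁆ : posPart 𝒜) : 𝔞) = ⁅(x : 𝔞), (y : 𝔞)⁆ := rfl
          rw [hG, h3, lie_lie, lie_sub]
          abel
        rw [h2]
        exact sub_mem (add_mem (lie_mem_indFilt N (ih s hs x) y) (hF p s hs _))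
          (lie_mem_indFilt N hs _)
      | hadd a d _ _ ha hd =>
        rw [map_add, LinearMap.add_apply, lie_add, add_sub_add_comm]
        exact add_mem ha hd
      | hsmul d a _ ha =>
        rw [map_smul, LinearMap.smul_apply, lie_smul, ← smul_sub]
        exact Submodule.smul_mem _ d ha
  induction p generalizing t with
  | zero =>
    induction ht using indFilt_induction with
    | h1 m => rw [hT, Nat.cast_zero, add_zero, sub_self]; exact zero_mem _
    | hlie y s hs =>
      have : s = 0 := hs
      rw [this, lie_zero, map_zero, LinearMap.zero_apply, smul_zero, sub_zero]
      exact zero_mem _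
    | hadd a d _ _ ha hd =>
      rw [map_add, LinearMap.add_apply, smul_add, add_sub_add_comm]
      exact add_mem ha hd
    | hsmul d a _ ha =>
      rw [map_smul, LinearMap.smul_apply, smul_comm _ d, ← smul_sub]
      exact Submodule.smul_mem _ d ha
  | succ p ih =>
    induction ht using indFilt_induction with
    | h1 m =>
      rw [hT, ← sub_smul]
      exact Submodule.smul_mem _ _ (one_mem_indFilt N p m)
    | hlie y s hs =>
      -- The first summand carries the scalar `c + p` already found for `s`; pulling out `y`
      -- contributes one further copy of `y s` to leading order.
      have h2 : G ⁅(y : 𝔞), s⁆ 1 - (c + (p + 1 : ℕ)) • ⁅(y : 𝔞), s⁆ =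
          ⁅(y : 𝔞), G s 1 - (c + p) • s⁆ +
          (G s (UniversalEnvelopingAlgebra.ι ℂ (y : 𝔞)) - ⁅(y : 𝔞), s⁆) := by
        rw [hG, one_mul, lie_sub, lie_smul]
        push_cast
        module
      rw [h2]
      exact add_mem (lie_mem_indFilt N (ih hs) y) (hx _ s hs y)
    | hadd a d _ _ ha hd =>
      rw [map_add, LinearMap.add_apply, smul_add, add_sub_add_comm]
      exact add_mem ha hd
    | hsmul d a _ ha =>
      rw [map_smul, LinearMap.smul_apply, smul_comm _ d, ← smul_sub]
      exact Submodule.smul_mem _ d ha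

end Filtration

end Contraction

/-! ### The contracting homotopy and acyclicity of the Koszul complex. -/

section Exactness

variable {𝔞 : Type u} [LieRing 𝔞] [LieAlgebra ℂ 𝔞] {𝒜 : ℕ → Submodule ℂ 𝔞} [GradedLieAlgebra 𝒜]
  (M : GrZeroMod 𝒜)

open TensorProduct

variable (𝒜) in
/-- A retraction of `U(𝔞)` onto `𝔞₊`. -/
def ueaRetract : UniversalEnvelopingAlgebra ℂ 𝔞 →ₗ[ℂ] posPart 𝒜 := (exists_ueaRetract 𝒜).choose

theorem ueaRetract_one : ueaRetract 𝒜 1 = 0 := (exists_ueaRetract 𝒜).choose_spec.1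

theorem ueaRetract_ι (x : posPart 𝒜) :
    ueaRetract 𝒜 (UniversalEnvelopingAlgebra.ι ℂ (x : 𝔞)) = x :=
  (exists_ueaRetract 𝒜).choose_spec.2.1 x

theorem ueaRetract_mul (a : UniversalEnvelopingAlgebra ℂ 𝔞) (y : zeroPart 𝒜) :
    ueaRetract 𝒜 (a * UniversalEnvelopingAlgebra.ι ℂ (y : 𝔞)) = -⁅(y : 𝔞), ueaRetract 𝒜 a⁆ :=
  (exists_ueaRetract 𝒜).choose_spec.2.2 a y

/-- The action `(x φ)(a) = x φ(a) + φ(a x)` of `𝔞` on linear maps out of `U(𝔞)`. -/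
def homAct (Q : Type u) [AddCommGroup Q] [Module ℂ Q] [LieRingModule 𝔞 Q] [LieModule ℂ 𝔞 Q] :
    𝔞 →ₗ⁅ℂ⁆ Module.End ℂ (UniversalEnvelopingAlgebra ℂ 𝔞 →ₗ[ℂ] Q) where
  toFun x :=
    { toFun := fun φ => LieModule.toEnd ℂ 𝔞 Q x ∘ₗ φ +
        φ ∘ₗ LinearMap.mulRight ℂ (UniversalEnvelopingAlgebra.ι ℂ x)
      map_add' := fun φ ψ => by
        rw [LinearMap.comp_add, LinearMap.add_comp]; abel
      map_smul' := fun c φ => by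
        rw [LinearMap.comp_smul, LinearMap.smul_comp, ← smul_add]; rfl }
  map_add' x y := LinearMap.ext fun φ => LinearMap.ext fun a => by
    change ⁅x + y, φ a⁆ + φ (a * UniversalEnvelopingAlgebra.ι ℂ (x + y)) =
      ⁅x, φ a⁆ + φ (a * UniversalEnvelopingAlgebra.ι ℂ x) +
      (⁅y, φ a⁆ + φ (a * UniversalEnvelopingAlgebra.ι ℂ y))
    rw [map_add, mul_add, map_add, add_lie]; abel
  map_smul' c x := LinearMap.ext fun φ => LinearMap.ext fun a => by
    change ⁅c • x, φ a⁆ + φ (a * UniversalEnvelopingAlgebra.ι ℂ (c • x)) =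
      c • (⁅x, φ a⁆ + φ (a * UniversalEnvelopingAlgebra.ι ℂ x))
    rw [map_smul, mul_smul_comm, map_smul, smul_lie, smul_add]
  map_lie' {x y} := LinearMap.ext fun φ => LinearMap.ext fun a => by
    change ⁅⁅x, y⁆, φ a⁆ + φ (a * UniversalEnvelopingAlgebra.ι ℂ ⁅x, y⁆) =
      (⁅x, ⁅y, φ a⁆ + φ (a * UniversalEnvelopingAlgebra.ι ℂ y)⁆ +
        (⁅y, φ (a * UniversalEnvelopingAlgebra.ι ℂ x)⁆ +
          φ (a * UniversalEnvelopingAlgebra.ι ℂ x * UniversalEnvelopingAlgebra.ι ℂ y))) -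
      (⁅y, ⁅x, φ a⁆ + φ (a * UniversalEnvelopingAlgebra.ι ℂ x)⁆ +
        (⁅x, φ (a * UniversalEnvelopingAlgebra.ι ℂ y)⁆ +
          φ (a * UniversalEnvelopingAlgebra.ι ℂ y * UniversalEnvelopingAlgebra.ι ℂ x)))
    rw [LieHom.map_lie, LieRing.of_associative_ring_bracket, mul_sub, map_sub, lie_lie, lie_add,
      lie_add, mul_assoc, mul_assoc]
    abel

theorem homAct_apply (Q : Type u) [AddCommGroup Q] [Module ℂ Q] [LieRingModule 𝔞 Q]
    [LieModule ℂ 𝔞 Q] (x : 𝔞) (φ : UniversalEnvelopingAlgebra ℂ 𝔞 →ₗ[ℂ] Q)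
    (a : UniversalEnvelopingAlgebra ℂ 𝔞) :
    homAct Q x φ a = ⁅x, φ a⁆ + φ (a * UniversalEnvelopingAlgebra.ι ℂ x) := rfl

/-- The contracting homotopies, indexed by `U(𝔞)`. -/
theorem exists_contraction (j : ℕ) :
    ∃ h : KoszulCarrier M j →ₗ[ℂ] UniversalEnvelopingAlgebra ℂ 𝔞 →ₗ[ℂ] KoszulCarrier M (j + 1),
      (∀ (x : 𝔞) t a, h ⁅x, t⁆ a = ⁅x, h t a⁆ + h t (a * UniversalEnvelopingAlgebra.ι ℂ x)) ∧
      ∀ w a, h (koszulMk M j 1 w) a =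
        koszulMk M (j + 1) 1 (wedgeCons M j (ueaRetract 𝒜 a) w) := by
  let φ : WedgeCarrier M j →ₗ[ℂ] UniversalEnvelopingAlgebra ℂ 𝔞 →ₗ[ℂ] KoszulCarrier M (j + 1) :=
    ((wedgeCons M j ∘ₗ ueaRetract 𝒜).compr₂ (koszulMk M (j + 1) 1)).flip
  have hφ : ∀ w a, φ w a = koszulMk M (j + 1) 1 (wedgeCons M j (ueaRetract 𝒜 a) w) :=
    fun _ _ => rfl
  let Θ := UniversalEnvelopingAlgebra.lift ℂ (homAct (𝔞 := 𝔞) (KoszulCarrier M (j + 1)))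
  have hΘ : ∀ x, Θ (UniversalEnvelopingAlgebra.ι ℂ x) = homAct (KoszulCarrier M (j + 1)) x :=
    fun x => UniversalEnvelopingAlgebra.lift_ι_apply _ _ _
  -- The twisted term `φ(a y)` cancels the action of `y` on the exterior factor: this is the purpose
  -- of the behaviour of the retraction under right multiplication by `𝔤`, and it lets the homotopy
  -- descend to the tensor product over `U(𝔤)`.
  have hbal : ∀ (y : zeroPart 𝒜) w,
      homAct (KoszulCarrier M (j + 1)) (y : 𝔞) (φ w) = φ ⁅y, w⁆ := by
    intro y w
    ext a
    have h1 : ⁅(y : 𝔞), koszulMk M (j + 1) 1 (wedgeCons M j (ueaRetract 𝒜 a) w)⁆ =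
        koszulMk M (j + 1) 1 ⁅y, wedgeCons M j (ueaRetract 𝒜 a) w⁆ := by
      rw [lie_koszulMk, mul_one, ← koszulMk_mul, one_mul]
    rw [homAct_apply, hφ, hφ, hφ, h1, lie_wedgeCons, ueaRetract_mul, map_neg, LinearMap.neg_apply,
      map_neg, map_add]
    abel
  let h : KoszulCarrier M j →ₗ[ℂ] UniversalEnvelopingAlgebra ℂ 𝔞 →ₗ[ℂ] KoszulCarrier M (j + 1) :=
    indDesc (M := wedgeTensor M j) ((LinearMap.lcomp ℂ _ φ) ∘ₗ Θ.toLinearMap) (by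
      intro u y (w : WedgeCarrier M j)
      change Θ (u * UniversalEnvelopingAlgebra.ι ℂ (y : 𝔞)) (φ w) = Θ u (φ ⁅y, w⁆)
      rw [map_mul, Module.End.mul_apply, hΘ, hbal])
  have hh : ∀ u w, h (koszulMk M j u w) = Θ u (φ w) := fun _ _ => rfl
  refine ⟨h, fun x t a => ?_, fun w a => ?_⟩
  · induction t using indCarrier_induction with
    | hmk u w =>
      have h1 := hh u w
      have h2 := hh (UniversalEnvelopingAlgebra.ι ℂ x * u) w
      change h (koszulMk M j (UniversalEnvelopingAlgebra.ι ℂ x * u) w) a =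
        ⁅x, h (koszulMk M j u w) a⁆ + h (koszulMk M j u w) _
      rw [h1, h2, map_mul, Module.End.mul_apply, hΘ, homAct_apply]
    | hadd s t hs ht => simp only [lie_add, map_add, LinearMap.add_apply, hs, ht]; abel
  · rw [hh, map_one, Module.End.one_apply, hφ]

/-- A choice of contracting homotopies. -/
def contraction (j : ℕ) :
    KoszulCarrier M j →ₗ[ℂ] UniversalEnvelopingAlgebra ℂ 𝔞 →ₗ[ℂ] KoszulCarrier M (j + 1) :=
  (exists_contraction M j).choose

theorem contraction_lie (j : ℕ) (x : 𝔞) (t : KoszulCarrier M j)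
    (a : UniversalEnvelopingAlgebra ℂ 𝔞) : contraction M j ⁅x, t⁆ a =
      ⁅x, contraction M j t a⁆ + contraction M j t (a * UniversalEnvelopingAlgebra.ι ℂ x) :=
  (exists_contraction M j).choose_spec.1 x t a

theorem contraction_one (j : ℕ) (w : WedgeCarrier M j) (a : UniversalEnvelopingAlgebra ℂ 𝔞) :
    contraction M j (koszulMk M j 1 w) a =
      koszulMk M (j + 1) 1 (wedgeCons M j (ueaRetract 𝒜 a) w) :=
  (exists_contraction M j).choose_spec.2 w a

theorem koszulMk_one_mem (j k : ℕ) (w : WedgeCarrier M j) :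
    koszulMk M j 1 w ∈ indFilt (wedgeTensor M j) (k + 1) := one_mem_indFilt (wedgeTensor M j) k w

theorem contraction_mem (j p : ℕ) {t : KoszulCarrier M j} (ht : t ∈ indFilt (wedgeTensor M j) p)
    (a : UniversalEnvelopingAlgebra ℂ 𝔞) :
    contraction M j t a ∈ indFilt (wedgeTensor M (j + 1)) p := by
  induction p generalizing t a with
  | zero =>
    have : t = 0 := ht
    rw [this, map_zero, LinearMap.zero_apply]; exact zero_mem _
  | succ p ih =>
    induction ht using indFilt_induction with
    | h1 w =>
      have := contraction_one M j w a
      change contraction M j (koszulMk M j 1 w) a ∈ _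
      rw [this]
      exact koszulMk_one_mem M _ _ _
    | hlie x s hs =>
      rw [contraction_lie]
      exact add_mem (lie_mem_indFilt _ (ih hs a) x) (indFilt_mono _ p.le_succ (ih hs _))
    | hadd a c _ _ ha hc => rw [map_add, LinearMap.add_apply]; exact add_mem ha hc
    | hsmul d a _ ha => rw [map_smul, LinearMap.smul_apply]; exact Submodule.smul_mem _ d ha

/-- The differential as a linear map. -/
def koszulDLin (j : ℕ) : KoszulCarrier M (j + 1) →ₗ[ℂ] KoszulCarrier M j :=
  LieModuleHom.toLinearMap (koszulD M j).1

theorem koszulDLin_lie (j : ℕ) (x : 𝔞) (t : KoszulCarrier M (j + 1)) :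
    koszulDLin M j ⁅x, t⁆ = ⁅x, koszulDLin M j t⁆ := LieModuleHom.map_lie (koszulD M j).1 x t

theorem koszulDLin_one (j : ℕ) (w : WedgeCarrier M (j + 1)) :
    koszulDLin M j (koszulMk M (j + 1) 1 w) = koszulMap M j w := by
  have := koszulD_mk M j 1 w
  refine this.trans ?_
  rw [← lift_toEnd_ind, map_one]
  rfl

theorem koszulDLin_koszulDLin (j : ℕ) (t : KoszulCarrier M (j + 2)) :
    koszulDLin M j (koszulDLin M (j + 1) t) = 0 := koszulD_koszulD M j t

theorem koszulStep_mem (j : ℕ) (x : posPart 𝒜) (w : WedgeCarrier M j) :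
    koszulStep M j x w ∈ indFilt (wedgeTensor M j) 2 := by
  rw [koszulStep_apply]
  refine sub_mem ?_ (Submodule.smul_mem _ _ (koszulMk_one_mem M j 1 _))
  have := lie_mem_indFilt _ (koszulMk_one_mem M j 0 w) x
  rwa [lie_koszulMk, mul_one] at this

theorem koszulDLin_mem (j p : ℕ) {t : KoszulCarrier M (j + 1)}
    (ht : t ∈ indFilt (wedgeTensor M (j + 1)) p) :
    koszulDLin M j t ∈ indFilt (wedgeTensor M j) (p + 1) := by
  induction p generalizing t with
  | zero =>
    have : t = 0 := ht
    rw [this, map_zero]; exact zero_mem _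
  | succ p ih =>
    induction ht using indFilt_induction with
    | h1 w =>
      have := koszulDLin_one M j w
      change koszulDLin M j (koszulMk M (j + 1) 1 w) ∈ _
      rw [this]
      induction w using wedge_induction with
      | hadd a c ha hc => rw [map_add]; exact add_mem (ha (koszulDLin_one M j _)) (hc (koszulDLin_one M j _))
      | hsmul d a ha => rw [map_smul]; exact Submodule.smul_mem _ d (ha (koszulDLin_one M j _))
      | hmk x m =>
        rw [koszulMap_wedge]
        exact sum_mem fun i _ => zsmul_mem (indFilt_mono _ (by omega : 2 ≤ p + 1 + 1)
          (koszulStep_mem M j _ _)) _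
    | hlie x s hs =>
      rw [koszulDLin_lie]
      exact lie_mem_indFilt _ (ih hs) x
    | hadd a c _ _ ha hc => rw [map_add]; exact add_mem ha hc
    | hsmul d a _ ha => rw [map_smul]; exact Submodule.smul_mem _ d ha

/-- Because the retraction kills `1`, only the terms `xᵢ ⊗ …` of the differential contribute. Each
of the `j + 1` terms puts `xᵢ` back in its place, signs cancelling. -/
theorem contraction_koszulMap_one (j : ℕ) (w : WedgeCarrier M (j + 1)) :
    contraction M j (koszulMap M j w) 1 = ((j : ℂ) + 1) • koszulMk M (j + 1) 1 w := by
  have hstep : ∀ (x : posPart 𝒜) w, contraction M j (koszulStep M j x w) 1 =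
      koszulMk M (j + 1) 1 (wedgeCons M j x w) := by
    intro x w
    have h1 : koszulMk M j (UniversalEnvelopingAlgebra.ι ℂ (x : 𝔞)) w =
        ⁅(x : 𝔞), koszulMk M j 1 w⁆ := by rw [lie_koszulMk, mul_one]
    rw [koszulStep_apply, h1, map_sub, map_smul, LinearMap.sub_apply, LinearMap.smul_apply,
      contraction_lie, contraction_one, contraction_one, contraction_one, ueaRetract_one, one_mul,
      ueaRetract_ι, map_zero, LinearMap.zero_apply, LinearMap.zero_apply, map_zero, lie_zero,
      smul_zero, sub_zero, zero_add]
  induction w using wedge_induction with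
  | hadd a c ha hc => simp only [map_add, LinearMap.add_apply, ha, hc, smul_add]
  | hsmul d a ha => simp only [map_smul, LinearMap.smul_apply, ha, smul_comm _ d]
  | hmk x m =>
    rw [koszulMap_wedge, map_sum, LinearMap.sum_apply]
    have : ∀ i : Fin (j + 1), (contraction M j ((-1 : ℤ) ^ (i : ℕ) •
        koszulStep M j (x i) (wedge M j (i.removeNth x) m))) 1 =
        koszulMk M (j + 1) 1 (wedge M (j + 1) x m) := by
      intro i
      rw [map_zsmul, LinearMap.smul_apply, hstep, ← map_zsmul, wedgeCons_removeNth]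
    rw [Finset.sum_congr rfl fun i _ => this i, Finset.sum_const, Finset.card_univ, Fintype.card_fin,
      ← Nat.cast_smul_eq_nsmul ℂ]
    push_cast
    rfl

/-- For a summand `z ⊗ w` of the differential, `h` at `x` gives `z ⊗ (x ∧ w)` plus the generator `1
⊗ (e(x z) ∧ w)`, with `e` the retraction. Exterior multiplication by `x` has to be done in the free
model before projecting. -/
theorem contraction_koszulMap_sub_mem (j : ℕ) (x : posPart 𝒜) (w : WedgeCarrier M (j + 1)) :
    contraction M j (koszulMap M j w) (UniversalEnvelopingAlgebra.ι ℂ (x : 𝔞)) -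
      freeProj M (j + 1) (freeCons M j x (freeMap M j w)) ∈ indFilt (wedgeTensor M (j + 1)) 1 := by
  have hstep : ∀ (z : posPart 𝒜) w,
      contraction M j (koszulStep M j z w) (UniversalEnvelopingAlgebra.ι ℂ (x : 𝔞)) -
      freeProj M (j + 1) (freeCons M j x (freeStep M j z w)) ∈
        indFilt (wedgeTensor M (j + 1)) 1 := by
    intro z w
    have h1 : koszulMk M j (UniversalEnvelopingAlgebra.ι ℂ (z : 𝔞)) w =
        ⁅(z : 𝔞), koszulMk M j 1 w⁆ := by rw [lie_koszulMk, mul_one]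
    rw [koszulStep_apply, freeStep_apply, h1, map_sub, map_smul, LinearMap.sub_apply,
      LinearMap.smul_apply, contraction_lie, contraction_one, contraction_one, contraction_one,
      ueaRetract_ι, map_sub, LinearMap.map_smul_of_tower, freeCons_tmul, freeCons_tmul, map_sub,
      map_smul, freeProj_tmul, freeProj_tmul, lie_koszulMk, mul_one]
    rw [sub_sub_sub_cancel_right, add_sub_cancel_left]
    exact koszulMk_one_mem M _ 0 _
  induction w using wedge_induction with
  | hadd a c ha hc =>
    simp only [map_add, LinearMap.add_apply]
    rw [add_sub_add_comm]
    exact add_mem ha hc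
  | hsmul d a ha =>
    simp only [map_smul, LinearMap.smul_apply, LinearMap.map_smul_of_tower]
    rw [← smul_sub]
    exact Submodule.smul_mem _ d ha
  | hmk v m =>
    rw [koszulMap_wedge, freeMap_wedge]
    simp only [map_sum, LinearMap.sum_apply, map_zsmul, LinearMap.smul_apply]
    rw [← Finset.sum_sub_distrib]
    refine sum_mem fun i _ => ?_
    rw [← smul_sub]
    exact zsmul_mem (hstep _ _) _

/-- Projected Cartan formula. Its last term cancels the leading part of `h d w` at `x`, so that `(dh
+ hd) w` at `x` equals `x w` modulo generators. -/
theorem koszulMap_wedgeCons (j : ℕ) (x : posPart 𝒜) (w : WedgeCarrier M (j + 1)) :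
    koszulMap M (j + 1) (wedgeCons M (j + 1) x w) = ⁅(x : 𝔞), koszulMk M (j + 1) 1 w⁆ -
      koszulMk M (j + 1) 1 (wedgeAd M (j + 1) x w) -
        freeProj M (j + 1) (freeCons M j x (freeMap M j w)) := by
  rw [← freeProj_freeMap, freeMap_wedgeCons, map_sub, freeTheta_tmul, map_sub, freeProj_tmul,
    freeProj_tmul, lie_koszulMk, mul_one, one_mul]

theorem koszulMap_wedgeCons_zero (x : posPart 𝒜) (w : WedgeCarrier M 0) :
    koszulMap M 0 (wedgeCons M 0 x w) = ⁅(x : 𝔞), koszulMk M 0 1 w⁆ := by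
  rw [← freeProj_freeMap, freeMap_wedgeCons_zero, freeTheta_tmul, map_sub, freeProj_tmul,
    freeProj_tmul, lie_koszulMk, mul_one, one_mul, wedgeAd_zero, map_zero, sub_zero]

/-- In exterior degree zero there is no `hd`, and `dh` counts only the factors from `𝔞₊`; its scalar
vanishes on the generators. -/
theorem homotopy_zero (p : ℕ) {t : KoszulCarrier M 0}
    (ht : t ∈ indFilt (wedgeTensor M 0) (p + 1)) :
    koszulDLin M 0 (contraction M 0 t 1) - (p : ℂ) • t ∈ indFilt (wedgeTensor M 0) p := by
  have := homotopy_sub_mem_indFilt ((contraction M 0).compr₂ (koszulDLin M 0)) 0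
    (fun x t a => by
      simp only [LinearMap.compr₂_apply, contraction_lie, map_add, koszulDLin_lie])
    (fun p t ht a => koszulDLin_mem M 0 p (contraction_mem M 0 p ht a))
    (fun x (w : WedgeCarrier M 0) => by
      have h1 : koszulDLin M 0 (contraction M 0 (koszulMk M 0 1 w)
          (UniversalEnvelopingAlgebra.ι ℂ (x : 𝔞))) = ⁅(x : 𝔞), koszulMk M 0 1 w⁆ := by
        rw [contraction_one, ueaRetract_ι, koszulDLin_one, koszulMap_wedgeCons_zero]
      exact (sub_eq_zero.mpr h1).symm ▸ zero_mem _)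
    (fun (w : WedgeCarrier M 0) => by
      have h1 : koszulDLin M 0 (contraction M 0 (koszulMk M 0 1 w) 1) = 0 := by
        rw [contraction_one, ueaRetract_one, map_zero, LinearMap.zero_apply, map_zero, map_zero]
      rw [zero_smul]
      exact h1)
    p ht
  have h0 : (0 : ℂ) + p = p := zero_add _
  rw [h0] at this
  exact this

/-- The analogue of the Koszul identity on `S(𝔞₊) ⊗ ⋀ 𝔞₊`, where `dh + hd` multiplies by total
degree: `j + 1` from the exterior part and `p` from the number of factors. -/
theorem homotopy_succ (j p : ℕ) {t : KoszulCarrier M (j + 1)}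
    (ht : t ∈ indFilt (wedgeTensor M (j + 1)) (p + 1)) :
    koszulDLin M (j + 1) (contraction M (j + 1) t 1) + contraction M j (koszulDLin M j t) 1 -
      ((j : ℂ) + 1 + p) • t ∈ indFilt (wedgeTensor M (j + 1)) p := by
  refine homotopy_sub_mem_indFilt ((contraction M (j + 1)).compr₂ (koszulDLin M (j + 1)) +
    contraction M j ∘ₗ koszulDLin M j) ((j : ℂ) + 1)
    (fun x t a => ?_) (fun p t ht a => ?_) (fun x (w : WedgeCarrier M (j + 1)) => ?_)
    (fun (w : WedgeCarrier M (j + 1)) => ?_) p ht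
  · simp only [LinearMap.add_apply, LinearMap.comp_apply, LinearMap.compr₂_apply, contraction_lie,
      map_add, koszulDLin_lie, lie_add]
    abel
  · exact add_mem (koszulDLin_mem M _ p (contraction_mem M _ p ht a))
      (contraction_mem M j _ (koszulDLin_mem M j p ht) a)
  · have h1 : koszulDLin M (j + 1) (contraction M (j + 1) (koszulMk M (j + 1) 1 w)
        (UniversalEnvelopingAlgebra.ι ℂ (x : 𝔞))) + contraction M j (koszulDLin M j
        (koszulMk M (j + 1) 1 w)) (UniversalEnvelopingAlgebra.ι ℂ (x : 𝔞)) -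
          ⁅(x : 𝔞), koszulMk M (j + 1) 1 w⁆ =
        (contraction M j (koszulMap M j w) (UniversalEnvelopingAlgebra.ι ℂ (x : 𝔞)) -
          freeProj M (j + 1) (freeCons M j x (freeMap M j w))) -
          koszulMk M (j + 1) 1 (wedgeAd M (j + 1) x w) := by
      rw [contraction_one, ueaRetract_ι, koszulDLin_one, koszulDLin_one, koszulMap_wedgeCons]
      abel
    have h2 := sub_mem (contraction_koszulMap_sub_mem M j x w)
      (koszulMk_one_mem M (j + 1) 0 (wedgeAd M (j + 1) x w))
    rw [← h1] at h2
    exact h2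
  · have h1 : koszulDLin M (j + 1) (contraction M (j + 1) (koszulMk M (j + 1) 1 w) 1) +
        contraction M j (koszulDLin M j (koszulMk M (j + 1) 1 w)) 1 =
        ((j : ℂ) + 1) • koszulMk M (j + 1) 1 w := by
      rw [contraction_one, ueaRetract_one, map_zero, LinearMap.zero_apply, map_zero, map_zero,
        zero_add, koszulDLin_one, contraction_koszulMap_one]
    exact h1

/-- Acyclicity of the Koszul complex in positive degrees. -/
theorem exists_koszulD_eq (j : ℕ) {t : KoszulCarrier M (j + 1)} (ht : koszulDLin M j t = 0) :
    ∃ s, koszulDLin M (j + 1) s = t := by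
  obtain ⟨p, hp⟩ := exists_mem_indFilt (wedgeTensor M (j + 1)) t
  induction p generalizing t with
  | zero => exact ⟨0, by rw [map_zero]; exact (show t = 0 from hp).symm⟩
  | succ p ih =>
    have h1 := homotopy_succ M j p hp
    rw [ht, map_zero, LinearMap.zero_apply, add_zero] at h1
    -- For a cycle `t`, the difference between `d h t` and a nonzero multiple of `t` is a cycle one
    -- level lower, hence a boundary.
    obtain ⟨s, hs⟩ := ih (by rw [map_sub, koszulDLin_koszulDLin, map_smul, ht, smul_zero, sub_zero]) h1
    have hc : ((j : ℂ) + 1 + p) ≠ 0 := by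
      have : ((j + 1 + p : ℕ) : ℂ) ≠ 0 := Nat.cast_ne_zero.mpr (by omega)
      push_cast at this
      exact this
    refine ⟨((j : ℂ) + 1 + p)⁻¹ • (contraction M (j + 1) t 1 - s), ?_⟩
    rw [map_smul, map_sub, hs, sub_sub_cancel, inv_smul_smul₀ hc]

/-- Acyclicity of the augmented Koszul complex in degree zero. -/
theorem exists_koszulD_zero_eq {N : Type*} [AddCommGroup N] [Module ℂ N]
    (ε : KoszulCarrier M 0 →ₗ[ℂ] N) (hε : ∀ s, ε (koszulDLin M 0 s) = 0)
    (hinj : ∀ w, ε (koszulMk M 0 1 w) = 0 → koszulMk M 0 1 w = 0)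
    {t : KoszulCarrier M 0} (ht : ε t = 0) : ∃ s, koszulDLin M 0 s = t := by
  obtain ⟨p, hp⟩ := exists_mem_indFilt (wedgeTensor M 0) t
  induction p generalizing t with
  | zero => exact ⟨0, by rw [map_zero]; exact (show t = 0 from hp).symm⟩
  | succ p ih =>
    -- At `p = 0` the scalar vanishes and cannot be divided out. But level one consists of
    -- generators, on which `ε` is injective.
    rcases Nat.eq_zero_or_pos p with rfl | hpos
    · obtain ⟨w, rfl⟩ : ∃ w, t = koszulMk M 0 1 w := by
        clear ht ih
        induction hp using indFilt_induction with
        | h1 w => exact ⟨w, rfl⟩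
        | hlie x s hs =>
          have : s = 0 := hs
          exact ⟨0, by rw [this, lie_zero, map_zero]⟩
        | hadd a c _ _ ha hc =>
          obtain ⟨w, rfl⟩ := ha
          obtain ⟨w', rfl⟩ := hc
          exact ⟨w + w', (map_add _ _ _).symm⟩
        | hsmul d a _ ha =>
          obtain ⟨w, rfl⟩ := ha
          exact ⟨d • w, (map_smul _ _ _).symm⟩
      exact ⟨0, by rw [map_zero, hinj w ht]⟩
    · obtain ⟨s, hs⟩ := ih (by rw [map_sub, hε, map_smul, ht, smul_zero, sub_zero])
        (homotopy_zero M p hp)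
      have hc : (p : ℂ) ≠ 0 := Nat.cast_ne_zero.mpr (by omega)
      refine ⟨(p : ℂ)⁻¹ • (contraction M 0 t 1 - s), ?_⟩
      rw [map_smul, map_sub, hs, sub_sub_cancel, inv_smul_smul₀ hc]

end Exactness

/-! ### Graded pieces of induced modules. -/

section Pieces

variable {𝔞 : Type u} [LieRing 𝔞] [LieAlgebra ℂ 𝔞] {𝒜 : ℕ → Submodule ℂ 𝔞} [GradedLieAlgebra 𝒜]
  (N : GrZeroMod 𝒜)

open TensorProduct

/-- The graded piece `N[k]` as a `𝔤`-module. -/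
def GrZeroMod.piece (k : ℤ) : LieSubmodule ℂ (zeroPart 𝒜) N.carrier where
  __ := N.gr k
  lie_mem := N.lie_mem k _ _

theorem lie_indMk_one (y : zeroPart 𝒜) (m : N.carrier) :
    ⁅(y : 𝔞), indMk N 1 m⁆ = indMk N 1 ⁅y, m⁆ := by
  rw [lie_indMk, mul_one, ← indMk_mul, one_mul]

/-- The graded pieces of an induced module are the smallest family of subspaces which contains the
generators and is stable under `𝔞`. -/
theorem indPiece_le {S : ℤ → Submodule ℂ (IndCarrier N)}
    (hone : ∀ k, ∀ m ∈ N.gr k, indMk N 1 m ∈ S k)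
    (hlie : ∀ (n : ℕ) k, ∀ x ∈ 𝒜 n, ∀ t ∈ S k, ⁅x, t⁆ ∈ S (n + k)) (k : ℤ) :
    indPiece N k ≤ S k := by
  rw [indPiece, Submodule.span_le]
  rintro _ ⟨i, l, u, m, hu, hm, rfl, rfl⟩
  change indMk N u m ∈ S (i + l)
  induction hu using Submodule.span_induction with
  | zero => simp
  | add a c _ _ ha hc => rw [map_add, LinearMap.add_apply]; exact add_mem ha hc
  | smul d a _ ha => rw [map_smul]; exact Submodule.smul_mem _ d ha
  | mem u hu =>
    obtain ⟨L, rfl, rfl⟩ := hu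
    induction L with
    | nil => simpa using hone l m hm
    | cons p L ih =>
      have := hlie p.1 _ _ p.2.2 _ ih
      simp only [List.map_cons, List.prod_cons, List.sum_cons, Nat.cast_add]
      rw [lie_indMk] at this
      rwa [add_assoc]

theorem indMk_one_mem {k : ℤ} {m : N.carrier} (hm : m ∈ N.gr k) : indMk N 1 m ∈ indPiece N k :=
  indMk_mem N one_mem_ueaPiece hm (by simp)

theorem indPiece_eq_bot {s : ℤ} (hN : ∀ k < s, N.gr k = ⊥) {k : ℤ} (hk : k < s) :
    indPiece N k = ⊥ := by
  have h := indPiece_le N (S := fun k => if k < s then ⊥ else ⊤) (fun k m hm => ?_)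
    (fun n k x _ t ht => ?_) k
  · simpa [hk] using h
  · by_cases hk : k < s
    · rw [hN k hk] at hm
      have : m = 0 := hm
      simp [this]
    · simp [hk]
  · by_cases hk : k < s
    · have : t = 0 := by simpa [hk] using ht
      rw [this, lie_zero]; exact zero_mem _
    · have : ¬ ((n : ℤ) + k < s) := by omega
      simp [this]

/-- The bracket as a bilinear map. -/
def indBracket : 𝔞 →ₗ[ℂ] IndCarrier N →ₗ[ℂ] IndCarrier N := LieModule.toEnd ℂ 𝔞 (IndCarrier N)

/-- The right-hand side contains the generators and is stable under `𝔞`: positive degrees by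
construction, degree zero by the Leibniz rule. It expresses each piece through strictly lower ones.
-/
theorem indPiece_le_sup (k : ℤ) : indPiece N k ≤ (N.gr k).map (indMk N 1) ⊔
    ⨆ n : ℕ, Submodule.map₂ (indBracket N) (𝒜 (n + 1)) (indPiece N (k - (n + 1))) := by
  set S : ℤ → Submodule ℂ (IndCarrier N) := fun k => (N.gr k).map (indMk N 1) ⊔
    ⨆ n : ℕ, Submodule.map₂ (indBracket N) (𝒜 (n + 1)) (indPiece N (k - (n + 1)))
  have hmem : ∀ (n : ℕ) (k l : ℤ), ∀ x ∈ 𝒜 (n + 1), ∀ t ∈ indPiece N k, l = (n + 1) + k →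
      ⁅x, t⁆ ∈ S l := by
    rintro n k l x hx t ht rfl
    refine Submodule.mem_sup_right (Submodule.mem_iSup_of_mem n
      (Submodule.apply_mem_map₂ (indBracket N) hx ?_))
    rwa [add_sub_cancel_left]
  have hle : ∀ k, S k ≤ indPiece N k := by
    intro k
    refine sup_le ?_ (iSup_le fun n => Submodule.map₂_le.mpr fun x hx t ht => ?_)
    · rintro _ ⟨m, hm, rfl⟩
      exact indMk_one_mem N hm
    · have h := (Ind N).lie_mem (n + 1) _ x t hx ht
      have h0 : ((n + 1 : ℕ) : ℤ) + (k - (n + 1)) = k := by push_cast; ring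
      rw [h0] at h
      exact h
  refine indPiece_le N (S := S) (fun k m hm => Submodule.mem_sup_left ⟨m, hm, rfl⟩)
    (fun n l x hx t ht => ?_) k
  cases n with
  | succ n => exact hmem n l _ x hx t (hle l ht) (by push_cast; ring)
  | zero =>
    have h0 : ((0 : ℕ) : ℤ) + l = l := by simp
    rw [h0]
    have hcomap : S l ≤ (S l).comap (indBracket N x) := by
      refine sup_le ?_ (iSup_le fun n => Submodule.map₂_le.mpr fun z hz t ht => ?_)
      · rintro _ ⟨m, hm, rfl⟩
        refine Submodule.mem_sup_left ⟨⁅(⟨x, hx⟩ : zeroPart 𝒜), m⁆, N.lie_mem l _ m hm, ?_⟩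
        exact (lie_indMk_one N ⟨x, hx⟩ m).symm
      · change ⁅x, ⁅z, t⁆⁆ ∈ S l
        rw [leibniz_lie]
        have hb := bracket_mem 𝒜 hx hz
        rw [zero_add] at hb
        have ht' := (Ind N).lie_mem 0 _ x t hx ht
        rw [Nat.cast_zero, zero_add] at ht'
        exact add_mem (hmem n _ _ _ hb t ht (by ring)) (hmem n _ _ _ hz _ ht' (by ring))
    exact hcomap ht

/-- In the lowest degree, an induced module consists of its generators. -/
theorem indPiece_lowest {s : ℤ} (hN : ∀ k < s, N.gr k = ⊥) {t : IndCarrier N}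
    (ht : t ∈ indPiece N s) : ∃ m ∈ N.gr s, indMk N 1 m = t := by
  have h := indPiece_le_sup N s ht
  have h0 : ⨆ n : ℕ, Submodule.map₂ (indBracket N) (𝒜 (n + 1)) (indPiece N (s - (n + 1))) = ⊥ := by
    rw [iSup_eq_bot]
    intro n
    rw [indPiece_eq_bot N hN (by omega), Submodule.map₂_bot_right]
  rw [h0, sup_bot_eq] at h
  exact h

variable [∀ n, FiniteDimensional ℂ (𝒜 n)]

/-- Pieces below degree `s` vanish, so only finitely many lower pieces enter the recursion, and each
has already been treated. -/
theorem indPiece_fg {s : ℤ} (hN : ∀ k < s, N.gr k = ⊥) (hfg : ∀ k, (N.gr k).FG) (k : ℤ) :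
    (indPiece N k).FG := by
  by_cases hk : k < s
  · rw [indPiece_eq_bot N hN hk]; exact Submodule.fg_bot
  obtain ⟨d, rfl⟩ : ∃ d : ℕ, k = s + d := ⟨(k - s).toNat, by omega⟩
  clear hk
  induction d using Nat.strong_induction_on with
  | _ d ih =>
  have hle : indPiece N (s + d) ≤ (N.gr (s + d)).map (indMk N 1) ⊔ ⨆ n ∈ Finset.range d,
      Submodule.map₂ (indBracket N) (𝒜 (n + 1)) (indPiece N (s + d - (n + 1))) := by
    refine (indPiece_le_sup N _).trans (sup_le_sup le_rfl (iSup_le fun n => ?_))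
    by_cases hn : n < d
    · exact le_biSup (fun n : ℕ => Submodule.map₂ (indBracket N) (𝒜 (n + 1))
        (indPiece N (s + d - (n + 1)))) (Finset.mem_range.mpr hn)
    · rw [indPiece_eq_bot N hN (by omega), Submodule.map₂_bot_right]; exact bot_le
  have hFG : ((N.gr (s + d)).map (indMk N 1) ⊔ ⨆ n ∈ Finset.range d,
      Submodule.map₂ (indBracket N) (𝒜 (n + 1)) (indPiece N (s + d - (n + 1)))).FG := by
    refine ((hfg _).map _).sup (Submodule.fg_biSup _ _ fun n hn => ?_)
    have hn' := Finset.mem_range.mp hn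
    have h1 : s + d - ((n : ℤ) + 1) = s + (d - (n + 1) : ℕ) := by omega
    rw [h1]
    exact Submodule.FG.map₂ _ (Submodule.FG.of_finite) (ih _ (by omega))
  exact Submodule.FG.of_le hFG hle

end Pieces

/-! ### Graded pieces of `⋀ʲ 𝔞₊ ⊗ M`. -/

section WedgePieces

variable {𝔞 : Type u} [LieRing 𝔞] [LieAlgebra ℂ 𝔞] {𝒜 : ℕ → Submodule ℂ 𝔞} [GradedLieAlgebra 𝒜]
  (M : GrZeroMod 𝒜)

variable (𝒜) in
/-- The homogeneous elements of `𝔞₊` of degree `n`. -/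
def posPiece (n : ℕ) : LieSubmodule ℂ (zeroPart 𝒜) (posPart 𝒜) where
  __ := (𝒜 n).comap (posPart 𝒜).toSubmodule.subtype
  lie_mem := by
    intro y x hx
    have h := bracket_mem 𝒜 (m := 0) y.2 (show (x : 𝔞) ∈ 𝒜 n from hx)
    rw [zero_add] at h
    exact h

instance [∀ n, FiniteDimensional ℂ (𝒜 n)] (n : ℕ) : FiniteDimensional ℂ (posPiece 𝒜 n) := by
  let f : posPiece 𝒜 n →ₗ[ℂ] 𝒜 n :=
    { toFun := fun x => ⟨(x : posPart 𝒜), x.2⟩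
      map_add' := fun _ _ => rfl
      map_smul' := fun _ _ => rfl }
  refine FiniteDimensional.of_injective f fun x y h => ?_
  exact Subtype.ext (Subtype.ext (congrArg (fun z : 𝒜 n => (z : 𝔞)) h))

theorem eq_zero_of_mem_posPiece_zero {x : posPart 𝒜} (hx : x ∈ posPiece 𝒜 0) : x = 0 := by
  have h : ∀ z ∈ posPart 𝒜, projZero 𝒜 z = 0 := by
    intro z hz
    induction hz using posPart_induction with
    | hmem n z hz => exact projZero_of_mem_ne 𝒜 n.succ_ne_zero hz
    | hadd a c _ _ ha hc => rw [map_add, ha, hc, add_zero]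
  have h1 := projZero_of_mem_zeroPart 𝒜 (⟨(x : 𝔞), hx⟩ : zeroPart 𝒜)
  have h2 := h x x.2
  rw [h2] at h1
  exact Subtype.ext (congrArg (fun z : zeroPart 𝒜 => (z : 𝔞)) h1).symm

/-- The graded pieces of `⋀ʲ⁺¹ 𝔞₊ ⊗ M` are spanned by exterior products with homogeneous elements. -/
theorem wedgePiece_succ_le (j : ℕ) (k : ℤ) : wedgePiece M (j + 1) k ≤
    ⨆ n : ℕ, Submodule.map₂ (wedgeCons M j) (posPiece 𝒜 (n + 1)).toSubmodule
      (wedgePiece M j (k - (n + 1))) := by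
  rw [wedgePiece, Submodule.span_le]
  rintro _ ⟨x, n, i, m, hx, hm, rfl, rfl⟩
  have hx' : Matrix.vecCons (x 0) (Fin.tail x) = x := Fin.cons_self_tail x
  rw [← hx', ← wedgeCons_wedge]
  have hmem : x 0 ∈ posPiece 𝒜 (n 0) := hx 0
  rcases hn : n 0 with _ | l
  · rw [hn] at hmem
    rw [eq_zero_of_mem_posPiece_zero hmem, map_zero]
    exact zero_mem _
  · rw [hn] at hmem
    refine Submodule.mem_iSup_of_mem l (Submodule.apply_mem_map₂ _ hmem ?_)
    refine wedge_mem M j (n := fun p => n p.succ) (fun p => hx p.succ) hm ?_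
    rw [Fin.sum_univ_succ, hn]
    push_cast
    ring

theorem wedgeCons_mem {j n : ℕ} {k : ℤ} {x : posPart 𝒜} (hx : x ∈ posPiece 𝒜 n)
    {w : WedgeCarrier M j} (hw : w ∈ wedgePiece M j k) :
    wedgeCons M j x w ∈ wedgePiece M (j + 1) (n + k) := by
  induction hw using Submodule.span_induction with
  | zero => rw [map_zero]; exact zero_mem _
  | add a c _ _ ha hc => rw [map_add]; exact add_mem ha hc
  | smul d a _ ha => rw [map_smul]; exact Submodule.smul_mem _ d ha
  | mem w hw =>
    obtain ⟨v, l, i, m, hv, hm, rfl, rfl⟩ := hw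
    rw [wedgeCons_wedge]
    refine wedge_mem M (j + 1) (n := Fin.cons n l) (Fin.cases hx hv) hm ?_
    rw [Fin.sum_univ_succ]
    simp only [Fin.cons_zero, Fin.cons_succ]
    push_cast
    ring

theorem wedgePiece_zero_le (k : ℤ) : wedgePiece M 0 k ≤
    (M.gr k).map (wedgeMk M 0 (exteriorPower.ιMulti ℂ 0 Fin.elim0)) := by
  rw [wedgePiece, Submodule.span_le]
  rintro _ ⟨x, n, i, m, hx, hm, rfl, rfl⟩
  refine ⟨m, by simpa using hm, ?_⟩
  have : x = Fin.elim0 := Subsingleton.elim _ _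
  rw [this]
  rfl

/-- Every exterior factor has degree at least one, so the lowest degree rises with `j`. This is the
source of the finiteness of the truncated resolution. -/
theorem wedgePiece_eq_bot {s : ℤ} (hM : ∀ k < s, M.gr k = ⊥) (j : ℕ) {k : ℤ} (hk : k < s + j) :
    wedgePiece M j k = ⊥ := by
  induction j generalizing k with
  | zero =>
    have h := wedgePiece_zero_le M k
    rw [hM k (by simpa using hk), Submodule.map_bot] at h
    exact le_bot_iff.mp h
  | succ j ih =>
    refine le_bot_iff.mp ((wedgePiece_succ_le M j k).trans (iSup_le fun n => ?_))
    rw [ih (by push_cast at hk; omega), Submodule.map₂_bot_right]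

theorem wedgePiece_fg [∀ n, FiniteDimensional ℂ (𝒜 n)] {s : ℤ} (hM : ∀ k < s, M.gr k = ⊥)
    (hfg : ∀ k, (M.gr k).FG) (j : ℕ) (k : ℤ) : (wedgePiece M j k).FG := by
  induction j generalizing k with
  | zero => exact Submodule.FG.of_le ((hfg k).map _) (wedgePiece_zero_le M k)
  | succ j ih =>
    have hle : wedgePiece M (j + 1) k ≤ ⨆ n ∈ Finset.range (k - s).toNat,
        Submodule.map₂ (wedgeCons M j) (posPiece 𝒜 (n + 1)).toSubmodule
          (wedgePiece M j (k - (n + 1))) := by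
      refine (wedgePiece_succ_le M j k).trans (iSup_le fun n => ?_)
      by_cases hn : n < (k - s).toNat
      · exact le_biSup (fun n : ℕ => Submodule.map₂ (wedgeCons M j)
          (posPiece 𝒜 (n + 1)).toSubmodule (wedgePiece M j (k - (n + 1)))) (Finset.mem_range.mpr hn)
      · rw [wedgePiece_eq_bot M hM j (by omega), Submodule.map₂_bot_right]; exact bot_le
    refine Submodule.FG.of_le (Submodule.fg_biSup _ _ fun n _ => ?_) hle
    have : Module.Finite ℂ (posPiece 𝒜 (n + 1)).toSubmodule :=
      inferInstanceAs (Module.Finite ℂ (posPiece 𝒜 (n + 1)))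
    exact Submodule.FG.map₂ _ (Submodule.FG.of_finite) (ih _)

end WedgePieces

/-! ### Projections onto graded pieces. -/

section Projections

variable {𝔞 : Type u} [LieRing 𝔞] [LieAlgebra ℂ 𝔞] {𝒜 : ℕ → Submodule ℂ 𝔞} [GradedLieAlgebra 𝒜]

theorem GrMod.homogeneous_induction (V : GrMod 𝒜) {p : V.carrier → Prop}
    (hmem : ∀ k, ∀ v ∈ V.gr k, p v) (hadd : ∀ v w, p v → p w → p (v + w)) (v : V.carrier) :
    p v := by
  have hv : v ∈ ⨆ k, V.gr k := by rw [iSup_eq_top_of_isInternal V.isInternal]; trivial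
  induction hv using Submodule.iSup_induction' with
  | mem k v hv => exact hmem k v hv
  | zero => exact hmem 0 0 (zero_mem _)
  | add a c _ _ ha hc => exact hadd a c ha hc

theorem GrMod.exists_proj (V : GrMod 𝒜) (k : ℤ) : ∃ π : V.carrier →ₗ⁅ℂ,zeroPart 𝒜⁆ V.piece k,
    (∀ v ∈ V.gr k, (π v : V.carrier) = v) ∧ ∀ l ≠ k, ∀ v ∈ V.gr l, π v = 0 := by
  obtain ⟨φ, hφ⟩ := exists_scaling V.gr V.isInternal (fun l => if l = k then 1 else 0)
  have h1 : ∀ v ∈ V.gr k, φ v = v := fun v hv => by simpa using hφ k v hv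
  have h2 : ∀ l ≠ k, ∀ v ∈ V.gr l, φ v = 0 := fun l hl v hv => by simpa [hl] using hφ l v hv
  have hmem : ∀ v, φ v ∈ V.gr k := by
    intro v
    induction v using V.homogeneous_induction with
    | hmem l v hv =>
      by_cases hl : l = k
      · subst hl; rw [h1 v hv]; exact hv
      · rw [h2 l hl v hv]; exact zero_mem _
    | hadd v w hv hw => rw [map_add]; exact add_mem hv hw
  refine ⟨{ φ.codRestrict (V.piece k).toSubmodule hmem with map_lie' := ?_ }, h1, fun l hl v hv =>
    Subtype.ext (h2 l hl v hv)⟩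
  intro y v
  refine Subtype.ext ?_
  change φ ⁅y, v⁆ = ⁅y, φ v⁆
  induction v using V.homogeneous_induction with
  | hmem l v hv =>
    have hyv : ⁅y, v⁆ ∈ V.gr l := (V.piece l).lie_mem hv
    by_cases hl : l = k
    · subst hl; rw [h1 v hv, h1 _ hyv]
    · rw [h2 l hl v hv, h2 l hl _ hyv, lie_zero]
  | hadd v w hv hw => rw [lie_add, map_add, map_add, lie_add, hv, hw]

/-- The projection of a graded module onto its graded piece of degree `k`. -/
def GrMod.proj (V : GrMod 𝒜) (k : ℤ) : V.carrier →ₗ⁅ℂ,zeroPart 𝒜⁆ V.piece k :=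
  (V.exists_proj k).choose

theorem GrMod.proj_of_mem (V : GrMod 𝒜) {k : ℤ} {v : V.carrier} (hv : v ∈ V.gr k) :
    V.proj k v = ⟨v, hv⟩ :=
  Subtype.ext ((V.exists_proj k).choose_spec.1 v hv)

theorem GrMod.proj_of_mem_ne (V : GrMod 𝒜) {k l : ℤ} (h : l ≠ k) {v : V.carrier}
    (hv : v ∈ V.gr l) : V.proj k v = 0 :=
  (V.exists_proj k).choose_spec.2 l h v hv

theorem GrMod.exists_eq_sum (V : GrMod 𝒜) (v : V.carrier) :
    ∃ s : Finset ℤ, ∀ t, s ⊆ t → ∑ k ∈ t, (V.proj k v : V.carrier) = v := by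
  induction v using V.homogeneous_induction with
  | hmem l v hv =>
    refine ⟨{l}, fun t ht => ?_⟩
    rw [Finset.sum_eq_single_of_mem l (ht (Finset.mem_singleton_self l)), V.proj_of_mem hv]
    intro k _ hk
    rw [V.proj_of_mem_ne hk.symm hv]
    rfl
  | hadd v w hv hw =>
    obtain ⟨s, hs⟩ := hv
    obtain ⟨s', hs'⟩ := hw
    refine ⟨s ∪ s', fun t ht => ?_⟩
    simp only [map_add, LieSubmodule.coe_add, Finset.sum_add_distrib]
    rw [hs t (Finset.union_subset_left ht), hs' t (Finset.union_subset_right ht)]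

theorem GrMod.mem_of_forall_proj_mem (V : GrMod 𝒜) {S : Submodule ℂ V.carrier} {v : V.carrier}
    (h : ∀ k, (V.proj k v : V.carrier) ∈ S) : v ∈ S := by
  obtain ⟨s, hs⟩ := V.exists_eq_sum v
  rw [← hs s subset_rfl]
  exact sum_mem fun k _ => h k

/-- The restriction of a morphism to graded pieces. -/
def pieceMap {V W : GrMod 𝒜} (f : gHom V W) (k : ℤ) :
    V.piece k →ₗ⁅ℂ,zeroPart 𝒜⁆ W.piece k where
  toFun v := ⟨f.1 v, f.2 k v v.2⟩
  map_add' _ _ := Subtype.ext (map_add f.1 _ _)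
  map_smul' c _ := Subtype.ext (map_smul f.1 c _)
  map_lie' := fun {y v} => Subtype.ext (LieModuleHom.map_lie f.1 (y : 𝔞) (v : V.carrier))

theorem pieceMap_apply {V W : GrMod 𝒜} (f : gHom V W) (k : ℤ) (v : V.piece k) :
    ((pieceMap f k v : W.piece k) : W.carrier) = f.1 v := rfl

theorem proj_map {V W : GrMod 𝒜} (f : gHom V W) (k : ℤ) (v : V.carrier) :
    (W.proj k (f.1 v) : W.carrier) = f.1 (V.proj k v) := by
  induction v using V.homogeneous_induction with
  | hmem l v hv =>
    by_cases h : l = k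
    · subst h; rw [V.proj_of_mem hv, W.proj_of_mem (f.2 l v hv)]
    · rw [V.proj_of_mem_ne h hv, W.proj_of_mem_ne h (f.2 l v hv), LieSubmodule.coe_zero,
        LieSubmodule.coe_zero, map_zero]
  | hadd v w hv hw =>
    rw [map_add, map_add, map_add, LieSubmodule.coe_add, LieSubmodule.coe_add, map_add, hv, hw]

theorem pieceMap_surjective {V W : GrMod 𝒜} {f : gHom V W} (hf : Function.Surjective f.1)
    (k : ℤ) : Function.Surjective (pieceMap f k) := by
  rintro ⟨w, hw⟩
  obtain ⟨v, rfl⟩ := hf w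
  refine ⟨V.proj k v, Subtype.ext ?_⟩
  rw [pieceMap_apply, ← proj_map, W.proj_of_mem hw]

end Projections

/-! ### The decomposition `V = V_Γ ⊕ V_{Λ∖Γ}` and `𝔞`-stability. -/

section LowerTrunc

variable {𝔞 : Type u} [LieRing 𝔞] [LieAlgebra ℂ 𝔞] {𝒜 : ℕ → Submodule ℂ 𝔞} [GradedLieAlgebra 𝒜]
  [∀ n, FiniteDimensional ℂ (𝒜 n)] [LieAlgebra.IsKilling ℂ (zeroPart 𝒜)]
  {H : LieSubalgebra ℂ (zeroPart 𝒜)} [H.IsCartanSubalgebra]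

open LieAlgebra LieAlgebra.IsKilling

variable {b : (rootSystem H).Base}

/-- The dominant weights which occur in degree `k` in a set of parameters. -/
def degreeWeights (Φ : Set (Parameter b)) (k : ℤ) : Set (Module.Dual ℂ H) :=
  {μ | ∃ h : IsDominant b μ, ((⟨μ, h⟩, k) : Parameter b) ∈ Φ}

/-- Nonzero maximal vectors of a finite-dimensional module have dominant weight, so the other
functionals in `S` contribute nothing. It is needed because complements of sets of weights contain
non-dominant functionals. -/
theorem weightSpan_le_of_isDominant {X : Type*} [AddCommGroup X] [Module ℂ X]
    [LieRingModule (zeroPart 𝒜) X] [LieModule ℂ (zeroPart 𝒜) X] [FiniteDimensional ℂ X]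
    {S T : Set (Module.Dual ℂ H)} (h : ∀ μ ∈ S, IsDominant b μ → μ ∈ T) :
    weightSpan b X S ≤ weightSpan b X T := by
  rw [weightSpan, LieSubmodule.lieSpan_le]
  rintro v ⟨μ, hμ, hv⟩
  by_cases hv0 : v = 0
  · rw [hv0]; exact zero_mem _
  · exact LieSubmodule.subset_lieSpan ⟨μ, h μ hμ (hv.isDominant hv0), hv⟩

theorem isMaximalVector_coe {V : GrMod 𝒜} {k : ℤ} {μ : Module.Dual ℂ H} {v : V.piece k} :
    IsMaximalVector b μ (v : V.carrier) ↔ IsMaximalVector b μ v := by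
  simp only [IsMaximalVector, Subtype.ext_iff, LieSubmodule.coe_bracket, LieSubmodule.coe_smul,
    LieSubmodule.coe_zero]

theorem coe_mem_lowerTrunc {V : GrMod 𝒜} {Φ : Set (Parameter b)} {k : ℤ} {x : V.piece k}
    (hx : x ∈ weightSpan b (V.piece k) (degreeWeights Φ k)) : (x : V.carrier) ∈ lowerTrunc V Φ := by
  have h : weightSpan b (V.piece k) (degreeWeights Φ k) ≤
      (lowerTrunc V Φ).comap (V.piece k).incl := by
    rw [weightSpan, LieSubmodule.lieSpan_le]
    rintro v ⟨μ, ⟨hμ, hΦ⟩, hv⟩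
    exact LieSubmodule.subset_lieSpan ⟨_, hΦ, v.2, isMaximalVector_coe.mpr hv⟩
  exact h hx

/-- Membership is decided degree by degree, where the isotypic theory of finite-dimensional modules
applies. -/
theorem mem_lowerTrunc_iff {V : GrMod 𝒜} {Φ : Set (Parameter b)} {v : V.carrier} :
    v ∈ lowerTrunc V Φ ↔ ∀ k, V.proj k v ∈ weightSpan b (V.piece k) (degreeWeights Φ k) := by
  constructor
  · intro hv k
    have h : lowerTrunc V Φ ≤ (weightSpan b (V.piece k) (degreeWeights Φ k)).comap (V.proj k) := by
      rw [lowerTrunc, LieSubmodule.lieSpan_le]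
      rintro v ⟨w, hw, hv, hm⟩
      change V.proj k v ∈ weightSpan b (V.piece k) (degreeWeights Φ k)
      by_cases hk : w.2 = k
      · subst hk
        rw [V.proj_of_mem hv]
        exact LieSubmodule.subset_lieSpan ⟨w.1.1, ⟨w.1.2, hw⟩, isMaximalVector_coe.mp hm⟩
      · rw [V.proj_of_mem_ne hk hv]; exact zero_mem _
    exact h hv
  · exact fun h => V.mem_of_forall_proj_mem (S := (lowerTrunc V Φ).toSubmodule)
      fun k => coe_mem_lowerTrunc (h k)

theorem coe_mem_lowerTrunc_iff {V : GrMod 𝒜} {Φ : Set (Parameter b)} {k : ℤ} {x : V.piece k} :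
    (x : V.carrier) ∈ lowerTrunc V Φ ↔ x ∈ weightSpan b (V.piece k) (degreeWeights Φ k) := by
  refine ⟨fun h => ?_, coe_mem_lowerTrunc⟩
  have := mem_lowerTrunc_iff.mp h k
  rwa [V.proj_of_mem x.2] at this

theorem map_mem_lowerTrunc {V W : GrMod 𝒜} (f : gHom V W) {Φ : Set (Parameter b)} {v : V.carrier}
    (hv : v ∈ lowerTrunc V Φ) : f.1 v ∈ lowerTrunc W Φ := by
  rw [mem_lowerTrunc_iff] at hv ⊢
  intro k
  have h := weightSpan_map_le (pieceMap f k) _ (hv k)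
  have h2 : pieceMap f k (V.proj k v) = W.proj k (f.1 v) := Subtype.ext (proj_map f k v).symm
  rwa [h2] at h

theorem categoryGhat.finiteDimensional_piece {V : GrMod 𝒜} (hV : categoryGhat 𝒜 V) (k : ℤ) :
    FiniteDimensional ℂ (V.piece k) := hV k

theorem lowerTrunc_sup_compl {V : GrMod 𝒜} (hV : categoryGhat 𝒜 V) (Φ : Set (Parameter b)) :
    lowerTrunc V Φ ⊔ lowerTrunc V Φᶜ = ⊤ := by
  rw [eq_top_iff]
  intro v _
  induction v using V.homogeneous_induction with
  | hadd v w hv hw => exact add_mem (hv trivial) (hw trivial)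
  | hmem k v hv =>
    have := hV.finiteDimensional_piece k
    have hmem : (⟨v, hv⟩ : V.piece k) ∈ weightSpan b (V.piece k) (degreeWeights Φ k) ⊔
        weightSpan b (V.piece k) (degreeWeights Φ k)ᶜ := by
      rw [weightSpan_sup_compl]; trivial
    obtain ⟨x, hx, y, hy, hxy⟩ := (LieSubmodule.mem_sup _ _ _).mp hmem
    have hy' := weightSpan_le_of_isDominant (S := (degreeWeights Φ k)ᶜ) (T := degreeWeights Φᶜ k)
      (fun μ hμ hd => ⟨hd, fun hΦ => hμ ⟨hd, hΦ⟩⟩) hy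
    have hv' : v = x + y := (congrArg (fun z : V.piece k => (z : V.carrier)) hxy).symm
    rw [hv']
    exact add_mem (LieSubmodule.mem_sup_left (coe_mem_lowerTrunc hx))
      (LieSubmodule.mem_sup_right (coe_mem_lowerTrunc hy'))

theorem lowerTrunc_disjoint {V : GrMod 𝒜} (hV : categoryGhat 𝒜 V) {Φ Ψ : Set (Parameter b)}
    (h : Disjoint Φ Ψ) {v : V.carrier} (hΦ : v ∈ lowerTrunc V Φ) (hΨ : v ∈ lowerTrunc V Ψ) :
    v = 0 := by
  refine V.mem_of_forall_proj_mem (S := ⊥) fun k => ?_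
  have := hV.finiteDimensional_piece k
  have hd : Disjoint (degreeWeights Φ k) (degreeWeights Ψ k) :=
    Set.disjoint_left.mpr fun μ ⟨_, h1⟩ ⟨_, h2⟩ => Set.disjoint_left.mp h h1 h2
  have h0 : V.proj k v ∈ weightSpan b (V.piece k) (degreeWeights Φ k) ⊓
      weightSpan b (V.piece k) (degreeWeights Ψ k) :=
    ⟨mem_lowerTrunc_iff.mp hΦ k, mem_lowerTrunc_iff.mp hΨ k⟩
  rw [weightSpan_disjoint hd, LieSubmodule.mem_bot] at h0
  rw [h0]
  exact zero_mem _

theorem mem_of_mem_lowerTrunc {V : GrMod 𝒜} (hV : categoryGhat 𝒜 V) {Φ : Set (Parameter b)}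
    {w : Parameter b} {v : V.carrier} (hgr : v ∈ V.gr w.2) (hv : IsMaximalVector b w.1.1 v)
    (hv0 : v ≠ 0) (hmem : v ∈ lowerTrunc V Φ) : w ∈ Φ := by
  have := hV.finiteDimensional_piece w.2
  have h := (coe_mem_lowerTrunc_iff (x := ⟨v, hgr⟩)).mp hmem
  obtain ⟨_, h⟩ := mem_of_mem_weightSpan (isMaximalVector_coe.mp hv)
    (fun h0 => hv0 (congrArg (fun z : V.piece w.2 => (z : V.carrier)) h0)) h
  exact h

theorem lowerTrunc_mono {V : GrMod 𝒜} {Φ Ψ : Set (Parameter b)} (h : Φ ⊆ Ψ) :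
    lowerTrunc V Φ ≤ lowerTrunc V Ψ :=
  LieSubmodule.lieSpan_mono fun _ ⟨w, hw, hv⟩ => ⟨w, h hw, hv⟩

/-- When every parameter of `V` lies in `Ψ`, parameters outside `Ψ` have no nonzero maximal vectors
in `V`. -/
theorem lowerTrunc_inter {V : GrMod 𝒜} (hV : categoryGhat 𝒜 V) {Φ Ψ : Set (Parameter b)}
    (h : lowerTrunc V Ψ = ⊤) : lowerTrunc V (Φ ∩ Ψ) = lowerTrunc V Φ := by
  refine le_antisymm (lowerTrunc_mono Set.inter_subset_left) ?_
  rw [lowerTrunc, LieSubmodule.lieSpan_le]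
  rintro v ⟨w, hw, hgr, hv⟩
  by_cases hv0 : v = 0
  · rw [hv0]; exact zero_mem _
  · have hmem : v ∈ lowerTrunc V Ψ := by rw [h]; trivial
    exact LieSubmodule.subset_lieSpan ⟨w, ⟨hw, mem_of_mem_lowerTrunc hV hgr hv hv0 hmem⟩, hgr, hv⟩

/-- Sets of parameters which contain every parameter covering one of their members. -/
def CoverClosed (Φ : Set (Parameter b)) : Prop := ∀ α ∈ Φ, ∀ β, Covers β α → β ∈ Φ

/-- A highest weight `ν` in the image differs from some `μ` by a weight of `𝔞_n`, which says that
`(ν, n + k)` covers `(μ, k)`. Here `n > 0`, since `𝔞₊` has nothing in degree zero. -/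
theorem bilinear_mem_degreeWeights {Φ : Set (Parameter b)} (hΦ : CoverClosed Φ) {n : ℕ}
    {X Y : Type*} [AddCommGroup X] [Module ℂ X] [LieRingModule (zeroPart 𝒜) X]
    [LieModule ℂ (zeroPart 𝒜) X] [AddCommGroup Y] [Module ℂ Y] [LieRingModule (zeroPart 𝒜) Y]
    [LieModule ℂ (zeroPart 𝒜) Y] [FiniteDimensional ℂ Y]
    (B : posPiece 𝒜 n →ₗ[ℂ] X →ₗ[ℂ] Y)
    (hB : ∀ (l : zeroPart 𝒜) a x, ⁅l, B a x⁆ = B ⁅l, a⁆ x + B a ⁅l, x⁆) (a : posPiece 𝒜 n)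
    {k : ℤ} {x : X} (hx : x ∈ weightSpan b X (degreeWeights Φ k)) :
    B a x ∈ weightSpan b Y (degreeWeights Φ (n + k)) := by
  refine weightSpan_le_of_isDominant ?_ (bilinear_mem_weightSpan B hB a hx)
  rintro ν ⟨μ, ⟨hμ, hk⟩, c, hc0, hc⟩ hν
  have hn : 0 < n := by
    rcases Nat.eq_zero_or_pos n with rfl | h
    · exact absurd (Subtype.ext (eq_zero_of_mem_posPiece_zero c.2)) hc0
    · exact h
  refine ⟨hν, hΦ _ hk _ ⟨by simpa using hn, ((c : posPart 𝒜) : 𝔞), ?_, ?_, fun t => ?_⟩⟩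
  · have hn' : ((n : ℤ) + k - k).toNat = n := by omega
    change _ ∈ 𝒜 ((n : ℤ) + k - k).toNat
    rw [hn']
    exact c.2
  · exact fun h => hc0 (Subtype.ext (Subtype.ext h))
  · exact congrArg (fun z : posPiece 𝒜 n => ((z : posPart 𝒜) : 𝔞)) (hc t)

/-- The action `𝔞_n × V[k] → V[n + k]` is equivariant and bilinear, so for `n > 0` it moves
parameters along covers; for `n = 0` stability is part of being a `𝔤`-submodule. -/
theorem isStable_lowerTrunc {V : GrMod 𝒜} (hV : categoryGhat 𝒜 V) {Φ : Set (Parameter b)}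
    (hΦ : CoverClosed Φ) : IsStable V (lowerTrunc V Φ) := by
  have hpos : ∀ (n : ℕ) (k : ℤ) (a : posPiece 𝒜 n) (x : V.piece k),
      x ∈ weightSpan b (V.piece k) (degreeWeights Φ k) →
      ⁅((a : posPart 𝒜) : 𝔞), (x : V.carrier)⁆ ∈ lowerTrunc V Φ := by
    intro n k a x hx
    have := hV.finiteDimensional_piece (n + k)
    let B : posPiece 𝒜 n →ₗ[ℂ] V.piece k →ₗ[ℂ] V.piece (n + k) :=
      LinearMap.mk₂ ℂ (fun a x => ⟨⁅((a : posPart 𝒜) : 𝔞), (x : V.carrier)⁆,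
          V.lie_mem n k _ _ a.2 x.2⟩)
        (fun a c x => Subtype.ext (add_lie _ _ _)) (fun d a x => Subtype.ext (smul_lie _ _ _))
        (fun a x y => Subtype.ext (lie_add _ _ _)) (fun d a x => Subtype.ext (lie_smul _ _ _))
    have h := bilinear_mem_degreeWeights hΦ B
      (fun l a x => Subtype.ext (leibniz_lie (l : 𝔞) ((a : posPart 𝒜) : 𝔞) (x : V.carrier))) a hx
    exact coe_mem_lowerTrunc h
  intro x v hv
  refine V.mem_of_forall_proj_mem (v := v) (S := (lowerTrunc V Φ).toSubmodule.comap
    (LieModule.toEnd ℂ 𝔞 V.carrier x)) fun k => ?_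
  have hk := mem_lowerTrunc_iff.mp hv k
  generalize V.proj k v = z at hk
  change ⁅x, (z : V.carrier)⁆ ∈ lowerTrunc V Φ
  induction x using homogeneous_induction 𝒜 with
  | hadd a c ha hc => rw [add_lie]; exact add_mem ha hc
  | hmem n x hx =>
    cases n with
    | zero => exact (lowerTrunc V Φ).lie_mem (x := ⟨x, hx⟩) (coe_mem_lowerTrunc hk)
    | succ n => exact hpos (n + 1) k ⟨⟨x, Submodule.mem_iSup_of_mem n hx⟩, hx⟩ z hk

end LowerTrunc

/-! ### All parameters of `P_j(λ, r)` lie above `(λ, r)`. -/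

section Generation

variable {𝔞 : Type u} [LieRing 𝔞] [LieAlgebra ℂ 𝔞] {𝒜 : ℕ → Submodule ℂ 𝔞} [GradedLieAlgebra 𝒜]
  [∀ n, FiniteDimensional ℂ (𝒜 n)] [LieAlgebra.IsKilling ℂ (zeroPart 𝒜)]
  {H : LieSubalgebra ℂ (zeroPart 𝒜)} [H.IsCartanSubalgebra]

open LieAlgebra LieAlgebra.IsKilling

variable {b : (rootSystem H).Base}

/-- The graded `𝔤`-module `N` is generated by maximal vectors whose parameters lie in `Ψ`. -/
def GeneratedIn (Ψ : Set (Parameter b)) (N : GrZeroMod 𝒜) : Prop :=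
  ∀ k, weightSpan b (N.piece k) (degreeWeights Ψ k) = ⊤

theorem simpleZero_gr_of_lt (w : Parameter b) : ∀ k < w.2, (simpleZero w).gr k = ⊥ :=
  fun _ hk => if_neg hk.ne

theorem simpleZero_fg (w : Parameter b) (k : ℤ) : ((simpleZero w).gr k).FG := by
  have : Module.Finite ℂ (simpleZero w).carrier :=
    inferInstanceAs (Module.Finite ℂ (SimpleModule b w.1))
  exact Submodule.FG.of_finite

/-- The inclusion of `V(λ)` into the graded module `V(λ, r)` as its piece of degree `r`. -/
def simpleZeroIncl (w : Parameter b) :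
    SimpleModule b w.1 →ₗ⁅ℂ,zeroPart 𝒜⁆ (simpleZero w).piece w.2 where
  toFun v := ⟨v, by change v ∈ (if w.2 = w.2 then (⊤ : Submodule ℂ (SimpleModule b w.1)) else ⊥); simp⟩
  map_add' _ _ := rfl
  map_smul' _ _ := rfl
  map_lie' := rfl

theorem generatedIn_simpleZero {Ψ : Set (Parameter b)} {w : Parameter b} (hw : w ∈ Ψ) :
    GeneratedIn Ψ (simpleZero w) := by
  intro k
  rw [eq_top_iff]
  rintro ⟨x, hx⟩ -
  by_cases hk : k = w.2
  · subst hk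
    have h : (⊤ : LieSubmodule ℂ (zeroPart 𝒜) (SimpleModule b w.1)) ≤
        (weightSpan b ((simpleZero w).piece w.2) (degreeWeights Ψ w.2)).comap (simpleZeroIncl w) := by
      rw [← SimpleModule.lieSpan_gen w.1, LieSubmodule.lieSpan_le, Set.singleton_subset_iff]
      exact LieSubmodule.subset_lieSpan
        ⟨w.1.1, ⟨w.1.2, hw⟩, (SimpleModule.isMaximalVector_gen w.1).map (simpleZeroIncl w)⟩
    exact h (show x ∈ ⊤ from trivial)
  · have hx' : x ∈ (if k = w.2 then (⊤ : Submodule ℂ (SimpleModule b w.1)) else ⊥) := hx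
    rw [if_neg hk] at hx'
    have h0 : (⟨x, hx⟩ : (simpleZero w).piece k) = 0 := Subtype.ext hx'
    rw [h0]
    exact zero_mem _

/-- Exterior multiplication by homogeneous elements of `𝔞₊` is equivariant and bilinear, so it moves
parameters along covers. The bounds on `M` make the graded pieces finite-dimensional. -/
theorem generatedIn_wedgeTensor {Ψ : Set (Parameter b)} (hΨ : CoverClosed Ψ) {M : GrZeroMod 𝒜}
    {s : ℤ} (hs : ∀ k < s, M.gr k = ⊥) (hfg : ∀ k, (M.gr k).FG) (hM : GeneratedIn Ψ M) (j : ℕ) :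
    GeneratedIn Ψ (wedgeTensor M j) := by
  induction j with
  | zero =>
    intro k
    rw [eq_top_iff]
    rintro ⟨x, hx⟩ -
    obtain ⟨m, hm, rfl⟩ := wedgePiece_zero_le M k hx
    let f : M.piece k →ₗ⁅ℂ,zeroPart 𝒜⁆ (wedgeTensor M 0).piece k :=
      { toFun := fun m => ⟨wedge M 0 Fin.elim0 m,
          wedge_mem M 0 (n := Fin.elim0) (fun l => l.elim0) m.2 (by simp)⟩
        map_add' := fun m m' => Subtype.ext (map_add (wedgeMk M 0 _) _ _)
        map_smul' := fun c m => Subtype.ext (map_smul (wedgeMk M 0 _) c _)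
        map_lie' := fun {y m} => Subtype.ext (by
          change wedge M 0 Fin.elim0 ⁅y, (m : M.carrier)⁆ = ⁅y, wedge M 0 Fin.elim0 (m : M.carrier)⁆
          rw [lie_wedge, Fin.sum_univ_zero, zero_add]) }
    have h : (⟨m, hm⟩ : M.piece k) ∈ weightSpan b (M.piece k) (degreeWeights Ψ k) := by
      rw [hM k]; trivial
    exact weightSpan_map_le f _ h
  | succ j ih =>
    intro k
    rw [eq_top_iff]
    have hle : wedgePiece M (j + 1) k ≤ (weightSpan b ((wedgeTensor M (j + 1)).piece k)
        (degreeWeights Ψ k)).toSubmodule.map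
          ((wedgeTensor M (j + 1)).piece k).toSubmodule.subtype := by
      refine (wedgePiece_succ_le M j k).trans (iSup_le fun n => ?_)
      obtain ⟨l, rfl⟩ : ∃ l : ℤ, k = ((n + 1 : ℕ) : ℤ) + l := ⟨k - (n + 1), by push_cast; ring⟩
      have hl : ((n + 1 : ℕ) : ℤ) + l - (n + 1) = l := by push_cast; ring
      rw [hl]
      refine Submodule.map₂_le.mpr fun a ha w hw => ?_
      let B : posPiece 𝒜 (n + 1) →ₗ[ℂ] (wedgeTensor M j).piece l →ₗ[ℂ]
          (wedgeTensor M (j + 1)).piece ((n + 1 : ℕ) + l) :=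
        LinearMap.mk₂ ℂ (fun a x => ⟨wedgeCons M j a x.1,
            wedgeCons_mem M a.2 x.2⟩)
          (fun a c x => Subtype.ext
            (LinearMap.map_add₂ (wedgeCons M j) _ _ x.1))
          (fun d a x => Subtype.ext
            (LinearMap.map_smul₂ (wedgeCons M j) d _ x.1))
          (fun a x y => Subtype.ext (map_add (wedgeCons M j _) x.1 y))
          (fun d a x => Subtype.ext (map_smul (wedgeCons M j _) d x.1))
      have hfin : FiniteDimensional ℂ ((wedgeTensor M (j + 1)).piece ((n + 1 : ℕ) + l)) :=
        Module.Finite.iff_fg.mpr (wedgePiece_fg M hs hfg (j + 1) _)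
      have h : (⟨w, hw⟩ : (wedgeTensor M j).piece l) ∈
          weightSpan b ((wedgeTensor M j).piece l) (degreeWeights Ψ l) := by rw [ih l]; trivial
      exact ⟨_, bilinear_mem_degreeWeights hΨ B
        (fun y a x => Subtype.ext (lie_wedgeCons M j y _ x.1)) ⟨a, ha⟩ h, rfl⟩
    rintro ⟨x, hx⟩ -
    obtain ⟨y, hy, rfl⟩ := hle hx
    exact hy

/-- The inclusion of the generators into an induced module. -/
def indIncl (N : GrZeroMod 𝒜) (k : ℤ) : N.piece k →ₗ⁅ℂ,zeroPart 𝒜⁆ (Ind N).piece k where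
  toFun m := ⟨indMk N 1 m, indMk_one_mem N m.2⟩
  map_add' _ _ := Subtype.ext (map_add (indMk N 1) _ _)
  map_smul' c _ := Subtype.ext (map_smul (indMk N 1) c _)
  map_lie' := fun {y _} => Subtype.ext (lie_indMk_one N y _).symm

theorem indMk_one_mem_lowerTrunc {Ψ : Set (Parameter b)} {N : GrZeroMod 𝒜} (hN : GeneratedIn Ψ N)
    {k : ℤ} {m : N.carrier} (hm : m ∈ N.gr k) : indMk N 1 m ∈ lowerTrunc (Ind N) Ψ := by
  have h : (⟨m, hm⟩ : N.piece k) ∈ weightSpan b (N.piece k) (degreeWeights Ψ k) := by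
    rw [hN k]; trivial
  exact coe_mem_lowerTrunc (weightSpan_map_le (indIncl N k) _ h)

/-- The span of the admissible components contains the generators and is `𝔞`-stable. -/
theorem lowerTrunc_ind_eq_top {Ψ : Set (Parameter b)} (hΨ : CoverClosed Ψ) {N : GrZeroMod 𝒜}
    (hInd : categoryGhat 𝒜 (Ind N)) (hN : GeneratedIn Ψ N) : lowerTrunc (Ind N) Ψ = ⊤ := by
  rw [eq_top_iff]
  intro t _
  induction t using (Ind N).homogeneous_induction with
  | hadd v w hv hw => exact add_mem (hv trivial) (hw trivial)
  | hmem k t ht =>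
    refine indPiece_le N (S := fun _ => (lowerTrunc (Ind N) Ψ).toSubmodule) (fun l m hm =>
        indMk_one_mem_lowerTrunc hN hm)
      (fun n l x _ t ht => isStable_lowerTrunc hInd hΨ x t ht) k ht

theorem coverClosed_upper (w : Parameter b) : CoverClosed {β | ParamLE w β} :=
  fun _ hα _ hβ => Relation.ReflTransGen.tail hα hβ

/-- Here interval-closedness enters: if `β` covers `α`, with `w ≼ α` and `β ∈ Γ`, then `α` lies
between two members of `Γ`. -/
theorem coverClosed_compl_inter {Γ : Set (Parameter b)} (hΓ : IntervalClosed Γ) {w : Parameter b}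
    (hw : w ∈ Γ) : CoverClosed (Γᶜ ∩ {β | ParamLE w β}) := by
  rintro α ⟨hα, hwα⟩ β hβ
  exact ⟨fun hβΓ => hα (hΓ w α β hwα (Relation.ReflTransGen.single hβ) hw hβΓ),
    Relation.ReflTransGen.tail hwα hβ⟩

/-- The complement of `Γ` need not be closed under covers, but only parameters above `w` occur in
`V`, and the part of the complement above `w` is closed. -/
theorem isStable_of_eq_top {V : GrMod 𝒜} (hV : categoryGhat 𝒜 V) {Γ : Set (Parameter b)}
    (hΓ : IntervalClosed Γ) {w : Parameter b} (hw : w ∈ Γ)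
    (h : lowerTrunc V {β | ParamLE w β} = ⊤) : IsStable V (lowerTrunc V Γᶜ) := by
  rw [← lowerTrunc_inter hV h]
  exact isStable_lowerTrunc hV (coverClosed_compl_inter hΓ hw)

/-- The graded `𝔤`-modules which induce the terms of the resolution. -/
def resolutionZero (w : Parameter b) : ℕ → GrZeroMod 𝒜
  | 0 => simpleZero w
  | j + 1 => wedgeTensor (simpleZero w) (j + 1)

theorem resolutionObj_eq (w : Parameter b) (j : ℕ) :
    resolutionObj w j = Ind (resolutionZero w j) := by
  cases j <;> rfl

theorem resolutionZero_gr_of_lt (w : Parameter b) (j : ℕ) {k : ℤ} (hk : k < w.2 + j) :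
    (resolutionZero w j).gr k = ⊥ := by
  cases j with
  | zero => exact simpleZero_gr_of_lt w k (by simpa using hk)
  | succ j => exact wedgePiece_eq_bot _ (simpleZero_gr_of_lt w) (j + 1) hk

theorem resolutionZero_fg (w : Parameter b) (j : ℕ) (k : ℤ) : ((resolutionZero w j).gr k).FG := by
  cases j with
  | zero => exact simpleZero_fg w k
  | succ j => exact wedgePiece_fg _ (simpleZero_gr_of_lt w) (simpleZero_fg w) (j + 1) k

theorem generatedIn_resolutionZero (w : Parameter b) (j : ℕ) :
    GeneratedIn {β | ParamLE w β} (resolutionZero w j) := by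
  have h0 := generatedIn_simpleZero (Ψ := {β | ParamLE w β}) (w := w) Relation.ReflTransGen.refl
  cases j with
  | zero => exact h0
  | succ j =>
    exact generatedIn_wedgeTensor (coverClosed_upper w) (simpleZero_gr_of_lt w) (simpleZero_fg w) h0 _

theorem categoryGhat_resolutionObj (w : Parameter b) (j : ℕ) :
    categoryGhat 𝒜 (resolutionObj w j) := by
  rw [resolutionObj_eq]
  exact fun k => Module.Finite.iff_fg.mpr
    (indPiece_fg _ (s := w.2 + j) (fun _ hk => resolutionZero_gr_of_lt w j hk)
      (resolutionZero_fg w j) k)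

theorem resolutionObj_gr_of_lt (w : Parameter b) (j : ℕ) {k : ℤ} (hk : k < w.2 + j) :
    (resolutionObj w j).gr k = ⊥ := by
  rw [resolutionObj_eq]
  exact indPiece_eq_bot _ (fun _ hk => resolutionZero_gr_of_lt w j hk) hk

theorem lowerTrunc_resolutionObj (w : Parameter b) (j : ℕ) :
    lowerTrunc (resolutionObj w j) {β | ParamLE w β} = ⊤ := by
  have h := categoryGhat_resolutionObj w j
  rw [resolutionObj_eq] at h ⊢
  exact lowerTrunc_ind_eq_top (coverClosed_upper w) h (generatedIn_resolutionZero w j)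

theorem isStable_resolutionObj {Γ : Set (Parameter b)} (hΓ : IntervalClosed Γ) {w : Parameter b}
    (hw : w ∈ Γ) (j : ℕ) : IsStable (resolutionObj w j) (lowerTrunc (resolutionObj w j) Γᶜ) :=
  isStable_of_eq_top (categoryGhat_resolutionObj w j) hΓ hw (lowerTrunc_resolutionObj w j)

end Generation

/-! ### The identification of `⋀⁰ 𝔞₊ ⊗ M` with `M`. -/

section LowDegrees

variable {𝔞 : Type u} [LieRing 𝔞] [LieAlgebra ℂ 𝔞] {𝒜 : ℕ → Submodule ℂ 𝔞} [GradedLieAlgebra 𝒜]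

theorem projZero_of_mem_posPart {z : 𝔞} (hz : z ∈ posPart 𝒜) : projZero 𝒜 z = 0 := by
  induction hz using posPart_induction with
  | hmem n z hz => exact projZero_of_mem_ne 𝒜 n.succ_ne_zero hz
  | hadd a c _ _ ha hc => rw [map_add, ha, hc, add_zero]

variable (M : GrZeroMod 𝒜)

/-- The canonical map `U(𝔞) ⊗_{U(𝔤)} (⋀⁰ 𝔞₊ ⊗ M) → U(𝔞) ⊗_{U(𝔤)} M` as a linear map. -/
def wedgeZeroLin : KoszulCarrier M 0 →ₗ[ℂ] IndCarrier M :=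
  LieModuleHom.toLinearMap (wedgeZeroHom M).1

theorem wedgeZeroLin_mk (u : UniversalEnvelopingAlgebra ℂ 𝔞) (x : Fin 0 → posPart 𝒜)
    (m : M.carrier) : wedgeZeroLin M (koszulMk M 0 u (wedge M 0 x m)) = indMk M u m := by
  have h : wedgeZeroLin M (koszulMk M 0 u (wedge M 0 x m)) =
      UniversalEnvelopingAlgebra.lift ℂ (LieModule.toEnd ℂ 𝔞 (IndCarrier M)) u
        (wedgeZeroMap M (wedge M 0 x m)) := rfl
  rw [h, wedgeZeroMap_wedge, lift_toEnd_ind, indMul_mk, mul_one]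

/-- The inverse of `wedgeZeroLin`. -/
def wedgeZeroInv : IndCarrier M →ₗ[ℂ] KoszulCarrier M 0 :=
  indDesc ((LinearMap.lcomp ℂ (KoszulCarrier M 0)
    (wedgeMk M 0 (exteriorPower.ιMulti ℂ 0 Fin.elim0))) ∘ₗ koszulMk M 0) (by
      intro u y m
      change koszulMk M 0 _ (wedge M 0 Fin.elim0 m) = koszulMk M 0 u (wedge M 0 Fin.elim0 ⁅y, m⁆)
      rw [koszulMk_mul, lie_wedge, Fin.sum_univ_zero, zero_add])

theorem wedgeZeroInv_mk (u : UniversalEnvelopingAlgebra ℂ 𝔞) (m : M.carrier) :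
    wedgeZeroInv M (indMk M u m) = koszulMk M 0 u (wedge M 0 Fin.elim0 m) := rfl

theorem wedgeZeroInv_wedgeZeroLin (t : KoszulCarrier M 0) :
    wedgeZeroInv M (wedgeZeroLin M t) = t := by
  induction t using indCarrier_induction with
  | hadd a c ha hc => rw [map_add, map_add, ha, hc]
  | hmk u w =>
    change wedgeZeroInv M (wedgeZeroLin M (koszulMk M 0 u (w : WedgeCarrier M 0))) = koszulMk M 0 u w
    induction (w : WedgeCarrier M 0) using wedge_induction with
    | hadd a c ha hc => simp only [map_add, ha, hc]
    | hsmul d a ha => simp only [map_smul, ha]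
    | hmk x m =>
      rw [wedgeZeroLin_mk, wedgeZeroInv_mk, Subsingleton.elim x Fin.elim0]

theorem wedgeZeroLin_wedgeZeroInv (t : IndCarrier M) : wedgeZeroLin M (wedgeZeroInv M t) = t := by
  induction t using indCarrier_induction with
  | hadd a c ha hc => rw [map_add, map_add, ha, hc]
  | hmk u m => rw [wedgeZeroInv_mk, wedgeZeroLin_mk]

end LowDegrees

/-! ### Exactness of the resolution and of its truncation. -/

section Resolution

variable {𝔞 : Type u} [LieRing 𝔞] [LieAlgebra ℂ 𝔞] {𝒜 : ℕ → Submodule ℂ 𝔞} [GradedLieAlgebra 𝒜]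
  [∀ n, FiniteDimensional ℂ (𝒜 n)] [LieAlgebra.IsKilling ℂ (zeroPart 𝒜)]
  {H : LieSubalgebra ℂ (zeroPart 𝒜)} [H.IsCartanSubalgebra]

open LieAlgebra LieAlgebra.IsKilling

variable {b : (rootSystem H).Base}

/-- The augmentation as a linear map. -/
def augmentationLin (w : Parameter b) : IndCarrier (simpleZero w) →ₗ[ℂ] (simpleObj w).carrier :=
  LieModuleHom.toLinearMap (M := (projObj w).carrier) (N := (simpleObj w).carrier)
    (augmentation w).1

theorem augmentationLin_one (w : Parameter b) (m : (simpleZero w).carrier) :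
    augmentationLin w (indMk (simpleZero w) 1 m) = m := by
  have h : augmentationLin w (indMk (simpleZero w) 1 m) = UniversalEnvelopingAlgebra.lift ℂ
    (LieModule.toEnd ℂ 𝔞 (simpleObj w).carrier) 1 m := rfl
  rw [h, map_one]
  rfl

theorem lie_simpleObj_of_mem_posPart (w : Parameter b) {x : 𝔞} (hx : x ∈ posPart 𝒜)
    (m : (simpleObj w).carrier) : ⁅x, m⁆ = 0 := by
  refine (inflate_lie (simpleZero w) x m).trans ?_
  rw [projZero_of_mem_posPart hx]
  exact zero_lie (M := (simpleZero w).carrier) m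

theorem augmentationLin_mul_posPart (w : Parameter b) (u : UniversalEnvelopingAlgebra ℂ 𝔞)
    (x : posPart 𝒜) (m : (simpleObj w).carrier) :
    augmentationLin w (indMk (simpleZero w) (u * UniversalEnvelopingAlgebra.ι ℂ (x : 𝔞)) m) = 0 := by
  have h : augmentationLin w (indMk (simpleZero w) (u * UniversalEnvelopingAlgebra.ι ℂ (x : 𝔞)) m) =
    UniversalEnvelopingAlgebra.lift ℂ (LieModule.toEnd ℂ 𝔞 (simpleObj w).carrier)
      (u * UniversalEnvelopingAlgebra.ι ℂ (x : 𝔞)) m := rfl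
  rw [h, map_mul, Module.End.mul_apply, UniversalEnvelopingAlgebra.lift_ι_apply]
  rw [LieModule.toEnd_apply_apply, lie_simpleObj_of_mem_posPart w x.2]
  exact map_zero _

theorem augmentation_surjective (w : Parameter b) : Function.Surjective (augmentation w).1 :=
  fun m => ⟨_, augmentationLin_one w m⟩

theorem augmentationLin_koszulD (w : Parameter b) (s : KoszulCarrier (simpleZero w) 1) :
    augmentationLin w (wedgeZeroLin (simpleZero w) (koszulDLin (simpleZero w) 0 s)) = 0 := by
  induction s using indCarrier_induction with
  | hadd a c ha hc => rw [map_add, map_add, map_add, ha, hc, add_zero]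
  | hmk u v =>
    change augmentationLin w (wedgeZeroLin (simpleZero w) (koszulDLin (simpleZero w) 0
      (koszulMk (simpleZero w) 1 u (v : WedgeCarrier (simpleZero w) 1)))) = 0
    induction (v : WedgeCarrier (simpleZero w) 1) using wedge_induction with
    | hadd a c ha hc => simp only [map_add, ha, hc, add_zero]
    | hsmul d a ha => simp only [map_smul, ha, smul_zero]
    | hmk x m =>
      have h : koszulDLin (simpleZero w) 0 (koszulMk (simpleZero w) 1 u
        (wedge (simpleZero w) 1 x m)) = _ := koszulD_mk_wedge_one (simpleZero w) u x m
      rw [h, wedgeZeroLin_mk]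
      exact augmentationLin_mul_posPart w u (x 0) m

theorem exists_eq_wedge_zero (M : GrZeroMod 𝒜) (v : WedgeCarrier M 0) :
    ∃ m, v = wedge M 0 Fin.elim0 m := by
  induction v using wedge_induction with
  | hmk x m => exact ⟨m, by rw [Subsingleton.elim x Fin.elim0]⟩
  | hadd a c ha hc =>
    obtain ⟨m, rfl⟩ := ha
    obtain ⟨m', rfl⟩ := hc
    exact ⟨m + m', (map_add (wedgeMk M 0 _) m m').symm⟩
  | hsmul d a ha =>
    obtain ⟨m, rfl⟩ := ha
    exact ⟨d • m, (map_smul (wedgeMk M 0 _) d m).symm⟩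

theorem exists_koszulD_zero_eq_of_augmentation (w : Parameter b)
    {t : KoszulCarrier (simpleZero w) 0}
    (ht : augmentationLin w (wedgeZeroLin (simpleZero w) t) = 0) :
    ∃ s, koszulDLin (simpleZero w) 0 s = t := by
  refine exists_koszulD_zero_eq (simpleZero w) (augmentationLin w ∘ₗ wedgeZeroLin (simpleZero w))
    (augmentationLin_koszulD w) (fun v hv => ?_) ht
  rw [LinearMap.comp_apply] at hv
  obtain ⟨m, rfl⟩ := exists_eq_wedge_zero (simpleZero w) v
  rw [wedgeZeroLin_mk, augmentationLin_one] at hv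
  have hm : m = 0 := hv
  have h : wedge (simpleZero w) 0 Fin.elim0 m = 0 := by
    rw [hm]
    exact map_zero (wedgeMk (simpleZero w) 0 _)
  rw [h, map_zero]

theorem exact_resolutionD_augmentation (w : Parameter b) :
    Function.Exact (resolutionD w 0).1 (augmentation w).1 := by
  intro t
  constructor
  · intro ht
    have h : augmentationLin w (wedgeZeroLin (simpleZero w) (wedgeZeroInv (simpleZero w) t)) = 0 :=
      (congrArg (augmentationLin w) (wedgeZeroLin_wedgeZeroInv (simpleZero w) t)).trans ht
    obtain ⟨s, hs⟩ := exists_koszulD_zero_eq_of_augmentation w h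
    refine ⟨s, ?_⟩
    change wedgeZeroLin (simpleZero w) (koszulDLin (simpleZero w) 0 s) = t
    rw [hs]
    exact wedgeZeroLin_wedgeZeroInv (simpleZero w) t
  · rintro ⟨s, rfl⟩
    exact augmentationLin_koszulD w s

theorem exact_resolutionD (w : Parameter b) (j : ℕ) :
    Function.Exact (resolutionD w (j + 1)).1 (resolutionD w j).1 := by
  intro t
  cases j with
  | zero =>
    constructor
    · intro ht
      have h : wedgeZeroLin (simpleZero w) (koszulDLin (simpleZero w) 0 t) = 0 := ht
      have h2 := congrArg (wedgeZeroInv (simpleZero w)) h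
      rw [wedgeZeroInv_wedgeZeroLin, map_zero] at h2
      exact exists_koszulD_eq (simpleZero w) 0 h2
    · rintro ⟨s, rfl⟩
      change wedgeZeroLin (simpleZero w)
        (koszulDLin (simpleZero w) 0 (koszulDLin (simpleZero w) 1 s)) = 0
      exact (congrArg (wedgeZeroLin (simpleZero w))
        (koszulDLin_koszulDLin (simpleZero w) 0 s)).trans (map_zero _)
  | succ j =>
    constructor
    · exact fun ht => exists_koszulD_eq (simpleZero w) (j + 1) ht
    · rintro ⟨s, rfl⟩
      exact koszulDLin_koszulDLin (simpleZero w) (j + 1) s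

/-- Truncation preserves exactness. -/
theorem exact_truncMap {U V W : GrMod 𝒜} (hV : categoryGhat 𝒜 V) (hW : categoryGhat 𝒜 W)
    {Γ : Set (Parameter b)} (hΓ : IsStable W (lowerTrunc W Γᶜ)) {f : gHom U V} {g : gHom V W}
    (h : Function.Exact f.1 g.1) : Function.Exact (truncMap Γ f).1 (truncMap Γ g).1 := by
  intro t
  constructor
  · intro ht
    obtain ⟨v, rfl⟩ := truncProj_surjective V Γ t
    have hgv : g.1 v ∈ truncKernel W Γ := (LieSubmodule.Quotient.mk_eq_zero' (N := truncKernel W Γ)).mp ht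
    rw [mem_truncKernel_iff hΓ] at hgv
    -- Write `v = x + y` with `x ∈ V_Γ` and `y ∈ V_{Λ∖Γ}`. Then `g x` lies in both `W_Γ` and
    -- `W_{Λ∖Γ}`, so it is zero and `x` is in the image of `f`, while `y` dies in the truncation.
    have hv : v ∈ lowerTrunc V Γ ⊔ lowerTrunc V Γᶜ := by rw [lowerTrunc_sup_compl hV]; trivial
    obtain ⟨x, hx, y, hy, rfl⟩ := (LieSubmodule.mem_sup _ _ _).mp hv
    rw [map_add] at hgv
    have h0 : g.1 x = 0 := lowerTrunc_disjoint hW disjoint_compl_right (map_mem_lowerTrunc g hx)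
      ((add_mem_cancel_right (map_mem_lowerTrunc g hy)).mp hgv)
    obtain ⟨s, rfl⟩ := (h x).mp h0
    refine ⟨(truncProj U Γ).1 s, ?_⟩
    have hy' : (truncProj V Γ).1 y = 0 :=
      (LieSubmodule.Quotient.mk_eq_zero' (N := truncKernel V Γ)).mpr (LieSubmodule.subset_lieSpan hy)
    rw [truncMap_proj, map_add, hy', add_zero]
  · rintro ⟨s, rfl⟩
    obtain ⟨s, rfl⟩ := truncProj_surjective U Γ s
    rw [truncMap_proj, truncMap_proj, (h _).mpr ⟨s, rfl⟩, map_zero]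

/-- A morphism to a module without excluded weights factors through the truncation. -/
def truncDesc {V X : GrMod 𝒜} {Γ : Set (Parameter b)} (hX : truncKernel X Γ = ⊥) (g : gHom V X) :
    gHom (trunc V Γ) X :=
  ⟨{ (truncKernel V Γ).toSubmodule.liftQ g.1.toLinearMap (fun v hv => by
        have h := map_truncKernel Γ g hv
        rw [hX] at h
        exact h) with
      map_lie' := by
        intro x t
        obtain ⟨v, rfl⟩ := truncProj_surjective V Γ t
        exact LieModuleHom.map_lie g.1 x v }, by
    rintro k _ ⟨v, hv, rfl⟩
    exact g.2 k v hv⟩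

theorem exact_truncDesc {U V X : GrMod 𝒜} {Γ : Set (Parameter b)} (hX : truncKernel X Γ = ⊥)
    {f : gHom U V} {g : gHom V X} (h : Function.Exact f.1 g.1) :
    Function.Exact (truncMap Γ f).1 (truncDesc hX g).1 := by
  intro t
  constructor
  · intro ht
    obtain ⟨v, rfl⟩ := truncProj_surjective V Γ t
    obtain ⟨s, rfl⟩ := (h v).mp ht
    exact ⟨(truncProj U Γ).1 s, rfl⟩
  · rintro ⟨s, rfl⟩
    obtain ⟨s, rfl⟩ := truncProj_surjective U Γ s
    exact (h _).mpr ⟨s, rfl⟩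

end Resolution

/-! ### Objects of `G[Γ]` and multiplicities under truncation. -/

section Membership

variable {𝔞 : Type u} [LieRing 𝔞] [LieAlgebra ℂ 𝔞] {𝒜 : ℕ → Submodule ℂ 𝔞} [GradedLieAlgebra 𝒜]
  [∀ n, FiniteDimensional ℂ (𝒜 n)] [LieAlgebra.IsKilling ℂ (zeroPart 𝒜)]
  {H : LieSubalgebra ℂ (zeroPart 𝒜)} [H.IsCartanSubalgebra]

open LieAlgebra LieAlgebra.IsKilling

variable {b : (rootSystem H).Base} {Γ : Set (Parameter b)}

theorem truncProj_eq_zero_iff {V : GrMod 𝒜} {v : V.carrier} :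
    (truncProj V Γ).1 v = 0 ↔ v ∈ truncKernel V Γ :=
  LieSubmodule.Quotient.mk_eq_zero' (N := truncKernel V Γ)

theorem categoryGhat_of_finiteDimensional {V : GrMod 𝒜} (hV : FiniteDimensional ℂ V.carrier) :
    categoryGhat 𝒜 V := fun k => FiniteDimensional.finiteDimensional_submodule (V.gr k)

theorem categoryG.categoryGhat {V : GrMod 𝒜} (hV : categoryG Γ V) : categoryGhat 𝒜 V :=
  categoryGhat_of_finiteDimensional hV.1

/-- A nonzero maximal vector contributes to the multiplicity of its parameter. -/
theorem simpleMult_pos {V : GrMod 𝒜} (hV : categoryGhat 𝒜 V) {w : Parameter b} {v : V.carrier}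
    (hgr : v ∈ V.gr w.2) (hv : IsMaximalVector b w.1.1 v) (hv0 : v ≠ 0) : 0 < simpleMult V w := by
  have := hV.finiteDimensional_piece w.2
  exact SimpleModule.finrank_hom_pos w.1 (v := (⟨v, hgr⟩ : V.piece w.2))
    (fun h => hv0 (congrArg Subtype.val h)) (isMaximalVector_coe.mp hv)

theorem exists_of_simpleMult_pos {V : GrMod 𝒜} {w : Parameter b} (h : 0 < simpleMult V w) :
    ∃ v ∈ V.gr w.2, v ≠ 0 ∧ IsMaximalVector b w.1.1 v := by
  obtain ⟨v, hv0, hv⟩ := SimpleModule.exists_of_finrank_hom_pos w.1 h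
  exact ⟨v, v.2, fun h => hv0 (Subtype.ext h), isMaximalVector_coe.mpr hv⟩

theorem truncKernel_eq_bot {X : GrMod 𝒜} (hX : categoryG Γ X) : truncKernel X Γ = ⊥ := by
  rw [eq_bot_iff]
  refine truncKernel_le ?_
  rintro v ⟨w, hw, hgr, hv⟩
  by_contra hv0
  exact hw (hX.2 w (simpleMult_pos hX.categoryGhat hgr hv hv0))

/-- Maximal vectors lift through surjections. -/
theorem exists_maximalVector_lift {V X : GrMod 𝒜} (hV : categoryGhat 𝒜 V) {q : gHom V X}
    (hq : Function.Surjective q.1) {w : Parameter b} {x : X.carrier} (hgr : x ∈ X.gr w.2)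
    (hx : IsMaximalVector b w.1.1 x) :
    ∃ v ∈ V.gr w.2, IsMaximalVector b w.1.1 v ∧ q.1 v = x := by
  have := hV.finiteDimensional_piece w.2
  obtain ⟨σ, hσ⟩ := exists_lieSection (pieceMap q w.2) (pieceMap_surjective hq w.2)
  have h := (isMaximalVector_coe (v := (⟨x, hgr⟩ : X.piece w.2)).mp hx).map σ
  exact ⟨σ ⟨x, hgr⟩, (σ ⟨x, hgr⟩).2, isMaximalVector_coe.mpr h,
    congrArg Subtype.val (hσ ⟨x, hgr⟩)⟩

theorem categoryG_of_surjective {V X : GrMod 𝒜} (hV : categoryG Γ V) {q : gHom V X}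
    (hq : Function.Surjective q.1) : categoryG Γ X := by
  have := hV.1
  refine ⟨Module.Finite.of_surjective q.1.toLinearMap hq, fun w hw => ?_⟩
  obtain ⟨x, hgr, hx0, hx⟩ := exists_of_simpleMult_pos hw
  obtain ⟨v, hv, hm, rfl⟩ := exists_maximalVector_lift hV.categoryGhat hq hgr hx
  refine hV.2 w (simpleMult_pos hV.categoryGhat hv hm ?_)
  rintro rfl
  exact hx0 (map_zero q.1)

theorem lowerTrunc_le_iSup (V : GrMod 𝒜) {K : Finset ℤ} (hK : ∀ w ∈ Γ, w.2 ∈ K) :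
    lowerTrunc V Γ ≤ ⨆ k ∈ K, V.piece k := by
  rw [lowerTrunc, LieSubmodule.lieSpan_le]
  rintro v ⟨w, hw, hgr, -⟩
  exact (le_biSup (fun k => V.piece k) (hK w hw)) hgr

/-- `V_Γ` maps onto `V^Γ` and lives in the finitely many degrees occurring in `Γ`. An excluded
maximal vector of `V^Γ` would lift to one of `V`, and such vectors are killed. -/
theorem categoryG_trunc {V : GrMod 𝒜} (hV : categoryGhat 𝒜 V) (hfin : Γ.Finite) :
    categoryG Γ (trunc V Γ) := by
  refine ⟨?_, fun w hw => ?_⟩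
  · let K : Finset ℤ := hfin.toFinset.image Prod.snd
    have hK : ∀ w ∈ Γ, w.2 ∈ K := fun w hw =>
      Finset.mem_image_of_mem _ (hfin.mem_toFinset.mpr hw)
    have hfg : (⨆ k ∈ K, V.gr k).FG :=
      Submodule.fg_biSup _ _ fun k _ => Module.Finite.iff_fg.mp (hV k)
    have htop : (⨆ k ∈ K, V.gr k).map (truncProj V Γ).1.toLinearMap = ⊤ := by
      rw [eq_top_iff]
      intro t _
      obtain ⟨v, rfl⟩ := truncProj_surjective V Γ t
      have hv : v ∈ lowerTrunc V Γ ⊔ lowerTrunc V Γᶜ := by rw [lowerTrunc_sup_compl hV]; trivial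
      obtain ⟨x, hx, y, hy, rfl⟩ := (LieSubmodule.mem_sup _ _ _).mp hv
      have hx' : x ∈ (⨆ k ∈ K, V.piece k).toSubmodule := lowerTrunc_le_iSup V hK hx
      simp only [LieSubmodule.iSup_toSubmodule] at hx'
      refine ⟨x, hx', ?_⟩
      have hy' := truncProj_eq_zero_iff.mpr
        (LieSubmodule.subset_lieSpan hy : y ∈ truncKernel V Γ)
      rw [map_add, hy', add_zero]
      rfl
    exact ⟨htop ▸ hfg.map _⟩
  · obtain ⟨x, hgr, hx0, hx⟩ := exists_of_simpleMult_pos hw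
    obtain ⟨v, hv, hm, rfl⟩ := exists_maximalVector_lift hV (truncProj_surjective V Γ) hgr hx
    by_contra hw'
    exact hx0 (truncProj_eq_zero_iff.mpr (mem_truncKernel_of_maximal ⟨w, hw', hv, hm⟩))

/-- No maximal vector has a parameter in `Γ`, so `V_Γ = 0` and `V` is equal to its discarded part.
-/
theorem subsingleton_trunc {V : GrMod 𝒜} (hV : categoryGhat 𝒜 V) (h : ∀ w ∈ Γ, V.gr w.2 = ⊥) :
    Subsingleton (trunc V Γ).carrier := by
  have h0 : lowerTrunc V Γ = ⊥ := by
    rw [eq_bot_iff, lowerTrunc, LieSubmodule.lieSpan_le]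
    rintro v ⟨w, hw, hgr, -⟩
    rw [h w hw] at hgr
    exact hgr
  have h1 := lowerTrunc_sup_compl hV Γ
  rw [h0, bot_sup_eq] at h1
  have h2 : ∀ t : (trunc V Γ).carrier, t = 0 := by
    intro t
    obtain ⟨v, rfl⟩ := truncProj_surjective V Γ t
    refine truncProj_eq_zero_iff.mpr (LieSubmodule.subset_lieSpan ?_)
    have hv : v ∈ lowerTrunc V Γᶜ := by rw [h1]; trivial
    exact hv
  exact ⟨fun s t => (h2 s).trans (h2 t).symm⟩

theorem exists_subsingleton_trunc (hfin : Γ.Finite) (w : Parameter b) :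
    ∃ N, ∀ j ≥ N, Subsingleton (trunc (resolutionObj w j) Γ).carrier := by
  obtain ⟨B, hB⟩ := (hfin.image Prod.snd).bddAbove
  refine ⟨(B - w.2 + 1).toNat, fun j hj => subsingleton_trunc (categoryGhat_resolutionObj w j)
    fun v hv => resolutionObj_gr_of_lt w j ?_⟩
  have := hB (Set.mem_image_of_mem Prod.snd hv)
  omega

theorem simpleObj_lie (w : Parameter b) (y : zeroPart 𝒜) (m : (simpleObj w).carrier) :
    ⁅y, m⁆ = (⁅y, (show SimpleModule b w.1 from m)⁆ : SimpleModule b w.1) := by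
  refine (inflate_lie (simpleZero w) (y : 𝔞) m).trans ?_
  rw [projZero_of_mem_zeroPart]
  rfl

theorem simpleObj_gr_of_ne (w : Parameter b) {k : ℤ} (hk : k ≠ w.2) : (simpleObj w).gr k = ⊥ :=
  if_neg hk

/-- Every maximal vector of `V(λ)` is a multiple of the generator, so `(λ, r)` is the only parameter
that occurs. -/
theorem categoryG_simpleObj {w : Parameter b} (hw : w ∈ Γ) : categoryG Γ (simpleObj w) := by
  refine ⟨inferInstanceAs (FiniteDimensional ℂ (SimpleModule b w.1)), fun w' hw' => ?_⟩
  obtain ⟨x, hgr, hx0, hx⟩ := exists_of_simpleMult_pos hw'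
  by_cases hk : w'.2 = w.2
  · let x' : SimpleModule b w.1 := x
    have hx' : IsMaximalVector b w'.1.1 x' :=
      ⟨fun h => (simpleObj_lie w h x).symm.trans (hx.1 h),
        fun α hα y hy => (simpleObj_lie w y x).symm.trans (hx.2 α hα y hy)⟩
    have hmem : x' ∈ LieSubmodule.lieSpan ℂ (zeroPart 𝒜) {SimpleModule.gen w.1} := by
      rw [SimpleModule.lieSpan_gen]; trivial
    have hspan := (SimpleModule.isMaximalVector_gen w.1).mem_span hx' hmem
    obtain ⟨c, hc⟩ := Submodule.mem_span_singleton.mp hspan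
    have hx2 : IsMaximalVector b w.1.1 x' := by
      rw [← hc]
      refine ⟨fun h => ?_, fun α hα y hy => ?_⟩
      · rw [lie_smul, (SimpleModule.isMaximalVector_gen w.1).1, smul_comm]
      · rw [lie_smul, (SimpleModule.isMaximalVector_gen w.1).2 α hα y hy, smul_zero]
    have h1 : w'.1 = w.1 := Subtype.ext (hx'.weight_eq hx2 hx0)
    have h2 : w' = w := Prod.ext h1 hk
    rw [h2]; exact hw
  · rw [simpleObj_gr_of_ne w hk] at hgr
    exact absurd hgr hx0

/-- Truncation does not change the multiplicities of the retained parameters. -/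
theorem simpleMult_trunc {V : GrMod 𝒜} (hV : categoryGhat 𝒜 V)
    (hst : IsStable V (lowerTrunc V Γᶜ)) {w : Parameter b} (hw : w ∈ Γ) :
    simpleMult V w = simpleMult (trunc V Γ) w := by
  have := hV.finiteDimensional_piece w.2
  let q := pieceMap (truncProj V Γ) w.2
  let F : (SimpleModule b w.1 →ₗ⁅ℂ,zeroPart 𝒜⁆ V.piece w.2) →ₗ[ℂ]
      (SimpleModule b w.1 →ₗ⁅ℂ,zeroPart 𝒜⁆ (trunc V Γ).piece w.2) :=
    { toFun := fun f => q.comp f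
      map_add' := fun f g => LieModuleHom.ext fun v => map_add q _ _
      map_smul' := fun c f => LieModuleHom.ext fun v => map_smul q c _ }
  refine (LinearEquiv.ofBijective F ⟨?_, fun g => ?_⟩).finrank_eq
  -- The image of the generator lies in `V_Γ` because `w ∈ Γ`, and in `V_{Λ∖Γ}` if it dies in the
  -- truncation.
  · rw [injective_iff_map_eq_zero]
    intro f hf
    refine SimpleModule.hom_ext (Subtype.ext ?_)
    have h0 : (truncProj V Γ).1 (f (SimpleModule.gen w.1) : V.carrier) = 0 :=
      congrArg Subtype.val (LieModuleHom.congr_fun hf (SimpleModule.gen w.1))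
    rw [truncProj_eq_zero_iff, mem_truncKernel_iff hst] at h0
    refine lowerTrunc_disjoint hV (disjoint_compl_right (a := Γ)) (LieSubmodule.subset_lieSpan
      ⟨w, hw, (f (SimpleModule.gen w.1)).2, ?_⟩) h0
    exact isMaximalVector_coe.mpr ((SimpleModule.isMaximalVector_gen w.1).map f)
  · obtain ⟨σ, hσ⟩ := exists_lieSection q (pieceMap_surjective (truncProj_surjective V Γ) w.2)
    exact ⟨σ.comp g, LieModuleHom.ext fun v => hσ (g v)⟩

end Membership

/-! ### Cokernels of graded morphisms. -/

section Quotient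

variable {𝔞 : Type u} [LieRing 𝔞] [LieAlgebra ℂ 𝔞] {𝒜 : ℕ → Submodule ℂ 𝔞} [GradedLieAlgebra 𝒜]

/-- The cokernel of a morphism of graded modules. -/
def gCoker {V W : GrMod 𝒜} (f : gHom V W) : GrMod 𝒜 where
  carrier := W.carrier ⧸ f.1.range
  gr k := (W.gr k).map (LieSubmodule.Quotient.mk' f.1.range).toLinearMap
  isInternal := by
    obtain ⟨σ, hσ⟩ := exists_scaling V.gr V.isInternal (fun k => (2 : ℂ) ^ k)
    obtain ⟨τ, hτ⟩ := exists_scaling W.gr W.isInternal (fun k => (2 : ℂ) ^ k)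
    -- The scalings by `2ᵏ` correspond under `f`, so the one on `W` descends to the quotient and
    -- separates the images of the graded pieces.
    have hcomm : ∀ v, f.1 (σ v) = τ (f.1 v) := by
      intro v
      induction v using V.homogeneous_induction with
      | hmem k v hv => rw [hσ k v hv, hτ k _ (f.2 k v hv), map_smul]
      | hadd v w hv hw => simp only [map_add, hv, hw]
    have hN : f.1.range.toSubmodule ≤ f.1.range.toSubmodule.comap τ := by
      rintro _ ⟨v, rfl⟩
      exact ⟨σ v, hcomm v⟩
    apply isInternal_of_scaling (M := W.carrier ⧸ f.1.range) _
      (f.1.range.toSubmodule.mapQ f.1.range.toSubmodule τ hN)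
    · rintro k _ ⟨v, hv, rfl⟩
      change LieSubmodule.Quotient.mk' f.1.range (τ v) = _
      rw [hτ k v hv, map_smul]
      rfl
    · rw [← Submodule.map_iSup, iSup_eq_top_of_isInternal W.isInternal, Submodule.map_top,
        LinearMap.range_eq_top]
      exact LieSubmodule.Quotient.surjective_mk' _
  lie_mem := by
    rintro n k x _ hx ⟨v, hv, rfl⟩
    exact ⟨⁅x, v⁆, W.lie_mem n k x v hx hv, LieModuleHom.map_lie _ x v⟩

/-- The projection onto the cokernel. -/
def gCokerProj {V W : GrMod 𝒜} (f : gHom V W) : gHom W (gCoker f) :=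
  ⟨LieSubmodule.Quotient.mk' f.1.range, fun _ v hv => ⟨v, hv, rfl⟩⟩

theorem gCokerProj_surjective {V W : GrMod 𝒜} (f : gHom V W) :
    Function.Surjective (gCokerProj f).1 :=
  LieSubmodule.Quotient.surjective_mk' _

theorem gCokerProj_eq_zero_iff {V W : GrMod 𝒜} (f : gHom V W) (w : W.carrier) :
    (gCokerProj f).1 w = 0 ↔ w ∈ f.1.range :=
  LieSubmodule.Quotient.mk_eq_zero' (N := f.1.range)

end Quotient

/-! ### Frobenius reciprocity and lifting for induced modules. -/

section Induced

variable {𝔞 : Type u} [LieRing 𝔞] [LieAlgebra ℂ 𝔞] {𝒜 : ℕ → Submodule ℂ 𝔞} [GradedLieAlgebra 𝒜]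
  {N : GrZeroMod 𝒜}

/-- An induced module is generated by `1 ⊗ N`. -/
theorem mem_of_indMk_one_mem {S : LieSubmodule ℂ 𝔞 (Ind N).carrier}
    (h : ∀ k, ∀ m ∈ N.gr k, indMk N 1 m ∈ S) (t : (Ind N).carrier) : t ∈ S := by
  induction t using (Ind N).homogeneous_induction with
  | hadd v w hv hw => exact add_mem hv hw
  | hmem k t ht =>
    exact indPiece_le N (S := fun _ => S.toSubmodule) h (fun _ _ x _ t ht => S.lie_mem ht) k ht

theorem ind_hom_ext {W : GrMod 𝒜} {f g : gHom (Ind N) W}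
    (h : ∀ k, ∀ m ∈ N.gr k, f.1 (indMk N 1 m) = g.1 (indMk N 1 m)) : f = g := by
  refine Subtype.ext (LieModuleHom.ext fun t => ?_)
  have ht : t ∈ (f.1 - g.1).ker := mem_of_indMk_one_mem (S := (f.1 - g.1).ker) (fun k m hm =>
    (LieModuleHom.mem_ker (M := (Ind N).carrier)).mpr (sub_eq_zero.mpr (h k m hm))) t
  have h0 := LieModuleHom.mem_ker.mp ht
  rwa [LieModuleHom.sub_apply, sub_eq_zero] at h0

theorem indLift_one {W : GrMod 𝒜} (f : N.carrier →ₗ[ℂ] W.carrier)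
    (hf : ∀ (y : zeroPart 𝒜) m, f ⁅y, m⁆ = ⁅(y : 𝔞), f m⁆)
    (hgr : ∀ k, ∀ m ∈ N.gr k, f m ∈ W.gr k) (m : N.carrier) :
    (indLift f hf hgr).1 (indMk N 1 m) = f m := by
  have h : (indLift f hf hgr).1 (indMk N 1 m) =
    UniversalEnvelopingAlgebra.lift ℂ (LieModule.toEnd ℂ 𝔞 W.carrier) 1 (f m) := rfl
  rw [h, map_one]
  rfl

/-- A family of `𝔤`-linear maps on the graded pieces of `N` extends to a morphism on the induced
module. -/
theorem exists_ind_hom {W : GrMod 𝒜} (φ : ∀ k, N.piece k →ₗ⁅ℂ,zeroPart 𝒜⁆ W.piece k) :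
    ∃ f : gHom (Ind N) W, ∀ k, ∀ m, ∀ hm : m ∈ N.gr k, f.1 (indMk N 1 m) = φ k ⟨m, hm⟩ := by
  let e := LinearEquiv.ofBijective (DirectSum.coeLinearMap N.gr) N.isInternal
  let F : N.carrier →ₗ[ℂ] W.carrier := DirectSum.toModule ℂ ℤ W.carrier
    (fun k => (W.piece k).toSubmodule.subtype ∘ₗ ((φ k : N.piece k →ₗ[ℂ] W.piece k))) ∘ₗ
      e.symm.toLinearMap
  have hF : ∀ k, ∀ m, ∀ hm : m ∈ N.gr k, F m = φ k ⟨m, hm⟩ := by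
    intro k m hm
    have h : e.symm m = DirectSum.lof ℂ ℤ (fun k => N.gr k) k ⟨m, hm⟩ := by
      rw [LinearEquiv.symm_apply_eq]
      exact (DirectSum.coeLinearMap_lof N.gr k ⟨m, hm⟩).symm
    change DirectSum.toModule ℂ ℤ W.carrier _ (e.symm m) = _
    rw [h]
    exact DirectSum.toModule_lof ℂ k _
  have hlie : ∀ (y : zeroPart 𝒜) m, F ⁅y, m⁆ = ⁅(y : 𝔞), F m⁆ := by
    intro y m
    have hm : m ∈ ⨆ k, N.gr k := by rw [iSup_eq_top_of_isInternal N.isInternal]; trivial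
    induction hm using Submodule.iSup_induction' with
    | mem k m hm =>
      rw [hF k m hm, hF k _ (N.lie_mem k y m hm)]
      exact congrArg Subtype.val (LieModuleHom.map_lie (φ k) y ⟨m, hm⟩)
    | zero => rw [lie_zero, map_zero, lie_zero]
    | add a c _ _ ha hc => rw [lie_add, map_add, ha, hc, map_add, lie_add]
  refine ⟨indLift F hlie fun k m hm => ?_, fun k m hm => ?_⟩
  · rw [hF k m hm]; exact (φ k ⟨m, hm⟩).2
  · rw [indLift_one, hF k m hm]

variable [∀ n, FiniteDimensional ℂ (𝒜 n)] [LieAlgebra.IsKilling ℂ (zeroPart 𝒜)]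

/-- Morphisms from an induced module lift through surjections. -/
theorem exists_ind_lift {E X : GrMod 𝒜} (hE : categoryGhat 𝒜 E) {e : gHom E X}
    (he : Function.Surjective e.1) (f : gHom (Ind N) X) : ∃ g : gHom (Ind N) E, gComp e g = f := by
  -- Weyl's theorem supplies a `𝔤`-section in each degree; composing it with `f` on generators
  -- defines the lift.
  have hσ : ∀ k, ∃ σ : X.piece k →ₗ⁅ℂ,zeroPart 𝒜⁆ E.piece k, ∀ x, pieceMap e k (σ x) = x := by
    intro k
    have := hE.finiteDimensional_piece k
    exact exists_lieSection (pieceMap e k) (pieceMap_surjective he k)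
  choose σ hσ using hσ
  obtain ⟨g, hg⟩ := exists_ind_hom (W := E)
    fun k => ((σ k).comp (pieceMap f k)).comp (indIncl N k)
  refine ⟨g, ind_hom_ext fun k m hm => ?_⟩
  change e.1 (g.1 (indMk N 1 m)) = _
  rw [hg k m hm]
  exact congrArg Subtype.val (hσ k (pieceMap f k (indIncl N k ⟨m, hm⟩)))

end Induced

/-! ### Epimorphisms and projective objects in `G[Γ]`. -/

section Categories

variable {𝔞 : Type u} [LieRing 𝔞] [LieAlgebra ℂ 𝔞] {𝒜 : ℕ → Submodule ℂ 𝔞} [GradedLieAlgebra 𝒜]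
  [∀ n, FiniteDimensional ℂ (𝒜 n)] [LieAlgebra.IsKilling ℂ (zeroPart 𝒜)]
  {H : LieSubalgebra ℂ (zeroPart 𝒜)} [H.IsCartanSubalgebra]

open LieAlgebra LieAlgebra.IsKilling

variable {b : (rootSystem H).Base} {Γ : Set (Parameter b)}

theorem epi_of_surjective {C : ObjectProperty (GrMod 𝒜)} {X Y : C.FullSubcategory} (f : X ⟶ Y)
    (hf : Function.Surjective (show gHom X.obj Y.obj from f.hom).1) : Epi f := by
  refine ⟨fun {Z} g h hgh => ObjectProperty.hom_ext _ (Subtype.ext (LieModuleHom.ext fun y => ?_))⟩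
  obtain ⟨x, rfl⟩ := hf y
  exact congrArg (fun k : X ⟶ Z => (show gHom X.obj Z.obj from k.hom).1 x) hgh

/-- The cokernel is a quotient of an object of `G[Γ]`, so it lies in `G[Γ]`. Its projection and the
zero map agree after `f`, hence are equal. -/
theorem surjective_of_epi {X Y : (categoryG Γ).FullSubcategory} (f : X ⟶ Y) [Epi f] :
    Function.Surjective (show gHom X.obj Y.obj from f.hom).1 := by
  let f' : gHom X.obj Y.obj := f.hom
  let Q : (categoryG Γ).FullSubcategory :=
    ⟨gCoker f', categoryG_of_surjective Y.property (gCokerProj_surjective f')⟩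
  let q : Y ⟶ Q := ObjectProperty.homMk (X := Y) (Y := Q) (gCokerProj f')
  let z : Y ⟶ Q := ObjectProperty.homMk (X := Y) (Y := Q) (0 : gHom Y.obj Q.obj)
  have hqz : f ≫ q = f ≫ z := by
    refine ObjectProperty.hom_ext _ (Subtype.ext (LieModuleHom.ext fun x => ?_))
    exact (gCokerProj_eq_zero_iff f' _).mpr ⟨x, rfl⟩
  have h : q = z := (cancel_epi f).mp hqz
  intro y
  have hy : (gCokerProj f').1 y = 0 :=
    congrArg (fun k : Y ⟶ Q => (show gHom Y.obj Q.obj from k.hom).1 y) h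
  exact (gCokerProj_eq_zero_iff f' y).mp hy

/-- Truncations of induced modules are projective. -/
theorem isProjectiveIn_trunc_ind {N : GrZeroMod 𝒜} (hN : categoryG Γ (trunc (Ind N) Γ)) :
    IsProjectiveIn (categoryG Γ) (trunc (Ind N) Γ) := by
  refine ⟨hN, ⟨fun {E X} f e _ => ?_⟩⟩
  obtain ⟨g, hg⟩ := exists_ind_lift E.property.categoryGhat (surjective_of_epi e)
    (gComp (show gHom (trunc (Ind N) Γ) X.obj from f.hom) (truncProj (Ind N) Γ))
  refine ⟨ObjectProperty.homMk (X := ⟨trunc (Ind N) Γ, hN⟩) (Y := E)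
    (truncDesc (truncKernel_eq_bot E.property) g), ?_⟩
  refine ObjectProperty.hom_ext _ (Subtype.ext (LieModuleHom.ext fun t => ?_))
  obtain ⟨v, rfl⟩ := truncProj_surjective (Ind N) Γ t
  exact congrArg (fun k : gHom (Ind N) X.obj => k.1 v) hg

end Categories

/-! ### Morphisms between truncated projectives, and projective covers. -/

section Truncation

variable {𝔞 : Type u} [LieRing 𝔞] [LieAlgebra ℂ 𝔞] {𝒜 : ℕ → Submodule ℂ 𝔞} [GradedLieAlgebra 𝒜]
  [∀ n, FiniteDimensional ℂ (𝒜 n)] [LieAlgebra.IsKilling ℂ (zeroPart 𝒜)]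
  {H : LieSubalgebra ℂ (zeroPart 𝒜)} [H.IsCartanSubalgebra]

open LieAlgebra LieAlgebra.IsKilling

variable {b : (rootSystem H).Base} {Γ : Set (Parameter b)}

theorem mem_simpleZero_gr {w : Parameter b} (m : (simpleZero w).carrier) :
    m ∈ (simpleZero w).gr w.2 := (simpleZeroIncl w m).2

theorem simpleZero_eq_zero {w : Parameter b} {k : ℤ} (hk : k ≠ w.2) {m : (simpleZero w).carrier}
    (hm : m ∈ (simpleZero w).gr k) : m = 0 := by
  have h : (simpleZero w).gr k = ⊥ := if_neg hk
  rwa [h] at hm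

/-- Injectivity: the generators lie in the `Γ`-part, which morphisms preserve and which meets the
kernel of truncation in zero. Surjectivity: the composite `P(λ, r) → P(λ, r)^Γ → P(μ, s)^Γ` lifts to
`P(μ, s)`. -/
theorem truncMap_bijective (hΓ : IntervalClosed Γ) {lr ms : Parameter b} (hlr : lr ∈ Γ)
    (hms : ms ∈ Γ) : Function.Bijective (truncMap Γ : gHom (projObj lr) (projObj ms) →ₗ[ℂ]
      gHom (trunc (projObj lr) Γ) (trunc (projObj ms) Γ)) := by
  have hst := isStable_resolutionObj hΓ hms 0
  have hghat := categoryGhat_resolutionObj ms 0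
  constructor
  · rw [injective_iff_map_eq_zero]
    intro f hf
    refine ind_hom_ext (N := simpleZero lr) fun k m hm => ?_
    have h0 : (truncProj (projObj ms) Γ).1 (f.1 (indMk (simpleZero lr) 1 m)) = 0 :=
      congrArg (fun g : gHom (trunc (projObj lr) Γ) (trunc (projObj ms) Γ) =>
        g.1 ((truncProj (projObj lr) Γ).1 (indMk (simpleZero lr) 1 m))) hf
    exact lowerTrunc_disjoint hghat (disjoint_compl_right (a := Γ))
      (map_mem_lowerTrunc f (indMk_one_mem_lowerTrunc (generatedIn_simpleZero hlr) hm))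
      ((mem_truncKernel_iff hst _).mp (truncProj_eq_zero_iff.mp h0))
  · intro h
    obtain ⟨f, hf⟩ := exists_ind_lift (N := simpleZero lr) hghat
      (truncProj_surjective (projObj ms) Γ) (gComp h (truncProj (projObj lr) Γ))
    refine ⟨f, Subtype.ext (LieModuleHom.ext fun t => ?_)⟩
    obtain ⟨v, rfl⟩ := truncProj_surjective (projObj lr) Γ t
    exact congrArg (fun k : gHom (projObj lr) (trunc (projObj ms) Γ) => k.1 v) hf

/-- Morphisms from the truncation of `P(μ, s)` compute multiplicities. -/
theorem finrank_gHom_trunc {X : GrMod 𝒜} (hX : categoryG Γ X) (ms : Parameter b) :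
    simpleMult X ms = Module.finrank ℂ (gHom (trunc (projObj ms) Γ) X) := by
  let ι := (indIncl (simpleZero ms) ms.2).comp (simpleZeroIncl ms)
  let q := pieceMap (truncProj (projObj ms) Γ) ms.2
  let F : gHom (trunc (projObj ms) Γ) X →ₗ[ℂ]
      (SimpleModule b ms.1 →ₗ⁅ℂ,zeroPart 𝒜⁆ X.piece ms.2) :=
    { toFun := fun f => ((pieceMap f ms.2).comp q).comp ι
      map_add' := fun _ _ => rfl
      map_smul' := fun _ _ => rfl }
  symm
  refine (LinearEquiv.ofBijective F ⟨?_, fun φ => ?_⟩).finrank_eq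
  · rw [injective_iff_map_eq_zero]
    intro f hf
    -- A morphism from an induced module is determined on generators, where it agrees with the given
    -- `𝔤`-map.
    have h0 : gComp f (truncProj (projObj ms) Γ) = 0 := by
      refine ind_hom_ext (N := simpleZero ms) fun k m hm => ?_
      exact congrArg Subtype.val (LieModuleHom.congr_fun hf m)
    refine Subtype.ext (LieModuleHom.ext fun t => ?_)
    obtain ⟨v, rfl⟩ := truncProj_surjective (projObj ms) Γ t
    exact congrArg (fun k : gHom (projObj ms) X => k.1 v) h0
  · have hψ : ∀ k, ∃ ψ : (simpleZero ms).piece k →ₗ⁅ℂ,zeroPart 𝒜⁆ X.piece k,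
        ∀ m : (simpleZero ms).piece k, (ψ m : X.carrier) = φ (m : (simpleZero ms).carrier) := by
      intro k
      by_cases hk : k = ms.2
      · subst hk
        exact ⟨{ toFun := fun m => φ (m : (simpleZero ms).carrier)
                 map_add' := fun m m' => map_add φ _ _
                 map_smul' := fun c m => map_smul φ c _
                 map_lie' := fun {y m} => LieModuleHom.map_lie φ y _ }, fun m => rfl⟩
      · refine ⟨0, fun m => ?_⟩
        have hm : (m : (simpleZero ms).carrier) = 0 := simpleZero_eq_zero hk m.2
        rw [hm]
        exact (congrArg Subtype.val (map_zero φ)).symm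
    choose ψ hψ using hψ
    obtain ⟨f, hf⟩ := exists_ind_hom ψ
    refine ⟨truncDesc (truncKernel_eq_bot hX) f, LieModuleHom.ext fun m => Subtype.ext ?_⟩
    exact (hf ms.2 m (mem_simpleZero_gr m)).trans (hψ _ _)

/-- The truncation of `P(λ, r)` is the projective cover of `V(λ, r)`. -/
theorem exists_projectiveCover (hfin : Γ.Finite) {w : Parameter b} (hw : w ∈ Γ) :
    ∃ π : gHom (trunc (projObj w) Γ) (simpleObj w),
      gComp π (truncProj (projObj w) Γ) = augmentation w ∧
      IsProjectiveCoverIn (categoryG Γ) π := by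
  have hS : categoryG Γ (simpleObj w) := categoryG_simpleObj hw
  have hP : categoryG Γ (trunc (projObj w) Γ) :=
    categoryG_trunc (categoryGhat_resolutionObj w 0) hfin
  let π : gHom (trunc (projObj w) Γ) (simpleObj w) :=
    truncDesc (truncKernel_eq_bot hS) (augmentation w)
  have hπ : ∀ v, π.1 ((truncProj (projObj w) Γ).1 v) = (augmentation w).1 v := fun _ => rfl
  have hπs : Function.Surjective π.1 := by
    intro m
    obtain ⟨v, rfl⟩ := augmentation_surjective w m
    exact ⟨_, hπ v⟩
  refine ⟨π, rfl, hP, hS, ?_, ?_, ?_⟩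
  · obtain ⟨_, h⟩ := isProjectiveIn_trunc_ind (N := simpleZero w) hP
    exact h
  · exact epi_of_surjective _ hπs
  · intro Y g hg
    have hgs := @surjective_of_epi _ _ _ _ _ _ _ _ _ _ _ _ _ _ hg
    let g' : gHom Y.obj (trunc (projObj w) Γ) := g.hom
    -- The source has just `1 ⊗ V(λ)` in degree `r`. Project a preimage of `m` to that degree: its
    -- image under `g` is the class of some `1 ⊗ m'`, and applying `π` gives `m' = m`. So the range
    -- of `g` contains the generators.
    have hone : ∀ m : (simpleZero w).carrier,
        ∃ y, g'.1 y = (truncProj (projObj w) Γ).1 (indMk (simpleZero w) 1 m) := by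
      intro m
      obtain ⟨y, hy⟩ := hgs m
      have hy : π.1 (g'.1 y) = m := hy
      refine ⟨Y.obj.proj w.2 y, ?_⟩
      obtain ⟨t, ht, htg⟩ := g'.2 w.2 _ (Y.obj.proj w.2 y).2
      obtain ⟨m', -, rfl⟩ := indPiece_lowest _ (simpleZero_gr_of_lt w) ht
      have h1 : π.1 (g'.1 (Y.obj.proj w.2 y)) = m := by
        rw [← proj_map g', ← proj_map π, hy]
        exact congrArg Subtype.val ((simpleObj w).proj_of_mem (mem_simpleZero_gr m))
      have h2 : π.1 (g'.1 (Y.obj.proj w.2 y)) = m' := by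
        rw [← htg]
        exact augmentationLin_one w m'
      rw [← htg, ← h2, h1]
      rfl
    refine epi_of_surjective g fun t => ?_
    obtain ⟨v, rfl⟩ := truncProj_surjective (projObj w) Γ t
    exact mem_of_indMk_one_mem (N := simpleZero w)
      (S := g'.1.range.comap (truncProj (projObj w) Γ).1) (fun k m _ => hone m) v

end Truncation

end GradedCurrent

end

theorem propositionP54 {𝔞 : Type u} [LieRing 𝔞] [LieAlgebra ℂ 𝔞]
    -- a `ℤ₊`-graded Lie algebra with finite-dimensional pieces and `𝔤 = 𝔞₀` semisimple
    (𝒜 : ℕ → Submodule ℂ 𝔞) [GradedLieAlgebra 𝒜] [∀ n, FiniteDimensional ℂ (𝒜 n)]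
    [LieAlgebra.IsSemisimple ℂ (zeroPart 𝒜)]
    -- a Cartan subalgebra of `𝔤` and a set of simple roots
    (H : LieSubalgebra ℂ (zeroPart 𝒜)) [H.IsCartanSubalgebra]
    (b : (LieAlgebra.IsKilling.rootSystem H).Base)
    (Γ : Set (Parameter b)) (hfin : Γ.Finite) (hΓ : IntervalClosed Γ) :
    -- the modules `P_j(λ, r)` are objects of `Ĝ`, and their truncations are quotient `𝔞`-modules
    (∀ lr ∈ Γ, ∀ j, categoryGhat 𝒜 (resolutionObj lr j) ∧
      IsStable (resolutionObj lr j) (lowerTrunc (resolutionObj lr j) Γᶜ)) ∧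
    -- `P(λ, r)^Γ` is the projective cover of `V(λ, r)` in `G[Γ]`
    (∀ lr ∈ Γ, ∃ π : gHom (trunc (projObj lr) Γ) (simpleObj lr),
      gComp π (truncProj (projObj lr) Γ) = augmentation lr ∧
      IsProjectiveCoverIn (categoryG Γ) π) ∧
    -- multiplicities and dimensions of Hom-spaces
    (∀ lr ∈ Γ, ∀ ms ∈ Γ,
      simpleMult (projObj lr) ms = simpleMult (trunc (projObj lr) Γ) ms ∧
      simpleMult (trunc (projObj lr) Γ) ms =
        Module.finrank ℂ (gHom (trunc (projObj ms) Γ) (trunc (projObj lr) Γ))) ∧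
    -- `f ↦ f^Γ` identifies the Hom-spaces
    (∀ lr ∈ Γ, ∀ ms ∈ Γ, Function.Bijective
      (truncMap Γ : gHom (projObj lr) (projObj ms) →ₗ[ℂ]
        gHom (trunc (projObj lr) Γ) (trunc (projObj ms) Γ))) ∧
    -- the truncated complex is a finite projective resolution of `V(μ, s)` in `G[Γ]`
    (∀ ms ∈ Γ,
      (∀ j, IsProjectiveIn (categoryG Γ) (trunc (resolutionObj ms j) Γ)) ∧
      categoryG Γ (simpleObj ms) ∧
      (∃ ε : gHom (trunc (resolutionObj ms 0) Γ) (simpleObj ms),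
        gComp ε (truncProj (resolutionObj ms 0) Γ) = augmentation ms ∧
        Function.Surjective ε.1 ∧
        Function.Exact (truncMap Γ (resolutionD ms 0)).1 ε.1) ∧
      (∀ j, Function.Exact (truncMap Γ (resolutionD ms (j + 1))).1
        (truncMap Γ (resolutionD ms j)).1) ∧
      ∃ N, ∀ j ≥ N, Subsingleton (trunc (resolutionObj ms j) Γ).carrier) := by
  refine ⟨fun lr hlr j => ⟨categoryGhat_resolutionObj lr j, isStable_resolutionObj hΓ hlr j⟩,
    fun lr hlr => exists_projectiveCover hfin hlr, fun lr hlr ms hms => ⟨?_, ?_⟩,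
    fun lr hlr ms hms => truncMap_bijective hΓ hlr hms, fun ms hms => ⟨fun j => ?_, ?_, ?_,
      fun j => ?_, exists_subsingleton_trunc hfin ms⟩⟩
  · exact simpleMult_trunc (categoryGhat_resolutionObj lr 0) (isStable_resolutionObj hΓ hlr 0) hms
  · exact finrank_gHom_trunc (categoryG_trunc (categoryGhat_resolutionObj lr 0) hfin) ms
  · have h := categoryG_trunc (categoryGhat_resolutionObj ms j) hfin
    rw [resolutionObj_eq] at h ⊢
    exact isProjectiveIn_trunc_ind h
  · exact categoryG_simpleObj hms
  · refine ⟨truncDesc (truncKernel_eq_bot (categoryG_simpleObj hms)) (augmentation ms), rfl,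
      fun m => ?_, exact_truncDesc _ (exact_resolutionD_augmentation ms)⟩
    obtain ⟨v, rfl⟩ := augmentation_surjective ms m
    exact ⟨(truncProj (resolutionObj ms 0) Γ).1 v, rfl⟩
  · exact exact_truncMap (categoryGhat_resolutionObj ms (j + 1)) (categoryGhat_resolutionObj ms j)
      (isStable_resolutionObj hΓ hms j) (exact_resolutionD ms j)
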